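/- **Conventions.** Manifolds are smooth, Hausdorff and second countable; $n\ge 1$. An almost quaternionic structure on a $4n$-dimensional manifold $X$ is a triple $(I,J,K)$ of smooth almost complex structures with $IJ=K$. For a smooth function $\rho\colon X\to\mathbb R$ put $\sigma^{I}_\rho=-\mathrm d(\mathrm d\rho\circ I)$, and similarly $\sigma^J_\rho,\sigma^K_\rho$. The function $\rho$ is *$IJK$-convex at $x\in X$* if for every non-zero linear map $A\colon\mathbb R^3\to T_xX$ with $I Ae_1+J Ae_2+K Ae_3=0$, $$\sigma_\rho^I(Ae_2,Ae_3)+\sigma_\rho^J(Ae_3,Ae_1)+\sigma_\rho^K(Ae_1,Ae_2)<0,$$ i.e. the pull-back of $\sigma^I_\rho\wedge \mathrm d\tau+\sigma^J_\rho\wedge \mathrm ds+\sigma^K_\rho\wedge \mathrm dt$ under the graph of $A$ is a negative multiple of the volume form of $\mathbb R^3$. A submanifold $L$ is *$JK$-conical at $y\in L$* (with respect to $\rho$) if $\mathrm d\rho$ is non-zero on $T_yL$ and vanishes on $J(T_yL)$ and $K(T_yL)$; it is *$I$-complex* if $I(T_yL)\subset T_yL$ for all $y\in L$. Let $(M,I,J,K)$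 be a compact almost quaternionic manifold of dimension $4n$ with boundary, and let $\rho\colon M\to\mathbb R$ be a boundary-defining function: $\rho$ is smooth, $\rho<0$ in the interior of $M$, and $\partial M=\rho^{-1}(0)$ is a regular level set. Suppose that $\rho$ is $IJK$-convex at every point of a neighborhood of $\partial M$. Let $$\widehat M=M\cup_{\partial M}\bigl(\partial M\times[0,\infty)\bigr)$$ be the topological space obtained by gluing $x\in\partial M$ to $(x,0)$, and let $\widehat\rho\colon\widehat M\to\mathbb R$ be equal to $\rho$ on $M$ and to $e^r-1$ at $(x,r)\in\partial M\times[0,\infty)$. A *conical completion* of $(M,I,J,K,\rho)$ consists of a smooth structure on $\widehat M$ (without boundary) for which $M\to\widehat M$ is a smooth embedding and $\partial M\times[0,\infty)\to\widehat M$ is a diffeomorphism onto its image, together with an almost quaternionic structure on $\widehat M$ extending $(I,J,K)$, such that $\widehat\rho$ is smooth and is $IJK$-convex at every point of $\partial M\times[0,\infty)$. Then: 1. A conical completion exists. 2. Let $L\subset M$ be a compact embedded submanifold, possibly with boundary, with *$JK$-conical boundary*: $\partial L=L\cap\partial M$, this intersection is transverse, and $L$ is $JK$-conical at its points in a neighborhood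 of $\partial M$. Then there is a conical completion (depending on $L$) such that $$\widehat L=L\cup_{\partial L}\bigl(\partial L\times[0,\infty)\bigr)\subset\widehat M$$ is a smooth embedded submanifold without boundary, whose smooth structure is glued from those of $L$ and $\partial L\times[0,\infty)$ in the same sense, and such that $\widehat L$ is $JK$-conical with respect to $\widehat\rho$ at every point of $\partial L\times[0,\infty)$. If moreover $L$ is $I$-complex, then so is $\widehat L$. -/

import Mathlib

open Set Filter Topology Manifold
open scoped ContDiff

noncomputable section

namespace ConicalCompletion

/-! ### Exterior derivative of a one-form on a manifold (possibly with boundary) -/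

section Forms

variable {E : Type*} [NormedAddCommGroup E] [NormedSpace ℝ E] {H : Type*} [TopologicalSpace H]
  (𝓜 : ModelWithCorners ℝ E H) {X : Type*} [TopologicalSpace X] [ChartedSpace H X]

/-- The differential `dρ` of a real function, as a one-form. -/
def differential (ρ : X → ℝ) (x : X) : TangentSpace 𝓜 x →L[ℝ] ℝ :=
  mfderiv 𝓜 𝓘(ℝ, ℝ) ρ x

/-- The coordinate expression of a one-form `α` in the preferred chart at `x`, i.e. the pull-back
of `α` under the inverse of that chart. -/
def oneFormInChart (α : ∀ y : X, TangentSpace 𝓜 y →L[ℝ] ℝ) (x : X) (u : E) : E →L[ℝ] ℝ :=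
  (α ((extChartAt 𝓜 x).symm u)).comp
    (mfderivWithin 𝓘(ℝ, E) 𝓜 (extChartAt 𝓜 x).symm (range 𝓜) u)

/-- The exterior derivative of a one-form `α` at `x`, as a function of two tangent vectors:
`dα` is computed in the preferred chart at `x`. -/
def dOneForm (α : ∀ y : X, TangentSpace 𝓜 y →L[ℝ] ℝ) (x : X) (v w : TangentSpace 𝓜 x) : ℝ :=
  extDerivWithin
    (fun u : E => ContinuousAlternatingMap.ofSubsingleton ℝ E ℝ (0 : Fin 1)
      (oneFormInChart 𝓜 α x u))
    (range 𝓜) (extChartAt 𝓜 x x)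
    ![mfderiv 𝓜 𝓘(ℝ, E) (extChartAt 𝓜 x) x v, mfderiv 𝓜 𝓘(ℝ, E) (extChartAt 𝓜 x) x w]

/-- The Levi form `σ_ρ^J = - d(dρ ∘ J)` of `ρ` with respect to a field `J` of endomorphisms of
the tangent spaces. -/
def leviForm (J : ∀ y : X, TangentSpace 𝓜 y →L[ℝ] TangentSpace 𝓜 y) (ρ : X → ℝ) (x : X)
    (v w : TangentSpace 𝓜 x) : ℝ :=
  - dOneForm 𝓜 (fun y => (differential 𝓜 ρ y).comp (J y)) x v w

end Forms

/-! ### Almost quaternionic structures and convexity -/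

section Quaternionic

variable {E : Type*} [NormedAddCommGroup E] [NormedSpace ℝ E] {H : Type*} [TopologicalSpace H]

/-- A smooth field of endomorphisms of the tangent bundle. -/
def IsSmoothEndField (𝓜 : ModelWithCorners ℝ E H) {X : Type*} [TopologicalSpace X]
    [ChartedSpace H X] [IsManifold 𝓜 ∞ X]
    (A : ∀ x : X, TangentSpace 𝓜 x →L[ℝ] TangentSpace 𝓜 x) : Prop :=
  ContMDiff 𝓜 (𝓜.prod 𝓘(ℝ, E →L[ℝ] E)) ∞
    (fun x => Bundle.TotalSpace.mk' (E →L[ℝ] E)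
      (E := fun x : X => TangentSpace 𝓜 x →L[ℝ] TangentSpace 𝓜 x) x (A x))

/-- An almost quaternionic structure: smooth almost complex structures `I, J, K`
with `I J = K`. -/
structure AlmostQuaternionic (𝓜 : ModelWithCorners ℝ E H) (X : Type*) [TopologicalSpace X]
    [ChartedSpace H X] [IsManifold 𝓜 ∞ X] where
  I : ∀ x : X, TangentSpace 𝓜 x →L[ℝ] TangentSpace 𝓜 x
  J : ∀ x : X, TangentSpace 𝓜 x →L[ℝ] TangentSpace 𝓜 x
  K : ∀ x : X, TangentSpace 𝓜 x →L[ℝ] TangentSpace 𝓜 x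
  smooth_I : IsSmoothEndField 𝓜 I
  smooth_J : IsSmoothEndField 𝓜 J
  smooth_K : IsSmoothEndField 𝓜 K
  I_sq : ∀ x v, I x (I x v) = -v
  J_sq : ∀ x v, J x (J x v) = -v
  K_sq : ∀ x v, K x (K x v) = -v
  I_J : ∀ x v, I x (J x v) = K x v

variable {𝓜 : ModelWithCorners ℝ E H} {X : Type*} [TopologicalSpace X] [ChartedSpace H X]
  [IsManifold 𝓜 ∞ X]

/-- A linear map `A : ℝ³ → T_x X` is quaternion-antilinear if `I A e₁ + J A e₂ + K A e₃ = 0`. -/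
def AlmostQuaternionic.IsAntilinear (Q : AlmostQuaternionic 𝓜 X) (x : X)
    (A : (Fin 3 → ℝ) →ₗ[ℝ] TangentSpace 𝓜 x) : Prop :=
  Q.I x (A (Pi.single 0 1)) + Q.J x (A (Pi.single 1 1)) + Q.K x (A (Pi.single 2 1)) = 0

/-- The coefficient of the volume form `dτ ∧ ds ∧ dt` in the pull-back, under the graph of
`A : ℝ³ → T_x X`, of the `IJK`-Levi form
`σ_ρ = σ_ρ^I ∧ dτ + σ_ρ^J ∧ ds + σ_ρ^K ∧ dt`. -/
def AlmostQuaternionic.leviCoefficient (Q : AlmostQuaternionic 𝓜 X) (ρ : X → ℝ) (x : X)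
    (A : (Fin 3 → ℝ) →ₗ[ℝ] TangentSpace 𝓜 x) : ℝ :=
  leviForm 𝓜 Q.I ρ x (A (Pi.single 1 1)) (A (Pi.single 2 1)) +
  leviForm 𝓜 Q.J ρ x (A (Pi.single 2 1)) (A (Pi.single 0 1)) +
  leviForm 𝓜 Q.K ρ x (A (Pi.single 0 1)) (A (Pi.single 1 1))

/-- `ρ` is `IJK`-convex at the point `x`. -/
def AlmostQuaternionic.IsConvexAt (Q : AlmostQuaternionic 𝓜 X) (ρ : X → ℝ) (x : X) : Prop :=
  ∀ A : (Fin 3 → ℝ) →ₗ[ℝ] TangentSpace 𝓜 x,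
    Q.IsAntilinear x A → A ≠ 0 → Q.leviCoefficient ρ x A < 0

variable {F : Type*} [NormedAddCommGroup F] [NormedSpace ℝ F] {G : Type*} [TopologicalSpace G]
  (𝓝' : ModelWithCorners ℝ F G) {Y : Type*} [TopologicalSpace Y] [ChartedSpace G Y]

/-- The `JK`-conical condition for the submanifold parametrized by `j : Y → X`, at the point
`j y`: with `T = T_{j y} j(Y)`, the form `dρ` is non-zero on `T` and vanishes on `J T` and
`K T`. -/
def AlmostQuaternionic.IsJKConicalAt (Q : AlmostQuaternionic 𝓜 X) (ρ : X → ℝ) (j : Y → X)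
    (y : Y) : Prop :=
  (∃ v : TangentSpace 𝓝' y, differential 𝓜 ρ (j y) (mfderiv 𝓝' 𝓜 j y v) ≠ 0) ∧
  (∀ v : TangentSpace 𝓝' y, differential 𝓜 ρ (j y) (Q.J (j y) (mfderiv 𝓝' 𝓜 j y v)) = 0) ∧
  (∀ v : TangentSpace 𝓝' y, differential 𝓜 ρ (j y) (Q.K (j y) (mfderiv 𝓝' 𝓜 j y v)) = 0)

/-- The submanifold parametrized by `j : Y → X` is `I`-complex: its tangent spaces are
invariant under `I`. -/
def AlmostQuaternionic.IsIComplex (Q : AlmostQuaternionic 𝓜 X) (j : Y → X) : Prop :=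
  ∀ (y : Y) (v : TangentSpace 𝓝' y), ∃ w : TangentSpace 𝓝' y,
    Q.I (j y) (mfderiv 𝓝' 𝓜 j y v) = mfderiv 𝓝' 𝓜 j y w

end Quaternionic

/-! ### The space `X̂ = X ∪_{∂X} (∂X × [0, ∞))` -/

section Completion

variable {E : Type*} [NormedAddCommGroup E] [NormedSpace ℝ E] {H : Type*} [TopologicalSpace H]

/-- The gluing relation, identifying `x ∈ ∂X` with `(x, 0) ∈ ∂X × [0, ∞)`. -/
inductive GlueRel (𝓜 : ModelWithCorners ℝ E H) (X : Type*) [TopologicalSpace X]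
    [ChartedSpace H X] :
    X ⊕ (𝓜.boundary X × Ici (0 : ℝ)) → X ⊕ (𝓜.boundary X × Ici (0 : ℝ)) → Prop
  | glue (x : 𝓜.boundary X) :
      GlueRel 𝓜 X (Sum.inl x.1) (Sum.inr (x, ⟨0, le_refl (0 : ℝ)⟩))

/-- The completion `X̂ = X ∪_{∂X} (∂X × [0, ∞))`, with the quotient topology. -/
def Completion (𝓜 : ModelWithCorners ℝ E H) (X : Type*) [TopologicalSpace X]
    [ChartedSpace H X] : Type _ :=
  Quot (GlueRel 𝓜 X)

variable (𝓜 : ModelWithCorners ℝ E H) {X : Type*} [TopologicalSpace X] [ChartedSpace H X]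

instance : TopologicalSpace (Completion 𝓜 X) :=
  inferInstanceAs (TopologicalSpace (Quot (GlueRel 𝓜 X)))

/-- The inclusion `X → X̂`. -/
def Completion.core (x : X) : Completion 𝓜 X := Quot.mk _ (Sum.inl x)

/-- The inclusion `∂X × [0, ∞) → X̂` of the conical end. -/
def Completion.coneEnd (p : 𝓜.boundary X × Ici (0 : ℝ)) : Completion 𝓜 X :=
  Quot.mk _ (Sum.inr p)

/-- The extension of a function `ρ` vanishing on `∂X` by `(x, r) ↦ e ^ r - 1`. -/
def Completion.extendFun (ρ : X → ℝ) (hρ : ∀ x ∈ 𝓜.boundary X, ρ x = 0) :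
    Completion 𝓜 X → ℝ :=
  Quot.lift (Sum.elim ρ (fun p => Real.exp (p.2 : ℝ) - 1)) (by
    rintro _ _ ⟨x⟩
    simp [hρ x.1 x.2])

/-- The map `Ŷ → X̂` induced by a map `j : Y → X` with `j (∂Y) ⊆ ∂X`, which is `j × id` on the
conical end. -/
def Completion.map {F : Type*} [NormedAddCommGroup F] [NormedSpace ℝ F] {G : Type*}
    [TopologicalSpace G] (𝓝' : ModelWithCorners ℝ F G) {Y : Type*} [TopologicalSpace Y]
    [ChartedSpace G Y] (j : Y → X) (hj : ∀ y ∈ 𝓝'.boundary Y, j y ∈ 𝓜.boundary X) :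
    Completion 𝓝' Y → Completion 𝓜 X :=
  Quot.lift
    (Sum.elim (fun y => Completion.core 𝓜 (j y))
      (fun p => Completion.coneEnd 𝓜 (⟨j p.1.1, hj p.1.1 p.1.2⟩, p.2)))
    (by
      rintro _ _ ⟨y⟩
      exact Quot.sound (GlueRel.glue ⟨j y.1, hj y.1 y.2⟩))

/-- A smooth structure without boundary on `X̂` is a smooth gluing if `X → X̂` is a smooth
embedding and `∂X × [0, ∞) → X̂` is a diffeomorphism onto its image. Here `∂X × [0, ∞)` is
regarded as a subset of the manifold `X × ℝ`, so that smoothness of maps from and to it is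
smoothness within that subset. -/
structure IsSmoothGluing [ChartedSpace E (Completion 𝓜 X)] : Prop where
  isManifold : IsManifold 𝓘(ℝ, E) ∞ (Completion 𝓜 X)
  t2Space : T2Space (Completion 𝓜 X)
  secondCountable : SecondCountableTopology (Completion 𝓜 X)
  core_isSmoothEmbedding :
    IsSmoothEmbedding 𝓜 𝓘(ℝ, E) ∞ (Completion.core 𝓜 : X → Completion 𝓜 X)
  coneEnd_smooth : ∃ f : X × ℝ → Completion 𝓜 X,
    (∀ p : 𝓜.boundary X × Ici (0 : ℝ), f (p.1.1, p.2.1) = Completion.coneEnd 𝓜 p) ∧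
    ContMDiffOn (𝓜.prod 𝓘(ℝ, ℝ)) 𝓘(ℝ, E) ∞ f (𝓜.boundary X ×ˢ Ici (0 : ℝ))
  coneEnd_inv_smooth : ∃ g : Completion 𝓜 X → X × ℝ,
    (∀ p : 𝓜.boundary X × Ici (0 : ℝ), g (Completion.coneEnd 𝓜 p) = (p.1.1, p.2.1)) ∧
    ContMDiffOn 𝓘(ℝ, E) (𝓜.prod 𝓘(ℝ, ℝ)) ∞ g (range (Completion.coneEnd 𝓜 (X := X)))

/-- An almost quaternionic structure on `X̂` extends the one on `X`. -/
def AlmostQuaternionic.Extends [IsManifold 𝓜 ∞ X] [ChartedSpace E (Completion 𝓜 X)]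
    [IsManifold 𝓘(ℝ, E) ∞ (Completion 𝓜 X)]
    (Q' : AlmostQuaternionic 𝓘(ℝ, E) (Completion 𝓜 X)) (Q : AlmostQuaternionic 𝓜 X) : Prop :=
  ∀ (x : X) (v : TangentSpace 𝓜 x),
    Q'.I (Completion.core 𝓜 x) (mfderiv 𝓜 𝓘(ℝ, E) (Completion.core 𝓜) x v) =
      mfderiv 𝓜 𝓘(ℝ, E) (Completion.core 𝓜) x (Q.I x v) ∧
    Q'.J (Completion.core 𝓜 x) (mfderiv 𝓜 𝓘(ℝ, E) (Completion.core 𝓜) x v) =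
      mfderiv 𝓜 𝓘(ℝ, E) (Completion.core 𝓜) x (Q.J x v) ∧
    Q'.K (Completion.core 𝓜 x) (mfderiv 𝓜 𝓘(ℝ, E) (Completion.core 𝓜) x v) =
      mfderiv 𝓜 𝓘(ℝ, E) (Completion.core 𝓜) x (Q.K x v)

/-- A conical completion of `(X, Q, ρ)`: a smooth structure on `X̂` glued from those of `X` and
`∂X × [0, ∞)`, and an almost quaternionic structure `Q'` on `X̂` extending `Q`, such that the
extension of `ρ` by `e ^ r - 1` is smooth, and is `IJK`-convex on `∂X × [0, ∞)`. -/
structure IsConicalCompletion [IsManifold 𝓜 ∞ X] [ChartedSpace E (Completion 𝓜 X)]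
    [IsManifold 𝓘(ℝ, E) ∞ (Completion 𝓜 X)] (Q : AlmostQuaternionic 𝓜 X) (ρ : X → ℝ)
    (hρ : ∀ x ∈ 𝓜.boundary X, ρ x = 0)
    (Q' : AlmostQuaternionic 𝓘(ℝ, E) (Completion 𝓜 X)) : Prop where
  isSmoothGluing : IsSmoothGluing 𝓜 (X := X)
  extends_structure : AlmostQuaternionic.Extends 𝓜 Q' Q
  smooth_extendFun : ContMDiff 𝓘(ℝ, E) 𝓘(ℝ, ℝ) ∞ (Completion.extendFun 𝓜 ρ hρ)
  convex_end : ∀ p : 𝓜.boundary X × Ici (0 : ℝ),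
    Q'.IsConvexAt (Completion.extendFun 𝓜 ρ hρ) (Completion.coneEnd 𝓜 p)

end Completion

/-! ### Boundary-defining functions and submanifolds with conical boundary -/

section Boundary

variable {d : ℕ} [NeZero d] {M : Type*} [TopologicalSpace M]
  [ChartedSpace (EuclideanHalfSpace d) M]

/-- A boundary-defining function: smooth, negative in the interior, with `∂M = ρ⁻¹(0)` a regular
level set. -/
structure IsBoundaryDefining (ρ : M → ℝ) : Prop where
  smooth : ContMDiff (𝓡∂ d) 𝓘(ℝ, ℝ) ∞ ρ
  neg_interior : ∀ x ∈ (𝓡∂ d).interior M, ρ x < 0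
  zero_iff : ∀ x, x ∈ (𝓡∂ d).boundary M ↔ ρ x = 0
  regular : ∀ x ∈ (𝓡∂ d).boundary M, differential (𝓡∂ d) ρ x ≠ 0

/-- The tangent space of `∂M` at `x ∈ ∂M`: the vectors whose normal coordinate (the coordinate
with index `0`) vanishes in the preferred half-space chart at `x`. -/
def boundaryTangent (x : M) : Submodule ℝ (TangentSpace (𝓡∂ d) x) :=
  LinearMap.ker
    (((EuclideanSpace.proj (0 : Fin d) : EuclideanSpace ℝ (Fin d) →L[ℝ] ℝ).comp
      (mfderiv (𝓡∂ d) 𝓘(ℝ, EuclideanSpace ℝ (Fin d)) (extChartAt (𝓡∂ d) x) x)).toLinearMap)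

/-- The (embedded) submanifold `L = j(N)` of `M` has a `JK`-conical boundary: `∂L = L ∩ ∂M`, the
intersection is transverse, and `L` is `JK`-conical in a neighborhood of `∂M`. -/
structure HasJKConicalBoundary [IsManifold (𝓡∂ d) ∞ M] (Q : AlmostQuaternionic (𝓡∂ d) M)
    (ρ : M → ℝ) {F : Type*} [NormedAddCommGroup F] [NormedSpace ℝ F] {G : Type*}
    [TopologicalSpace G] (𝓝' : ModelWithCorners ℝ F G) {N : Type*} [TopologicalSpace N]
    [ChartedSpace G N] (j : N → M) : Prop where
  isSmoothEmbedding : IsSmoothEmbedding 𝓝' (𝓡∂ d) ∞ j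
  boundary_iff : ∀ y, y ∈ 𝓝'.boundary N ↔ j y ∈ (𝓡∂ d).boundary M
  transverse : ∀ y ∈ 𝓝'.boundary N,
    LinearMap.range (mfderiv 𝓝' (𝓡∂ d) j y).toLinearMap ⊔ boundaryTangent (j y) = ⊤
  conical : ∃ U : Set M, IsOpen U ∧ (𝓡∂ d).boundary M ⊆ U ∧
    ∀ y, j y ∈ U → Q.IsJKConicalAt 𝓝' ρ j y

end Boundary

end ConicalCompletion

end

open Set Filter Topology Manifold
open scoped ContDiff Ring

set_option linter.unusedSectionVars false

noncomputable section

namespace ConicalCompletion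

/-! Near `∂M` the structure is extended outwards a little, and this short collar is then stretched
to infinite length in a way that cannot destroy convexity.

Smooth structure. Smooth maps that push a neighborhood of a boundary point into `∂M` are composed to
a map `π : M → M` which retracts a neighborhood of `∂M` onto `∂M` (`exists_retraction`). With a
boundary chart `κ` and a transverse vector `ν`, the formula `-ρ̂ ν + κ ∘ π` is a chart of the
completion on both sides of `∂M` (`HalfChart.exists_endChart`, `EndChart.completionChart`). In it
`ρ̂` is minus a linear form, the rays of the end are lines parallel to `ν`, and transition maps
commute with translations along `ν`.

Short extension. Seeley's reflection series extends `I, J, K` smoothly across `∂M`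
(`exists_contDiff_extension`), and a partition of unity makes them global
(`exists_field_extension`). The results are mere endomorphism fields, but where they are close
enough to the quaternionic triple at the foot of the ray they can be corrected: the reference triple
is conjugated by an invertible endomorphism built canonically from the data (`TransportData.total`).
The construction commutes with linear isomorphisms, hence does not depend on charts, and it returns
the given triple wherever that is already quaternionic. Invertibility and convexity are open
conditions and `∂M` is compact, so the corrected structure exists and is convex for heights in `[0,
ε)` (`exists_isConvexPoint`).

Stretching. Let `θ` be a smooth increasing concave function with `θ t = t` for `t ≤ 0` and `θ < ε`
(`exists_bounded_reparametrization`). Sliding the point of height `t` to height `θ t` maps the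
infinite end into the short collar. The structure on the end is the pull-back under the slide. For
it `θ ∘ ρ̂` is convex, being the pull-back of a convex function. The Levi coefficient of `θ ∘ ρ̂` on
an antilinear map is `θ'` times that of `ρ̂` plus `-θ''` times a sum of squares, so concavity of `θ`
yields convexity of `ρ̂` itself (`VectorConvexAt.of_comp_left`).

Submanifold. All choices are made compatible with `L`. Since `dρ ≠ 0` on `TL`, there are charts in
which `L` is linear and `ν` is tangent to `L`; then `π` preserves `L`, and the tangent spaces of
`L̂` are constant along rays. The extension at a point is a linear combination of values on the same
line parallel to `ν`, so `dρ̂ ∘ J = 0` and `dρ̂ ∘ K = 0` on `TL̂`, and `I`-invariance of `TL̂` if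
`L` is `I`-complex, survive the extension. The correction ends with a conjugation by `g`, which
fixes `λ = dρ̂` and prescribes `λ ∘ J` and `λ ∘ K`; if `L` is `I`-complex, `g` is chosen to commute
with `I` (`lam_total_J`, `lam_total_K`, `ringConj_total_I`). Finally the slide preserves `TL̂` and
only rescales `λ`. -/

/-! ### Smooth extension across a hyperplane -/

section Seeley

/-- The coefficients of the entire function `∏ (1 - z / 2 ^ j)`. -/
def eulerCoeff : ℕ → ℝ
  | 0 => 1
  | k + 1 => -eulerCoeff k * (2 / (2 ^ (k + 1) - 1))

lemma one_le_two_pow_succ_sub_one (k : ℕ) : (1 : ℝ) ≤ 2 ^ (k + 1) - 1 := by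
  have : (1 : ℝ) ≤ 2 ^ k := one_le_pow₀ (by norm_num)
  rw [pow_succ]; linarith

lemma eulerCoeff_ne_zero (k : ℕ) : eulerCoeff k ≠ 0 := by
  induction k with
  | zero => simp [eulerCoeff]
  | succ k ih =>
    have := one_le_two_pow_succ_sub_one k
    rw [eulerCoeff]
    have h2 : (2 : ℝ) ^ (k + 1) - 1 ≠ 0 := by linarith
    simp [ih, h2]

/-- Successive coefficients have a ratio of order `2 ^ (-k)`, so they beat every geometric sequence.
The weights `(2 ^ k) ^ m` are those produced by differentiating a reflection series `m` times. -/
lemma summable_eulerCoeff (m : ℕ) : Summable fun k => |eulerCoeff k| * (2 ^ k) ^ m := by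
  refine summable_of_ratio_test_tendsto_lt_one (l := 0) one_pos
    (Eventually.of_forall fun k => by
      have := eulerCoeff_ne_zero k
      positivity) ?_
  have h : ∀ k, ‖|eulerCoeff (k + 1)| * (2 ^ (k + 1) : ℝ) ^ m‖ / ‖|eulerCoeff k| * (2 ^ k) ^ m‖ =
      2 ^ (m + 1) * (2 ^ (k + 1) - 1)⁻¹ := by
    intro k
    have h0 := eulerCoeff_ne_zero k
    have h1 := one_le_two_pow_succ_sub_one k
    have h2 : (0 : ℝ) < 2 ^ (k + 1) - 1 := by linarith
    have h3 : (2 : ℝ) ^ (k + 1) - 1 ≠ 0 := h2.ne'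
    rw [eulerCoeff, abs_mul, abs_neg, abs_of_pos (div_pos two_pos h2)]
    rw [norm_mul, norm_mul, norm_mul]
    simp only [norm_pow, Real.norm_ofNat, Real.norm_eq_abs, abs_abs]
    rw [abs_of_pos (div_pos two_pos h2)]
    have h4 : |eulerCoeff k| ≠ 0 := abs_ne_zero.2 h0
    field_simp
    ring
  simp_rw [h]
  have : Tendsto (fun k : ℕ => ((2 : ℝ) ^ (k + 1) - 1)⁻¹) atTop (𝓝 0) := by
    refine tendsto_inv_atTop_zero.comp ?_
    refine tendsto_atTop_add_const_right _ _ ?_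
    exact (tendsto_pow_atTop_atTop_of_one_lt (one_lt_two)).comp (tendsto_add_atTop_nat 1)
  simpa using this.const_mul (2 ^ (m + 1))

lemma summable_eulerCoeff' (m : ℕ) : Summable fun k => eulerCoeff k * (2 ^ k) ^ m := by
  refine (summable_eulerCoeff m).of_norm_bounded fun k => ?_
  simp

/-- The recursion encodes the functional equation `f (2 z) = (1 - 2 z) f z` of the product over `j ≥
0`. Hence `f 1 = 0 · f (1 / 2) = 0`, and then `f` vanishes at every `2 ^ m`. -/
lemma tsum_eulerCoeff (m : ℕ) : ∑' k, eulerCoeff k * (2 ^ k) ^ m = 0 := by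
  have key : ∀ z : ℝ, Summable (fun k => eulerCoeff k * z ^ k) →
      Summable (fun k => eulerCoeff k * (2 * z) ^ k) →
      ∑' k, eulerCoeff k * (2 * z) ^ k = (1 - 2 * z) * ∑' k, eulerCoeff k * z ^ k := by
    intro z h1 h2
    have h3 : ∑' k, eulerCoeff k * (2 * z) ^ k - ∑' k, eulerCoeff k * z ^ k =
        ∑' k, eulerCoeff k * ((2 * z) ^ k - z ^ k) := by
      rw [← h2.tsum_sub h1]; simp_rw [mul_sub]
    have h4 : Summable fun k => eulerCoeff k * ((2 * z) ^ k - z ^ k) := by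
      simpa [mul_sub] using h2.sub h1
    have h5 : ∑' k, eulerCoeff k * ((2 * z) ^ k - z ^ k) = -(2 * z) * ∑' k, eulerCoeff k * z ^ k := by
      rw [h4.tsum_eq_zero_add, ← tsum_mul_left]
      simp only [pow_zero, sub_self, mul_zero, zero_add]
      congr 1; ext k
      have := one_le_two_pow_succ_sub_one k
      have h6 : (2 : ℝ) ^ (k + 1) - 1 ≠ 0 := by linarith
      rw [eulerCoeff, mul_pow]
      field_simp
      ring
    linarith
  have hs : ∀ m : ℕ, Summable fun k => eulerCoeff k * ((2 : ℝ) ^ m) ^ k := fun m => by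
    simpa [← pow_mul, mul_comm] using summable_eulerCoeff' m
  have hm : ∑' k, eulerCoeff k * ((2 : ℝ) ^ m) ^ k = 0 := by
    induction m with
    | zero =>
      have hs' : Summable fun k => eulerCoeff k * (1 / 2 : ℝ) ^ k := by
        refine (summable_eulerCoeff 0).of_norm_bounded fun k => ?_
        rw [norm_mul, norm_pow]
        simp only [pow_zero, mul_one, Real.norm_eq_abs]
        refine mul_le_of_le_one_right (abs_nonneg _) (pow_le_one₀ (by positivity) ?_)
        rw [abs_of_pos] <;> norm_num
      have := key (1 / 2) hs' (by simpa using hs 0)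
      simpa using this
    | succ m ih =>
      have := key (2 ^ m) (hs m) (by simpa [pow_succ'] using hs (m + 1))
      rw [ih, mul_zero] at this
      simpa [pow_succ'] using this
  simpa [← pow_mul, mul_comm] using hm

/-- Tail estimate for the non-vanishing below: the term of index 3 is `8 / 189` in absolute value,
and each later one is at most half its predecessor. -/
lemma abs_eulerCoeff_add_le (k : ℕ) :
    |eulerCoeff (k + 3)| / (1 + 2 ^ (k + 3)) ≤ (8 / 189) * (1 / 2) ^ k := by
  induction k with
  | zero => norm_num [eulerCoeff, abs_of_pos, abs_of_neg]
  | succ k ih =>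
    have h1 := one_le_two_pow_succ_sub_one (k + 3)
    have h2 : (2 : ℝ) ^ (k + 3) ≥ 8 := by
      have : (1 : ℝ) ≤ 2 ^ k := one_le_pow₀ (by norm_num)
      rw [pow_add]; linarith
    have e : |eulerCoeff (k + 1 + 3)| = |eulerCoeff (k + 3)| * (2 / (2 ^ (k + 3 + 1) - 1)) := by
      rw [show k + 1 + 3 = (k + 3) + 1 by ring, eulerCoeff, abs_mul, abs_neg, abs_of_pos (a := 2 / _)]
      exact div_pos two_pos (by linarith)
    have h3 : (2 : ℝ) / (2 ^ (k + 3 + 1) - 1) ≤ 1 / 2 := by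
      rw [div_le_div_iff₀ (by linarith) two_pos, pow_succ]; linarith
    rw [e]
    calc |eulerCoeff (k + 3)| * (2 / (2 ^ (k + 3 + 1) - 1)) / (1 + 2 ^ (k + 1 + 3))
        ≤ |eulerCoeff (k + 3)| * (1 / 2) / (1 + 2 ^ (k + 3)) := by
          gcongr
          · norm_num
          · linarith
      _ = (|eulerCoeff (k + 3)| / (1 + 2 ^ (k + 3))) * (1 / 2) := by ring
      _ ≤ ((8 / 189) * (1 / 2) ^ k) * (1 / 2) := by gcongr
      _ = _ := by ring

lemma summable_eulerCoeff_div (m : ℕ) :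
    Summable fun k => |eulerCoeff k / (1 + 2 ^ k)| * (2 ^ k) ^ m := by
  refine (summable_eulerCoeff m).of_nonneg_of_le (fun k => by positivity) fun k => ?_
  refine mul_le_mul_of_nonneg_right ?_ (by positivity)
  have : (0 : ℝ) < 2 ^ k := by positivity
  rw [abs_div, abs_of_pos (a := 1 + (2 : ℝ) ^ k) (by linarith)]
  exact div_le_self (abs_nonneg _) (by linarith)

/-- The first three terms add up to `1 / 2 - 2 / 3 + 4 / 15 = 1 / 10`, and the tail is at most `16 /
189 < 1 / 10`. -/
lemma tsum_eulerCoeff_div_ne_zero : ∑' k, eulerCoeff k / (1 + 2 ^ k) ≠ 0 := by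
  have hs : Summable fun k => eulerCoeff k / (1 + 2 ^ k) := by
    refine (summable_eulerCoeff_div 0).of_norm_bounded fun k => ?_
    rw [pow_zero, mul_one, Real.norm_eq_abs]
  rw [← hs.sum_add_tsum_nat_add 3]
  have hg : Summable fun k : ℕ => (8 / 189 : ℝ) * (1 / 2) ^ k :=
    (summable_geometric_of_lt_one (by norm_num) (by norm_num)).mul_left _
  have h2 : |∑' k, eulerCoeff (k + 3) / (1 + 2 ^ (k + 3))| ≤ ∑' k : ℕ, (8 / 189 : ℝ) * (1 / 2) ^ k := by
    rw [← Real.norm_eq_abs]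
    refine tsum_of_norm_bounded hg.hasSum fun k => ?_
    have := abs_eulerCoeff_add_le k
    rw [Real.norm_eq_abs, abs_div, abs_of_pos (a := 1 + _) (by positivity)]
    exact this
  rw [tsum_mul_left, tsum_geometric_of_lt_one (by norm_num) (by norm_num)] at h2
  have h3 := neg_le_of_abs_le h2
  norm_num [Finset.sum_range_succ, eulerCoeff] at h3 ⊢
  intro h
  linarith

/-- After division by `1 + 2 ^ k`, the sum of two consecutive moments is a value of the Euler
product at a power of 2, hence zero. The moments therefore alternate in sign; normalizing the zeroth
one and passing to the nodes `-2 ^ k` makes all of them 1. This is what matches all derivatives at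
the hyperplane. -/
lemma exists_seeley_coeff : ∃ a : ℕ → ℝ, (∀ m : ℕ, Summable fun k => |a k| * (2 ^ k) ^ m) ∧
    ∀ m : ℕ, ∑' k, a k * (-2 ^ k) ^ m = 1 := by
  set S : ℕ → ℝ := fun m => ∑' k, eulerCoeff k / (1 + 2 ^ k) * (2 ^ k) ^ m with hS
  have hsum : ∀ m, Summable fun k => eulerCoeff k / (1 + 2 ^ k) * (2 ^ k) ^ m := fun m => by
    refine (summable_eulerCoeff_div m).of_norm_bounded fun k => ?_
    rw [norm_mul, norm_pow, Real.norm_eq_abs]; simp only [Real.norm_eq_abs, Nat.abs_ofNat, norm_pow]; exact le_rfl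
  have h0 : S 0 ≠ 0 := by simpa [hS] using tsum_eulerCoeff_div_ne_zero
  have hstep : ∀ m, S (m + 1) = -S m := by
    intro m
    have : S (m + 1) + S m = 0 := by
      rw [hS, ← (hsum (m + 1)).tsum_add (hsum m), ← tsum_eulerCoeff m]
      congr 1; ext k
      have : (1 : ℝ) + 2 ^ k ≠ 0 := by positivity
      field_simp
      ring
    linarith
  have hSm : ∀ m, S m = (-1) ^ m * S 0 := by
    intro m
    induction m with
    | zero => simp
    | succ m ih => rw [hstep, ih, pow_succ]; ring
  refine ⟨fun k => eulerCoeff k / (1 + 2 ^ k) / S 0, fun m => ?_, fun m => ?_⟩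
  · have := (summable_eulerCoeff_div m).div_const |S 0|
    refine this.congr fun k => ?_
    rw [abs_div _ (S 0)]; ring
  · have h1 : ∀ k, eulerCoeff k / (1 + 2 ^ k) / S 0 * (-2 ^ k) ^ m =
        ((-1) ^ m / S 0) * (eulerCoeff k / (1 + 2 ^ k) * (2 ^ k) ^ m) := by
      intro k
      rw [neg_pow]; ring
    simp_rw [h1, tsum_mul_left]
    change (-1) ^ m / S 0 * S m = 1
    rw [hSm m, div_mul_eq_mul_div, ← mul_assoc, ← mul_pow]
    simp [h0]

variable {E F : Type*} [NormedAddCommGroup E] [NormedSpace ℝ E]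
  [NormedAddCommGroup F] [NormedSpace ℝ F] (ℓ : E →L[ℝ] ℝ) (ν : E) (a : ℕ → ℝ)

/-- The projection onto the line spanned by `ν`, with kernel `ker ℓ` if `ℓ ν = 1`. -/
def normalProj : E →L[ℝ] E := ℓ.smulRight ν

/-- The linear map scaling `ν` by `- 2 ^ k` and fixing `ker ℓ`, if `ℓ ν = 1`. -/
def scaledReflection (k : ℕ) : E →L[ℝ] E :=
  (ContinuousLinearMap.id ℝ E - normalProj ℓ ν) + (-2 ^ k : ℝ) • normalProj ℓ ν

lemma scaledReflection_apply (k : ℕ) (u : E) :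
    scaledReflection ℓ ν k u = u - ℓ u • ν + (-2 ^ k * ℓ u) • ν := by
  simp [scaledReflection, normalProj, mul_smul]

variable {ℓ ν} in
lemma apply_scaledReflection (h : ℓ ν = 1) (k : ℕ) (u : E) :
    ℓ (scaledReflection ℓ ν k u) = -2 ^ k * ℓ u := by
  simp [scaledReflection_apply, h]

open Classical in
/-- Seeley's extension operator, with the coefficients multiplied by `(- 2 ^ k) ^ m`. -/
def seeleyExt (m : ℕ) (f : E → F) (u : E) : F :=
  if 0 ≤ ℓ u then f u
  else ∑' k, (a k * (-2 ^ k) ^ m) • f (scaledReflection ℓ ν k u)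

variable {ℓ ν a}

lemma norm_seeley_term_le (h : ℓ ν = 1) {f : E → F} {C : ℝ} (hC : ∀ u, 0 ≤ ℓ u → ‖f u‖ ≤ C)
    (m k : ℕ) {u : E} (hu : ℓ u ≤ 0) :
    ‖(a k * (-2 ^ k) ^ m) • f (scaledReflection ℓ ν k u)‖ ≤ |a k| * (2 ^ k) ^ m * C := by
  rw [norm_smul, norm_mul, norm_pow, norm_neg, norm_pow, Real.norm_ofNat, Real.norm_eq_abs]
  refine mul_le_mul_of_nonneg_left (hC _ ?_) (by positivity)
  rw [apply_scaledReflection h]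
  have : (0 : ℝ) < 2 ^ k := by positivity
  nlinarith

lemma scaledReflection_of_zero (k : ℕ) {u : E} (hu : ℓ u = 0) :
    scaledReflection ℓ ν k u = u := by
  simp [scaledReflection_apply, hu]

lemma seeleyExt_of_nonneg (m : ℕ) (f : E → F) {u : E} (hu : 0 ≤ ℓ u) :
    seeleyExt ℓ ν a m f u = f u := if_pos hu

/-- On the hyperplane every reflection fixes the point and the coefficients have sum 1, so both
branches of the definition agree there. -/
lemma seeleyExt_of_nonpos (ha : ∀ m : ℕ, Summable fun k => |a k| * (2 ^ k) ^ m)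
    (ha' : ∀ m : ℕ, ∑' k, a k * (-2 ^ k) ^ m = 1) (m : ℕ) (f : E → F) {u : E} (hu : ℓ u ≤ 0) :
    seeleyExt ℓ ν a m f u = ∑' k, (a k * (-2 ^ k) ^ m) • f (scaledReflection ℓ ν k u) := by
  rcases hu.eq_or_lt with h0 | h0
  · rw [seeleyExt_of_nonneg _ _ h0.ge]
    simp_rw [scaledReflection_of_zero _ h0]
    have hs : Summable fun k => a k * (-2 ^ k) ^ m := by
      refine (ha m).of_norm_bounded fun k => ?_
      simp
    rw [hs.tsum_smul_const, ha', one_smul]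
  · exact if_neg h0.not_ge

variable [CompleteSpace F]

lemma continuous_seeleyExt (h : ℓ ν = 1) (ha : ∀ m : ℕ, Summable fun k => |a k| * (2 ^ k) ^ m)
    (ha' : ∀ m : ℕ, ∑' k, a k * (-2 ^ k) ^ m = 1) (m : ℕ) {f : E → F}
    (hf : ContinuousOn f {u | 0 ≤ ℓ u}) {C : ℝ} (hC : ∀ u, 0 ≤ ℓ u → ‖f u‖ ≤ C) :
    Continuous (seeleyExt ℓ ν a m f) := by
  have h1 : ContinuousOn (seeleyExt ℓ ν a m f) {u | 0 ≤ ℓ u} :=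
    hf.congr fun u hu => seeleyExt_of_nonneg _ _ hu
  have h2 : ContinuousOn (seeleyExt ℓ ν a m f) {u | ℓ u ≤ 0} := by
    have : ContinuousOn (fun u => ∑' k, (a k * (-2 ^ k) ^ m) • f (scaledReflection ℓ ν k u))
        {u | ℓ u ≤ 0} := by
      refine continuousOn_tsum (fun k => ContinuousOn.const_smul ?_ _) ((ha m).mul_right C)
        fun k u hu => norm_seeley_term_le h hC m k hu
      refine hf.comp (ContinuousLinearMap.continuous _).continuousOn fun u hu => ?_
      simp only [mem_ofPred_eq] at hu ⊢
      rw [apply_scaledReflection h]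
      have : (0 : ℝ) < 2 ^ k := by positivity
      nlinarith
    exact this.congr fun u hu => seeleyExt_of_nonpos ha ha' _ _ hu
  have h3 : {u | 0 ≤ ℓ u} ∪ {u | ℓ u ≤ 0} = (univ : Set E) := by
    ext u; simpa using le_total 0 (ℓ u)
  rw [← continuousOn_univ, ← h3]
  exact h1.union_of_isClosed h2 (isClosed_le continuous_const ℓ.continuous)
    (isClosed_le ℓ.continuous continuous_const)

/-- The derivative of Seeley's extension of a function with derivative `f'`. -/
def seeleyDeriv (ℓ : E →L[ℝ] ℝ) (ν : E) (a : ℕ → ℝ) (m : ℕ) (f' : E → E →L[ℝ] F) (u : E) :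
    E →L[ℝ] F :=
  (seeleyExt ℓ ν a m f' u).comp (ContinuousLinearMap.id ℝ E - normalProj ℓ ν) +
    (seeleyExt ℓ ν a (m + 1) f' u).comp (normalProj ℓ ν)

lemma closure_setOf_pos (h : ℓ ν = 1) : closure {u | 0 < ℓ u} = {u | 0 ≤ ℓ u} := by
  refine subset_antisymm (closure_minimal (fun u (hu : 0 < ℓ u) => hu.le)
    (isClosed_le continuous_const ℓ.continuous)) fun u hu => ?_
  have : Tendsto (fun t : ℝ => u + t • ν) (𝓝[>] 0) (𝓝 (u + (0 : ℝ) • ν)) := by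
    refine Tendsto.mono_left (Continuous.tendsto ?_ 0) nhdsWithin_le_nhds
    fun_prop
  rw [zero_smul, add_zero] at this
  refine mem_closure_of_tendsto this ?_
  filter_upwards [self_mem_nhdsWithin] with t ht
  simp only [mem_Ioi, mem_ofPred_eq, map_add, map_smul, h, smul_eq_mul, mul_one] at *
  linarith

/-- Off the hyperplane the series is differentiated term by term. On the hyperplane the derivative
is the common limit of the derivatives from the two open half-spaces, since the candidate is
continuous. -/
lemma hasFDerivAt_seeleyExt (h : ℓ ν = 1) (ha : ∀ m : ℕ, Summable fun k => |a k| * (2 ^ k) ^ m)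
    (ha' : ∀ m : ℕ, ∑' k, a k * (-2 ^ k) ^ m = 1) (m : ℕ) {f : E → F} {f' : E → E →L[ℝ] F}
    (hf : ∀ u, 0 ≤ ℓ u → HasFDerivWithinAt f (f' u) {u | 0 ≤ ℓ u} u)
    (hf' : ContinuousOn f' {u | 0 ≤ ℓ u})
    {C : ℝ} (hC : ∀ u, 0 ≤ ℓ u → ‖f u‖ ≤ C) {C' : ℝ} (hC' : ∀ u, 0 ≤ ℓ u → ‖f' u‖ ≤ C') (u : E) :
    HasFDerivAt (seeleyExt ℓ ν a m f) (seeleyDeriv ℓ ν a m f' u) u := by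
  have hpos : ∀ u, 0 < ℓ u → HasFDerivAt (seeleyExt ℓ ν a m f) (seeleyDeriv ℓ ν a m f' u) u := by
    intro u hu
    have hn : {u | 0 ≤ ℓ u} ∈ 𝓝 u :=
      mem_of_superset ((isOpen_lt continuous_const ℓ.continuous).mem_nhds hu)
        fun v (hv : 0 < ℓ v) => hv.le
    have := (hf u hu.le).hasFDerivAt hn
    have e : seeleyDeriv ℓ ν a m f' u = f' u := by
      rw [seeleyDeriv, seeleyExt_of_nonneg _ _ hu.le, seeleyExt_of_nonneg _ _ hu.le,
        ← ContinuousLinearMap.comp_add]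
      simp
    rw [e]
    refine this.congr_of_eventuallyEq ?_
    filter_upwards [hn] with v hv using seeleyExt_of_nonneg _ _ hv
  have hneg : ∀ u, ℓ u < 0 → HasFDerivAt (seeleyExt ℓ ν a m f) (seeleyDeriv ℓ ν a m f' u) u := by
    intro u hu
    have ho : IsOpen {u | ℓ u < 0} := isOpen_lt ℓ.continuous continuous_const
    have hc : Convex ℝ {u | ℓ u < 0} := convex_halfSpace_lt ℓ.toLinearMap.isLinear 0
    have hmem : ∀ k, ∀ v, ℓ v < 0 → 0 < ℓ (scaledReflection ℓ ν k v) := by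
      intro k v hv
      rw [apply_scaledReflection h]
      have : (0 : ℝ) < 2 ^ k := by positivity
      nlinarith
    have hsum' : ∀ m, Summable fun k => (a k * (-2 ^ k) ^ m) • f' (scaledReflection ℓ ν k u) :=
      fun m => Summable.of_norm_bounded ((ha m).mul_right C')
        fun k => norm_seeley_term_le h hC' m k hu.le
    -- The chain rule multiplies the normal component by `-2 ^ k`, which raises `m` by one, and
    -- leaves the tangential component alone.
    have e : seeleyDeriv ℓ ν a m f' u = ∑' k, (a k * (-2 ^ k) ^ m) •
        (f' (scaledReflection ℓ ν k u)).comp (scaledReflection ℓ ν k) := by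
      rw [seeleyDeriv, seeleyExt_of_nonpos ha ha' _ _ hu.le, seeleyExt_of_nonpos ha ha' _ _ hu.le]
      have e1 : ∀ (m : ℕ) (P : E →L[ℝ] E),
          (∑' k, (a k * (-2 ^ k) ^ m) • f' (scaledReflection ℓ ν k u)).comp P =
          ∑' k, ((a k * (-2 ^ k) ^ m) • f' (scaledReflection ℓ ν k u)).comp P := by
        intro m P
        exact ((ContinuousLinearMap.compL ℝ E E F).flip P).map_tsum (hsum' m)
      have e2 : ∀ (m : ℕ) (P : E →L[ℝ] E), Summable fun k =>
          ((a k * (-2 ^ k) ^ m) • f' (scaledReflection ℓ ν k u)).comp P := fun m P =>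
        ((ContinuousLinearMap.compL ℝ E E F).flip P).summable (hsum' m)
      rw [e1, e1, ← (e2 _ _).tsum_add (e2 _ _)]
      congr 1; ext k w
      simp only [scaledReflection, add_apply, ContinuousLinearMap.comp_apply,
        smul_apply, map_add, map_smul, smul_add, smul_smul]
      congr 2
      ring
    rw [e]
    have := hasFDerivAt_tsum_of_isPreconnected
      (f := fun k v => (a k * (-2 ^ k) ^ m) • f (scaledReflection ℓ ν k v))
      (f' := fun k v => (a k * (-2 ^ k) ^ m) •
        (f' (scaledReflection ℓ ν k v)).comp (scaledReflection ℓ ν k))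
      (u := fun k => |a k| * (2 ^ k) ^ m * C' * (‖ContinuousLinearMap.id ℝ E - normalProj ℓ ν‖) +
        |a k| * (2 ^ k) ^ (m + 1) * C' * ‖normalProj ℓ ν‖)
      (s := {u | ℓ u < 0}) (x₀ := u) (x := u)
      ((((ha m).mul_right C').mul_right _).add (((ha (m + 1)).mul_right C').mul_right _))
      ho hc.isPreconnected ?_ ?_ hu ?_ hu
    · refine this.congr_of_eventuallyEq ?_
      filter_upwards [ho.mem_nhds hu] with v hv
      exact seeleyExt_of_nonpos ha ha' _ _ (le_of_lt hv)
    · intro k v hv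
      refine HasFDerivAt.const_smul ?_ _
      have h1 := hmem k v hv
      have hn : {u | 0 ≤ ℓ u} ∈ 𝓝 (scaledReflection ℓ ν k v) :=
        mem_of_superset ((isOpen_lt continuous_const ℓ.continuous).mem_nhds h1)
          fun v (hv : 0 < ℓ v) => hv.le
      exact ((hf _ h1.le).hasFDerivAt hn).comp v (scaledReflection ℓ ν k).hasFDerivAt
    · intro k v hv
      have h1 := norm_seeley_term_le (a := a) h hC' m k (le_of_lt hv)
      have hC0 : 0 ≤ C' := (norm_nonneg _).trans (hC' _ (hmem k v hv).le)
      rw [← ContinuousLinearMap.smul_comp]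
      refine (ContinuousLinearMap.opNorm_comp_le _ _).trans ?_
      have h2 : ‖scaledReflection ℓ ν k‖ ≤ ‖ContinuousLinearMap.id ℝ E - normalProj ℓ ν‖ +
          2 ^ k * ‖normalProj ℓ ν‖ := by
        refine (norm_add_le _ _).trans ?_
        rw [norm_smul, norm_neg, norm_pow, Real.norm_ofNat]
      calc _ ≤ (|a k| * (2 ^ k) ^ m * C') * (‖ContinuousLinearMap.id ℝ E - normalProj ℓ ν‖ +
          2 ^ k * ‖normalProj ℓ ν‖) := by gcongr
        _ = _ := by ring
    · exact Summable.of_norm_bounded ((ha m).mul_right C)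
        fun k => norm_seeley_term_le h hC m k hu.le
  have hcont : Continuous (seeleyExt ℓ ν a m f) :=
    continuous_seeleyExt h ha ha' m (fun u hu => (hf u hu).continuousWithinAt) hC
  have hcont' : Continuous (seeleyDeriv ℓ ν a m f') := by
    have h1 := continuous_seeleyExt h ha ha' m hf' hC'
    have h2 := continuous_seeleyExt h ha ha' (m + 1) hf' hC'
    unfold seeleyDeriv
    fun_prop
  rcases lt_trichotomy (ℓ u) 0 with hu | hu | hu
  · exact hneg u hu
  · have h1 : HasFDerivWithinAt (seeleyExt ℓ ν a m f) (seeleyDeriv ℓ ν a m f' u)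
        (closure {u | 0 < ℓ u}) u := by
      refine hasFDerivWithinAt_closure_of_tendsto_fderiv
        (fun v hv => (hpos v hv).differentiableAt.differentiableWithinAt)
        (convex_halfSpace_gt ℓ.toLinearMap.isLinear 0)
        (isOpen_lt continuous_const ℓ.continuous) (fun v _ => hcont.continuousWithinAt) ?_
      refine (hcont'.continuousWithinAt (s := {u | 0 < ℓ u}) (x := u)).tendsto.congr' ?_
      filter_upwards [self_mem_nhdsWithin] with v hv using (hpos v hv).fderiv.symm
    have h2 : HasFDerivWithinAt (seeleyExt ℓ ν a m f) (seeleyDeriv ℓ ν a m f' u)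
        (closure {u | 0 < (-ℓ) u}) u := by
      refine hasFDerivWithinAt_closure_of_tendsto_fderiv
        (fun v hv => (hneg v (by simpa using hv)).differentiableAt.differentiableWithinAt)
        (convex_halfSpace_gt (-ℓ).toLinearMap.isLinear 0)
        (isOpen_lt continuous_const (-ℓ).continuous) (fun v _ => hcont.continuousWithinAt) ?_
      refine (hcont'.continuousWithinAt (s := {u | 0 < (-ℓ) u}) (x := u)).tendsto.congr' ?_
      filter_upwards [self_mem_nhdsWithin] with v hv using (hneg v (by simpa using hv)).fderiv.symm
    rw [closure_setOf_pos h] at h1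
    rw [closure_setOf_pos (ℓ := -ℓ) (ν := -ν) (by simp [h])] at h2
    have h3 := h1.union h2
    have h4 : {u | 0 ≤ ℓ u} ∪ {u | 0 ≤ (-ℓ) u} = (univ : Set E) := by
      ext u; simpa using le_total 0 (ℓ u)
    rwa [h4, hasFDerivWithinAt_univ] at h3
  · exact hpos u hu

end Seeley

/-! ### Smoothness of the reflection series and preservation of linear constraints -/

section SeeleySmooth

universe u

variable {E : Type u} [NormedAddCommGroup E] [NormedSpace ℝ E] {ℓ : E →L[ℝ] ℝ} {ν : E} {a : ℕ → ℝ}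

/-- The derivative of an extension is composed of extensions of `f'` with parameters `m` and `m +
1`, so the induction runs over all `m` and all target spaces at once. Vanishing off a compact set
supplies the bounds that make the series converge. -/
lemma contDiff_seeleyExt (h : ℓ ν = 1) (ha : ∀ m : ℕ, Summable fun k => |a k| * (2 ^ k) ^ m)
    (ha' : ∀ m : ℕ, ∑' k, a k * (-2 ^ k) ^ m = 1) {K : Set E} (hK : IsCompact K) (n : ℕ) :
    ∀ {F : Type u} [NormedAddCommGroup F] [NormedSpace ℝ F] [CompleteSpace F] (m : ℕ) {f : E → F},
      ContDiffOn ℝ ∞ f {u | 0 ≤ ℓ u} → (∀ u ∉ K, 0 ≤ ℓ u → f u = 0) →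
      ContDiff ℝ n (seeleyExt ℓ ν a m f) := by
  have hclosed : IsClosed {u | 0 ≤ ℓ u} := isClosed_le continuous_const ℓ.continuous
  have hbound : ∀ {F : Type u} [NormedAddCommGroup F] [NormedSpace ℝ F] {f : E → F},
      ContinuousOn f {u | 0 ≤ ℓ u} → (∀ u ∉ K, 0 ≤ ℓ u → f u = 0) →
      ∃ C, ∀ u, 0 ≤ ℓ u → ‖f u‖ ≤ C := by
    intro F _ _ f hf h0
    obtain ⟨C, hC⟩ := (hK.inter_right hclosed).exists_bound_of_continuousOn
      (hf.mono inter_subset_right)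
    refine ⟨max C 0, fun u hu => ?_⟩
    by_cases huK : u ∈ K
    · exact (hC u ⟨huK, hu⟩).trans (le_max_left _ _)
    · simp [h0 u huK hu]
  have hud : UniqueDiffOn ℝ {u | 0 ≤ ℓ u} := by
    refine uniqueDiffOn_convex (convex_halfSpace_ge ℓ.toLinearMap.isLinear 0) ⟨ν, ?_⟩
    refine interior_maximal (s := {u | 0 ≤ ℓ u}) (t := {u | 0 < ℓ u}) (fun u (hu : 0 < ℓ u) => hu.le)
      (isOpen_lt continuous_const ℓ.continuous) ?_
    simp [h]
  induction n with
  | zero =>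
    intro F _ _ _ m f hf h0
    obtain ⟨C, hC⟩ := hbound hf.continuousOn h0
    exact contDiff_zero.2 (continuous_seeleyExt h ha ha' m hf.continuousOn hC)
  | succ n ih =>
    intro F _ _ _ m f hf h0
    have hf' : ContDiffOn ℝ ∞ (fderivWithin ℝ f {u | 0 ≤ ℓ u}) {u | 0 ≤ ℓ u} :=
      hf.fderivWithin hud (by simp)
    have h0' : ∀ u ∉ K, 0 ≤ ℓ u → fderivWithin ℝ f {u | 0 ≤ ℓ u} u = 0 := by
      intro u hu hu'
      have : f =ᶠ[𝓝[{u | 0 ≤ ℓ u}] u] fun _ => 0 := by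
        filter_upwards [self_mem_nhdsWithin,
          mem_nhdsWithin_of_mem_nhds (hK.isClosed.isOpen_compl.mem_nhds hu)] with v hv hv'
        exact h0 v hv' hv
      rw [this.fderivWithin_eq (h0 u hu hu')]
      simp
    obtain ⟨C, hC⟩ := hbound hf.continuousOn h0
    obtain ⟨C', hC'⟩ := hbound hf'.continuousOn h0'
    have hd := hasFDerivAt_seeleyExt h ha ha' m
      (fun u hu => ((hf.differentiableOn (by simp)) u hu).hasFDerivWithinAt) hf'.continuousOn hC hC'
    rw [show ((n + 1 : ℕ) : WithTop ℕ∞) = (n : WithTop ℕ∞) + 1 by norm_cast,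
      contDiff_succ_iff_fderiv]
    refine ⟨fun u => (hd u).differentiableAt, by simp, ?_⟩
    have e : fderiv ℝ (seeleyExt ℓ ν a m f) =
        seeleyDeriv ℓ ν a m (fderivWithin ℝ f {u | 0 ≤ ℓ u}) := funext fun u => (hd u).fderiv
    rw [e]
    exact ((ih m hf' h0').clm_comp contDiff_const).add ((ih (m + 1) hf' h0').clm_comp contDiff_const)

/-- Smooth extension across a hyperplane: a function which is smooth on a half-ball extends to a
smooth function, and the extension can be chosen to satisfy all linear constraints that the
function satisfies on a line parallel to `ν`. -/
theorem exists_contDiff_extension [FiniteDimensional ℝ E] (h : ℓ ν = 1) {F : Type u}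
    [NormedAddCommGroup F] [NormedSpace ℝ F] [CompleteSpace F] {f : E → F} {u₀ : E} {R : ℝ}
    (hR : 0 < R) (hf : ContDiffOn ℝ ∞ f (Metric.ball u₀ R ∩ {u | 0 ≤ ℓ u})) :
    ∃ g : E → F, ContDiff ℝ ∞ g ∧ (∀ u ∈ Metric.ball u₀ (R / 2), 0 ≤ ℓ u → g u = f u) ∧
      ∀ (T : F →L[ℝ] ℝ) (u : E), (∀ s : ℝ, 0 ≤ ℓ (u + s • ν) → u + s • ν ∈ Metric.ball u₀ R →
        T (f (u + s • ν)) = 0) → T (g u) = 0 := by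
  obtain ⟨a, ha, ha'⟩ := exists_seeley_coeff
  -- Multiplication by the cut-off turns `f` into a function on the whole half-space. The outer
  -- radius stays below `R`, so the product vanishes near the points outside the ball.
  let χ : ContDiffBump u₀ := ⟨R / 2, 3 * R / 4, by positivity, by linarith⟩
  have hχ : ∀ u, u ∉ Metric.ball u₀ R → χ u = 0 := by
    intro u hu
    have : u ∉ Function.support χ := by
      rw [χ.support_eq]
      intro h; exact hu (Metric.ball_subset_ball (by change 3 * R / 4 ≤ R; linarith) h)
    simpa using this
  have hsmooth : ContDiffOn ℝ ∞ (fun u => χ u • f u) {u | 0 ≤ ℓ u} := by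
    intro u hu
    by_cases huR : u ∈ Metric.ball u₀ R
    · refine (χ.contDiff.contDiffWithinAt).smul ((hf u ⟨huR, hu⟩).mono_of_mem_nhdsWithin ?_)
      rw [inter_comm]
      exact inter_mem_nhdsWithin _ (Metric.isOpen_ball.mem_nhds huR)
    · refine (contDiffWithinAt_const (c := (0 : F))).congr_of_eventuallyEq ?_ (by simp [hχ u huR])
      have : (Metric.closedBall u₀ (3 * R / 4))ᶜ ∈ 𝓝 u := by
        refine Metric.isClosed_closedBall.isOpen_compl.mem_nhds fun h => huR ?_
        exact Metric.closedBall_subset_ball (by linarith) h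
      filter_upwards [mem_nhdsWithin_of_mem_nhds this] with v hv
      have : v ∉ Function.support χ := by
        rw [χ.support_eq]
        exact fun h => hv (Metric.ball_subset_closedBall h)
      simp [show χ v = 0 by simpa using this]
  refine ⟨seeleyExt ℓ ν a 0 (fun u => χ u • f u), ?_, ?_, ?_⟩
  · rw [contDiff_infty]
    intro n
    exact contDiff_seeleyExt h ha ha' (isCompact_closedBall u₀ R) n 0 hsmooth fun u hu _ => by
      rw [hχ u fun h => hu (Metric.ball_subset_closedBall h), zero_smul]
  · intro u hu hu'
    rw [seeleyExt_of_nonneg _ _ hu']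
    have : χ u = 1 := χ.one_of_mem_closedBall (Metric.ball_subset_closedBall hu)
    rw [this, one_smul]
  -- The extension at `u` is a linear combination of values of `χ f` on the line `u + ℝ ν`, so it
  -- inherits every linear relation that holds there.
  · intro T u hT
    have key : ∀ s : ℝ, 0 ≤ ℓ (u + s • ν) → T (χ (u + s • ν) • f (u + s • ν)) = 0 := by
      intro s hs
      by_cases hb : u + s • ν ∈ Metric.ball u₀ R
      · rw [map_smul, hT s hs hb, smul_zero]
      · rw [hχ _ hb, zero_smul, map_zero]
    by_cases hu : 0 ≤ ℓ u
    · rw [seeleyExt_of_nonneg _ _ hu]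
      simpa using key 0 (by simpa using hu)
    · rw [seeleyExt, if_neg hu]
      have hb : ∃ C, ∀ u, 0 ≤ ℓ u → ‖χ u • f u‖ ≤ C := by
        obtain ⟨C, hC⟩ := ((isCompact_closedBall u₀ R).inter_right
          (isClosed_le continuous_const ℓ.continuous)).exists_bound_of_continuousOn
          (hsmooth.continuousOn.mono inter_subset_right)
        refine ⟨max C 0, fun u hu => ?_⟩
        by_cases huK : u ∈ Metric.closedBall u₀ R
        · exact (hC u ⟨huK, hu⟩).trans (le_max_left _ _)
        · rw [hχ u fun h => huK (Metric.ball_subset_closedBall h)]; simp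
      obtain ⟨C, hC⟩ := hb
      rw [T.map_tsum (Summable.of_norm_bounded ((ha 0).mul_right C)
        fun k => norm_seeley_term_le (f := fun u => χ u • f u) h hC 0 k (not_le.1 hu).le)]
      refine (tsum_congr fun k => ?_).trans tsum_zero
      have e : scaledReflection ℓ ν k u = u + (-(1 + 2 ^ k) * ℓ u) • ν := by
        rw [scaledReflection_apply]; module
      have hpos : 0 ≤ ℓ (scaledReflection ℓ ν k u) := by
        rw [apply_scaledReflection h]
        have : (0 : ℝ) < 2 ^ k := by positivity
        nlinarith
      rw [e] at hpos ⊢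
      rw [map_smul, key _ hpos, smul_zero]

end SeeleySmooth

/-! ### A bounded concave reparametrization of the line -/

section Reparametrization

/-- `θ` is the primitive of `w = exp (-P)`, where `P` is nondecreasing, zero on the negative axis
and equal to `c s` once `c s ≥ 1`. Positivity and monotonicity of `w` make `θ` increasing and
concave; its exponential decay makes `θ` bounded. -/
lemma exists_bounded_reparametrization {ε : ℝ} (hε : 0 < ε) :
    ∃ θ : ℝ → ℝ, ContDiff ℝ ∞ θ ∧ (∀ t ≤ 0, θ t = t) ∧ (∀ t, 0 < deriv θ t) ∧
      (∀ t, deriv (deriv θ) t ≤ 0) ∧ (∀ t, θ t < ε) ∧ ∀ t, 0 ≤ t → 0 ≤ θ t := by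
  -- With this constant the integral of the majorant `e · exp (-c s)` over `[0, ∞)` is exactly `ε`.
  set c : ℝ := Real.exp 1 / ε with hc
  have hc0 : 0 < c := by positivity
  set P : ℝ → ℝ := fun s => c * s * Real.smoothTransition (c * s) with hP
  set w : ℝ → ℝ := fun s => Real.exp (-P s) with hw
  have hPs : ContDiff ℝ ∞ P := (contDiff_const.mul contDiff_id).mul
    (Real.smoothTransition.contDiff.comp (contDiff_const.mul contDiff_id))
  have hws : ContDiff ℝ ∞ w := hPs.neg.exp
  have hP0 : ∀ s ≤ 0, P s = 0 := fun s hs => by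
    simp [hP, Real.smoothTransition.zero_of_nonpos (mul_nonpos_of_nonneg_of_nonpos hc0.le hs)]
  have hPm : Monotone P := by
    intro s t hst
    rcases le_total s 0 with hs | hs
    · rw [hP0 s hs]
      rcases le_total t 0 with ht | ht
      · rw [hP0 t ht]
      · exact mul_nonneg (by positivity) (Real.smoothTransition.nonneg _)
    · have h1 : c * s ≤ c * t := by gcongr
      have h2 : 0 ≤ c * s := by positivity
      exact mul_le_mul h1 (Real.smoothTransition.monotone h1) (Real.smoothTransition.nonneg _)
        (h2.trans h1)
  have hwa : Antitone w := fun s t hst => Real.exp_le_exp.2 (neg_le_neg (hPm hst))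
  have hint : ∀ a b, IntervalIntegrable w MeasureTheory.volume a b :=
    fun a b => hws.continuous.intervalIntegrable a b
  have hd : ∀ t, HasDerivAt (fun t => ∫ s in (0 : ℝ)..t, w s) (w t) t := fun t =>
    intervalIntegral.integral_hasDerivAt_right (hint _ _)
      (hws.continuous.stronglyMeasurableAtFilter _ _) hws.continuous.continuousAt
  have hderiv : deriv (fun t => ∫ s in (0 : ℝ)..t, w s) = w := funext fun t => (hd t).deriv
  have hmono : Monotone fun t => ∫ s in (0 : ℝ)..t, w s := by
    refine monotone_of_deriv_nonneg (fun t => (hd t).differentiableAt) fun t => ?_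
    rw [hderiv]; positivity
  have hnonneg : ∀ t, 0 ≤ t → 0 ≤ ∫ s in (0 : ℝ)..t, w s := fun t ht => by
    simpa using hmono ht
  have hle : ∀ s, 0 ≤ s → w s ≤ Real.exp 1 * Real.exp (-(c * s)) := by
    intro s hs
    rw [← Real.exp_add]
    refine Real.exp_le_exp.2 ?_
    rcases le_total (c * s) 1 with h | h
    · have : 0 ≤ P s := mul_nonneg (by positivity) (Real.smoothTransition.nonneg _)
      linarith
    · have : P s = c * s := by simp [hP, Real.smoothTransition.one_of_one_le h]
      linarith
  have hbound : ∀ t, 0 ≤ t → ∫ s in (0 : ℝ)..t, w s < ε := by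
    intro t ht
    -- The integral of the majorant up to `t`, minus the integral of `w`. It vanishes at 0 and is
    -- nondecreasing, which gives the strict bound since `exp (-c t) > 0`.
    set D : ℝ → ℝ := fun t => ε * (1 - Real.exp (-(c * t))) - ∫ s in (0 : ℝ)..t, w s with hD
    have hD' : ∀ t, HasDerivAt D (Real.exp 1 * Real.exp (-(c * t)) - w t) t := by
      intro t
      have h1 : HasDerivAt (fun t => Real.exp (-(c * t))) (Real.exp (-(c * t)) * (-c)) t := by
        have : HasDerivAt (fun t => -(c * t)) (-c) t := by
          simpa using ((hasDerivAt_id t).const_mul c).fun_neg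
        exact this.exp
      have h2 := ((h1.const_sub 1).const_mul ε).sub (hd t)
      refine h2.congr_deriv ?_
      rw [hc]; field_simp
    have hDm : MonotoneOn D (Ici 0) := by
      refine monotoneOn_of_deriv_nonneg (convex_Ici 0)
        (fun t _ => (hD' t).continuousAt.continuousWithinAt)
        (fun t _ => (hD' t).differentiableAt.differentiableWithinAt) fun t ht => ?_
      rw [interior_Ici] at ht
      rw [(hD' t).deriv]
      linarith [hle t (le_of_lt ht)]
    have h3 := hDm (self_mem_Ici) ht ht
    have h4 : D 0 = 0 := by simp [hD]
    rw [h4] at h3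
    have h5 : 0 < ε * Real.exp (-(c * t)) := by positivity
    simp only [hD] at h3
    linarith
  refine ⟨fun t => ∫ s in (0 : ℝ)..t, w s, ?_, ?_, ?_, ?_, ?_, hnonneg⟩
  · rw [contDiff_infty_iff_deriv]
    exact ⟨fun t => (hd t).differentiableAt, by rwa [hderiv]⟩
  · intro t ht
    have : ∫ s in (0 : ℝ)..t, w s = ∫ s in (0 : ℝ)..t, (1 : ℝ) := by
      refine intervalIntegral.integral_congr fun s hs => ?_
      rw [uIcc_of_ge ht] at hs
      simp [hw, hP0 s hs.2]
    simp [this]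
  · intro t; rw [hderiv]; positivity
  · intro t; rw [hderiv]
    exact hwa.deriv_nonpos
  · intro t
    rcases le_total 0 t with ht | ht
    · exact hbound t ht
    · have := hmono ht
      simp only [intervalIntegral.integral_same] at this
      linarith

end Reparametrization

/-! ### Quaternionic triples in an algebra -/

section Triples

/-- `I, J, K` generate a quaternionic structure. -/
structure IsQuatTriple {R : Type*} [Ring R] (I J K : R) : Prop where
  I_sq : I * I = -1
  J_sq : J * J = -1
  K_sq : K * K = -1
  I_J : I * J = K

variable {R : Type*} [Ring R]

namespace IsQuatTriple

variable {I J K : R}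

/-- Anticommutation is not part of the definition. It results from `(I J)² = -1` by multiplying with
`I` on the left and `J` on the right. -/
lemma J_I (h : IsQuatTriple I J K) : J * I = -K := by
  have h1 : I * J * (I * J) = -1 := by rw [h.I_J, h.K_sq]
  calc J * I = -((I * I) * (J * I)) := by rw [h.I_sq]; simp
    _ = (I * J * (I * J)) * (I * J) := by
      have : I * J * (I * J) * (I * J) = I * J * I * (J * (I * J)) := by noncomm_ring
      rw [h1]
      have : I * I * (J * I) = I * (I * J * (I * J)) * -J := by
        have h2 : I * (I * J * (I * J)) * -J = -(I * I * J * I * (J * J)) := by noncomm_ring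
        rw [h2, h.J_sq]; noncomm_ring
      rw [this, h1]; noncomm_ring
    _ = -K := by rw [h1, h.I_J]; simp

lemma I_K (h : IsQuatTriple I J K) : I * K = -J := by
  rw [← h.I_J, ← mul_assoc, h.I_sq]; simp

lemma K_I (h : IsQuatTriple I J K) : K * I = J := by
  rw [← h.I_J, mul_assoc, h.J_I, mul_neg, h.I_K]; simp

lemma J_K (h : IsQuatTriple I J K) : J * K = I := by
  rw [← h.I_J, ← mul_assoc, h.J_I, neg_mul, ← h.I_J, mul_assoc, h.J_sq]; simp

lemma K_J (h : IsQuatTriple I J K) : K * J = -I := by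
  rw [← h.I_J, mul_assoc, h.J_sq]; simp

end IsQuatTriple

/-- Conjugation in a ring. -/
def ringConj (h A : R) : R := h * A * h⁻¹ʳ

lemma ringConj_mul {h : R} (hh : IsUnit h) (A B : R) :
    ringConj h (A * B) = ringConj h A * ringConj h B := by
  have := Ring.inverse_mul_cancel h hh
  calc h * (A * B) * h⁻¹ʳ = h * A * 1 * B * h⁻¹ʳ := by noncomm_ring
    _ = _ := by rw [← this, ringConj, ringConj]; noncomm_ring

lemma ringConj_one {h : R} (hh : IsUnit h) : ringConj h 1 = 1 := by
  rw [ringConj, mul_one, Ring.mul_inverse_cancel h hh]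

lemma ringConj_neg (h A : R) : ringConj h (-A) = -ringConj h A := by
  simp [ringConj]

lemma ringConj_mul_left {g h : R} (hg : IsUnit g) (hh : IsUnit h) (A : R) :
    ringConj (g * h) A = ringConj g (ringConj h A) := by
  obtain ⟨g, rfl⟩ := hg
  obtain ⟨h, rfl⟩ := hh
  rw [ringConj, ringConj, ringConj, ← Units.val_mul, Ring.inverse_unit, Ring.inverse_unit,
    Ring.inverse_unit]
  simp [mul_assoc]

lemma ringConj_eq_of_mul_eq {h A B : R} (hh : IsUnit h) (e : h * A = B * h) :
    ringConj h A = B := by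
  rw [ringConj, e, mul_assoc, Ring.mul_inverse_cancel h hh, mul_one]

lemma ringConj_mul_self {h : R} (hh : IsUnit h) (A : R) : ringConj h A * h = h * A := by
  rw [ringConj, mul_assoc, Ring.inverse_mul_cancel h hh, mul_one]

lemma IsQuatTriple.ringConj {I J K h : R} (H : IsQuatTriple I J K) (hh : IsUnit h) :
    IsQuatTriple (ringConj h I) (ringConj h J) (ringConj h K) where
  I_sq := by rw [← ringConj_mul hh, H.I_sq, ringConj_neg, ringConj_one hh]
  J_sq := by rw [← ringConj_mul hh, H.J_sq, ringConj_neg, ringConj_one hh]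
  K_sq := by rw [← ringConj_mul hh, H.K_sq, ringConj_neg, ringConj_one hh]
  I_J := by rw [← ringConj_mul hh, H.I_J]

lemma map_ringInverse {S Φ : Type*} [Ring S] [EquivLike Φ R S] [RingEquivClass Φ R S] (φ : Φ) (a : R) : φ (a⁻¹ʳ) = (φ a)⁻¹ʳ := by
  by_cases ha : IsUnit a
  · obtain ⟨u, rfl⟩ := ha
    rw [Ring.inverse_unit]
    exact (Ring.inverse_unit (Units.map (φ : R →* S) u)).symm
  · rw [Ring.inverse_non_unit a ha, map_zero, Ring.inverse_non_unit]
    exact fun h => ha ((MulEquiv.isUnit_map φ).1 h)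

lemma map_ringConj {S Φ : Type*} [Ring S] [EquivLike Φ R S] [RingEquivClass Φ R S] (φ : Φ) (h a : R) :
    φ (ringConj h a) = ringConj (φ h) (φ a) := by
  simp [ringConj, map_ringInverse]

end Triples

/-! ### Correcting an approximate quaternionic structure -/

section Transport

/-- An approximate quaternionic structure `(It, Jt, Kt)`, a reference quaternionic structure
`(I0, J0, K0)`, a linear form and a vector. -/
structure TransportData (V : Type*) [NormedAddCommGroup V] [NormedSpace ℝ V] where
  It : V →L[ℝ] V
  Jt : V →L[ℝ] V
  Kt : V →L[ℝ] V
  I0 : V →L[ℝ] V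
  J0 : V →L[ℝ] V
  K0 : V →L[ℝ] V
  lam : V →L[ℝ] ℝ
  eta : V

namespace TransportData

variable {V : Type*} [NormedAddCommGroup V] [NormedSpace ℝ V] (D : TransportData V)

/-- The complex linear isomorphism from the reference `I0` to an approximation of `It`. -/
def h1 : V →L[ℝ] V := (1 / 2 : ℝ) • (1 - D.It * D.I0)

/-- The transported complex structure. -/
def I1 : V →L[ℝ] V := ringConj D.h1 D.I0

/-- An approximation of `Jt` anticommuting with `I1`. -/
def J01 : V →L[ℝ] V := ringConj D.h1 D.J0

/-- The auxiliary endomorphism intertwining `J01` and `Jt` approximately. -/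
def k : V →L[ℝ] V := (1 / 2 : ℝ) • (1 - D.Jt * D.J01)

/-- The `I1`-linear part of `k`. -/
def h2 : V →L[ℝ] V := (1 / 2 : ℝ) • (D.k - D.I1 * D.k * D.I1)

/-- The transported second complex structure. -/
def J1 : V →L[ℝ] V := ringConj (D.h2 * D.h1) D.J0

/-- The transported third complex structure. -/
def K1 : V →L[ℝ] V := ringConj (D.h2 * D.h1) D.K0

/-- A vector with `λ ξ = 1` and `λ (I1 ξ) = λ (J1 ξ) = λ (K1 ξ) = 0`. -/
def xi : V :=
  ((D.lam D.eta) ^ 2 + (D.lam (D.I1 D.eta)) ^ 2 + (D.lam (D.J1 D.eta)) ^ 2 +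
    (D.lam (D.K1 D.eta)) ^ 2)⁻¹ •
  ((D.lam D.eta) • D.eta + (D.lam (D.I1 D.eta)) • D.I1 D.eta +
   (D.lam (D.J1 D.eta)) • D.J1 D.eta + (D.lam (D.K1 D.eta)) • D.K1 D.eta)

/-- The rank one operator `ξ ⊗ λ`. -/
def X : V →L[ℝ] V := D.lam.smulRight D.xi

open Classical in
/-- The desired change of `λ K1`. -/
def DK (b : Prop) : V →L[ℝ] V := if b then -(D.Jt - D.J1) * D.I1 else D.Kt - D.K1

/-- The correction taking `λ J1` to `λ Jt`. -/
def g (b : Prop) : V →L[ℝ] V := 1 - D.J1 * D.X * (D.Jt - D.J1) - D.K1 * D.X * D.DK b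

/-- The total transport from the reference structure. -/
def total (b : Prop) : V →L[ℝ] V := (D.g b)⁻¹ʳ * (D.h2 * D.h1)

/-- All the endomorphisms involved are invertible. -/
structure IsGood (b : Prop) : Prop where
  h1 : IsUnit D.h1
  h2 : IsUnit D.h2
  g : IsUnit (D.g b)

variable {D} {b : Prop}

lemma IsGood.isUnit_total (h : D.IsGood b) : IsUnit (D.total b) :=
  h.g.ringInverse.mul (h.h2.mul h.h1)

lemma isQuatTriple_one (hq : IsQuatTriple D.I0 D.J0 D.K0) (h : D.IsGood b) :
    IsQuatTriple D.I1 D.J01 (ringConj D.h1 D.K0) := hq.ringConj h.h1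

lemma h2_comm (hI : D.I1 * D.I1 = -1) : D.h2 * D.I1 = D.I1 * D.h2 := by
  rw [h2, smul_mul_assoc, mul_smul_comm]
  congr 1
  calc (D.k - D.I1 * D.k * D.I1) * D.I1 = D.k * D.I1 - D.I1 * D.k * (D.I1 * D.I1) := by
        noncomm_ring
    _ = D.I1 * D.k - (D.I1 * D.I1) * D.k * D.I1 := by rw [hI]; noncomm_ring
    _ = _ := by noncomm_ring

/-- As `h2` commutes with `I1`, conjugation by it moves the second and third structures without
disturbing the first. -/
lemma isQuatTriple_two (hq : IsQuatTriple D.I0 D.J0 D.K0) (h : D.IsGood b) :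
    IsQuatTriple D.I1 D.J1 D.K1 := by
  have h1 := hq.ringConj (h.h2.mul h.h1)
  have : ringConj (D.h2 * D.h1) D.I0 = D.I1 := by
    rw [ringConj_mul_left h.h2 h.h1]
    exact ringConj_eq_of_mul_eq h.h2 (h2_comm (isQuatTriple_one hq h).I_sq)
  rwa [this] at h1

lemma isQuatTriple_total (hq : IsQuatTriple D.I0 D.J0 D.K0) (h : D.IsGood b) :
    IsQuatTriple (ringConj (D.total b) D.I0) (ringConj (D.total b) D.J0)
      (ringConj (D.total b) D.K0) := hq.ringConj h.isUnit_total

lemma ringConj_total (hq : IsQuatTriple D.I0 D.J0 D.K0) (h : D.IsGood b) :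
    ringConj (D.total b) D.I0 = ringConj (D.g b)⁻¹ʳ D.I1 ∧
    ringConj (D.total b) D.J0 = ringConj (D.g b)⁻¹ʳ D.J1 ∧
    ringConj (D.total b) D.K0 = ringConj (D.g b)⁻¹ʳ D.K1 := by
  have hu := h.h2.mul h.h1
  have hg := h.g.ringInverse
  have : ringConj (D.h2 * D.h1) D.I0 = D.I1 := by
    rw [ringConj_mul_left h.h2 h.h1]
    exact ringConj_eq_of_mul_eq h.h2 (h2_comm (isQuatTriple_one hq h).I_sq)
  simp only [total, ringConj_mul_left hg hu]
  exact ⟨by rw [this], rfl, rfl⟩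

/-- If the approximate structure is quaternionic, then it is the transported one. -/
lemma ringConj_total_of_isQuatTriple (hq : IsQuatTriple D.I0 D.J0 D.K0) (h : D.IsGood b)
    (ht : IsQuatTriple D.It D.Jt D.Kt) :
    ringConj (D.total b) D.I0 = D.It ∧ ringConj (D.total b) D.J0 = D.Jt ∧
      ringConj (D.total b) D.K0 = D.Kt := by
  -- Once `It` squares to `-1`, both `(1 - It I0) I0` and `It (1 - It I0)` are equal to `I0 + It`.
  have hI : D.I1 = D.It := by
    refine ringConj_eq_of_mul_eq h.h1 ?_
    rw [TransportData.h1, smul_mul_assoc, mul_smul_comm]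
    congr 1
    calc (1 - D.It * D.I0) * D.I0 = D.I0 - D.It * (D.I0 * D.I0) := by noncomm_ring
      _ = D.It - (D.It * D.It) * D.I0 := by rw [hq.I_sq, ht.I_sq]; noncomm_ring
      _ = _ := by noncomm_ring
  have hq1 := isQuatTriple_one hq h
  -- For an exact triple, `Jt` and `J01` both anticommute with `I1`; their product is `I1`-linear,
  -- and taking the linear part of `k` changes nothing.
  have hk : D.h2 = D.k := by
    have e : D.I1 * D.k * D.I1 = -D.k := by
      rw [k, mul_smul_comm, smul_mul_assoc, ← smul_neg]
      congr 1
      have e1 : D.I1 * D.Jt * (D.J01 * D.I1) = -(D.Jt * D.J01) := by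
        have e2 : D.J01 * D.I1 = -(D.It * D.J01) := by rw [hq1.J_I, ← hq1.I_J, hI]
        rw [hI, ht.I_J, ← hI, e2, mul_neg, ← mul_assoc, ht.K_I]
      calc D.I1 * (1 - D.Jt * D.J01) * D.I1 = D.I1 * D.I1 - D.I1 * D.Jt * (D.J01 * D.I1) := by
            noncomm_ring
        _ = -(1 - D.Jt * D.J01) := by rw [e1, hq1.I_sq]; noncomm_ring
    rw [h2, e]
    module
  have hJ : D.J1 = D.Jt := by
    have : D.J1 = ringConj D.h2 D.J01 := ringConj_mul_left h.h2 h.h1 _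
    rw [this]
    refine ringConj_eq_of_mul_eq h.h2 ?_
    rw [hk, k, smul_mul_assoc, mul_smul_comm]
    congr 1
    calc (1 - D.Jt * D.J01) * D.J01 = D.J01 - D.Jt * (D.J01 * D.J01) := by noncomm_ring
      _ = D.Jt - (D.Jt * D.Jt) * D.J01 := by rw [hq1.J_sq, ht.J_sq]; noncomm_ring
      _ = _ := by noncomm_ring
  have hq2 := isQuatTriple_two hq h
  have hK : D.K1 = D.Kt := by rw [← hq2.I_J, hI, hJ, ht.I_J]
  have hg : D.g b = 1 := by
    rw [g, DK, hJ, hK]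
    split_ifs <;> simp
  obtain ⟨a1, a2, a3⟩ := ringConj_total hq h
  rw [a1, a2, a3, hg, hI, hJ, hK]
  simp [ringConj]


/-! #### The exact case -/

/-- Here all three factors are 1. As invertibility is an open condition, this gives goodness near
the boundary of the core. -/
lemma isGood_of_eq (hq : IsQuatTriple D.I0 D.J0 D.K0) (hI : D.It = D.I0) (hJ : D.Jt = D.J0)
    (hK : D.Kt = D.K0) : D.IsGood b := by
  have e1 : D.h1 = 1 := by
    rw [h1, hI, hq.I_sq, sub_neg_eq_add, ← two_smul ℝ, smul_smul]; norm_num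
  have eI : D.I1 = D.I0 := by rw [I1, e1]; simp [ringConj]
  have eJ : D.J01 = D.J0 := by rw [J01, e1]; simp [ringConj]
  have ek : D.k = 1 := by
    rw [k, eJ, hJ, hq.J_sq, sub_neg_eq_add, ← two_smul ℝ, smul_smul]; norm_num
  have e2 : D.h2 = 1 := by
    rw [h2, ek, eI, mul_one, hq.I_sq, sub_neg_eq_add, ← two_smul ℝ, smul_smul]; norm_num
  have eJ1 : D.J1 = D.J0 := by rw [J1, e1, e2]; simp [ringConj]
  have eK1 : D.K1 = D.K0 := by rw [K1, e1, e2]; simp [ringConj]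
  have eg : D.g b = 1 := by
    rw [g, DK, eJ1, eK1, hJ, hK]
    split_ifs <;> simp
  exact ⟨by rw [e1]; exact isUnit_one, by rw [e2]; exact isUnit_one, by rw [eg]; exact isUnit_one⟩

/-! #### Linear constraints -/

/-- `xi` is the normalized sum of `λ(A η) A η` over `A = 1, I1, J1, K1`. Applying `λ` gives the sum
of squares; applying one of the three structures first permutes the terms up to sign, and `λ` of the
result cancels in pairs. -/
lemma lam_xi (hq : IsQuatTriple D.I1 D.J1 D.K1) (hlam : D.lam D.eta ≠ 0) :
    D.lam D.xi = 1 ∧ D.lam (D.I1 D.xi) = 0 ∧ D.lam (D.J1 D.xi) = 0 ∧ D.lam (D.K1 D.xi) = 0 := by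
  have m : ∀ A B : V →L[ℝ] V, ∀ v, A (B v) = (A * B) v := fun _ _ _ => rfl
  have n : ∀ (A : V →L[ℝ] V) (v : V), (-A) v = -(A v) := fun _ _ => rfl
  have hne : (D.lam D.eta) ^ 2 + (D.lam (D.I1 D.eta)) ^ 2 + (D.lam (D.J1 D.eta)) ^ 2 +
    (D.lam (D.K1 D.eta)) ^ 2 ≠ 0 := by positivity
  have one : ∀ v : V, (1 : V →L[ℝ] V) v = v := fun _ => rfl
  refine ⟨?_, ?_, ?_, ?_⟩ <;>
  simp only [xi, map_smul, map_add, smul_eq_mul] <;> (try simp only [m]) <;>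
  (try simp only [hq.I_sq, hq.J_sq, hq.K_sq, hq.I_J, hq.J_I, hq.I_K, hq.K_I, hq.J_K, hq.K_J, n, one,
    map_neg])
  · field_simp
  all_goals
    rw [mul_eq_zero]; right; ring

/-- The rank one corrections point along `J1 ξ` and `K1 ξ`, which `λ` annihilates. The operators
`J1` and `K1` turn these directions into `-ξ` or `± I1 ξ`, on which `λ` is `-1` or `0`. So `λ J1`
and `λ K1` change by prescribed amounts while `λ` stays. -/
lemma lam_J1_g (hq : IsQuatTriple D.I1 D.J1 D.K1) (hlam : D.lam D.eta ≠ 0) (v : V) :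
    D.lam (D.g b v) = D.lam v ∧ D.lam (D.J1 (D.g b v)) = D.lam (D.Jt v) ∧
      D.lam (D.K1 (D.g b v)) = D.lam (D.K1 v) + D.lam (D.DK b v) := by
  obtain ⟨x1, x2, x3, x4⟩ := lam_xi hq hlam
  have hg : D.g b v = v - D.lam (D.Jt v - D.J1 v) • D.J1 D.xi - D.lam (D.DK b v) • D.K1 D.xi := by
    simp [g, X]
  have m : ∀ A B : V →L[ℝ] V, ∀ v, A (B v) = (A * B) v := fun _ _ _ => rfl
  have n : ∀ (A : V →L[ℝ] V) (v : V), (-A) v = -(A v) := fun _ _ => rfl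
  have one : ∀ v : V, (1 : V →L[ℝ] V) v = v := fun _ => rfl
  refine ⟨?_, ?_, ?_⟩
  · rw [hg]; simp [x3, x4]
  · rw [hg]
    simp only [map_sub, map_smul, m, hq.J_sq, hq.J_K, n, one, x2, x1, map_neg, smul_eq_mul]
    ring
  · rw [hg]
    simp only [map_sub, map_smul, m, hq.K_sq, hq.K_J, n, one, x2, x1, map_neg, smul_eq_mul]
    ring

/-- An injective endomorphism of a finite-dimensional subspace is onto, so the inverse preserves the
subspace too. -/
lemma unit_apply_mem {A : V →L[ℝ] V} {W : Submodule ℝ V} [FiniteDimensional ℝ W]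
    (hA : ∀ w ∈ W, A w ∈ W) (hu : IsUnit A) : ∀ w ∈ W, A⁻¹ʳ w ∈ W := by
  intro w hw
  have hinj : Function.Injective (A.toLinearMap.restrict hA) := by
    intro x y hxy
    have h1 : A x = A y := congrArg Subtype.val hxy
    have h2 : (A⁻¹ʳ * A) x = (A⁻¹ʳ * A) y := congrArg (fun v => A⁻¹ʳ v) h1
    rw [Ring.inverse_mul_cancel A hu] at h2
    exact Subtype.ext h2
  obtain ⟨x, hx⟩ := (LinearMap.injective_iff_surjective.1 hinj) ⟨w, hw⟩
  have h1 : A x = w := congrArg Subtype.val hx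
  have h2 : (A⁻¹ʳ * A) x = A⁻¹ʳ w := congrArg (fun v => A⁻¹ʳ v) h1
  rw [Ring.inverse_mul_cancel A hu] at h2
  rw [← h2]
  exact x.2

lemma lam_ginv (hq : IsQuatTriple D.I1 D.J1 D.K1) (hlam : D.lam D.eta ≠ 0) (h : D.IsGood b)
    (v : V) : D.lam ((D.g b)⁻¹ʳ v) = D.lam v := by
  rw [← (lam_J1_g (b := b) hq hlam ((D.g b)⁻¹ʳ v)).1]
  have : (D.g b * (D.g b)⁻¹ʳ) v = v := by rw [Ring.mul_inverse_cancel _ h.g]; rfl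
  exact congrArg D.lam this

lemma ringConj_inverse_apply {A B : V →L[ℝ] V} (hA : IsUnit A) (v : V) :
    ringConj A⁻¹ʳ B v = A⁻¹ʳ (B (A v)) := by
  obtain ⟨u, rfl⟩ := hA
  rw [Ring.inverse_unit, ringConj, Ring.inverse_unit, inv_inv]
  rfl

lemma lam_total_J (hq : IsQuatTriple D.I0 D.J0 D.K0) (hlam : D.lam D.eta ≠ 0) (h : D.IsGood b)
    (v : V) : D.lam (ringConj (D.total b) D.J0 v) = D.lam (D.Jt v) := by
  have hq2 := isQuatTriple_two hq h
  rw [(ringConj_total hq h).2.1, ringConj_inverse_apply h.g, lam_ginv hq2 hlam h,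
    (lam_J1_g hq2 hlam v).2.1]

lemma lam_total_K_of_not (hq : IsQuatTriple D.I0 D.J0 D.K0) (hlam : D.lam D.eta ≠ 0)
    (h : D.IsGood b) (hb : ¬ b) (v : V) :
    D.lam (ringConj (D.total b) D.K0 v) = D.lam (D.Kt v) := by
  have hq2 := isQuatTriple_two hq h
  rw [(ringConj_total hq h).2.2, ringConj_inverse_apply h.g, lam_ginv hq2 hlam h,
    (lam_J1_g hq2 hlam v).2.2, DK, if_neg hb]
  simp

/-- In this case `g` is chosen to commute with `I1` instead of realizing `λ Kt`, and the value of `λ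
K` is forced. It still vanishes on an `I1`-invariant subspace on which `λ Jt` vanishes. -/
lemma lam_total_K (hq : IsQuatTriple D.I0 D.J0 D.K0) (hlam : D.lam D.eta ≠ 0)
    (h : D.IsGood b) (hb : b) (v : V) :
    D.lam (ringConj (D.total b) D.K0 v) = -D.lam (D.Jt (D.I1 v)) := by
  have hq2 := isQuatTriple_two hq h
  rw [(ringConj_total hq h).2.2, ringConj_inverse_apply h.g, lam_ginv hq2 hlam h,
    (lam_J1_g hq2 hlam v).2.2, DK, if_pos hb]
  have : D.J1 (D.I1 v) = -D.K1 v := by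
    have := congrArg (fun A : V →L[ℝ] V => A v) hq2.J_I
    exact this
  simp only [neg_mul, neg_apply, mul_apply_eq_comp, sub_apply, map_neg, map_sub, this]
  ring

lemma I1_mem (h : D.IsGood b) {W : Submodule ℝ V} [FiniteDimensional ℝ W]
    (hIt : ∀ w ∈ W, D.It w ∈ W) (hI0 : ∀ w ∈ W, D.I0 w ∈ W) : ∀ w ∈ W, D.I1 w ∈ W := by
  have h1 : ∀ w ∈ W, D.h1 w ∈ W := fun w hw =>
    W.smul_mem _ (W.sub_mem hw (hIt _ (hI0 _ hw)))
  intro w hw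
  exact h1 _ (hI0 _ (unit_apply_mem h1 h.h1 w hw))

/-- With `DK = -(Jt - J1) I1` the two rank one terms of `g` are exchanged by `I1` in such a way that
their sum is `I1`-linear. Conjugation by `g` then does not move `I1`. -/
lemma ringConj_total_I (hq : IsQuatTriple D.I0 D.J0 D.K0) (h : D.IsGood b) (hb : b) :
    ringConj (D.total b) D.I0 = D.I1 := by
  have hq2 := isQuatTriple_two hq h
  rw [(ringConj_total hq h).1]
  have hX : D.I1 * D.g b = D.g b * D.I1 := by
    ext v
    have m : ∀ A B : V →L[ℝ] V, ∀ v, A (B v) = (A * B) v := fun _ _ _ => rfl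
    have n : ∀ (A : V →L[ℝ] V) (v : V), (-A) v = -(A v) := fun _ _ => rfl
    have one : ∀ v : V, (1 : V →L[ℝ] V) v = v := fun _ => rfl
    have hg : ∀ v, D.g b v = v - D.lam (D.Jt v - D.J1 v) • D.J1 D.xi +
        D.lam (D.Jt (D.I1 v) - D.J1 (D.I1 v)) • D.K1 D.xi := by
      intro v
      simp [g, X, DK, hb]
      module
    have e1 : D.I1 (D.I1 v) = -v := by rw [m, hq2.I_sq]; rfl
    have e2 : D.I1 (D.J1 D.xi) = D.K1 D.xi := by rw [m, hq2.I_J]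
    have e3 : D.I1 (D.K1 D.xi) = -D.J1 D.xi := by rw [m, hq2.I_K]; rfl
    change D.I1 (D.g b v) = D.g b (D.I1 v)
    rw [hg, hg]
    simp only [map_add, map_sub, map_smul, e1, e2, e3, map_neg]
    module
  refine ringConj_eq_of_mul_eq h.g.ringInverse ?_
  obtain ⟨u, hu⟩ := h.g
  rw [← hu] at hX ⊢
  rw [Ring.inverse_unit]
  calc (↑u⁻¹ : V →L[ℝ] V) * D.I1 = ↑u⁻¹ * (D.I1 * ↑u) * ↑u⁻¹ := by simp [mul_assoc]
    _ = _ := by rw [hX]; simp [← mul_assoc]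

/-! #### Naturality -/

section Map

variable {V' : Type*} [NormedAddCommGroup V'] [NormedSpace ℝ V'] (D) (B : V ≃L[ℝ] V')

/-- Transport of all the data by a linear isomorphism. -/
@[simps] def map : TransportData V' where
  It := B.conjContinuousAlgEquiv D.It
  Jt := B.conjContinuousAlgEquiv D.Jt
  Kt := B.conjContinuousAlgEquiv D.Kt
  I0 := B.conjContinuousAlgEquiv D.I0
  J0 := B.conjContinuousAlgEquiv D.J0
  K0 := B.conjContinuousAlgEquiv D.K0
  lam := D.lam.comp (B.symm : V' →L[ℝ] V)
  eta := B D.eta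

/-- Each stage is built from the data by sums, products, inverses and evaluations, and so commutes
with linear isomorphisms. This makes the corrected structure independent of the chart in which it is
computed. -/
lemma h1_map : (D.map B).h1 = B.conjContinuousAlgEquiv D.h1 := by simp [h1]
lemma I1_map : (D.map B).I1 = B.conjContinuousAlgEquiv D.I1 := by simp [I1, h1_map, map_ringConj]
lemma J01_map : (D.map B).J01 = B.conjContinuousAlgEquiv D.J01 := by
  simp [J01, h1_map, map_ringConj]
lemma k_map : (D.map B).k = B.conjContinuousAlgEquiv D.k := by simp [k, J01_map]
lemma h2_map : (D.map B).h2 = B.conjContinuousAlgEquiv D.h2 := by simp [h2, k_map, I1_map]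
lemma J1_map : (D.map B).J1 = B.conjContinuousAlgEquiv D.J1 := by
  simp [J1, h1_map, h2_map, map_ringConj]
lemma K1_map : (D.map B).K1 = B.conjContinuousAlgEquiv D.K1 := by
  simp [K1, h1_map, h2_map, map_ringConj]
lemma xi_map : (D.map B).xi = B D.xi := by simp [xi, I1_map, J1_map, K1_map]
lemma X_map : (D.map B).X = B.conjContinuousAlgEquiv D.X := by
  ext v
  simp [X, xi_map]
lemma DK_map : (D.map B).DK b = B.conjContinuousAlgEquiv (D.DK b) := by
  unfold DK
  split_ifs <;> simp [I1_map, J1_map, K1_map]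
lemma g_map : (D.map B).g b = B.conjContinuousAlgEquiv (D.g b) := by
  simp [g, J1_map, K1_map, X_map, DK_map]
lemma total_map : (D.map B).total b = B.conjContinuousAlgEquiv (D.total b) := by
  simp [total, g_map, h1_map, h2_map, map_ringInverse]

lemma isGood_map : (D.map B).IsGood b ↔ D.IsGood b := by
  constructor
  · rintro ⟨a1, a2, a3⟩
    rw [h1_map] at a1
    rw [h2_map] at a2
    rw [g_map] at a3
    exact ⟨(MulEquiv.isUnit_map _).1 a1, (MulEquiv.isUnit_map _).1 a2, (MulEquiv.isUnit_map _).1 a3⟩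
  · rintro ⟨a1, a2, a3⟩
    exact ⟨h1_map D B ▸ a1.map _, h2_map D B ▸ a2.map _, g_map D B ▸ a3.map _⟩

end Map

/-! #### Smoothness -/

section Smooth

variable {E : Type*} [NormedAddCommGroup E] [NormedSpace ℝ E]

/-- A family of data depends smoothly on its parameter at `u`. -/
structure SmoothAt (D : E → TransportData V) (u : E) : Prop where
  It : ContDiffAt ℝ ∞ (fun v => (D v).It) u
  Jt : ContDiffAt ℝ ∞ (fun v => (D v).Jt) u
  Kt : ContDiffAt ℝ ∞ (fun v => (D v).Kt) u
  I0 : ContDiffAt ℝ ∞ (fun v => (D v).I0) u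
  J0 : ContDiffAt ℝ ∞ (fun v => (D v).J0) u
  K0 : ContDiffAt ℝ ∞ (fun v => (D v).K0) u
  lam : ContDiffAt ℝ ∞ (fun v => (D v).lam) u
  eta : ContDiffAt ℝ ∞ (fun v => (D v).eta) u

lemma contDiffAt_mul {f f' : E → V →L[ℝ] V} {u : E} (hf : ContDiffAt ℝ ∞ f u)
    (hf' : ContDiffAt ℝ ∞ f' u) : ContDiffAt ℝ ∞ (fun v => f v * f' v) u := hf.clm_comp hf'

lemma contDiffAt_ringInverse_comp [CompleteSpace V] {f : E → V →L[ℝ] V} {u : E}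
    (hf : ContDiffAt ℝ ∞ f u) (hu : IsUnit (f u)) : ContDiffAt ℝ ∞ (fun v => (f v)⁻¹ʳ) u := by
  obtain ⟨x, hx⟩ := hu
  have := contDiffAt_ringInverse ℝ x (n := ∞)
  rw [hx] at this
  exact this.comp u hf

lemma contDiffAt_ringConj [CompleteSpace V] {f f' : E → V →L[ℝ] V} {u : E}
    (hf : ContDiffAt ℝ ∞ f u) (hf' : ContDiffAt ℝ ∞ f' u) (hu : IsUnit (f u)) :
    ContDiffAt ℝ ∞ (fun v => ringConj (f v) (f' v)) u :=
  contDiffAt_mul (contDiffAt_mul hf hf') (contDiffAt_ringInverse_comp hf hu)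

variable [CompleteSpace V] {D : E → TransportData V} {u : E}

/-- The transport is a rational expression in the data, with denominators that are invertible at
`u`, hence also nearby. -/
lemma SmoothAt.total_and_eventually (h : SmoothAt D u) (hg : (D u).IsGood b)
    (hlam : (D u).lam (D u).eta ≠ 0) :
    ContDiffAt ℝ ∞ (fun v => (D v).total b) u ∧ ∀ᶠ v in 𝓝 u, (D v).IsGood b := by
  have c1 : ContDiffAt ℝ ∞ (fun v => (D v).h1) u :=
    (contDiffAt_const.sub (contDiffAt_mul h.It h.I0)).const_smul _
  have cI : ContDiffAt ℝ ∞ (fun v => (D v).I1) u := contDiffAt_ringConj c1 h.I0 hg.h1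
  have cJ : ContDiffAt ℝ ∞ (fun v => (D v).J01) u := contDiffAt_ringConj c1 h.J0 hg.h1
  have ck : ContDiffAt ℝ ∞ (fun v => (D v).k) u :=
    (contDiffAt_const.sub (contDiffAt_mul h.Jt cJ)).const_smul _
  have c2 : ContDiffAt ℝ ∞ (fun v => (D v).h2) u :=
    (ck.sub (contDiffAt_mul (contDiffAt_mul cI ck) cI)).const_smul _
  have c21 := contDiffAt_mul c2 c1
  have cJ1 : ContDiffAt ℝ ∞ (fun v => (D v).J1) u :=
    contDiffAt_ringConj c21 h.J0 (hg.h2.mul hg.h1)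
  have cK1 : ContDiffAt ℝ ∞ (fun v => (D v).K1) u :=
    contDiffAt_ringConj c21 h.K0 (hg.h2.mul hg.h1)
  have s0 : ContDiffAt ℝ ∞ (fun v => (D v).lam (D v).eta) u := h.lam.clm_apply h.eta
  have e1 : ContDiffAt ℝ ∞ (fun v => (D v).I1 (D v).eta) u := cI.clm_apply h.eta
  have e2 : ContDiffAt ℝ ∞ (fun v => (D v).J1 (D v).eta) u := cJ1.clm_apply h.eta
  have e3 : ContDiffAt ℝ ∞ (fun v => (D v).K1 (D v).eta) u := cK1.clm_apply h.eta
  have s1 := h.lam.clm_apply e1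
  have s2 := h.lam.clm_apply e2
  have s3 := h.lam.clm_apply e3
  have cxi : ContDiffAt ℝ ∞ (fun v => (D v).xi) u := by
    refine ContDiffAt.smul (ContDiffAt.inv ?_ (by positivity)) ?_
    · exact (((s0.pow 2).add (s1.pow 2)).add (s2.pow 2)).add (s3.pow 2)
    · exact (((s0.smul h.eta).add (s1.smul e1)).add (s2.smul e2)).add (s3.smul e3)
  have cX : ContDiffAt ℝ ∞ (fun v => (D v).X) u := h.lam.smulRight cxi
  have cDK : ContDiffAt ℝ ∞ (fun v => (D v).DK b) u := by
    unfold DK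
    split_ifs
    · exact contDiffAt_mul (h.Jt.sub cJ1).neg cI
    · exact h.Kt.sub cK1
  have cg : ContDiffAt ℝ ∞ (fun v => (D v).g b) u :=
    (contDiffAt_const.sub (contDiffAt_mul (contDiffAt_mul cJ1 cX) (h.Jt.sub cJ1))).sub
      (contDiffAt_mul (contDiffAt_mul cK1 cX) cDK)
  refine ⟨contDiffAt_mul (contDiffAt_ringInverse_comp cg hg.g) c21, ?_⟩
  have open_units : IsOpen {A : V →L[ℝ] V | IsUnit A} := Units.isOpen
  filter_upwards [c1.continuousAt.eventually (open_units.mem_nhds hg.h1),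
    c2.continuousAt.eventually (open_units.mem_nhds hg.h2),
    cg.continuousAt.eventually (open_units.mem_nhds hg.g)] with v a1 a2 a3
  exact ⟨a1, a2, a3⟩

end Smooth

end TransportData

end Transport

/-! ### Levi forms in coordinates -/

section LeviCoordinates

variable {F : Type*} [NormedAddCommGroup F] [NormedSpace ℝ F]

/-- The one-form `dρ ∘ A` on a vector space. -/
def vectorForm (A : F → F →L[ℝ] F) (ρ : F → ℝ) (u : F) : F →L[ℝ] ℝ := (fderiv ℝ ρ u).comp (A u)

/-- The Levi form `- d (dρ ∘ A)` on a vector space. -/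
def vectorLevi (A : F → F →L[ℝ] F) (ρ : F → ℝ) (u v w : F) : ℝ :=
  -(fderiv ℝ (vectorForm A ρ) u v w - fderiv ℝ (vectorForm A ρ) u w v)

lemma extDeriv_ofSubsingleton {α : F → F →L[ℝ] ℝ} {u : F} (hα : DifferentiableAt ℝ α u) (v w : F) :
    extDeriv (fun u => ContinuousAlternatingMap.ofSubsingleton ℝ F ℝ (0 : Fin 1) (α u)) u ![v, w] =
      fderiv ℝ α u v w - fderiv ℝ α u w v := by
  have hd : DifferentiableAt ℝ
      (fun u => ContinuousAlternatingMap.ofSubsingleton ℝ F ℝ (0 : Fin 1) (α u)) u :=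
    ((ContinuousAlternatingMap.ofSubsingletonLIE (𝕜 := ℝ) (E := F) (F := ℝ) (0 : Fin 1)).toContinuousLinearEquiv
      |>.differentiableAt).comp u hα
  rw [extDeriv_apply hd]
  have e : ∀ x y : F, fderiv ℝ (fun u => α u x) u y = fderiv ℝ α u y x := by
    intro x y
    rw [fderiv_clm_apply hα (differentiableAt_const x)]
    simp
  simp [Fin.sum_univ_two, Fin.removeNth, e, sub_eq_add_neg]

variable {E : Type*} [NormedAddCommGroup E] [NormedSpace ℝ E] {H : Type*} [TopologicalSpace H]
  {𝓜 : ModelWithCorners ℝ E H} {X : Type*} [TopologicalSpace X] [ChartedSpace H X]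
  [IsManifold 𝓜 ∞ X]

/-- Naturality of the Levi form. -/
theorem leviForm_eq_vectorLevi {f : X → F} {x : X} (hf : ContMDiffAt 𝓜 𝓘(ℝ, F) ∞ f x)
    {A : ∀ y : X, TangentSpace 𝓜 y →L[ℝ] TangentSpace 𝓜 y} {A' : F → F →L[ℝ] F}
    {ρ : X → ℝ} {ρ' : F → ℝ} (hA' : ContDiffAt ℝ ∞ A' (f x)) (hρ' : ContDiffAt ℝ ∞ ρ' (f x))
    (hρ : ρ =ᶠ[𝓝 x] ρ' ∘ f)
    (hA : ∀ᶠ y in 𝓝 x, ∀ v, mfderiv 𝓜 𝓘(ℝ, F) f y (A y v) = A' (f y) (mfderiv 𝓜 𝓘(ℝ, F) f y v))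
    (v w : TangentSpace 𝓜 x) :
    leviForm 𝓜 A ρ x v w =
      vectorLevi A' ρ' (f x) (mfderiv 𝓜 𝓘(ℝ, F) f x v) (mfderiv 𝓜 𝓘(ℝ, F) f x w) := by
  set χ := extChartAt 𝓜 x with hχ
  set G : E → F := f ∘ χ.symm with hG
  have hGx : χ.symm (χ x) = x := extChartAt_to_inv (I := 𝓜) x
  have hGs : ContDiffWithinAt ℝ ∞ G (range 𝓜) (χ x) := by
    have := (contMDiffAt_iff.1 hf).2
    simpa using! this
  set β : F → F [⋀^Fin 1]→L[ℝ] ℝ :=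
    fun u => ContinuousAlternatingMap.ofSubsingleton ℝ F ℝ (0 : Fin 1) (vectorForm A' ρ' u) with hβ
  have hform : DifferentiableAt ℝ (vectorForm A' ρ') (f x) := by
    have h1 : ContDiffAt ℝ ∞ (fderiv ℝ ρ') (f x) := hρ'.fderiv_right (by simp)
    exact (h1.clm_comp hA').differentiableAt (by simp)
  have hβd : DifferentiableAt ℝ β (f x) :=
    ((ContinuousAlternatingMap.ofSubsingletonLIE (𝕜 := ℝ) (E := F) (F := ℝ) (0 : Fin 1)).toContinuousLinearEquiv
      |>.differentiableAt).comp _ hform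
  -- In the chart at `x` the one-form is the pull-back under `G` of `dρ' ∘ A'`, because the
  -- differential of `f` intertwines `A` and `A'`. The identity is needed on a neighborhood, as it
  -- is differentiated afterwards; exterior differentiation commutes with the pull-back.
  have key : (fun u : E => ContinuousAlternatingMap.ofSubsingleton ℝ E ℝ (0 : Fin 1)
      (oneFormInChart 𝓜 (fun y => (differential 𝓜 ρ y).comp (A y)) x u)) =ᶠ[𝓝[range 𝓜] (χ x)]
      fun u => (β (G u)).compContinuousLinearMap (fderivWithin ℝ G (range 𝓜) u) := by
    have t1 : Tendsto χ.symm (𝓝[range 𝓜] (χ x)) (𝓝 x) := by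
      have := (continuousAt_extChartAt_symm (I := 𝓜) x).tendsto
      rw [extChartAt_to_inv] at this
      exact this.mono_left nhdsWithin_le_nhds
    have hf' : ∀ᶠ y in 𝓝 x, MDifferentiableAt 𝓜 𝓘(ℝ, F) f y := by
      filter_upwards [(contMDiffAt_iff_contMDiffAt_nhds (by simp)).1
        (hf.of_le (m := 1) (by simp))] with y hy
      exact hy.mdifferentiableAt (by simp)
    have hρd : ∀ᶠ y in 𝓝 x, DifferentiableAt ℝ ρ' (f y) := by
      have : ∀ᶠ z in 𝓝 (f x), DifferentiableAt ℝ ρ' z := by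
        filter_upwards [(hρ'.of_le (m := 1) (by simp)).eventually (by simp)] with y hy
        exact hy.differentiableAt (by simp)
      exact hf.continuousAt.eventually this
    filter_upwards [t1.eventually hρ.eventually_nhds, t1.eventually hA, t1.eventually hf',
      t1.eventually hρd, extChartAt_target_mem_nhdsWithin (I := 𝓜) x]
      with u h1 h2 h3 h4 h5
    have e1 : mfderivWithin 𝓘(ℝ, E) 𝓘(ℝ, F) G (range 𝓜) u =
        (mfderiv 𝓜 𝓘(ℝ, F) f (χ.symm u)).comp (mfderivWithin 𝓘(ℝ, E) 𝓜 χ.symm (range 𝓜) u) :=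
      mfderiv_comp_mfderivWithin u h3 (mdifferentiableWithinAt_extChartAt_symm h5)
        (𝓜.uniqueMDiffOn u (extChartAt_target_subset_range x h5))
    have e2 : mfderiv 𝓜 𝓘(ℝ, ℝ) ρ (χ.symm u) =
        (fderiv ℝ ρ' (f (χ.symm u))).comp (mfderiv 𝓜 𝓘(ℝ, F) f (χ.symm u)) := by
      rw [EventuallyEq.mfderiv_eq h1, mfderiv_comp _ h4.mdifferentiableAt h3, mfderiv_eq_fderiv]
      rfl
    ext z
    simp only [ContinuousAlternatingMap.ofSubsingleton_apply_apply, oneFormInChart, differential,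
      ContinuousAlternatingMap.compContinuousLinearMap_apply, hβ, vectorForm]
    rw [e2]
    rw [← mfderivWithin_eq_fderivWithin, e1]
    exact congrArg (fderiv ℝ ρ' (f (χ.symm u))) (h2 _)
  have hx : χ x ∈ range 𝓜 := extChartAt_target_subset_range x (mem_extChartAt_target x)
  have hGx' : G (χ x) = f x := congrArg f hGx
  have hpull := extDerivWithin_pullback (𝕜 := ℝ) (x := χ x) (s := range 𝓜) (t := univ)
    (f := G) (r := ∞) (show DifferentiableWithinAt ℝ β univ (G (χ x)) from by
      rw [hGx']; exact hβd.differentiableWithinAt) hGs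
    (by rw [minSmoothness_of_isRCLikeNormedField]; exact WithTop.coe_le_coe.2 (le_top : (2 : ℕ∞) ≤ ⊤))
    𝓜.uniqueDiffOn (𝓜.range_subset_closure_interior hx) hx (mapsTo_univ _ _)
  rw [leviForm, dOneForm, key.extDerivWithin_eq_of_mem hx, hpull, extDerivWithin_univ, hGx']
  have e3 : fderivWithin ℝ G (range 𝓜) (χ x) = mfderiv 𝓜 𝓘(ℝ, F) f x := by
    rw [(hf.mdifferentiableAt (by simp)).mfderiv]
    rfl
  have e4 : ∀ z : TangentSpace 𝓜 x, mfderiv 𝓜 𝓘(ℝ, E) (extChartAt 𝓜 x) x z = z := fun z => by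
    rw [mfderiv_extChartAt_self]; rfl
  have e5 := extDeriv_ofSubsingleton hform (fderivWithin ℝ G (range 𝓜) (χ x) v)
    (fderivWithin ℝ G (range 𝓜) (χ x) w)
  refine congrArg Neg.neg (Eq.trans ?_ (e5.trans (by rw [e3]; rfl)))
  rw [ContinuousAlternatingMap.compContinuousLinearMap_apply]
  refine congrArg _ (funext fun i => ?_)
  fin_cases i
  · exact congrArg (fderivWithin ℝ G (range 𝓜) (χ x)) (e4 v)
  · exact congrArg (fderivWithin ℝ G (range 𝓜) (χ x)) (e4 w)

/-- Convexity with respect to three fields of endomorphisms of a vector space. -/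
def VectorConvexAt (I J K : F → F →L[ℝ] F) (ρ : F → ℝ) (u : F) : Prop :=
  ∀ a : Fin 3 → F, I u (a 0) + J u (a 1) + K u (a 2) = 0 → a ≠ 0 →
    vectorLevi I ρ u (a 1) (a 2) + vectorLevi J ρ u (a 2) (a 0) + vectorLevi K ρ u (a 0) (a 1) < 0

/-- Naturality of convexity. -/
theorem isConvexAt_iff_vectorConvexAt (Q : AlmostQuaternionic 𝓜 X) {f : X → F} {x : X}
    (hf : ContMDiffAt 𝓜 𝓘(ℝ, F) ∞ f x) (hbij : Function.Bijective (mfderiv 𝓜 𝓘(ℝ, F) f x))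
    {I J K : F → F →L[ℝ] F} {ρ : X → ℝ} {ρ' : F → ℝ}
    (hI : ContDiffAt ℝ ∞ I (f x)) (hJ : ContDiffAt ℝ ∞ J (f x)) (hK : ContDiffAt ℝ ∞ K (f x))
    (hρ' : ContDiffAt ℝ ∞ ρ' (f x)) (hρ : ρ =ᶠ[𝓝 x] ρ' ∘ f)
    (eI : ∀ᶠ y in 𝓝 x, ∀ v, mfderiv 𝓜 𝓘(ℝ, F) f y (Q.I y v) = I (f y) (mfderiv 𝓜 𝓘(ℝ, F) f y v))
    (eJ : ∀ᶠ y in 𝓝 x, ∀ v, mfderiv 𝓜 𝓘(ℝ, F) f y (Q.J y v) = J (f y) (mfderiv 𝓜 𝓘(ℝ, F) f y v))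
    (eK : ∀ᶠ y in 𝓝 x, ∀ v, mfderiv 𝓜 𝓘(ℝ, F) f y (Q.K y v) = K (f y) (mfderiv 𝓜 𝓘(ℝ, F) f y v)) :
    Q.IsConvexAt ρ x ↔ VectorConvexAt I J K ρ' (f x) := by
  have key : ∀ A : (Fin 3 → ℝ) →ₗ[ℝ] TangentSpace 𝓜 x, ∀ a : Fin 3 → F,
      (∀ i, a i = mfderiv 𝓜 𝓘(ℝ, F) f x (A (Pi.single i 1))) →
      ((Q.IsAntilinear x A → A ≠ 0 → Q.leviCoefficient ρ x A < 0) ↔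
        (I (f x) (a 0) + J (f x) (a 1) + K (f x) (a 2) = 0 → a ≠ 0 →
    vectorLevi I ρ' (f x) (a 1) (a 2) + vectorLevi J ρ' (f x) (a 2) (a 0) +
      vectorLevi K ρ' (f x) (a 0) (a 1) < 0)) := by
    intro A a ha
    have h1 : Q.IsAntilinear x A ↔ I (f x) (a 0) + J (f x) (a 1) + K (f x) (a 2) = 0 := by
      rw [AlmostQuaternionic.IsAntilinear, ha, ha, ha, ← eI.self_of_nhds, ← eJ.self_of_nhds,
        ← eK.self_of_nhds]
      have e : ∀ p q r : TangentSpace 𝓜 x, (mfderiv 𝓜 𝓘(ℝ, F) f x p + mfderiv 𝓜 𝓘(ℝ, F) f x q +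
          mfderiv 𝓜 𝓘(ℝ, F) f x r : TangentSpace 𝓘(ℝ, F) (f x)) =
          mfderiv 𝓜 𝓘(ℝ, F) f x (p + q + r) := fun p q r => by rw [map_add, map_add]
      refine Iff.trans ?_ (Eq.congr_left (e _ _ _)).symm
      constructor
      · intro h; rw [h]; exact map_zero _
      · intro h; exact hbij.1 (h.trans (map_zero _).symm)
    have h2 : A ≠ 0 ↔ a ≠ 0 := by
      refine not_congr ⟨fun h => funext fun i => by rw [ha, h]; exact map_zero _, fun h => ?_⟩
      refine LinearMap.pi_ext' fun i => LinearMap.ext_ring ?_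
      have : a i = 0 := by rw [h]; rfl
      rw [ha] at this
      exact hbij.1 (this.trans (map_zero _).symm)
    have h3 : Q.leviCoefficient ρ x A = vectorLevi I ρ' (f x) (a 1) (a 2) +
        vectorLevi J ρ' (f x) (a 2) (a 0) + vectorLevi K ρ' (f x) (a 0) (a 1) := by
      rw [AlmostQuaternionic.leviCoefficient, leviForm_eq_vectorLevi hf hI hρ' hρ eI,
        leviForm_eq_vectorLevi hf hJ hρ' hρ eJ, leviForm_eq_vectorLevi hf hK hρ' hρ eK,
        ha, ha, ha]
    rw [h1, h2, h3]
  constructor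
  · intro h a
    choose b hb using fun i => hbij.2 (a i)
    let A : (Fin 3 → ℝ) →ₗ[ℝ] TangentSpace 𝓜 x := (Fintype.linearCombination ℝ b)
    refine (key A a fun i => ?_).1 (h A)
    simp [A, hb]
  · intro h A
    exact (key A (fun i => mfderiv 𝓜 𝓘(ℝ, F) f x (A (Pi.single i 1))) fun i => rfl).2
      (h fun i => mfderiv 𝓜 𝓘(ℝ, F) f x (A (Pi.single i 1)))

lemma vectorLevi_comp {T : F → F} {u : F} (hT : ContDiffAt ℝ ∞ T u) {A A' : F → F →L[ℝ] F}
    {ρ' : F → ℝ} (hAs : ContDiffAt ℝ ∞ A u) (hA's : ContDiffAt ℝ ∞ A' (T u))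
    (hρ' : ContDiffAt ℝ ∞ ρ' (T u))
    (hA : ∀ᶠ y in 𝓝 u, ∀ v, fderiv ℝ T y (A y v) = A' (T y) (fderiv ℝ T y v)) (v w : F) :
    vectorLevi A (ρ' ∘ T) u v w = vectorLevi A' ρ' (T u) (fderiv ℝ T u v) (fderiv ℝ T u w) := by
  have h1 := leviForm_eq_vectorLevi (𝓜 := 𝓘(ℝ, F)) (f := T) (A := A) (A' := A') hT.contMDiffAt
    hA's hρ' (EventuallyEq.refl _ _) (by simpa [mfderiv_eq_fderiv] using! hA) v w
  have h2 := leviForm_eq_vectorLevi (𝓜 := 𝓘(ℝ, F)) (f := (id : F → F)) (x := u) (A := A) (A' := A)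
    contMDiffAt_id (ρ := ρ' ∘ T) (ρ' := ρ' ∘ T) hAs (hρ'.comp u hT) (EventuallyEq.refl _ _)
    (Eventually.of_forall fun y v => by rw [mfderiv_id]; rfl) v w
  rw [mfderiv_eq_fderiv] at h1
  rw [mfderiv_id] at h2
  exact h2.symm.trans h1

/-- Pull-back of convexity under a smooth map with injective differential. -/
lemma VectorConvexAt.comp {T : F → F} {u : F} (hT : ContDiffAt ℝ ∞ T u)
    (hinj : Function.Injective (fderiv ℝ T u)) {I J K I' J' K' : F → F →L[ℝ] F} {ρ' : F → ℝ}
    (hI : ContDiffAt ℝ ∞ I u) (hJ : ContDiffAt ℝ ∞ J u) (hK : ContDiffAt ℝ ∞ K u)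
    (hI' : ContDiffAt ℝ ∞ I' (T u)) (hJ' : ContDiffAt ℝ ∞ J' (T u))
    (hK' : ContDiffAt ℝ ∞ K' (T u)) (hρ' : ContDiffAt ℝ ∞ ρ' (T u))
    (eI : ∀ᶠ y in 𝓝 u, ∀ v, fderiv ℝ T y (I y v) = I' (T y) (fderiv ℝ T y v))
    (eJ : ∀ᶠ y in 𝓝 u, ∀ v, fderiv ℝ T y (J y v) = J' (T y) (fderiv ℝ T y v))
    (eK : ∀ᶠ y in 𝓝 u, ∀ v, fderiv ℝ T y (K y v) = K' (T y) (fderiv ℝ T y v))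
    (h : VectorConvexAt I' J' K' ρ' (T u)) : VectorConvexAt I J K (ρ' ∘ T) u := by
  intro a ha ha0
  rw [vectorLevi_comp hT hI hI' hρ' eI, vectorLevi_comp hT hJ hJ' hρ' eJ,
    vectorLevi_comp hT hK hK' hρ' eK]
  refine h (fun i => fderiv ℝ T u (a i)) ?_ fun h0 => ha0 (funext fun i => hinj ?_)
  · rw [← eI.self_of_nhds, ← eJ.self_of_nhds, ← eK.self_of_nhds, ← map_add, ← map_add, ha, map_zero]
  · rw [Pi.zero_apply, map_zero]
    exact congrFun h0 i

lemma contDiffAt_vectorForm {A : F → F →L[ℝ] F} {ρ : F → ℝ} {u : F} (hA : ContDiffAt ℝ ∞ A u)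
    (hρ : ContDiffAt ℝ ∞ ρ u) : ContDiffAt ℝ ∞ (vectorForm A ρ) u :=
  (hρ.fderiv_right (m := ∞) (by simp)).clm_comp hA

/-- Product rule for `θ'(ρ) · (dρ ∘ A)`: differentiating the coefficient produces the wedge of `dρ`
with `dρ ∘ A`. -/
lemma vectorLevi_comp_left {θ : ℝ → ℝ} (hθ : ContDiff ℝ ∞ θ) {A : F → F →L[ℝ] F} {ρ : F → ℝ} {u : F}
    (hA : ContDiffAt ℝ ∞ A u) (hρ : ContDiffAt ℝ ∞ ρ u) (v w : F) :
    vectorLevi A (θ ∘ ρ) u v w = deriv θ (ρ u) * vectorLevi A ρ u v w -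
      deriv (deriv θ) (ρ u) * (fderiv ℝ ρ u v * fderiv ℝ ρ u (A u w) -
        fderiv ℝ ρ u w * fderiv ℝ ρ u (A u v)) := by
  have hd : ∀ᶠ y in 𝓝 u, DifferentiableAt ℝ ρ y := by
    filter_upwards [(hρ.of_le (m := 1) (by simp)).eventually (by simp)] with y hy
    exact hy.differentiableAt (by simp)
  have hθd : ∀ t, DifferentiableAt ℝ θ t := hθ.differentiable (by simp)
  have hθ' : ContDiff ℝ ∞ (deriv θ) := (contDiff_infty_iff_deriv.1 hθ).2
  have e : vectorForm A (θ ∘ ρ) =ᶠ[𝓝 u] fun y => deriv θ (ρ y) • vectorForm A ρ y := by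
    filter_upwards [hd] with y hy
    rw [vectorForm, ((hθd (ρ y)).hasDerivAt.comp_hasFDerivAt y hy.hasFDerivAt).fderiv]
    rfl
  have h1 : HasFDerivAt (fun y => deriv θ (ρ y)) (deriv (deriv θ) (ρ u) • fderiv ℝ ρ u) u :=
    ((hθ'.differentiable (by simp) (ρ u)).hasDerivAt).comp_hasFDerivAt u
      hd.self_of_nhds.hasFDerivAt
  have h2 := h1.fun_smul ((contDiffAt_vectorForm hA hρ).differentiableAt (by simp)).hasFDerivAt
  rw [vectorLevi, e.fderiv_eq, h2.fderiv, vectorLevi]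
  simp [vectorForm]
  ring

/-- On an antilinear triple the three terms with `θ''` add up to `-θ''` times the sum of the squares
of `dρ (a i)`, which is nonnegative for concave `θ`. So `θ'` times the Levi coefficient of `ρ` is at
most that of `θ ∘ ρ`. -/
lemma VectorConvexAt.of_comp_left {θ : ℝ → ℝ} (hθ : ContDiff ℝ ∞ θ) {I J K : F → F →L[ℝ] F}
    {ρ : F → ℝ} {u : F} (hI : ContDiffAt ℝ ∞ I u) (hJ : ContDiffAt ℝ ∞ J u)
    (hK : ContDiffAt ℝ ∞ K u) (hρ : ContDiffAt ℝ ∞ ρ u) (hq : IsQuatTriple (I u) (J u) (K u))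
    (h1 : 0 < deriv θ (ρ u)) (h2 : deriv (deriv θ) (ρ u) ≤ 0)
    (h : VectorConvexAt I J K (θ ∘ ρ) u) : VectorConvexAt I J K ρ u := by
  intro a ha ha0
  have key := h a ha ha0
  rw [vectorLevi_comp_left hθ hI hρ, vectorLevi_comp_left hθ hJ hρ,
    vectorLevi_comp_left hθ hK hρ] at key
  have m : ∀ A B : F →L[ℝ] F, ∀ v, A (B v) = (A * B) v := fun _ _ _ => rfl
  -- Applying `I`, `J` and `K` to the antilinearity relation expresses each of the three vectors
  -- through the other two.
  have e0 : a 0 = K u (a 1) - J u (a 2) := by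
    have := congrArg (I u) ha
    simp only [map_add, m, hq.I_sq, hq.I_J, hq.I_K, map_zero] at this
    have e : -(a 0) + K u (a 1) + -(J u (a 2)) = 0 := this
    rw [eq_comm, ← sub_eq_zero, ← e]; abel
  have e1 : a 1 = I u (a 2) - K u (a 0) := by
    have := congrArg (J u) ha
    simp only [map_add, m, hq.J_sq, hq.J_I, hq.J_K, map_zero] at this
    have e : -(K u (a 0)) + -(a 1) + I u (a 2) = 0 := this
    rw [eq_comm, ← sub_eq_zero, ← e]; abel
  have e2 : a 2 = J u (a 0) - I u (a 1) := by
    have := congrArg (K u) ha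
    simp only [map_add, m, hq.K_sq, hq.K_I, hq.K_J, map_zero] at this
    have e : J u (a 0) + -(I u (a 1)) + -(a 2) = 0 := this
    rw [eq_comm, ← sub_eq_zero, ← e]; abel
  have f0 := congrArg (fderiv ℝ ρ u) e0
  have f1 := congrArg (fderiv ℝ ρ u) e1
  have f2 := congrArg (fderiv ℝ ρ u) e2
  simp only [map_sub] at f0 f1 f2
  set p0 := fderiv ℝ ρ u (a 0)
  set p1 := fderiv ℝ ρ u (a 1)
  set p2 := fderiv ℝ ρ u (a 2)
  set d2 := deriv (deriv θ) (ρ u)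
  have e3 : (p1 * fderiv ℝ ρ u (I u (a 2)) - p2 * fderiv ℝ ρ u (I u (a 1))) +
      (p2 * fderiv ℝ ρ u (J u (a 0)) - p0 * fderiv ℝ ρ u (J u (a 2))) +
      (p0 * fderiv ℝ ρ u (K u (a 1)) - p1 * fderiv ℝ ρ u (K u (a 0))) =
      p0 ^ 2 + p1 ^ 2 + p2 ^ 2 := by
    linear_combination (-p0) * f0 + (-p1) * f1 + (-p2) * f2
  have e4 : 0 ≤ -d2 * (p0 ^ 2 + p1 ^ 2 + p2 ^ 2) := mul_nonneg (by linarith) (by positivity)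
  rw [← e3] at e4
  by_contra hcon
  rw [not_lt] at hcon
  have := mul_nonneg h1.le hcon
  linarith

section Openness

lemma continuousAt_vectorLevi {A : F → F →L[ℝ] F} {ρ : F → ℝ} {u : F} (hA : ContDiffAt ℝ ∞ A u)
    (hρ : ContDiffAt ℝ ∞ ρ u) (v w : F) :
    ContinuousAt (fun p : F × F × F => vectorLevi A ρ p.1 p.2.1 p.2.2) (u, v, w) := by
  have h1 : ContinuousAt (fun p : F × F × F => fderiv ℝ (vectorForm A ρ) p.1) (u, v, w) :=
    ContinuousAt.comp (x := (u, v, w)) (f := Prod.fst) (g := fderiv ℝ (vectorForm A ρ))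
      ((contDiffAt_vectorForm hA hρ).fderiv_right (m := ∞) (by simp)).continuousAt
      continuousAt_fst
  have h2 : ContinuousAt (fun p : F × F × F => p.2.1) (u, v, w) := by fun_prop
  have h3 : ContinuousAt (fun p : F × F × F => p.2.2) (u, v, w) := by fun_prop
  exact (((h1.clm_apply h2).clm_apply h3).sub ((h1.clm_apply h3).clm_apply h2)).neg

lemma vectorLevi_smul (A : F → F →L[ℝ] F) (ρ : F → ℝ) (u v w : F) (c : ℝ) :
    vectorLevi A ρ u (c • v) (c • w) = c ^ 2 * vectorLevi A ρ u v w := by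
  simp [vectorLevi]; ring

/-- Convexity is an open condition. -/
theorem VectorConvexAt.eventually [FiniteDimensional ℝ F] {I J K : F → F →L[ℝ] F} {ρ : F → ℝ}
    {u : F} (hI : ContDiffAt ℝ ∞ I u) (hJ : ContDiffAt ℝ ∞ J u) (hK : ContDiffAt ℝ ∞ K u)
    (hρ : ContDiffAt ℝ ∞ ρ u) (hq : ∀ᶠ y in 𝓝 u, IsQuatTriple (I y) (J y) (K y))
    (h : VectorConvexAt I J K ρ u) : ∀ᶠ y in 𝓝 u, VectorConvexAt I J K ρ y := by
  have m : ∀ A B : F →L[ℝ] F, ∀ v, A (B v) = (A * B) v := fun _ _ _ => rfl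
  -- Antilinearity determines `a 0` from `(a 1, a 2)`, so the test triples at all nearby points are
  -- parametrized by the same space `F × F`. By homogeneity its unit sphere suffices, and that is
  -- compact.
  set N : F × (F × F) → ℝ := fun p =>
    vectorLevi I ρ p.1 p.2.1 p.2.2 + vectorLevi J ρ p.1 p.2.2 (K p.1 p.2.1 - J p.1 p.2.2) +
      vectorLevi K ρ p.1 (K p.1 p.2.1 - J p.1 p.2.2) p.2.1 with hN
  have hNc : ∀ q : F × F, ContinuousAt N (u, q) := by
    rintro ⟨b, c⟩
    have hK' : ContinuousAt (fun p : F × F × F => K p.1) (u, b, c) :=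
      ContinuousAt.comp (x := (u, b, c)) (f := Prod.fst) hK.continuousAt continuousAt_fst
    have hJ' : ContinuousAt (fun p : F × F × F => J p.1) (u, b, c) :=
      ContinuousAt.comp (x := (u, b, c)) (f := Prod.fst) hJ.continuousAt continuousAt_fst
    have h1 : ContinuousAt (fun p : F × F × F => p.1) (u, b, c) := by fun_prop
    have h2 : ContinuousAt (fun p : F × F × F => p.2.1) (u, b, c) := by fun_prop
    have h3 : ContinuousAt (fun p : F × F × F => p.2.2) (u, b, c) := by fun_prop
    have h4 : ContinuousAt (fun p : F × F × F => K p.1 p.2.1 - J p.1 p.2.2) (u, b, c) :=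
      (hK'.clm_apply h2).sub (hJ'.clm_apply h3)
    refine ((continuousAt_vectorLevi hI hρ b c).add ?_).add ?_
    · exact ContinuousAt.comp (x := (u, b, c))
        (f := fun p : F × F × F => (p.1, p.2.2, K p.1 p.2.1 - J p.1 p.2.2))
        (continuousAt_vectorLevi hJ hρ _ _) (h1.prodMk (h3.prodMk h4))
    · exact ContinuousAt.comp (x := (u, b, c))
        (f := fun p : F × F × F => (p.1, K p.1 p.2.1 - J p.1 p.2.2, p.2.1))
        (continuousAt_vectorLevi hK hρ _ _) (h1.prodMk (h4.prodMk h2))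
  have hNneg : ∀ q ∈ Metric.sphere (0 : F × F) 1, ∀ᶠ z in 𝓝 (u, q), N z < 0 := by
    intro q hq1
    refine (hNc q).eventually_lt continuousAt_const ?_
    have hq0 := hq.self_of_nhds
    refine h ![K u q.1 - J u q.2, q.1, q.2] ?_ fun h0 => ?_
    · change I u (K u q.1 - J u q.2) + J u q.1 + K u q.2 = 0
      simp only [map_sub, m, hq0.I_K, hq0.I_J]
      change -(J u q.1) - K u q.2 + J u q.1 + K u q.2 = 0
      abel
    · have a1 : q.1 = 0 := congrFun h0 1
      have a2 : q.2 = 0 := congrFun h0 2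
      have : q = 0 := Prod.ext a1 a2
      simp [this] at hq1
  have := (isCompact_sphere (0 : F × F) 1).eventually_forall_of_forall_eventually
    (P := fun y q => N (y, q) < 0) (x₀ := u) hNneg
  filter_upwards [this, hq] with y hy hqy a ha ha0
  have e0 : a 0 = K y (a 1) - J y (a 2) := by
    have := congrArg (I y) ha
    simp only [map_add, m, hqy.I_sq, hqy.I_J, hqy.I_K, map_zero] at this
    have e : -(a 0) + K y (a 1) + -(J y (a 2)) = 0 := this
    rw [eq_comm, ← sub_eq_zero, ← e]; abel
  have hne : (a 1, a 2) ≠ (0 : F × F) := by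
    intro h0
    obtain ⟨h1, h2⟩ := Prod.mk.inj h0
    refine ha0 (funext fun i => ?_)
    fin_cases i
    · simp [e0, h1, h2]
    · exact h1
    · exact h2
  set r := ‖(a 1, a 2)‖ with hr
  have hr0 : 0 < r := norm_pos_iff.2 hne
  have h3 := hy (r⁻¹ • (a 1, a 2)) (by
    rw [mem_sphere_zero_iff_norm, norm_smul, norm_inv, Real.norm_of_nonneg hr0.le, ← hr,
      inv_mul_cancel₀ hr0.ne'])
  have h4 : N (y, r⁻¹ • (a 1, a 2)) = (r⁻¹) ^ 2 * (vectorLevi I ρ y (a 1) (a 2) +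
      vectorLevi J ρ y (a 2) (a 0) + vectorLevi K ρ y (a 0) (a 1)) := by
    simp only [hN, Prod.smul_mk, map_smul, ← smul_sub, ← e0, vectorLevi_smul]
    ring
  rw [h4] at h3
  exact (pos_iff_neg_of_mul_neg h3).1 (by positivity)

end Openness

end LeviCoordinates

/-! ### Half-space charts -/

section HalfCharts

variable {E : Type*} [NormedAddCommGroup E] [NormedSpace ℝ E] {H : Type*} [TopologicalSpace H]
  {𝓜 : ModelWithCorners ℝ E H} {X : Type*} [TopologicalSpace X] [ChartedSpace H X]
  [IsManifold 𝓜 ∞ X]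

/-- A chart of the maximal atlas is a local diffeomorphism into `H`, and these preserve interior
points. -/
lemma isInteriorPoint_iff_of_mem_maximalAtlas {e : OpenPartialHomeomorph X H}
    (he : e ∈ IsManifold.maximalAtlas 𝓜 ∞ X) {x : X} (hx : x ∈ e.source) :
    x ∈ 𝓜.interior X ↔ e.extend 𝓜 x ∈ interior (range 𝓜) := by
  let Φ : PartialDiffeomorph 𝓜 𝓜 X H ∞ :=
    { toPartialEquiv := e.toPartialEquiv
      open_source := e.open_source
      open_target := e.open_target
      contMDiffOn_toFun := contMDiffOn_of_mem_maximalAtlas he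
      contMDiffOn_invFun := contMDiffOn_symm_of_mem_maximalAtlas he }
  have h : IsLocalDiffeomorphAt 𝓜 𝓜 ∞ e x := ⟨Φ, hx, fun _ _ => rfl⟩
  exact h.isInteriorPoint_iff (by simp)

lemma contMDiffOn_extend_symm_target {e : OpenPartialHomeomorph X H}
    (he : e ∈ IsManifold.maximalAtlas 𝓜 ∞ X) :
    ContMDiffOn 𝓘(ℝ, E) 𝓜 ∞ (e.extend 𝓜).symm (e.extend 𝓜).target := by
  rw [e.extend_target']
  exact contMDiffOn_extend_symm he

variable (𝓜 X) in
/-- A chart which identifies a neighborhood of each of its boundary points with an open subset of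
a closed half-space, together with a vector transverse to the boundary of the half-space. -/
structure HalfChart where
  chart : OpenPartialHomeomorph X H
  mem : chart ∈ IsManifold.maximalAtlas 𝓜 ∞ X
  ℓ : E →L[ℝ] ℝ
  ν : E
  ℓ_ν : ℓ ν = 1
  nonneg : ∀ y ∈ chart.source, 0 ≤ ℓ (chart.extend 𝓜 y)
  zero_iff : ∀ y ∈ chart.source, ℓ (chart.extend 𝓜 y) = 0 ↔ y ∈ 𝓜.boundary X
  half : ∀ y ∈ chart.source, y ∈ 𝓜.boundary X →
    (chart.extend 𝓜).target ∈ 𝓝[{u | 0 ≤ ℓ u}] (chart.extend 𝓜 y)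

namespace HalfChart

variable (c : HalfChart 𝓜 X)

/-- The extended chart. -/
def ext (c : HalfChart 𝓜 X) : PartialEquiv X E := c.chart.extend 𝓜

lemma ext_source : c.ext.source = c.chart.source := c.chart.extend_source

lemma contMDiffOn_ext : ContMDiffOn 𝓜 𝓘(ℝ, E) ∞ c.ext c.chart.source :=
  c.chart.contMDiffOn_extend c.mem

lemma contMDiffOn_ext_symm : ContMDiffOn 𝓘(ℝ, E) 𝓜 ∞ c.ext.symm c.ext.target :=
  contMDiffOn_extend_symm_target c.mem

lemma left_inv {y : X} (hy : y ∈ c.chart.source) : c.ext.symm (c.ext y) = y :=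
  c.chart.extend_left_inv hy

lemma right_inv {u : E} (hu : u ∈ c.ext.target) : c.ext (c.ext.symm u) = u := c.ext.right_inv hu

lemma map_source {y : X} (hy : y ∈ c.chart.source) : c.ext y ∈ c.ext.target :=
  c.ext.map_source (c.ext_source ▸ hy)

lemma map_target {u : E} (hu : u ∈ c.ext.target) : c.ext.symm u ∈ c.chart.source :=
  c.ext_source ▸ c.ext.map_target hu

lemma continuousAt_ext {y : X} (hy : y ∈ c.chart.source) : ContinuousAt c.ext y :=
  c.chart.continuousAt_extend hy

lemma continuousAt_ext_symm {y : X} (hy : y ∈ c.chart.source) :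
    ContinuousAt c.ext.symm (c.ext y) := c.chart.continuousAt_extend_symm hy

lemma target_nonneg {u : E} (hu : u ∈ c.ext.target) : 0 ≤ c.ℓ u := by
  rw [← c.right_inv hu]; exact c.nonneg _ (c.map_target hu)

lemma boundary_of_target {u : E} (hu : u ∈ c.ext.target) (h : c.ℓ u = 0) :
    c.ext.symm u ∈ 𝓜.boundary X := by
  refine (c.zero_iff _ (c.map_target hu)).1 ?_
  change c.ℓ (c.ext _) = 0
  rw [c.right_inv hu, h]

/-- The restriction of a half-space chart to an open set. -/
def restr {W : Set X} (hW : IsOpen W) : HalfChart 𝓜 X where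
  chart := c.chart.restr W
  mem := restr_mem_maximalAtlas _ c.mem hW
  ℓ := c.ℓ
  ν := c.ν
  ℓ_ν := c.ℓ_ν
  nonneg y hy := c.nonneg y (by simp at hy; exact hy.1)
  zero_iff y hy := c.zero_iff y (by simp at hy; exact hy.1)
  half y hy hB := by
    have hy' : y ∈ c.chart.source ∧ y ∈ W := by
      simpa [hW.interior_eq] using hy
    have e : ((c.chart.restr W).extend 𝓜).target = c.ext.target ∩ c.ext.symm ⁻¹' W := by
      ext u
      simp only [OpenPartialHomeomorph.extend_target, OpenPartialHomeomorph.restr_target, ext,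
        hW.interior_eq, OpenPartialHomeomorph.extend_coe_symm, mem_inter_iff, mem_preimage,
        Function.comp_apply]
      tauto
    rw [e]
    refine inter_mem (c.half y hy'.1 hB) (mem_nhdsWithin_of_mem_nhds ?_)
    refine (c.continuousAt_ext_symm hy'.1).preimage_mem_nhds ?_
    rw [c.left_inv hy'.1]
    exact hW.mem_nhds hy'.2

variable {W : Set X} (hW : IsOpen W)

lemma restr_source : (c.restr hW).chart.source = c.chart.source ∩ W := by
  simp [restr, hW.interior_eq]

lemma restr_ext (y : X) : (c.restr hW).ext y = c.ext y := rfl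

lemma mem_restr_target {u : E} :
    u ∈ (c.restr hW).ext.target ↔ u ∈ c.ext.target ∧ c.ext.symm u ∈ W := by
  simp only [ext, restr, OpenPartialHomeomorph.extend_target, OpenPartialHomeomorph.restr_target,
    hW.interior_eq, OpenPartialHomeomorph.extend_coe_symm, mem_inter_iff, mem_preimage,
    Function.comp_apply]
  tauto

lemma exists_ball {x : X} (hx : x ∈ c.chart.source) (hB : x ∈ 𝓜.boundary X) {S : Set X}
    (hS : S ∈ 𝓝 x) : ∃ R > 0, Metric.ball (c.ext x) R ∩ {u | 0 ≤ c.ℓ u} ⊆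
      c.ext.target ∩ c.ext.symm ⁻¹' S := by
  have h1 : c.ext.symm ⁻¹' S ∈ 𝓝 (c.ext x) :=
    (c.continuousAt_ext_symm hx).preimage_mem_nhds (by rwa [c.left_inv hx])
  exact Metric.mem_nhdsWithin_iff.1
    (inter_mem (c.half x hx hB) (mem_nhdsWithin_of_mem_nhds h1))

end HalfChart

end HalfCharts

/-! ### Retraction onto the boundary -/

section Retraction

variable {E : Type*} [NormedAddCommGroup E] [NormedSpace ℝ E] [FiniteDimensional ℝ E]
  {H : Type*} [TopologicalSpace H]
  {𝓜 : ModelWithCorners ℝ E H} {X : Type*} [TopologicalSpace X] [ChartedSpace H X]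
  [IsManifold 𝓜 ∞ X] [T2Space X]

/-- As `ℓ` vanishes at `u₀`, removing a part of the `ν`-component of `v` enlarges the distance to
`u₀` at most by the factor `1 + ‖ℓ‖ ‖ν‖`. -/
lemma norm_sub_smul_sub_lt {ℓ : E →L[ℝ] ℝ} {ν u₀ v : E} {r R s : ℝ} (h0 : ℓ u₀ = 0)
    (hv : v ∈ Metric.ball u₀ r) (hr : r * (1 + ‖ℓ‖ * ‖ν‖) ≤ R) (hs : |s| ≤ 1) :
    v - s • ℓ v • ν ∈ Metric.ball u₀ R := by
  rw [mem_ball_iff_norm] at hv ⊢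
  have h1 : |ℓ v| ≤ ‖ℓ‖ * ‖v - u₀‖ := by
    have := ℓ.le_opNorm (v - u₀)
    rwa [map_sub, h0, sub_zero] at this
  have h2 : ‖s • ℓ v • ν‖ ≤ ‖ℓ‖ * ‖v - u₀‖ * ‖ν‖ := by
    rw [norm_smul, norm_smul, Real.norm_eq_abs, Real.norm_eq_abs]
    calc |s| * (|ℓ v| * ‖ν‖) ≤ 1 * (|ℓ v| * ‖ν‖) := by gcongr
      _ ≤ _ := by rw [one_mul]; gcongr
  calc ‖v - s • ℓ v • ν - u₀‖ = ‖(v - u₀) - s • ℓ v • ν‖ := by congr 1; abel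
    _ ≤ ‖v - u₀‖ + ‖ℓ‖ * ‖v - u₀‖ * ‖ν‖ := (norm_sub_le _ _).trans (by gcongr)
    _ = ‖v - u₀‖ * (1 + ‖ℓ‖ * ‖ν‖) := by ring
    _ < r * (1 + ‖ℓ‖ * ‖ν‖) := by gcongr
    _ ≤ R := hr

/-- A smooth map pushing a neighborhood of a boundary point into the boundary, along the normal
direction of a half-space chart. -/
theorem HalfChart.exists_push (c : HalfChart 𝓜 X) {x : X} (hx : x ∈ c.chart.source)
    (hB : x ∈ 𝓜.boundary X) {R₀ : ℝ} (hR₀ : 0 < R₀) :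
    ∃ h : X → X, ContMDiff 𝓜 𝓜 ∞ h ∧ (∀ y ∈ 𝓜.boundary X, h y = y) ∧
      (∀ᶠ y in 𝓝 x, h y ∈ 𝓜.boundary X) ∧
      ∀ y, h y = y ∨ (y ∈ c.chart.source ∧ ∃ s ∈ Icc (0 : ℝ) 1,
        c.ext y - s • c.ℓ (c.ext y) • c.ν ∈ Metric.ball (c.ext x) R₀ ∧
        h y = c.ext.symm (c.ext y - s • c.ℓ (c.ext y) • c.ν)) := by
  classical
  obtain ⟨R₁, hR₁, hsub⟩ := c.exists_ball hx hB (S := univ) univ_mem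
  set u₀ := c.ext x
  have hu₀ : c.ℓ u₀ = 0 := (c.zero_iff x hx).2 hB
  set R := min R₀ R₁
  have hR : 0 < R := lt_min hR₀ hR₁
  have hC : 0 < 1 + ‖c.ℓ‖ * ‖c.ν‖ := by positivity
  set r := R / 2 / (1 + ‖c.ℓ‖ * ‖c.ν‖) with hrdef
  have hr : 0 < r := by positivity
  have hrR : r * (1 + ‖c.ℓ‖ * ‖c.ν‖) ≤ R / 2 := by rw [hrdef]; field_simp; exact le_refl _
  have hrR' : r ≤ R / 2 := by
    refine le_trans ?_ hrR
    have : 0 ≤ ‖c.ℓ‖ * ‖c.ν‖ := by positivity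
    nlinarith
  let χ : ContDiffBump u₀ := ⟨r / 2, r, by positivity, by linarith⟩
  -- `m` removes the whole `ν`-component where `χ = 1` and is the identity off the bump. It scales
  -- `ℓ` by `1 - χ ≥ 0`, so the half-space is preserved and its boundary is fixed.
  let m : E → E := fun v => v - χ v • c.ℓ v • c.ν
  have hm : ContDiff ℝ ∞ m :=
    contDiff_id.sub (χ.contDiff.smul (c.ℓ.contDiff.smul contDiff_const))
  have hm0 : ∀ v, v ∉ Metric.ball u₀ r → m v = v := by
    intro v hv
    have : χ v = 0 := by
      by_contra h
      exact hv (by rw [← show Function.support χ = Metric.ball u₀ r from χ.support_eq]; exact h)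
    simp [m, this]
  have hχ1 : ∀ v, |χ v| ≤ 1 := fun v => by
    rw [abs_of_nonneg χ.nonneg]; exact χ.le_one
  have hℓm : ∀ v, c.ℓ (m v) = (1 - χ v) * c.ℓ v := fun v => by
    simp [m, c.ℓ_ν]; ring
  have hmball : ∀ v ∈ Metric.ball u₀ r, m v ∈ Metric.ball u₀ R := fun v hv =>
    Metric.ball_subset_ball (by linarith) (norm_sub_smul_sub_lt hu₀ hv hrR (hχ1 v))
  have hmt : ∀ v ∈ c.ext.target, m v ∈ c.ext.target := by
    intro v hv
    by_cases hvr : v ∈ Metric.ball u₀ r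
    · refine (hsub ⟨Metric.ball_subset_ball (min_le_right _ _) (hmball v hvr), ?_⟩).1
      change 0 ≤ c.ℓ (m v)
      rw [hℓm]
      exact mul_nonneg (sub_nonneg.2 χ.le_one) (c.target_nonneg hv)
    · rwa [hm0 v hvr]
  let h : X → X := fun y => if y ∈ c.chart.source then c.ext.symm (m (c.ext y)) else y
  -- `h` is the identity off `K`, which is compact and hence closed; this gives smoothness at the
  -- points outside the chart.
  let K : Set X := c.ext.symm '' (Metric.closedBall u₀ r ∩ {u | 0 ≤ c.ℓ u})
  have hKt : Metric.closedBall u₀ r ∩ {u | 0 ≤ c.ℓ u} ⊆ c.ext.target := fun u hu =>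
    (hsub ⟨Metric.closedBall_subset_ball (by linarith [min_le_right R₀ R₁] : r < R₁) hu.1, hu.2⟩).1
  have hK : IsClosed K := by
    refine (IsCompact.image_of_continuousOn ?_ (c.contMDiffOn_ext_symm.continuousOn.mono hKt)).isClosed
    exact (isCompact_closedBall u₀ r).inter_right (isClosed_le continuous_const c.ℓ.continuous)
  have hhK : ∀ y ∉ K, h y = y := by
    intro y hy
    by_cases hys : y ∈ c.chart.source
    · have : c.ext y ∉ Metric.ball u₀ r := fun hb => hy
        ⟨c.ext y, ⟨Metric.ball_subset_closedBall hb, c.nonneg y hys⟩, c.left_inv hys⟩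
      simp only [h, if_pos hys, hm0 _ this, c.left_inv hys]
    · simp only [h, if_neg hys]
  refine ⟨h, fun y => ?_, fun y hy => ?_, ?_, fun y => ?_⟩
  · by_cases hys : y ∈ c.chart.source
    · have h1 : ContMDiffOn 𝓜 𝓜 ∞ (c.ext.symm ∘ m ∘ c.ext) c.chart.source :=
        c.contMDiffOn_ext_symm.comp (hm.contMDiff.comp_contMDiffOn c.contMDiffOn_ext)
          fun z hz => hmt _ (c.map_source hz)
      refine (h1.contMDiffAt (c.chart.open_source.mem_nhds hys)).congr_of_eventuallyEq ?_
      filter_upwards [c.chart.open_source.mem_nhds hys] with z hz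
      simp only [h, if_pos hz, Function.comp_apply]
    · have hyK : y ∉ K := by
        rintro ⟨u, hu, rfl⟩
        exact hys (c.map_target (hKt hu))
      refine contMDiffAt_id.congr_of_eventuallyEq ?_
      filter_upwards [hK.isOpen_compl.mem_nhds hyK] with z hz
      exact hhK z hz
  · by_cases hys : y ∈ c.chart.source
    · have : c.ℓ (c.ext y) = 0 := (c.zero_iff y hys).2 hy
      simp only [h, if_pos hys, m, this, zero_smul, smul_zero, sub_zero, c.left_inv hys]
    · simp only [h, if_neg hys]
  · filter_upwards [c.chart.open_source.mem_nhds hx,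
      (c.continuousAt_ext hx).preimage_mem_nhds (Metric.ball_mem_nhds u₀ (half_pos hr))] with y hy hy2
    have : χ (c.ext y) = 1 := χ.one_of_mem_closedBall (Metric.ball_subset_closedBall hy2)
    simp only [h, if_pos hy]
    refine c.boundary_of_target (hmt _ (c.map_source hy)) ?_
    rw [hℓm, this, sub_self, zero_mul]
  · by_cases hys : y ∈ c.chart.source
    · by_cases hb : c.ext y ∈ Metric.ball u₀ r
      · right
        refine ⟨hys, χ (c.ext y), ⟨χ.nonneg, χ.le_one⟩, ?_, ?_⟩
        · exact Metric.ball_subset_ball (min_le_left _ _) (hmball _ hb)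
        · simp only [h, if_pos hys]; rfl
      · left
        simp only [h, if_pos hys, hm0 _ hb, c.left_inv hys]
    · left
      simp only [h, if_neg hys]

variable [CompactSpace X]

/-- A smooth retraction of a neighborhood of the boundary onto the boundary, defined on all of `X`
and preserving a given subset, provided that this is possible locally. -/
theorem exists_retraction (S : Set X)
    (hloc : ∀ x ∈ 𝓜.boundary X, ∃ h : X → X, ContMDiff 𝓜 𝓜 ∞ h ∧
      (∀ y ∈ 𝓜.boundary X, h y = y) ∧ (∀ᶠ y in 𝓝 x, h y ∈ 𝓜.boundary X) ∧ MapsTo h S S) :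
    ∃ π : X → X, ContMDiff 𝓜 𝓜 ∞ π ∧ (∀ y ∈ 𝓜.boundary X, π y = y) ∧
      (∀ x ∈ 𝓜.boundary X, ∀ᶠ y in 𝓝 x, π y ∈ 𝓜.boundary X) ∧ MapsTo π S S := by
  have hcomp : IsCompact (𝓜.boundary X) := (𝓜.isClosed_boundary (n := ∞) (by simp)).isCompact
  suffices ∃ π : X → X, ContMDiff 𝓜 𝓜 ∞ π ∧ (∀ y ∈ 𝓜.boundary X, π y = y) ∧
      (∀ x ∈ 𝓜.boundary X, x ∈ 𝓜.boundary X → ∀ᶠ y in 𝓝 x, π y ∈ 𝓜.boundary X) ∧ MapsTo π S S by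
    obtain ⟨π, h1, h2, h3, h4⟩ := this
    exact ⟨π, h1, h2, fun x hx => h3 x hx hx, h4⟩
  -- Finitely many local pushes are composed. Each of them fixes the boundary pointwise, so points
  -- which have reached the boundary stay there.
  refine hcomp.induction_on (p := fun T => ∃ π : X → X, ContMDiff 𝓜 𝓜 ∞ π ∧
    (∀ y ∈ 𝓜.boundary X, π y = y) ∧
      (∀ x ∈ T, x ∈ 𝓜.boundary X → ∀ᶠ y in 𝓝 x, π y ∈ 𝓜.boundary X) ∧ MapsTo π S S) ?_ ?_ ?_ ?_
  · exact ⟨id, contMDiff_id, fun _ _ => rfl, fun x hx => hx.elim, fun _ h => h⟩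
  · rintro s t hst ⟨π, h1, h2, h3, h4⟩
    exact ⟨π, h1, h2, fun x hx => h3 x (hst hx), h4⟩
  · rintro s t ⟨π, h1, h2, h3, h4⟩ ⟨π', h1', h2', h3', h4'⟩
    refine ⟨π ∘ π', h1.comp h1', fun y hy => by simp [h2' y hy, h2 y hy], ?_, h4.comp h4'⟩
    rintro x (hx | hx) hB
    · have : Tendsto π' (𝓝 x) (𝓝 x) := by
        have := h1'.continuous.tendsto x
        rwa [h2' x hB] at this
      exact this.eventually (h3 x hx hB)
    · filter_upwards [h3' x hx hB] with y hy
      simpa [h2 _ hy] using hy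
  · intro x hx
    obtain ⟨h, h1, h2, h3, h4⟩ := hloc x hx
    refine ⟨_, mem_nhdsWithin_of_mem_nhds h3.eventually_nhds, h, h1, h2, fun y hy _ => hy, h4⟩

end Retraction

/-! ### Charts of the collar -/

section EndCharts

variable {E : Type*} [NormedAddCommGroup E] [NormedSpace ℝ E]
  {H : Type*} [TopologicalSpace H]
  {𝓜 : ModelWithCorners ℝ E H} {X : Type*} [TopologicalSpace X] [ChartedSpace H X]
  [IsManifold 𝓜 ∞ X]

variable (𝓜 X) in
/-- A boundary-defining function together with a smooth retraction of a neighborhood of the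
boundary onto the boundary. -/
structure CollarData where
  ρ : X → ℝ
  π : X → X
  smooth_ρ : ContMDiff 𝓜 𝓘(ℝ, ℝ) ∞ ρ
  smooth_π : ContMDiff 𝓜 𝓜 ∞ π
  nonpos : ∀ x, ρ x ≤ 0
  zero_iff : ∀ x, x ∈ 𝓜.boundary X ↔ ρ x = 0
  regular : ∀ x ∈ 𝓜.boundary X, mfderiv 𝓜 𝓘(ℝ, ℝ) ρ x ≠ 0
  π_boundary : ∀ x ∈ 𝓜.boundary X, π x = x
  π_mem : ∀ x ∈ 𝓜.boundary X, ∀ᶠ y in 𝓝 x, π y ∈ 𝓜.boundary X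

/-- A half-space chart `κ` for which `y ↦ -ρ(y) ν + κ(π(y))` is a chart, too; it is expressed as
`G ∘ κ`, where `G` is a local diffeomorphism of the model vector space. -/
structure EndChart (C : CollarData 𝓜 X) extends HalfChart 𝓜 X where
  G : OpenPartialHomeomorph E E
  smooth_G : ContDiffOn ℝ ∞ G G.source
  smooth_symm : ContDiffOn ℝ ∞ G.symm G.target
  mem_source : ∀ y ∈ chart.source, toHalfChart.ext y ∈ G.source
  π_source : ∀ y ∈ chart.source, C.π y ∈ chart.source
  π_boundary : ∀ y ∈ chart.source, C.π y ∈ 𝓜.boundary X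
  G_ext : ∀ y ∈ chart.source,
    G (toHalfChart.ext y) = -C.ρ y • ν + toHalfChart.ext (C.π y)
  symm_mem : ∀ u ∈ G.target, 0 ≤ ℓ u → G.symm u ∈ toHalfChart.ext.target

/-- A one-sided derivative test. -/
lemma HasDerivAt.nonneg_of_right {f : ℝ → ℝ} {d : ℝ} (hf : HasDerivAt f d 0) (h0 : f 0 = 0)
    (h : ∀ᶠ s in 𝓝[>] (0 : ℝ), 0 ≤ f s) : 0 ≤ d := by
  have h1 := (hasDerivAt_iff_tendsto_slope.1 hf).mono_left
    (nhdsWithin_mono 0 (fun s (hs : s ∈ Ioi (0 : ℝ)) => (ne_of_gt hs : s ≠ 0)))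
  refine ge_of_tendsto h1 ?_
  filter_upwards [h, self_mem_nhdsWithin] with s hs hs0
  rw [slope_def_field, h0, sub_zero, sub_zero]
  exact div_nonneg hs (le_of_lt hs0)

variable [FiniteDimensional ℝ E]

/-- The map `-ρ ν + κ ∘ π`, read in the chart `κ`, is the identity on the boundary hyperplane, and
the `ℓ`-component of its normal derivative is positive because `ρ ≤ 0` is regular. Extended across
the hyperplane it is a local diffeomorphism `G` of the whole model space, which is what a chart
reaching beyond the core requires. -/
theorem HalfChart.exists_endChart (c : HalfChart 𝓜 X) (C : CollarData 𝓜 X) {x : X}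
    (hx : x ∈ c.chart.source) (hB : x ∈ 𝓜.boundary X) {S : Set X} (hS : S ∈ 𝓝 x) :
    ∃ (W : Set X) (hW : IsOpen W) (D : EndChart C), x ∈ W ∧ W ⊆ S ∧
      D.toHalfChart = c.restr hW := by
  set u₀ := c.ext x with hu₀
  have hℓ0 : c.ℓ u₀ = 0 := (c.zero_iff x hx).2 hB
  have hπx : C.π x = x := C.π_boundary x hB
  have hS' : {y | y ∈ S ∧ C.π y ∈ 𝓜.boundary X ∧ C.π y ∈ c.chart.source} ∈ 𝓝 x := by
    filter_upwards [hS, C.π_mem x hB, C.smooth_π.continuous.continuousAt.preimage_mem_nhds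
      (by rw [hπx]; exact c.chart.open_source.mem_nhds hx)] with y h1 h2 h3
    exact ⟨h1, h2, h3⟩
  obtain ⟨R, hR, hsub⟩ := c.exists_ball hx hB hS'
  set f : E → E := fun u => -C.ρ (c.ext.symm u) • c.ν + c.ext (C.π (c.ext.symm u)) with hf
  have hfs : ContDiffOn ℝ ∞ f (Metric.ball u₀ R ∩ {u | 0 ≤ c.ℓ u}) := by
    rw [← contMDiffOn_iff_contDiffOn]
    have h1 : ContMDiffOn 𝓘(ℝ, E) 𝓜 ∞ c.ext.symm (Metric.ball u₀ R ∩ {u | 0 ≤ c.ℓ u}) :=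
      c.contMDiffOn_ext_symm.mono fun u hu => (hsub hu).1
    have h2 : ContMDiffOn 𝓘(ℝ, E) 𝓘(ℝ, E) ∞ (fun u => c.ext (C.π (c.ext.symm u)))
        (Metric.ball u₀ R ∩ {u | 0 ≤ c.ℓ u}) :=
      c.contMDiffOn_ext.comp (C.smooth_π.comp_contMDiffOn h1) fun u hu => (hsub hu).2.2.2
    have h3 := C.smooth_ρ.comp_contMDiffOn h1
    rw [contMDiffOn_iff_contDiffOn] at h2 h3 ⊢
    exact (h3.neg.smul contDiffOn_const).add h2
  obtain ⟨g, hg, hgf, -⟩ := exists_contDiff_extension c.ℓ_ν hR hfs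
  have hR2 : 0 < R / 2 := half_pos hR
  have hgd : Differentiable ℝ g := hg.differentiable (by simp)
  -- values of `g`
  have hgy : ∀ y ∈ c.chart.source, c.ext y ∈ Metric.ball u₀ (R / 2) →
      g (c.ext y) = -C.ρ y • c.ν + c.ext (C.π y) := by
    intro y hy hyb
    rw [hgf _ hyb (c.nonneg y hy)]
    simp only [hf, c.left_inv hy]
  have hmemR : ∀ u ∈ Metric.ball u₀ (R / 2), 0 ≤ c.ℓ u → u ∈ c.ext.target ∧
      (c.ext.symm u ∈ S ∧ C.π (c.ext.symm u) ∈ 𝓜.boundary X ∧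
        C.π (c.ext.symm u) ∈ c.chart.source) := fun u hu h0 =>
    hsub ⟨Metric.ball_subset_ball (by linarith) hu, h0⟩
  have hga : ∀ u ∈ Metric.ball u₀ (R / 2), c.ℓ u = 0 → g u = u := by
    intro u hu h0
    obtain ⟨h1, -⟩ := hmemR u hu h0.ge
    have hb := c.boundary_of_target h1 h0
    rw [hgf u hu h0.ge]
    simp only [hf]
    rw [(C.zero_iff _).1 hb, C.π_boundary _ hb, c.right_inv h1]
    simp
  have hgb : ∀ u ∈ Metric.ball u₀ (R / 2), 0 ≤ c.ℓ u → c.ℓ (g u) = -C.ρ (c.ext.symm u) := by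
    intro u hu h0
    obtain ⟨h1, -, h2, h3⟩ := hmemR u hu h0
    rw [hgf u hu h0]
    have : c.ℓ (c.ext (C.π (c.ext.symm u))) = 0 := (c.zero_iff _ h3).2 h2
    simp [hf, this, c.ℓ_ν]
  -- the derivative of `g`
  set D := fderiv ℝ g u₀ with hD
  have hline : ∀ w, HasDerivAt (fun s : ℝ => g (u₀ + s • w)) (D w) 0 := by
    intro w
    have h1 : HasDerivAt (fun s : ℝ => u₀ + s • w) w 0 := by
      simpa using! ((hasDerivAt_id (0 : ℝ)).smul_const w).const_add u₀
    have h2 : HasFDerivAt g D (u₀ + (0 : ℝ) • w) := by simpa using (hgd u₀).hasFDerivAt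
    exact h2.comp_hasDerivAt (0 : ℝ) h1
  have hlinec : ∀ w, ∀ᶠ s in 𝓝 (0 : ℝ), u₀ + s • w ∈ Metric.ball u₀ (R / 2) := by
    intro w
    have : ContinuousAt (fun s : ℝ => u₀ + s • w) 0 := by fun_prop
    exact this.preimage_mem_nhds (by simpa using Metric.ball_mem_nhds u₀ hR2)
  have hDker : ∀ w, c.ℓ w = 0 → D w = w := by
    intro w hw
    refine (hline w).unique (HasDerivAt.congr_of_eventuallyEq
      (f := fun s : ℝ => u₀ + s • w) ?_ ?_)
    · simpa using! ((hasDerivAt_id (0 : ℝ)).smul_const w).const_add u₀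
    · filter_upwards [hlinec w] with s hs
      exact hga _ hs (by simp [hℓ0, hw])
  have hDℓ : ∀ w, c.ℓ (D w) = c.ℓ w * c.ℓ (D c.ν) := by
    intro w
    have h1 := hDker (w - c.ℓ w • c.ν) (by simp [c.ℓ_ν])
    have h2 := congrArg c.ℓ h1
    simp only [map_sub, map_smul, smul_eq_mul, c.ℓ_ν] at h2
    linarith
  have hDν0 : 0 ≤ c.ℓ (D c.ν) := by
    refine HasDerivAt.nonneg_of_right (f := fun s : ℝ => c.ℓ (g (u₀ + s • c.ν)))
      (c.ℓ.hasFDerivAt.comp_hasDerivAt (0 : ℝ) (hline c.ν)) ?_ ?_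
    · simp [hga u₀ (Metric.mem_ball_self hR2) hℓ0, hℓ0]
    · filter_upwards [nhdsWithin_le_nhds (hlinec c.ν), self_mem_nhdsWithin] with s hs hs0
      rw [hgb _ hs (by simpa [hℓ0, c.ℓ_ν] using le_of_lt hs0)]
      linarith [C.nonpos (c.ext.symm (u₀ + s • c.ν))]
  -- If this component were zero, then `ℓ ∘ D` and with it the differential of `ρ` at `x` would
  -- vanish.
  have hDν : 0 < c.ℓ (D c.ν) := by
    refine lt_of_le_of_ne hDν0 fun h0 => C.regular x hB ?_
    have h1 : C.ρ =ᶠ[𝓝 x] (fun u => -c.ℓ (g u)) ∘ c.ext := by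
      filter_upwards [c.chart.open_source.mem_nhds hx,
        (c.continuousAt_ext hx).preimage_mem_nhds (Metric.ball_mem_nhds u₀ hR2)] with y hy hyb
      simp only [Function.comp_apply]
      rw [hgb _ hyb (c.nonneg y hy), c.left_inv hy, neg_neg]
    have h2 : HasFDerivAt (fun u => -c.ℓ (g u)) (0 : E →L[ℝ] ℝ) u₀ := by
      have := (c.ℓ.hasFDerivAt.comp u₀ (hgd u₀).hasFDerivAt).neg
      refine this.congr_fderiv ?_
      ext w
      simp [hDℓ w, ← h0, ← hD]
    have h3 : MDifferentiableAt 𝓜 𝓘(ℝ, E) c.ext x :=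
      (c.contMDiffOn_ext.contMDiffAt (c.chart.open_source.mem_nhds hx)).mdifferentiableAt (by simp)
    rw [h1.mfderiv_eq]
    have h4 := (h2.hasMFDerivAt.comp x h3.hasMFDerivAt).mfderiv
    rw [h4]
    exact ContinuousLinearMap.zero_comp _
  have hDinj : Function.Injective D := by
    rw [injective_iff_map_eq_zero]
    intro w hw
    have h1 := hDℓ w
    rw [hw, map_zero, eq_comm, mul_eq_zero] at h1
    have h2 := hDker w (h1.resolve_right hDν.ne')
    rw [← h2, hw]
  let De : E ≃L[ℝ] E := (LinearEquiv.ofInjectiveEndo D.toLinearMap hDinj).toContinuousLinearEquiv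
  have hDe : (De : E →L[ℝ] E) = D := by ext w; rfl
  have hgD : HasFDerivAt g (De : E →L[ℝ] E) u₀ := by rw [hDe]; exact (hgd u₀).hasFDerivAt
  -- the inverse function theorem
  let G₀ := hg.contDiffAt.toOpenPartialHomeomorph g hgD (by simp)
  have hG₀ : ∀ u, G₀ u = g u := fun u => rfl
  have hG₀u : u₀ ∈ G₀.source := hg.contDiffAt.mem_toOpenPartialHomeomorph_source hgD (by simp)
  have hDcont : Continuous (fderiv ℝ g) := hg.continuous_fderiv (by simp)
  have hgood : {u | u ∈ Metric.ball u₀ (R / 2) ∧ u ∈ G₀.source ∧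
      fderiv ℝ g u ∈ range ((↑) : (E ≃L[ℝ] E) → E →L[ℝ] E) ∧ 0 < c.ℓ (fderiv ℝ g u c.ν)} ∈ 𝓝 u₀ := by
    have h1 := hDcont.continuousAt.preimage_mem_nhds (x := u₀) (t := range ((↑) : (E ≃L[ℝ] E) → E →L[ℝ] E))
      (by rw [← hD, ← hDe]; exact De.nhds)
    have h2 : Continuous fun u => c.ℓ (fderiv ℝ g u c.ν) :=
      c.ℓ.continuous.comp (hDcont.clm_apply continuous_const)
    filter_upwards [Metric.ball_mem_nhds u₀ hR2, G₀.open_source.mem_nhds hG₀u, h1,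
      h2.continuousAt.eventually_const_lt hDν] with u a1 a2 a3 a4
    exact ⟨a1, a2, a3, a4⟩
  obtain ⟨r₁, hr₁, hgood⟩ := Metric.mem_nhds_iff.1 hgood
  have hC : 0 < 1 + ‖c.ℓ‖ * ‖c.ν‖ := by positivity
  set r := r₁ / (1 + ‖c.ℓ‖ * ‖c.ν‖) with hrdef
  have hr : 0 < r := by positivity
  have hrr : r * (1 + ‖c.ℓ‖ * ‖c.ν‖) ≤ r₁ := by rw [hrdef]; field_simp; exact le_refl _
  have hrr₁ : r ≤ r₁ := by
    have : 0 ≤ ‖c.ℓ‖ * ‖c.ν‖ := by positivity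
    nlinarith
  -- On the segment from `v` to the hyperplane in the direction of `ν`, the function `ℓ ∘ g` is
  -- strictly increasing and ends at 0. So `g` keeps the outer side outside, and targets with `ℓ ≥
  -- 0` come from the half-space.
  have hneg : ∀ v ∈ Metric.ball u₀ r, c.ℓ v < 0 → c.ℓ (g v) < 0 := by
    intro v hv hv0
    have hseg : ∀ s ∈ Icc (0 : ℝ) 1, v - s • c.ℓ v • c.ν ∈ Metric.ball u₀ r₁ := fun s hs =>
      norm_sub_smul_sub_lt hℓ0 hv hrr (by rw [abs_of_nonneg hs.1]; exact hs.2)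
    have hder : ∀ s : ℝ, HasDerivAt (fun s : ℝ => c.ℓ (g (v - s • c.ℓ v • c.ν)))
        (-c.ℓ v * c.ℓ (fderiv ℝ g (v - s • c.ℓ v • c.ν) c.ν)) s := by
      intro s
      have h1 : HasDerivAt (fun s : ℝ => v - s • c.ℓ v • c.ν) (-(c.ℓ v • c.ν)) s := by
        simpa using! ((hasDerivAt_id s).smul_const (c.ℓ v • c.ν)).const_sub v
      have h2 := c.ℓ.hasFDerivAt.comp_hasDerivAt s ((hgd _).hasFDerivAt.comp_hasDerivAt s h1)
      convert! h2 using 1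
      simp
    have hmono : StrictMonoOn (fun s : ℝ => c.ℓ (g (v - s • c.ℓ v • c.ν))) (Icc 0 1) := by
      refine strictMonoOn_of_deriv_pos (convex_Icc 0 1)
        (fun s _ => (hder s).continuousAt.continuousWithinAt) fun s hs => ?_
      rw [(hder s).deriv]
      rw [interior_Icc] at hs
      exact mul_pos (neg_pos.2 hv0) (hgood (hseg s (Ioo_subset_Icc_self hs))).2.2.2
    have h1 := hmono (left_mem_Icc.2 zero_le_one) (right_mem_Icc.2 zero_le_one) zero_lt_one
    have hz : c.ℓ (v - (1 : ℝ) • c.ℓ v • c.ν) = 0 := by simp [c.ℓ_ν]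
    simp only [hga _ (hgood (hseg 1 (right_mem_Icc.2 zero_le_one))).1 hz, hz] at h1
    simpa using h1
  -- the open sets
  let P : E → E := fun u => u - c.ℓ u • c.ν
  have hPc : Continuous P := by fun_prop
  -- On the chart domain `P ∘ g` is the coordinate expression of `π`; the second condition makes the
  -- domain invariant under `π`.
  let S₁ : Set E := Metric.ball u₀ r ∩ (fun v => P (g v)) ⁻¹' Metric.ball u₀ r
  have hS₁ : IsOpen S₁ :=
    Metric.isOpen_ball.inter (Metric.isOpen_ball.preimage (hPc.comp hg.continuous))
  have hS₁mem : ∀ v ∈ Metric.ball u₀ r, v ∈ Metric.ball u₀ (R / 2) := fun v hv =>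
    (hgood (Metric.ball_subset_ball hrr₁ hv)).1
  have hu₀S : u₀ ∈ S₁ := by
    refine ⟨Metric.mem_ball_self hr, ?_⟩
    simp only [mem_preimage, P, hga u₀ (Metric.mem_ball_self hR2) hℓ0, hℓ0]
    simpa using hr
  let W : Set X := c.chart.source ∩ c.ext ⁻¹' S₁
  have hW : IsOpen W := by
    have := c.chart.isOpen_extend_preimage' (I := 𝓜) hS₁
    rwa [c.chart.extend_source] at this
  have hWmem : ∀ y, y ∈ (c.restr hW).chart.source ↔ y ∈ W := fun y => by
    rw [c.restr_source]; exact ⟨fun h => h.2, fun h => ⟨h.1, h⟩⟩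
  have hWd : ∀ y ∈ W, y ∈ S ∧ C.π y ∈ 𝓜.boundary X ∧ C.π y ∈ c.chart.source := by
    intro y hy
    have := (hmemR _ (hS₁mem _ hy.2.1) (c.nonneg y hy.1)).2
    rwa [c.left_inv hy.1] at this
  have hWP : ∀ y ∈ W, P (g (c.ext y)) = c.ext (C.π y) := by
    intro y hy
    have h0 : c.ℓ (c.ext (C.π y)) = 0 := (c.zero_iff _ (hWd y hy).2.2).2 (hWd y hy).2.1
    simp [P, hgy y hy.1 (hS₁mem _ hy.2.1), h0, c.ℓ_ν]
  let G := G₀.restr S₁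
  have hGs : G.source = G₀.source ∩ S₁ := by simp [G, hS₁.interior_eq]
  have hGt : ∀ u ∈ G.target, G₀.symm u ∈ S₁ ∧ g (G₀.symm u) = u ∧ u ∈ G₀.target := by
    intro u hu
    have : u ∈ G₀.target ∧ G₀.symm u ∈ S₁ := by simpa [G, hS₁.interior_eq] using hu
    exact ⟨this.2, G₀.right_inv this.1, this.1⟩
  refine ⟨W, hW,
    { toHalfChart := c.restr hW
      G := G
      smooth_G := ?_
      smooth_symm := ?_
      mem_source := ?_
      π_source := ?_
      π_boundary := ?_
      G_ext := ?_
      symm_mem := ?_ },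
    ⟨hx, hu₀S⟩, fun y hy => (hWd y hy).1, rfl⟩
  · exact hg.contDiffOn
  · intro u hu
    obtain ⟨h1, h2, h3⟩ := hGt u hu
    obtain ⟨-, -, ⟨e, he⟩, -⟩ := hgood (Metric.ball_subset_ball hrr₁ h1.1)
    refine (G₀.contDiffAt_symm h3 (f₀' := e) ?_ hg.contDiffAt).contDiffWithinAt
    rw [he]
    exact (hgd _).hasFDerivAt
  · intro y hy
    rw [hWmem] at hy
    rw [hGs]
    exact ⟨(hgood (Metric.ball_subset_ball hrr₁ hy.2.1)).2.1, hy.2⟩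
  · intro y hy
    rw [hWmem] at hy ⊢
    have h1 := hWP y hy
    have hb : c.ext (C.π y) ∈ Metric.ball u₀ r := by rw [← h1]; exact hy.2.2
    have h0 : c.ℓ (c.ext (C.π y)) = 0 := (c.zero_iff _ (hWd y hy).2.2).2 (hWd y hy).2.1
    refine ⟨(hWd y hy).2.2, hb, ?_⟩
    simp only [mem_preimage, P, hga _ (hS₁mem _ hb) h0, h0, zero_smul, sub_zero]
    exact hb
  · intro y hy
    rw [hWmem] at hy
    exact (hWd y hy).2.1
  · intro y hy
    rw [hWmem] at hy
    exact hgy y hy.1 (hS₁mem _ hy.2.1)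
  · intro u hu h0
    obtain ⟨h1, h2, h3⟩ := hGt u hu
    have hv0 : 0 ≤ c.ℓ (G₀.symm u) := by
      by_contra hcon
      have := hneg _ h1.1 (not_le.1 hcon)
      rw [h2] at this
      exact absurd h0 (not_le.2 this)
    have ht := (hmemR _ (hS₁mem _ h1.1) hv0).1
    refine (c.mem_restr_target hW).2 ⟨ht, c.map_target ht, ?_⟩
    change c.ext (c.ext.symm (G₀.symm u)) ∈ S₁
    rw [c.right_inv ht]
    exact h1

end EndCharts

/-! ### Adapted charts for a submanifold -/

section Adapted

variable {E : Type*} [NormedAddCommGroup E] [NormedSpace ℝ E]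
  {H : Type*} [TopologicalSpace H]
  {𝓜 : ModelWithCorners ℝ E H} {X : Type*} [TopologicalSpace X] [ChartedSpace H X]
  [IsManifold 𝓜 ∞ X]
  {F : Type*} [NormedAddCommGroup F] [NormedSpace ℝ F]
  {G : Type*} [TopologicalSpace G]
  {𝓝' : ModelWithCorners ℝ F G} {N : Type*} [TopologicalSpace N] [ChartedSpace G N]
  [IsManifold 𝓝' ∞ N] {C : Type*} [NormedAddCommGroup C] [NormedSpace ℝ C]

/-- In the half-space charts `c` and `c'`, the map `j` is the linear map `w ↦ e (w, 0)`. -/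
structure IsAdapted (j : N → X) (c : HalfChart 𝓜 X) (c' : HalfChart 𝓝' N) (e : (F × C) ≃L[ℝ] E) :
    Prop where
  source : ∀ y, j y ∈ c.chart.source → y ∈ c'.chart.source
  source' : ∀ y ∈ c'.chart.source, j y ∈ c.chart.source
  ext : ∀ y ∈ c'.chart.source, c.ext (j y) = e (c'.ext y, 0)
  ν : e (c'.ν, 0) = c.ν
  ℓ : ∀ w, c.ℓ (e (w, 0)) = c'.ℓ w

/-- The half-space chart of a submanifold induced by a half-space chart of the ambient manifold. -/
def HalfChart.ofImmersion (c : HalfChart 𝓜 X) (j : N → X)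
    (hB : ∀ y, y ∈ 𝓝'.boundary N ↔ j y ∈ 𝓜.boundary X) (κ : OpenPartialHomeomorph N G)
    (hκ : κ ∈ IsManifold.maximalAtlas 𝓝' ∞ N) (e : (F × C) ≃L[ℝ] E)
    (hs : ∀ y ∈ κ.source, j y ∈ c.chart.source)
    (he : ∀ y ∈ κ.source, c.ext (j y) = e (κ.extend 𝓝' y, 0)) (ν : F) (hν : e (ν, 0) = c.ν) :
    HalfChart 𝓝' N where
  chart := κ
  mem := hκ
  ℓ := c.ℓ.comp (e.toContinuousLinearMap.comp (ContinuousLinearMap.inl ℝ F C))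
  ν := ν
  ℓ_ν := by simp [hν, c.ℓ_ν]
  nonneg y hy := by
    have := c.nonneg _ (hs y hy)
    change 0 ≤ c.ℓ (c.ext (j y)) at this
    rw [he y hy] at this
    exact this
  zero_iff y hy := by
    rw [hB, ← c.zero_iff _ (hs y hy)]
    change c.ℓ (e (κ.extend 𝓝' y, 0)) = 0 ↔ c.ℓ (c.ext (j y)) = 0
    rw [he y hy]
  half y hy hyB := by
    set l : F →L[ℝ] ℝ := c.ℓ.comp (e.toContinuousLinearMap.comp (ContinuousLinearMap.inl ℝ F C))
    have hl : ∀ w, l w = c.ℓ (e (w, 0)) := fun w => rfl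
    have hlν : l ν = 1 := by rw [hl, hν, c.ℓ_ν]
    obtain ⟨R, hR, hsub⟩ := Metric.mem_nhdsWithin_iff.1 (κ.extend_target_mem_nhdsWithin (I := 𝓝') hy)
    set w₀ := κ.extend 𝓝' y with hw₀
    set A : Set F := Metric.ball w₀ R ∩ {w | 0 < l w} with hA
    have hcl : ∀ w ∈ Metric.ball w₀ R, 0 ≤ l w → w ∈ closure A := by
      intro w hw h0
      have ht : Tendsto (fun s : ℝ => w + s • ν) (𝓝[>] 0) (𝓝 w) := by
        have : Continuous (fun s : ℝ => w + s • ν) := by fun_prop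
        simpa using! (this.tendsto 0).mono_left (nhdsWithin_le_nhds (s := Ioi 0))
      refine mem_closure_of_tendsto ht ?_
      filter_upwards [ht (Metric.isOpen_ball.mem_nhds hw), self_mem_nhdsWithin] with s hs1 hs2
      refine ⟨hs1, ?_⟩
      change 0 < l (w + s • ν)
      rw [map_add, map_smul, hlν, smul_eq_mul, mul_one]
      exact add_pos_of_nonneg_of_pos h0 hs2
    have hpos : ∀ w ∈ Metric.ball w₀ R ∩ range 𝓝', 0 ≤ l w := by
      intro w hw
      have hwt := hsub hw
      have h1 := c.nonneg _ (hs _ (κ.extend_source (I := 𝓝') ▸ (κ.extend 𝓝').map_target hwt))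
      change 0 ≤ c.ℓ (c.ext _) at h1
      rwa [he _ (κ.extend_source (I := 𝓝') ▸ (κ.extend 𝓝').map_target hwt),
        (κ.extend 𝓝').right_inv hwt] at h1
    -- The open half-ball `A` is connected. Its points in the range of the model are interior points
    -- of the range, since their images under `j` are off the boundary. So `A` is covered by two
    -- disjoint open sets, the interior of the range and the complement of the range, and it meets
    -- the first.
    have hAr : A ⊆ interior (range 𝓝') := by
      have hconn : IsPreconnected A :=
        ((convex_ball w₀ R).inter (convex_halfSpace_gt l.isLinear 0)).isPreconnected
      refine hconn.subset_left_of_subset_union isOpen_interior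
        𝓝'.isClosed_range.isOpen_compl ?_ ?_ ?_
      · exact disjoint_compl_right.mono_left interior_subset
      · intro w hw
        by_cases hwr : w ∈ range 𝓝'
        · left
          have hwt := hsub ⟨hw.1, hwr⟩
          have hz : (κ.extend 𝓝').symm w ∈ κ.source :=
            κ.extend_source (I := 𝓝') ▸ (κ.extend 𝓝').map_target hwt
          have hnb : j ((κ.extend 𝓝').symm w) ∉ 𝓜.boundary X := by
            intro hb
            have h1 := (c.zero_iff _ (hs _ hz)).2 hb
            change c.ℓ (c.ext _) = 0 at h1
            rw [he _ hz, (κ.extend 𝓝').right_inv hwt] at h1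
            exact absurd h1 (ne_of_gt hw.2)
          rw [← hB, ← 𝓝'.compl_interior, notMem_compl_iff,
            isInteriorPoint_iff_of_mem_maximalAtlas hκ hz, (κ.extend 𝓝').right_inv hwt] at hnb
          exact hnb
        · exact Or.inr hwr
      · have hw₀r : w₀ ∈ range 𝓝' := κ.extend_target_subset_range ((κ.extend 𝓝').map_source
          (by rwa [κ.extend_source]))
        obtain ⟨w, hw1, hw2⟩ := mem_closure_iff.1 (𝓝'.range_subset_closure_interior hw₀r) _
          Metric.isOpen_ball (Metric.mem_ball_self hR)
        obtain ⟨w', hw3, hw4⟩ := mem_closure_iff.1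
          (hcl w hw1 (hpos w ⟨hw1, interior_subset hw2⟩)) _ isOpen_interior hw2
        exact ⟨w', hw4, hw3⟩
    refine Metric.mem_nhdsWithin_iff.2 ⟨R, hR, fun w hw => hsub ⟨hw.1, ?_⟩⟩
    exact 𝓝'.isClosed_range.closure_subset_iff.2 (hAr.trans interior_subset) (hcl w hw.1 hw.2)

/-- A push-in map preserving the submanifold. -/
theorem IsAdapted.exists_push [FiniteDimensional ℝ E] [T2Space X] {j : N → X} {c : HalfChart 𝓜 X}
    {c' : HalfChart 𝓝' N} {e : (F × C) ≃L[ℝ] E} (h : IsAdapted j c c' e) {y : N}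
    (hy : y ∈ c'.chart.source) (hyB : y ∈ 𝓝'.boundary N) (hjB : j y ∈ 𝓜.boundary X) :
    ∃ h : X → X, ContMDiff 𝓜 𝓜 ∞ h ∧ (∀ y ∈ 𝓜.boundary X, h y = y) ∧
      (∀ᶠ z in 𝓝 (j y), h z ∈ 𝓜.boundary X) ∧ MapsTo h (range j) (range j) := by
  obtain ⟨R', hR', hsub⟩ := c'.exists_ball hy hyB (S := univ) univ_mem
  have hcont : ContinuousAt (fun u : E => (e.symm u).1) (c.ext (j y)) := by fun_prop
  have hmem : (fun u : E => (e.symm u).1) ⁻¹' Metric.ball (c'.ext y) R' ∈ 𝓝 (c.ext (j y)) := by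
    refine hcont.preimage_mem_nhds ?_
    rw [h.ext y hy, e.symm_apply_apply]
    exact Metric.ball_mem_nhds _ hR'
  -- Within this radius the `F`-component stays in the half-ball contained in the chart of the
  -- submanifold.
  obtain ⟨R, hR, hRsub⟩ := Metric.mem_nhds_iff.1 hmem
  obtain ⟨f, h1, h2, h3, h4⟩ := c.exists_push (h.source' y hy) hjB hR
  refine ⟨f, h1, h2, h3, ?_⟩
  rintro _ ⟨z, rfl⟩
  obtain h5 | ⟨hz, s, hs, hb, h5⟩ := h4 (j z)
  · rw [h5]; exact mem_range_self z
  · have hz' := h.source z hz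
    -- Since `ν` is the image of the normal vector `ν'` of the submanifold chart, the push moves
    -- points of the submanifold inside the linear subspace that represents it.
    have e1 : c.ext (j z) - s • c.ℓ (c.ext (j z)) • c.ν =
        e (c'.ext z - s • c'.ℓ (c'.ext z) • c'.ν, 0) := by
      rw [h.ext z hz', h.ℓ, ← h.ν, ← map_smul, ← map_smul, ← map_sub]
      congr 1
      ext <;> simp
    rw [e1] at hb h5
    have hb' := hRsub hb
    simp only [mem_preimage, e.symm_apply_apply] at hb'
    have ht := (hsub ⟨hb', by
      change 0 ≤ c'.ℓ _
      rw [map_sub, map_smul, map_smul, c'.ℓ_ν, smul_eq_mul, smul_eq_mul, mul_one]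
      nlinarith [hs.2, c'.target_nonneg (c'.map_source hz')]⟩).1
    have h6 := h.ext _ (c'.map_target ht)
    rw [c'.right_inv ht] at h6
    exact ⟨_, by rw [h5, ← h6, c.left_inv (h.source' _ (c'.map_target ht))]⟩

end Adapted

/-! ### Adapted charts and collars over the Euclidean half-space -/

section HalfSpace

variable {d : ℕ} [NeZero d] {M : Type*} [TopologicalSpace M]
  [ChartedSpace (EuclideanHalfSpace d) M] [IsManifold (𝓡∂ d) ∞ M]

/-- Every chart of a manifold with boundary is a half-space chart. -/
def HalfChart.ofEuclidean (κ : OpenPartialHomeomorph M (EuclideanHalfSpace d))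
    (hκ : κ ∈ IsManifold.maximalAtlas (𝓡∂ d) ∞ M) (ν : EuclideanSpace ℝ (Fin d)) (hν : ν 0 = 1) :
    HalfChart (𝓡∂ d) M where
  chart := κ
  mem := hκ
  ℓ := EuclideanSpace.proj 0
  ν := ν
  ℓ_ν := hν
  nonneg y hy := by
    have : κ.extend (𝓡∂ d) y ∈ range (𝓡∂ d) := κ.extend_target_subset_range
      ((κ.extend (𝓡∂ d)).map_source (by rwa [κ.extend_source]))
    rw [range_modelWithCornersEuclideanHalfSpace] at this
    exact this
  zero_iff y hy := by
    have h1 : κ.extend (𝓡∂ d) y ∈ range (𝓡∂ d) := κ.extend_target_subset_range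
      ((κ.extend (𝓡∂ d)).map_source (by rwa [κ.extend_source]))
    rw [range_modelWithCornersEuclideanHalfSpace] at h1
    rw [← (𝓡∂ d).compl_interior, mem_compl_iff, isInteriorPoint_iff_of_mem_maximalAtlas hκ hy,
      interior_range_modelWithCornersEuclideanHalfSpace]
    change (κ.extend (𝓡∂ d) y) 0 = 0 ↔ ¬ 0 < (κ.extend (𝓡∂ d) y) 0
    rw [not_lt]
    exact ⟨fun h => h.le, fun h => le_antisymm h h1⟩
  half y hy _ := by
    have := κ.extend_target_mem_nhdsWithin (I := 𝓡∂ d) hy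
    rwa [range_modelWithCornersEuclideanHalfSpace] at this

variable {F : Type*} [NormedAddCommGroup F] [NormedSpace ℝ F]
  {G : Type*} [TopologicalSpace G]
  {𝓝' : ModelWithCorners ℝ F G} {N : Type*} [TopologicalSpace N] [ChartedSpace G N]
  [IsManifold 𝓝' ∞ N]

/-- The charts of the immersion make `j` linear, and only a transverse vector tangent to the
submanifold is missing. If the normal coordinate vanished on all of `e (F × 0)`, then `ρ ∘ j` would
be zero near `y`, contrary to `dρ ≠ 0` on the tangent space. -/
theorem exists_isAdapted {C : Type*} [NormedAddCommGroup C] [NormedSpace ℝ C] {j : N → M}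
    {ρ : M → ℝ} (hρ : IsBoundaryDefining (d := d) ρ)
    (hB : ∀ y, y ∈ 𝓝'.boundary N ↔ j y ∈ (𝓡∂ d).boundary M) (hemb : IsEmbedding j)
    {y : N} (himm : IsImmersionAtOfComplement C 𝓝' (𝓡∂ d) ∞ j y)
    (hcon : ∃ v : TangentSpace 𝓝' y, differential (𝓡∂ d) ρ (j y) (mfderiv 𝓝' (𝓡∂ d) j y v) ≠ 0) :
    ∃ (c : HalfChart (𝓡∂ d) M) (c' : HalfChart 𝓝' N) (e : (F × C) ≃L[ℝ] EuclideanSpace ℝ (Fin d)),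
      IsAdapted j c c' e ∧ y ∈ c'.chart.source := by
  set κ := himm.codChart
  set κ' := himm.domChart
  set e := himm.equiv
  have hys : y ∈ κ'.source := himm.mem_domChart_source
  have hs : ∀ z ∈ κ'.source, j z ∈ κ.source := fun z hz => himm.source_subset_preimage_source hz
  have hw : ∀ z ∈ κ'.source, κ.extend (𝓡∂ d) (j z) = e (κ'.extend 𝓝' z, 0) := by
    intro z hz
    have := himm.writtenInCharts ((κ'.extend 𝓝').map_source (by rwa [κ'.extend_source]))
    simp only [Function.comp_apply] at this
    rwa [κ'.extend_left_inv hz] at this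
  have hκ := himm.codChart_mem_maximalAtlas
  have hzero : ∀ z ∈ κ'.source, (κ.extend (𝓡∂ d) (j z)) 0 = 0 → ρ (j z) = 0 := by
    intro z hz h0
    rw [← hρ.zero_iff]
    have hν0 : (EuclideanSpace.single (0 : Fin d) (1 : ℝ)) 0 = 1 := by simp
    exact ((HalfChart.ofEuclidean κ hκ _ hν0).zero_iff (j z) (hs z hz)).1 h0
  obtain ⟨v, hv⟩ : ∃ v : F, (e (v, 0)) 0 ≠ 0 := by
    by_contra hcon'
    push Not at hcon'
    obtain ⟨v, hv⟩ := hcon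
    refine hv ?_
    have h1 : ρ ∘ j =ᶠ[𝓝 y] fun _ => 0 := by
      filter_upwards [κ'.open_source.mem_nhds hys] with z hz
      exact hzero z hz (by rw [hw z hz]; exact hcon' _)
    have h2 := h1.mfderiv_eq (I := 𝓝') (I' := 𝓘(ℝ, ℝ))
    rw [mfderiv_const, mfderiv_comp y (hρ.smooth.mdifferentiableAt (by simp))
      (himm.contMDiffAt.mdifferentiableAt (by simp))] at h2
    exact DFunLike.congr_fun h2 v
  set ν' : F := ((e (v, 0)) 0)⁻¹ • v
  have hν : (e (ν', 0)) 0 = 1 := by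
    have : (ν', (0 : C)) = ((e (v, 0)) 0)⁻¹ • (v, (0 : C)) := by simp [ν']
    rw [this, map_smul]
    simp [hv]
  let c := HalfChart.ofEuclidean κ hκ (e (ν', 0)) hν
  -- As `j` is an embedding, cutting the ambient chart down to `W` excludes all other parts of the
  -- submanifold.
  obtain ⟨W, hW, hWj⟩ := hemb.isOpen_iff.1 κ'.open_source
  let c' := HalfChart.ofImmersion c j hB κ' himm.domChart_mem_maximalAtlas e hs hw ν' rfl
  have hWs : ∀ z, j z ∈ W ↔ z ∈ κ'.source := fun z => by rw [← hWj]; rfl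
  refine ⟨c.restr hW, c', e, ⟨?_, ?_, hw, rfl, fun _ => rfl⟩, hys⟩
  · intro z hz
    rw [c.restr_source] at hz
    exact (hWs z).1 hz.2
  · intro z hz
    rw [c.restr_source]
    exact ⟨hs z hz, (hWs z).2 hz⟩

/-- An adapted collar for a submanifold with conical boundary. -/
theorem exists_collarData [T2Space M] [CompactSpace M] [CompactSpace N] [FiniteDimensional ℝ F]
    {C : Type*} [NormedAddCommGroup C] [NormedSpace ℝ C] {j : N → M}
    {ρ : M → ℝ} (hρ : IsBoundaryDefining (d := d) ρ)
    (hB : ∀ y, y ∈ 𝓝'.boundary N ↔ j y ∈ (𝓡∂ d).boundary M) (hemb : IsEmbedding j)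
    (himm : IsImmersionOfComplement C 𝓝' (𝓡∂ d) ∞ j)
    (hcon : ∀ y ∈ 𝓝'.boundary N,
      ∃ v : TangentSpace 𝓝' y, differential (𝓡∂ d) ρ (j y) (mfderiv 𝓝' (𝓡∂ d) j y v) ≠ 0) :
    ∃ (K : CollarData (𝓡∂ d) M) (K' : CollarData 𝓝' N), K.ρ = ρ ∧ (∀ y, K'.ρ y = ρ (j y)) ∧
      (∀ y, j (K'.π y) = K.π (j y)) ∧
      ∀ x ∈ (𝓡∂ d).boundary M, ∃ D : EndChart K, x ∈ D.chart.source ∧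
        ((∀ y, j y ∉ D.chart.source) ∨
          ∃ (D' : EndChart K') (e : (F × C) ≃L[ℝ] EuclideanSpace ℝ (Fin d)) (y : N), j y = x ∧
            y ∈ D'.chart.source ∧ (∀ y, j y ∈ D.chart.source → y ∈ D'.chart.source) ∧
            (∀ y ∈ D'.chart.source, D.ext (j y) = e (D'.ext y, 0)) ∧ e (D'.ν, 0) = D.ν ∧
            ∀ w, D.ℓ (e (w, 0)) = D'.ℓ w) := by
  have hjs : ContMDiff 𝓝' (𝓡∂ d) ∞ j := himm.contMDiff
  have hclosed : IsClosed (range j) := (isCompact_range hjs.continuous).isClosed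
  have hν0 : (EuclideanSpace.single (0 : Fin d) (1 : ℝ)) 0 = 1 := by simp
  have hnonpos : ∀ x, ρ x ≤ 0 := by
    intro x
    by_cases hx : x ∈ (𝓡∂ d).boundary M
    · exact ((hρ.zero_iff x).1 hx).le
    · rw [← (𝓡∂ d).compl_interior, notMem_compl_iff] at hx
      exact (hρ.neg_interior x hx).le
  -- the retraction
  obtain ⟨π, hπ1, hπ2, hπ3, hπ4⟩ := exists_retraction (𝓜 := 𝓡∂ d) (X := M) (range j) (by
    intro x hx
    -- The push is made in an adapted chart at points of the submanifold, and elsewhere in a chart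
    -- that misses the closed set `range j`; it preserves `range j` either way.
    by_cases hxj : x ∈ range j
    · obtain ⟨y, rfl⟩ := hxj
      obtain ⟨c, c', e, h1, h2⟩ := exists_isAdapted hρ hB hemb (himm y)
        (hcon y ((hB y).2 hx))
      exact h1.exists_push h2 ((hB y).2 hx) hx
    · let c := (HalfChart.ofEuclidean (chartAt (EuclideanHalfSpace d) x)
        (IsManifold.chart_mem_maximalAtlas x) _ hν0).restr hclosed.isOpen_compl
      have hc : c.chart.source = _ := HalfChart.restr_source _ hclosed.isOpen_compl
      obtain ⟨h, h1, h2, h3, h4⟩ := c.exists_push (x := x) (by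
        rw [hc]; exact ⟨mem_chart_source _ x, hxj⟩) hx one_pos
      refine ⟨h, h1, h2, h3, fun y hy => ?_⟩
      obtain h5 | ⟨h5, -⟩ := h4 y
      · rwa [h5]
      · rw [hc] at h5; exact absurd hy h5.2)
  let K : CollarData (𝓡∂ d) M :=
    { ρ := ρ
      π := π
      smooth_ρ := hρ.smooth
      smooth_π := hπ1
      nonpos := hnonpos
      zero_iff := hρ.zero_iff
      regular := hρ.regular
      π_boundary := hπ2
      π_mem := hπ3 }
  -- The retraction restricts to the submanifold. Continuity of the restriction uses the embedding
  -- property of `j`, and smoothness the immersion property.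
  choose π' hπ' using fun y => hπ4 (mem_range_self y)
  have hcomp : j ∘ π' = π ∘ j := funext hπ'
  have hπ'c : Continuous π' := by
    rw [hemb.continuous_iff, hcomp]
    exact hπ1.continuous.comp hjs.continuous
  let K' : CollarData 𝓝' N :=
    { ρ := ρ ∘ j
      π := π'
      smooth_ρ := hρ.smooth.comp hjs
      smooth_π := fun y => (ContMDiffAt.iff_comp_isImmersionAtOfComplement (himm (π' y))).2
        ⟨hπ'c.continuousAt, by rw [hcomp]; exact (hπ1.comp hjs) y⟩
      nonpos := fun y => hnonpos (j y)
      zero_iff := fun y => (hB y).trans (hρ.zero_iff _)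
      regular := by
        intro y hy h0
        obtain ⟨v, hv⟩ := hcon y hy
        refine hv ?_
        rw [mfderiv_comp y (hρ.smooth.mdifferentiableAt (by simp))
          (hjs.mdifferentiableAt (by simp))] at h0
        exact DFunLike.congr_fun h0 v
      π_boundary := fun y hy => hemb.injective (by rw [hπ', hπ2 _ ((hB y).1 hy)])
      π_mem := by
        intro y hy
        filter_upwards [hjs.continuous.continuousAt.eventually (hπ3 _ ((hB y).1 hy))] with z hz
        rw [hB, hπ']
        exact hz }
  refine ⟨K, K', rfl, fun _ => rfl, hπ', fun x hx => ?_⟩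
  by_cases hxj : x ∈ range j
  · obtain ⟨y, rfl⟩ := hxj
    obtain ⟨c, c', e, h1, h2⟩ := exists_isAdapted hρ hB hemb (himm y)
      (hcon y ((hB y).2 hx))
    -- The chart of the submanifold is shrunk before the ambient one, so that the latter can be
    -- taken small enough to meet the submanifold only inside the former.
    obtain ⟨W', hW', D', hyW', -, hD'⟩ := c'.exists_endChart K' h2 ((hB y).2 hx) univ_mem
    have hsD' : D'.chart.source = c'.chart.source ∩ W' := by
      rw [← c'.restr_source hW', ← hD']
    have hD's : D'.chart.source ∈ 𝓝 y := D'.chart.open_source.mem_nhds (by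
      rw [hsD']; exact ⟨h2, hyW'⟩)
    rw [hemb.nhds_eq_comap, mem_comap] at hD's
    obtain ⟨S, hS, hSj⟩ := hD's
    obtain ⟨W, hW, D, hxW, hWS, hD⟩ := c.exists_endChart K (h1.source' y h2) hx hS
    have hsD : D.chart.source = c.chart.source ∩ W := by
      rw [← c.restr_source hW, ← hD]
    refine ⟨D, by rw [hsD]; exact ⟨h1.source' y h2, hxW⟩, Or.inr ⟨D', e, y, rfl, ?_, ?_, ?_, ?_, ?_⟩⟩
    · rw [hsD']; exact ⟨h2, hyW'⟩
    · intro z hz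
      rw [hsD] at hz
      exact hSj (hWS hz.2)
    · intro z hz
      rw [hD, hD', c.restr_ext, c'.restr_ext]
      rw [hsD'] at hz
      exact h1.ext z hz.1
    · rw [hD, hD']; exact h1.ν
    · rw [hD, hD']; exact h1.ℓ
  · let c := HalfChart.ofEuclidean (chartAt (EuclideanHalfSpace d) x)
        (IsManifold.chart_mem_maximalAtlas x) _ hν0
    obtain ⟨W, hW, D, hxW, hWS, hD⟩ := c.exists_endChart K (mem_chart_source _ x) hx
      (hclosed.isOpen_compl.mem_nhds hxj)
    have hsD : D.chart.source = c.chart.source ∩ W := by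
      rw [← c.restr_source hW, ← hD]
    refine ⟨D, by rw [hsD]; exact ⟨mem_chart_source _ x, hxW⟩, Or.inl fun y hy => ?_⟩
    rw [hsD] at hy
    exact hWS hy.2 (mem_range_self y)

end HalfSpace

/-! ### The topology of the completion -/

section CompletionTopology

variable {E : Type*} [NormedAddCommGroup E] [NormedSpace ℝ E]
  {H : Type*} [TopologicalSpace H]
  {𝓜 : ModelWithCorners ℝ E H} {X : Type*} [TopologicalSpace X] [ChartedSpace H X]

/-- The projection `X̂ → X` which collapses the conical end to the boundary. -/
def Completion.base : Completion 𝓜 X → X :=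
  Quot.lift (Sum.elim id (fun p => p.1.1)) (by rintro _ _ ⟨x⟩; rfl)

@[simp] lemma Completion.base_core (x : X) : Completion.base (Completion.core 𝓜 x) = x := rfl

@[simp] lemma Completion.base_coneEnd (p : 𝓜.boundary X × Ici (0 : ℝ)) :
    Completion.base (Completion.coneEnd 𝓜 p) = p.1.1 := rfl

lemma Completion.ind {P : Completion 𝓜 X → Prop} (h1 : ∀ x, P (Completion.core 𝓜 x))
    (h2 : ∀ p, P (Completion.coneEnd 𝓜 p)) (p : Completion 𝓜 X) : P p := by
  induction p using Quot.ind with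
  | mk a => rcases a with x | p
            · exact h1 x
            · exact h2 p

lemma Completion.continuous_core : Continuous (Completion.core 𝓜 : X → Completion 𝓜 X) :=
  continuous_quot_mk.comp continuous_inl

lemma Completion.continuous_coneEnd :
    Continuous (Completion.coneEnd 𝓜 : _ → Completion 𝓜 X) :=
  continuous_quot_mk.comp continuous_inr

lemma Completion.continuous_base : Continuous (Completion.base : Completion 𝓜 X → X) :=
  continuous_quot_lift _ (continuous_sum_dom.2
    ⟨continuous_id, continuous_subtype_val.comp continuous_fst⟩)

lemma Completion.coneEnd_zero (x : 𝓜.boundary X) :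
    Completion.coneEnd 𝓜 (x, ⟨0, le_refl (0 : ℝ)⟩) = Completion.core 𝓜 x.1 :=
  (Quot.sound (GlueRel.glue x)).symm

variable [IsManifold 𝓜 ∞ X]

namespace CollarData

variable (C : CollarData 𝓜 X)

/-- The extension of the boundary-defining function to the completion. -/
def height : Completion 𝓜 X → ℝ :=
  Completion.extendFun 𝓜 C.ρ (fun x hx => (C.zero_iff x).1 hx)

@[simp] lemma height_core (x : X) : C.height (Completion.core 𝓜 x) = C.ρ x := rfl

@[simp] lemma height_coneEnd (p : 𝓜.boundary X × Ici (0 : ℝ)) :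
    C.height (Completion.coneEnd 𝓜 p) = Real.exp p.2.1 - 1 := rfl

lemma height_coneEnd_nonneg (p : 𝓜.boundary X × Ici (0 : ℝ)) :
    0 ≤ Real.exp p.2.1 - 1 := sub_nonneg.2 (Real.one_le_exp p.2.2)

lemma continuous_height : Continuous C.height :=
  continuous_quot_lift _ (continuous_sum_dom.2 ⟨C.smooth_ρ.continuous,
    (Real.continuous_exp.comp (continuous_subtype_val.comp continuous_snd)).sub continuous_const⟩)

lemma ρ_base (p : Completion 𝓜 X) : C.ρ (Completion.base p) = min (C.height p) 0 := by
  induction p using Completion.ind with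
  | h1 x => simp [C.nonpos x]
  | h2 q => simp [(C.zero_iff _).1 q.1.2, q.2.2.out]

open Classical in
/-- The point of the completion with given base point and height. -/
def point (_ : CollarData 𝓜 X) (q : X × ℝ) : Completion 𝓜 X :=
  if h : q.1 ∈ 𝓜.boundary X ∧ 0 ≤ q.2 then
    Completion.coneEnd 𝓜 (⟨q.1, h.1⟩, ⟨Real.log (1 + q.2), Real.log_nonneg (by linarith [h.2])⟩)
  else Completion.core 𝓜 q.1

lemma point_of_mem {x : X} (hx : x ∈ 𝓜.boundary X) {t : ℝ} (ht : 0 ≤ t) :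
    C.point (x, t) = Completion.coneEnd 𝓜
      (⟨x, hx⟩, ⟨Real.log (1 + t), Real.log_nonneg (by linarith)⟩) :=
  dif_pos ⟨hx, ht⟩

lemma point_of_neg (x : X) {t : ℝ} (ht : t < 0) : C.point (x, t) = Completion.core 𝓜 x :=
  dif_neg fun h => absurd h.2 (not_le.2 ht)

@[simp] lemma base_point (q : X × ℝ) : Completion.base (C.point q) = q.1 := by
  unfold point; split_ifs <;> rfl

lemma height_point {q : X × ℝ} (h : C.ρ q.1 = min q.2 0) : C.height (C.point q) = q.2 := by
  obtain ⟨x, t⟩ := q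
  obtain ht | ht := lt_or_ge t 0
  · rw [C.point_of_neg x ht, height_core, h]
    exact min_eq_left ht.le
  · have hx : x ∈ 𝓜.boundary X := (C.zero_iff x).2 (by rw [h]; exact min_eq_right ht)
    rw [C.point_of_mem hx ht, height_coneEnd, Real.exp_log (by linarith)]
    ring

lemma point_base_height (p : Completion 𝓜 X) : C.point (Completion.base p, C.height p) = p := by
  induction p using Completion.ind with
  | h1 x =>
    rw [Completion.base_core, height_core]
    obtain hx | hx := (C.nonpos x).lt_or_eq
    · exact C.point_of_neg x hx
    · rw [hx, C.point_of_mem ((C.zero_iff x).2 hx) le_rfl,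
        ← Completion.coneEnd_zero ⟨x, (C.zero_iff x).2 hx⟩]
      simp
  | h2 q =>
    rw [Completion.base_coneEnd, height_coneEnd, C.point_of_mem q.1.2 (height_coneEnd_nonneg q)]
    simp

lemma point_core {x : X} {t : ℝ} (h : C.ρ x = t) : C.point (x, t) = Completion.core 𝓜 x := by
  rw [← h]
  exact C.point_base_height (Completion.core 𝓜 x)

/-- The completion is a closed subspace of `X × ℝ`. -/
def embed (p : Completion 𝓜 X) : X × ℝ := (Completion.base p, C.height p)

lemma continuous_embed : Continuous C.embed :=
  Completion.continuous_base.prodMk C.continuous_height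

lemma injective_embed : Function.Injective C.embed := fun p q h => by
  rw [← C.point_base_height p, ← C.point_base_height q]
  exact congrArg C.point h

/-- A closed set meets the core in a compact set, and the end is a closed subset of `X` times the
half-line, embedded properly by `r ↦ e ^ r - 1`. The completion inherits the Hausdorff property and
second countability from `X × ℝ`. -/
lemma isClosedEmbedding_embed [CompactSpace X] [T2Space X] : IsClosedEmbedding C.embed := by
  refine IsClosedEmbedding.of_continuous_injective_isClosedMap C.continuous_embed
    C.injective_embed fun K hK => ?_
  have h1 : C.embed '' K = (fun x => (x, C.ρ x)) '' (Completion.core 𝓜 ⁻¹' K) ∪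
      (fun p : 𝓜.boundary X × Ici (0 : ℝ) => ((p.1 : X), Real.exp p.2 - 1)) ''
        (Completion.coneEnd 𝓜 ⁻¹' K) := by
    ext q
    constructor
    · rintro ⟨p, hp, rfl⟩
      induction p using Completion.ind with
      | h1 x => exact Or.inl ⟨x, hp, rfl⟩
      | h2 r => exact Or.inr ⟨r, hp, rfl⟩
    · rintro (⟨x, hx, rfl⟩ | ⟨p, hp, rfl⟩)
      · exact ⟨_, hx, rfl⟩
      · exact ⟨_, hp, rfl⟩
  rw [h1]
  refine IsClosed.union ?_ ?_
  · refine ((hK.preimage Completion.continuous_core).isCompact.image ?_).isClosed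
    exact continuous_id.prodMk C.smooth_ρ.continuous
  · have hB : IsClosed (𝓜.boundary X) := 𝓜.isClosed_boundary (n := ∞) (by simp)
    have he : IsClosedEmbedding (fun r : Ici (0 : ℝ) => Real.exp r - 1) := by
      have hinj : Function.Injective (fun r : Ici (0 : ℝ) => Real.exp r - 1) := fun r s h =>
        Subtype.ext (Real.exp_injective (by simpa using h))
      refine IsClosedEmbedding.of_continuous_injective_isClosedMap
        ((Real.continuous_exp.comp continuous_subtype_val).sub continuous_const) hinj
        fun S hS => ?_
      have h2 : (fun r : Ici (0 : ℝ) => Real.exp r - 1) '' S =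
          Ici 0 ∩ (fun t => (⟨max (Real.log (1 + max t 0)) 0, mem_Ici.2 (le_max_right _ _)⟩ : Ici (0 : ℝ))) ⁻¹' S := by
        have key : ∀ r : Ici (0 : ℝ), (⟨max (Real.log (1 + max (Real.exp r - 1) 0)) 0,
            mem_Ici.2 (le_max_right _ _)⟩ : Ici (0 : ℝ)) = r := by
          intro r
          have h0 : (0 : ℝ) ≤ Real.exp r - 1 := sub_nonneg.2 (Real.one_le_exp r.2)
          refine Subtype.ext ?_
          simp only [max_eq_left h0, add_sub_cancel, Real.log_exp]
          exact max_eq_left r.2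
        ext t
        constructor
        · rintro ⟨r, hr, rfl⟩
          refine ⟨sub_nonneg.2 (Real.one_le_exp r.2), ?_⟩
          rw [mem_preimage, key]
          exact hr
        · rintro ⟨ht, hS⟩
          refine ⟨_, hS, ?_⟩
          have ht' : (0 : ℝ) ≤ t := ht
          have h3 : 0 ≤ Real.log (1 + t) := Real.log_nonneg (by linarith)
          simp only [max_eq_left ht', max_eq_left h3]
          rw [Real.exp_log (by linarith)]
          ring
      rw [h2]
      refine isClosed_Ici.inter (hS.preimage ?_)
      refine Continuous.subtype_mk (Continuous.max (Continuous.log ?_ fun t => ?_) continuous_const) _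
      · fun_prop
      · have := le_max_right t 0
        positivity
    exact (hB.isClosedEmbedding_subtypeVal.prodMap he).isClosedMap _
      (hK.preimage Completion.continuous_coneEnd)

lemma t2Space_completion (C : CollarData 𝓜 X) [CompactSpace X] [T2Space X] : T2Space (Completion 𝓜 X) :=
  C.isClosedEmbedding_embed.isEmbedding.t2Space

lemma secondCountable_completion (C : CollarData 𝓜 X) [CompactSpace X] [T2Space X] [FiniteDimensional ℝ E] :
    SecondCountableTopology (Completion 𝓜 X) := by
  have : ProperSpace E := FiniteDimensional.proper_real E
  have : SecondCountableTopology H := 𝓜.secondCountableTopology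
  have : SecondCountableTopology X := ChartedSpace.secondCountable_of_sigmaCompact H X
  exact C.isClosedEmbedding_embed.isEmbedding.secondCountableTopology

end CollarData

end CompletionTopology

/-! ### Charts of the completion -/

section CompletionCharts

variable {E : Type*} [NormedAddCommGroup E] [NormedSpace ℝ E]
  {H : Type*} [TopologicalSpace H]
  {𝓜 : ModelWithCorners ℝ E H} {X : Type*} [TopologicalSpace X] [ChartedSpace H X]
  [IsManifold 𝓜 ∞ X]

namespace EndChart

variable {C : CollarData 𝓜 X} (D : EndChart C)

/-- The projection to the closed half-space. -/
def clamp (u : E) : E := u + max (-D.ℓ u) 0 • D.ν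

/-- The projection to the boundary of the half-space. -/
def flat (u : E) : E := u - D.ℓ u • D.ν

lemma continuous_clamp : Continuous D.clamp := by unfold clamp; fun_prop

lemma contDiff_flat : ContDiff ℝ ∞ D.flat :=
  contDiff_id.sub (D.ℓ.contDiff.smul contDiff_const)

lemma ℓ_clamp (u : E) : D.ℓ (D.clamp u) = max 0 (D.ℓ u) := by
  simp only [clamp, map_add, map_smul, D.ℓ_ν, smul_eq_mul, mul_one]
  rcases le_total 0 (D.ℓ u) with h | h
  · rw [max_eq_right (by linarith), max_eq_right h, add_zero]
  · rw [max_eq_left (by linarith), max_eq_left h, add_neg_cancel]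

lemma clamp_of_nonneg {u : E} (h : 0 ≤ D.ℓ u) : D.clamp u = u := by
  rw [clamp, max_eq_right (by linarith), zero_smul, add_zero]

lemma ℓ_ext_π {y : X} (hy : y ∈ D.chart.source) : D.ℓ (D.ext (C.π y)) = 0 :=
  (D.zero_iff _ (D.π_source y hy)).2 (D.π_boundary y hy)

/-- The base point corresponding to a point of the chart. -/
def basePoint (u : E) : X := D.ext.symm (D.G.symm (D.clamp u))

lemma symm_clamp_mem {u : E} (hu : D.clamp u ∈ D.G.target) :
    D.G.symm (D.clamp u) ∈ D.ext.target :=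
  D.symm_mem _ hu (by rw [D.ℓ_clamp]; exact le_max_left _ _)

lemma basePoint_mem {u : E} (hu : D.clamp u ∈ D.G.target) : D.basePoint u ∈ D.chart.source :=
  D.map_target (D.symm_clamp_mem hu)

lemma clamp_eq {u : E} (hu : D.clamp u ∈ D.G.target) :
    D.clamp u = -C.ρ (D.basePoint u) • D.ν + D.ext (C.π (D.basePoint u)) := by
  rw [← D.G_ext _ (D.basePoint_mem hu), basePoint, D.right_inv (D.symm_clamp_mem hu),
    D.G.right_inv hu]

lemma ρ_basePoint {u : E} (hu : D.clamp u ∈ D.G.target) :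
    C.ρ (D.basePoint u) = min (-D.ℓ u) 0 := by
  have h := congrArg D.ℓ (D.clamp_eq hu)
  rw [D.ℓ_clamp, map_add, map_smul, D.ℓ_ν, D.ℓ_ext_π (D.basePoint_mem hu)] at h
  have h1 : min (-D.ℓ u) 0 = -max 0 (D.ℓ u) := by rw [max_comm, ← min_neg_neg, neg_zero]
  rw [h1, h]; simp

lemma ext_π_basePoint {u : E} (hu : D.clamp u ∈ D.G.target) :
    D.ext (C.π (D.basePoint u)) = D.flat u := by
  have h := D.clamp_eq hu
  rw [D.ρ_basePoint hu, clamp] at h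
  have h1 : D.ext (C.π (D.basePoint u)) =
      u + (max (-D.ℓ u) 0 + min (-D.ℓ u) 0) • D.ν := by
    rw [add_smul, ← add_assoc, h]; module
  rw [h1, max_add_min, flat]; module

/-- Clamping replaces the height by `min height 0`, which is the value of `ρ` at the base point, and
so gives the expression whose preimage under `G` is the base point. The base point can thus be read
off from the chart value on the conical end too. -/
lemma G_ext_base {p : Completion 𝓜 X} (hp : Completion.base p ∈ D.chart.source) :
    D.clamp (-C.height p • D.ν + D.ext (C.π (Completion.base p))) =
      D.G (D.ext (Completion.base p)) := by
  rw [D.G_ext _ hp, C.ρ_base, clamp, map_add, map_smul, D.ℓ_ν, D.ℓ_ext_π hp]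
  simp only [smul_eq_mul, mul_one, add_zero, neg_neg]
  have h : min (C.height p) 0 = C.height p - max (C.height p) 0 := by
    rw [eq_sub_iff_add_eq, min_add_max, add_zero]
  rw [h]; module

/-- The chart of the completion at a point of the conical end. -/
def completionChart [CompactSpace X] [T2Space X] :
    OpenPartialHomeomorph (Completion 𝓜 X) E where
  toFun p := -C.height p • D.ν + D.ext (C.π (Completion.base p))
  invFun u := C.point (D.basePoint u, -D.ℓ u)
  source := Completion.base ⁻¹' D.chart.source
  target := D.clamp ⁻¹' D.G.target
  map_source' p hp := by
    rw [mem_preimage, D.G_ext_base hp]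
    exact D.G.map_source (D.mem_source _ hp)
  map_target' u hu := by
    rw [mem_preimage, C.base_point]
    exact D.basePoint_mem hu
  left_inv' p hp := by
    have h1 : D.basePoint (-C.height p • D.ν + D.ext (C.π (Completion.base p))) =
        Completion.base p := by
      rw [basePoint, D.G_ext_base hp, D.G.left_inv (D.mem_source _ hp), D.left_inv hp]
    have h2 : -D.ℓ (-C.height p • D.ν + D.ext (C.π (Completion.base p))) = C.height p := by
      rw [map_add, map_smul, D.ℓ_ν, D.ℓ_ext_π hp]; simp
    rw [h1, h2, C.point_base_height]
  right_inv' u hu := by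
    rw [C.height_point (q := (D.basePoint u, -D.ℓ u)) (D.ρ_basePoint hu), C.base_point,
      D.ext_π_basePoint hu, flat]
    module
  open_source := D.chart.open_source.preimage Completion.continuous_base
  open_target := D.G.open_target.preimage D.continuous_clamp
  continuousOn_toFun := by
    refine (C.continuous_height.neg.smul continuous_const).continuousOn.add ?_
    exact D.contMDiffOn_ext.continuousOn.comp
      (C.smooth_π.continuous.comp Completion.continuous_base).continuousOn
      fun p hp => D.π_source _ hp
  continuousOn_invFun := by
    rw [C.isClosedEmbedding_embed.isEmbedding.isInducing.continuousOn_iff]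
    have h1 : ContinuousOn D.basePoint (D.clamp ⁻¹' D.G.target) :=
      D.contMDiffOn_ext_symm.continuousOn.comp
        (D.G.continuousOn_symm.comp D.continuous_clamp.continuousOn fun u hu => hu)
        fun u hu => D.symm_clamp_mem hu
    refine (h1.prodMk D.ℓ.continuous.neg.continuousOn).congr fun u hu => ?_
    simp only [Function.comp_apply, CollarData.embed, C.base_point,
      C.height_point (q := (D.basePoint u, -D.ℓ u)) (D.ρ_basePoint hu)]
    rfl

variable [CompactSpace X] [T2Space X]

lemma completionChart_apply (p : Completion 𝓜 X) :
    D.completionChart p = -C.height p • D.ν + D.ext (C.π (Completion.base p)) := rfl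

lemma completionChart_symm_apply (u : E) :
    D.completionChart.symm u = C.point (D.basePoint u, -D.ℓ u) := rfl

lemma mem_completionChart_source {p : Completion 𝓜 X} :
    p ∈ D.completionChart.source ↔ Completion.base p ∈ D.chart.source := Iff.rfl

lemma mem_completionChart_target {u : E} :
    u ∈ D.completionChart.target ↔ D.clamp u ∈ D.G.target := Iff.rfl

lemma ℓ_completionChart {p : Completion 𝓜 X} (hp : Completion.base p ∈ D.chart.source) :
    D.ℓ (D.completionChart p) = -C.height p := by
  rw [completionChart_apply, map_add, map_smul, D.ℓ_ν, D.ℓ_ext_π hp]; simp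

lemma height_symm {u : E} (hu : u ∈ D.completionChart.target) :
    C.height (D.completionChart.symm u) = -D.ℓ u :=
  C.height_point (q := (D.basePoint u, -D.ℓ u)) (D.ρ_basePoint hu)

lemma base_symm (u : E) : Completion.base (D.completionChart.symm u) = D.basePoint u :=
  C.base_point _

lemma completionChart_core {y : X} (hy : y ∈ D.chart.source) :
    D.completionChart (Completion.core 𝓜 y) = D.G (D.ext y) := by
  rw [D.G_ext y hy]; rfl

lemma symm_eq_core {u : E} (hu : u ∈ D.completionChart.target) (h : 0 ≤ D.ℓ u) :
    D.completionChart.symm u = Completion.core 𝓜 (D.basePoint u) := by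
  rw [completionChart_symm_apply]
  refine C.point_core ?_
  rw [D.ρ_basePoint hu, min_eq_left (by linarith)]

lemma contMDiffOn_basePoint : ContMDiffOn 𝓘(ℝ, E) 𝓜 ∞ D.basePoint
    (D.completionChart.target ∩ {u | 0 ≤ D.ℓ u}) := by
  have h1 : ContMDiffOn 𝓘(ℝ, E) 𝓘(ℝ, E) ∞ D.G.symm (D.completionChart.target ∩ {u | 0 ≤ D.ℓ u}) := by
    rw [contMDiffOn_iff_contDiffOn]
    refine D.smooth_symm.mono fun u hu => ?_
    have := D.mem_completionChart_target.1 hu.1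
    rwa [D.clamp_of_nonneg hu.2] at this
  refine (D.contMDiffOn_ext_symm.comp h1 fun u hu => ?_).congr fun u hu => ?_
  · have := D.symm_clamp_mem hu.1
    rwa [D.clamp_of_nonneg hu.2] at this
  · rw [basePoint, D.clamp_of_nonneg hu.2]; rfl

lemma contMDiffOn_completionChart_core : ContMDiffOn 𝓜 𝓘(ℝ, E) ∞
    (fun y => D.completionChart (Completion.core 𝓜 y)) D.chart.source := by
  have : ContMDiffOn 𝓘(ℝ, E) 𝓘(ℝ, E) ∞ D.G D.G.source := by
    rw [contMDiffOn_iff_contDiffOn]; exact D.smooth_G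
  exact (this.comp D.contMDiffOn_ext fun y hy => D.mem_source y hy).congr
    fun y hy => D.completionChart_core hy

end EndChart

/-- The chart of the completion induced by a chart of the interior of `X`. -/
def interiorChart (e : OpenPartialHomeomorph X H) (C : CollarData 𝓜 X)
    (he : e ∈ IsManifold.maximalAtlas 𝓜 ∞ X) :
    OpenPartialHomeomorph (Completion 𝓜 X) E where
  toFun p := e.extend 𝓜 (Completion.base p)
  invFun u := Completion.core 𝓜 ((e.extend 𝓜).symm u)
  source := {p | C.height p < 0} ∩ Completion.base ⁻¹' e.source
  target := 𝓜.symm ⁻¹' e.target ∩ interior (range 𝓜)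
  map_source' p hp := by
    have h1 : Completion.base p ∈ e.source := hp.2
    have h2 : C.ρ (Completion.base p) < 0 := by
      rw [C.ρ_base]; exact min_lt_of_left_lt hp.1
    have h3 : Completion.base p ∈ 𝓜.interior X := by
      rw [← 𝓜.compl_boundary, mem_compl_iff, C.zero_iff]; exact h2.ne
    refine ⟨?_, (isInteriorPoint_iff_of_mem_maximalAtlas he h1).1 h3⟩
    have := (e.extend 𝓜).map_source (by rwa [e.extend_source])
    rw [e.extend_target] at this
    exact this.1
  map_target' u hu := by
    have h1 : u ∈ (e.extend 𝓜).target := by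
      rw [e.extend_target]; exact ⟨hu.1, interior_subset hu.2⟩
    have h2 : (e.extend 𝓜).symm u ∈ e.source := by
      have := (e.extend 𝓜).map_target h1; rwa [e.extend_source] at this
    refine ⟨?_, h2⟩
    have h3 := (isInteriorPoint_iff_of_mem_maximalAtlas he h2).2
      (by rw [(e.extend 𝓜).right_inv h1]; exact hu.2)
    rw [← 𝓜.compl_boundary, mem_compl_iff, C.zero_iff] at h3
    exact lt_of_le_of_ne (C.nonpos _) h3
  left_inv' p hp := by
    have h1 : Completion.base p ∈ e.source := hp.2
    have h2 : C.ρ (Completion.base p) = C.height p := by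
      rw [C.ρ_base]; exact min_eq_left (le_of_lt hp.1)
    rw [e.extend_left_inv h1, ← C.point_core h2, C.point_base_height]
  right_inv' u hu := by
    have h1 : u ∈ (e.extend 𝓜).target := by
      rw [e.extend_target]; exact ⟨hu.1, interior_subset hu.2⟩
    exact (e.extend 𝓜).right_inv h1
  open_source := (isOpen_lt C.continuous_height continuous_const).inter
    (e.open_source.preimage Completion.continuous_base)
  open_target := (e.open_target.preimage 𝓜.continuous_symm).inter isOpen_interior
  continuousOn_toFun := by
    have := (e.continuousOn_extend (I := 𝓜)).comp
      (Completion.continuous_base (𝓜 := 𝓜) (X := X)).continuousOn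
      (s := {p | C.height p < 0} ∩ Completion.base ⁻¹' e.source)
      (fun p hp => by rw [e.extend_source]; exact hp.2)
    exact this
  continuousOn_invFun := by
    refine Completion.continuous_core.comp_continuousOn
      ((e.continuousOn_extend_symm (I := 𝓜)).mono fun u hu => ?_)
    rw [e.extend_target]; exact ⟨hu.1, interior_subset hu.2⟩

variable [CompactSpace X] [T2Space X]

/-- A choice of charts of the collar at the boundary points. -/
structure CollarAtlas (C : CollarData 𝓜 X) where
  D : ∀ x ∈ 𝓜.boundary X, EndChart C
  mem : ∀ x hx, x ∈ (D x hx).chart.source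

open Classical in
/-- The smooth structure on the completion. -/
@[reducible] def CollarAtlas.chartedSpace {C : CollarData 𝓜 X} (A : CollarAtlas C) :
    ChartedSpace E (Completion 𝓜 X) where
  atlas := {e | (∃ D : EndChart C, e = D.completionChart) ∨ ∃ κ hκ, e = interiorChart κ C hκ}
  -- On the conical end the preferred chart depends only on the base point. The tangent spaces along
  -- a ray are therefore identified with `E` by one and the same chart.
  chartAt p := if h : Completion.base p ∈ 𝓜.boundary X then (A.D _ h).completionChart else
    interiorChart (chartAt H (Completion.base p)) C (IsManifold.chart_mem_maximalAtlas _)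
  mem_chart_source p := by
    split_ifs with h
    · exact A.mem _ h
    · refine ⟨?_, mem_chart_source _ _⟩
      rw [C.zero_iff, C.ρ_base] at h
      by_contra hcon
      exact h (min_eq_right (not_lt.1 hcon))
  chart_mem_atlas p := by
    split_ifs with h
    · exact Or.inl ⟨_, rfl⟩
    · exact Or.inr ⟨_, _, rfl⟩

/-- The transition maps between two charts of the conical end. -/
lemma EndChart.transition {C : CollarData 𝓜 X} (D D' : EndChart C) {u : E}
    (hu : u ∈ D.completionChart.target) :
    D'.completionChart (D.completionChart.symm u) =
      D.ℓ u • D'.ν + D'.ext (D.ext.symm (D.flat u)) := by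
  rw [D'.completionChart_apply, D.height_symm hu, D.base_symm, neg_neg, ← D.ext_π_basePoint hu,
    D.left_inv (D.π_source _ (D.basePoint_mem hu))]

lemma EndChart.flat_mem {C : CollarData 𝓜 X} (D : EndChart C) {u : E}
    (hu : u ∈ D.completionChart.target) : D.flat u ∈ D.ext.target := by
  rw [← D.ext_π_basePoint hu]
  exact D.map_source (D.π_source _ (D.basePoint_mem hu))

/-- The transition is linear in `ℓ` plus a transition between boundary charts precomposed with
`flat`. No one-sided condition remains, so it is smooth across the hyperplane. -/
lemma EndChart.contDiffOn_transition {C : CollarData 𝓜 X} (D D' : EndChart C) :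
    ContDiffOn ℝ ∞ (D'.completionChart ∘ D.completionChart.symm)
      (D.completionChart.target ∩ D.completionChart.symm ⁻¹' D'.completionChart.source) := by
  have hm : ∀ u ∈ D.completionChart.target ∩ D.completionChart.symm ⁻¹' D'.completionChart.source,
      D.ext.symm (D.flat u) ∈ D'.chart.source := by
    rintro u ⟨hu, hu'⟩
    rw [← D.ext_π_basePoint hu, D.left_inv (D.π_source _ (D.basePoint_mem hu)), ← D.base_symm]
    exact D'.π_source _ hu'
  have h1 : ContMDiffOn 𝓘(ℝ, E) 𝓘(ℝ, E) ∞ (fun u => D'.ext (D.ext.symm (D.flat u)))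
      (D.completionChart.target ∩ D.completionChart.symm ⁻¹' D'.completionChart.source) :=
    D'.contMDiffOn_ext.comp (D.contMDiffOn_ext_symm.comp D.contDiff_flat.contMDiff.contMDiffOn
      fun u hu => D.flat_mem hu.1) fun u hu => hm u hu
  rw [contMDiffOn_iff_contDiffOn] at h1
  exact ((D.ℓ.contDiff.smul contDiff_const).contDiffOn.add h1).congr
    fun u hu => D.transition D' hu.1

lemma contMDiffOn_chart_core {C : CollarData 𝓜 X} (A : CollarAtlas C)
    {e : OpenPartialHomeomorph (Completion 𝓜 X) E} (he : e ∈ A.chartedSpace.atlas) :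
    ContMDiffOn 𝓜 𝓘(ℝ, E) ∞ (fun y => e (Completion.core 𝓜 y))
      (Completion.core 𝓜 ⁻¹' e.source) := by
  obtain ⟨D, rfl⟩ | ⟨κ, hκ, rfl⟩ := he
  · exact D.contMDiffOn_completionChart_core
  · exact (κ.contMDiffOn_extend hκ).mono fun y hy => hy.2

/-- An overlap involving an interior chart lies in the core, where the transition is a chart
composed with the inclusion of `X`. Two end charts are covered by `EndChart.contDiffOn_transition`.
-/
lemma CollarAtlas.isManifold {C : CollarData 𝓜 X} (A : CollarAtlas C) :
    @IsManifold ℝ _ E _ _ E _ 𝓘(ℝ, E) ∞ (Completion 𝓜 X) _ A.chartedSpace := by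
  let _ := A.chartedSpace
  refine isManifold_of_contDiffOn 𝓘(ℝ, E) ∞ _ fun e e' he he' => ?_
  have hgoal : ContDiffOn ℝ ∞ (e' ∘ e.symm) (e.target ∩ e.symm ⁻¹' e'.source) → ContDiffOn ℝ ∞
      (𝓘(ℝ, E) ∘ e.symm ≫ₕ e' ∘ 𝓘(ℝ, E).symm) (𝓘(ℝ, E).symm ⁻¹' (e.symm ≫ₕ e').source ∩
        range 𝓘(ℝ, E)) := by
    intro h
    simpa using! h
  apply hgoal
  have hcore := contMDiffOn_chart_core A he'
  obtain ⟨D, rfl⟩ | ⟨κ, hκ, rfl⟩ := he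
  · obtain ⟨D', rfl⟩ | ⟨κ', hκ', rfl⟩ := he'
    · exact D.contDiffOn_transition D'
    · have hpos : ∀ u ∈ D.completionChart.target ∩
          D.completionChart.symm ⁻¹' (interiorChart κ' C hκ').source, 0 ≤ D.ℓ u := by
        rintro u ⟨hu, hu'⟩
        have : C.height (D.completionChart.symm u) < 0 := hu'.1
        rw [D.height_symm hu] at this
        linarith
      rw [← contMDiffOn_iff_contDiffOn]
      refine (hcore.comp (D.contMDiffOn_basePoint.mono fun u hu => ⟨hu.1, hpos u hu⟩)
        fun u hu => ?_).congr fun u hu => ?_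
      · rw [mem_preimage, mem_preimage, ← D.symm_eq_core hu.1 (hpos u hu)]
        exact hu.2
      · simp only [Function.comp_apply, D.symm_eq_core hu.1 (hpos u hu)]
  · rw [← contMDiffOn_iff_contDiffOn]
    refine hcore.comp ((contMDiffOn_extend_symm_target hκ).mono fun u hu => ?_) fun u hu => hu.2
    rw [κ.extend_target]
    exact ⟨hu.1.1, interior_subset hu.1.2⟩

end CompletionCharts

/-! ### The completion as a smooth gluing -/

section Gluing

universe u

variable {E : Type u} [NormedAddCommGroup E] [NormedSpace ℝ E]
  {H : Type*} [TopologicalSpace H]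
  {𝓜 : ModelWithCorners ℝ E H} {X : Type*} [TopologicalSpace X] [ChartedSpace H X]
  [IsManifold 𝓜 ∞ X] [CompactSpace X] [T2Space X] {C : CollarData 𝓜 X}

/-- The smooth structure on the completion is the one determined by a collar. -/
structure IsCollarStructure (A : CollarAtlas C) [cs : ChartedSpace E (Completion 𝓜 X)] : Prop where
  eq : cs = A.chartedSpace

variable [cs : ChartedSpace E (Completion 𝓜 X)] (A : CollarAtlas C)

lemma chartAt_of_base_mem (h : IsCollarStructure A) {p : Completion 𝓜 X}
    (hp : Completion.base p ∈ 𝓜.boundary X) : chartAt E p = (A.D _ hp).completionChart := by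
  obtain ⟨rfl⟩ := h
  exact dif_pos hp

variable [IsManifold 𝓘(ℝ, E) ∞ (Completion 𝓜 X)] {A}

lemma EndChart.mem_maximalAtlas (h : IsCollarStructure A) (D : EndChart C) :
    D.completionChart ∈ IsManifold.maximalAtlas 𝓘(ℝ, E) ∞ (Completion 𝓜 X) := by
  obtain ⟨rfl⟩ := h
  let _ := A.chartedSpace
  exact IsManifold.subset_maximalAtlas (Or.inl ⟨D, rfl⟩)

lemma interiorChart_mem_maximalAtlas (h : IsCollarStructure A) {κ : OpenPartialHomeomorph X H}
    (hκ : κ ∈ IsManifold.maximalAtlas 𝓜 ∞ X) :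
    interiorChart κ C hκ ∈ IsManifold.maximalAtlas 𝓘(ℝ, E) ∞ (Completion 𝓜 X) := by
  obtain ⟨rfl⟩ := h
  let _ := A.chartedSpace
  exact IsManifold.subset_maximalAtlas (Or.inr ⟨κ, hκ, rfl⟩)

lemma EndChart.contMDiffOn (h : IsCollarStructure A) (D : EndChart C) :
    ContMDiffOn 𝓘(ℝ, E) 𝓘(ℝ, E) ∞ D.completionChart D.completionChart.source :=
  contMDiffOn_of_mem_maximalAtlas (D.mem_maximalAtlas h)

lemma EndChart.contMDiffOn_symm (h : IsCollarStructure A) (D : EndChart C) :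
    ContMDiffOn 𝓘(ℝ, E) 𝓘(ℝ, E) ∞ D.completionChart.symm D.completionChart.target :=
  contMDiffOn_symm_of_mem_maximalAtlas (D.mem_maximalAtlas h)

lemma base_notMem_iff {p : Completion 𝓜 X} :
    Completion.base p ∉ 𝓜.boundary X ↔ C.height p < 0 := by
  rw [C.zero_iff, C.ρ_base]
  constructor
  · intro h
    by_contra hcon
    exact h (min_eq_right (not_lt.1 hcon))
  · intro h
    rw [min_eq_left h.le]
    exact h.ne

lemma contMDiff_height (h : IsCollarStructure A) : ContMDiff 𝓘(ℝ, E) 𝓘(ℝ, ℝ) ∞ C.height := by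
  intro p
  by_cases hp : Completion.base p ∈ 𝓜.boundary X
  · set D := A.D _ hp
    have hs : p ∈ D.completionChart.source := A.mem _ hp
    have h1 := (D.ℓ.contDiff (n := ∞)).neg.contMDiff.comp_contMDiffOn (D.contMDiffOn h)
    refine (h1.contMDiffAt (D.completionChart.open_source.mem_nhds hs)).congr_of_eventuallyEq ?_
    filter_upwards [D.completionChart.open_source.mem_nhds hs] with q hq
    simp [D.ℓ_completionChart hq]
  · have hκ : chartAt H (Completion.base p) ∈ IsManifold.maximalAtlas 𝓜 ∞ X :=
      IsManifold.chart_mem_maximalAtlas _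
    set κ := chartAt H (Completion.base p)
    set e := interiorChart κ C hκ
    have hs : p ∈ e.source := ⟨base_notMem_iff.1 hp, mem_chart_source _ _⟩
    have h0 := contMDiffOn_of_mem_maximalAtlas (interiorChart_mem_maximalAtlas h hκ)
    have h1 := C.smooth_ρ.comp_contMDiffOn ((contMDiffOn_extend_symm_target hκ).comp h0
      fun q hq => by
        have := e.map_source hq
        rw [κ.extend_target]
        exact ⟨this.1, interior_subset this.2⟩)
    refine (h1.contMDiffAt (e.open_source.mem_nhds hs)).congr_of_eventuallyEq ?_
    filter_upwards [e.open_source.mem_nhds hs] with q hq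
    have h2 : (κ.extend 𝓜).symm (e q) = Completion.base q := κ.extend_left_inv hq.2
    simp only [Function.comp_apply]
    rw [h2, C.ρ_base]
    exact (min_eq_left (le_of_lt hq.1)).symm

/-- The end chart followed by the inverse of `G` is a chart of the completion which restricts to `κ`
on the core, so the inclusion becomes the identity with trivial complement. -/
lemma isImmersionAtOfComplement_core (h : IsCollarStructure A) (x : X) :
    IsImmersionAtOfComplement PUnit.{u + 1} 𝓜 𝓘(ℝ, E) ∞ (Completion.core 𝓜 : X → Completion 𝓜 X) x := by
  let eq : (E × PUnit.{u + 1}) ≃L[ℝ] E := ContinuousLinearEquiv.prodUnique ℝ E PUnit.{u + 1}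
  by_cases hx : x ∈ 𝓜.boundary X
  · set D := A.D _ hx
    have hxs : x ∈ D.chart.source := A.mem _ hx
    let e := D.completionChart ≫ₕ D.G.symm
    refine IsImmersionAtOfComplement.mk_of_continuousAt Completion.continuous_core.continuousAt
      eq D.chart e hxs ?_ D.mem ?_ ?_
    · refine ⟨hxs, ?_⟩
      change D.completionChart (Completion.core 𝓜 x) ∈ D.G.target
      rw [D.completionChart_core hxs]
      exact D.G.map_source (D.mem_source _ hxs)
    · refine e.mem_maximalAtlas_of_contMDiffOn ?_ ?_
      · refine ContMDiffOn.comp (t := D.G.target) (g := D.G.symm) ?_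
          ((D.contMDiffOn h).mono fun q hq => hq.1) fun q hq => hq.2
        rw [contMDiffOn_iff_contDiffOn]
        exact D.smooth_symm
      · refine (D.contMDiffOn_symm h).comp (t := D.completionChart.target) (f := D.G) ?_ fun q hq => hq.2
        rw [contMDiffOn_iff_contDiffOn]
        exact D.smooth_G.mono fun q hq => hq.1
    · intro u hu
      have hy := D.map_target hu
      change D.G.symm (D.completionChart (Completion.core 𝓜 (D.ext.symm u))) = u
      rw [D.completionChart_core hy, D.right_inv hu, D.G.left_inv]
      rw [← D.right_inv hu]
      exact D.mem_source _ hy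
  · have hκ : chartAt H x ∈ IsManifold.maximalAtlas 𝓜 ∞ X := IsManifold.chart_mem_maximalAtlas _
    refine IsImmersionAtOfComplement.mk_of_continuousAt Completion.continuous_core.continuousAt
      eq (chartAt H x) (interiorChart (chartAt H x) C hκ) (mem_chart_source _ _)
      ⟨(base_notMem_iff (C := C) (p := Completion.core 𝓜 x)).1 hx, mem_chart_source _ _⟩ hκ
      (interiorChart_mem_maximalAtlas h hκ) ?_
    intro u hu
    exact ((chartAt H x).extend 𝓜).right_inv hu

/-- The collapse `base` is in general only continuous at the boundary of the core, but `π ∘ base` is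
the `flat` part of an end chart. -/
lemma contMDiffOn_π_base (h : IsCollarStructure A) (D : EndChart C) :
    ContMDiffOn 𝓘(ℝ, E) 𝓜 ∞ (fun p => C.π (Completion.base p)) D.completionChart.source := by
  refine (D.contMDiffOn_ext_symm.comp (D.contDiff_flat.contMDiff.comp_contMDiffOn
    (D.contMDiffOn h)) fun p hp => ?_).congr fun p hp => ?_
  · exact D.flat_mem (D.completionChart.map_source hp)
  · have h1 := D.ext_π_basePoint (D.completionChart.map_source hp)
    rw [← D.base_symm, D.completionChart.left_inv hp] at h1
    simp only [Function.comp_apply]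
    rw [← h1, D.left_inv (D.π_source _ hp)]

theorem isSmoothGluing [FiniteDimensional ℝ E] (h : IsCollarStructure A) :
    IsSmoothGluing 𝓜 (X := X) where
  isManifold := inferInstance
  t2Space := C.t2Space_completion
  secondCountable := C.secondCountable_completion
  core_isSmoothEmbedding := by
    have := C.t2Space_completion
    refine ⟨⟨PUnit, inferInstance, inferInstance, fun x => isImmersionAtOfComplement_core h x⟩, ?_⟩
    refine (Completion.continuous_core.isClosedEmbedding fun x y hxy => ?_).isEmbedding
    exact congrArg Completion.base hxy
  coneEnd_smooth := by
    refine ⟨fun q => C.point (q.1, Real.exp q.2 - 1), fun p => ?_, ?_⟩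
    · exact C.point_base_height (Completion.coneEnd 𝓜 p)
    · rintro ⟨x, r⟩ ⟨hx, hr⟩
      set D := A.D _ hx
      have hxs : x ∈ D.chart.source := A.mem _ hx
      have hopen : D.chart.source ×ˢ (univ : Set ℝ) ∈ 𝓝 (x, r) :=
        (D.chart.open_source.prod isOpen_univ).mem_nhds ⟨hxs, mem_univ _⟩
      -- The retraction extends the chart expression of the conical end from `∂X × [0, ∞)` to an
      -- open subset of `X × ℝ`.
      set g : X × ℝ → E := fun q => -(Real.exp q.2 - 1) • D.ν + D.ext (C.π q.1) with hg
      have h1 : ContMDiffAt (𝓜.prod 𝓘(ℝ, ℝ)) 𝓘(ℝ, E) ∞ g (x, r) := by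
        have a1 : ContMDiffAt (𝓜.prod 𝓘(ℝ, ℝ)) 𝓘(ℝ, E) ∞
            (fun q : X × ℝ => -(Real.exp q.2 - 1) • D.ν) (x, r) := by
          have : ContDiff ℝ ∞ (fun s : ℝ => -(Real.exp s - 1) • D.ν) :=
            (Real.contDiff_exp.sub contDiff_const).neg.smul contDiff_const
          exact this.contMDiff.contMDiffAt.comp (x, r) contMDiffAt_snd
        have a2 : ContMDiffAt (𝓜.prod 𝓘(ℝ, ℝ)) 𝓘(ℝ, E) ∞
            (fun q : X × ℝ => D.ext (C.π q.1)) (x, r) := by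
          have b1 := D.contMDiffOn_ext.comp C.smooth_π.contMDiffOn (s := D.chart.source)
            fun y hy => D.π_source y hy
          exact (b1.contMDiffAt (D.chart.open_source.mem_nhds hxs)).comp (x, r)
            (g := fun y => D.ext (C.π y)) contMDiffAt_fst
        exact a1.add a2
      have key : ∀ q ∈ (𝓜.boundary X ×ˢ Ici (0 : ℝ)) ∩ D.chart.source ×ˢ (univ : Set ℝ),
          C.point (q.1, Real.exp q.2 - 1) ∈ D.completionChart.source ∧
          g q = D.completionChart (C.point (q.1, Real.exp q.2 - 1)) := by
        rintro ⟨y, s⟩ ⟨⟨hy, hs⟩, hys, -⟩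
        refine ⟨by rw [D.mem_completionChart_source, C.base_point]; exact hys, ?_⟩
        rw [D.completionChart_apply, C.base_point, C.height_point]
        rw [(C.zero_iff y).1 hy, min_eq_right (sub_nonneg.2 (Real.one_le_exp hs))]
      have hmem := key (x, r) ⟨⟨hx, hr⟩, hxs, mem_univ _⟩
      have h2 : ContMDiffAt 𝓘(ℝ, E) 𝓘(ℝ, E) ∞ D.completionChart.symm (g (x, r)) := by
        rw [hmem.2]
        exact (D.contMDiffOn_symm h).contMDiffAt
          (D.completionChart.open_target.mem_nhds (D.completionChart.map_source hmem.1))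
      have h3 := (h2.comp (x, r) h1).contMDiffWithinAt (s := 𝓜.boundary X ×ˢ Ici (0 : ℝ))
      refine h3.congr_of_eventuallyEq_of_mem ?_ ⟨hx, hr⟩
      filter_upwards [self_mem_nhdsWithin, mem_nhdsWithin_of_mem_nhds hopen] with q hq1 hq2
      have := key q ⟨hq1, hq2⟩
      simp only [Function.comp_apply]
      rw [this.2, D.completionChart.left_inv this.1]
  coneEnd_inv_smooth := by
    refine ⟨fun p => (Completion.base p, Real.log (1 + C.height p)), fun p => ?_, ?_⟩
    · simp
    · rintro _ ⟨p, rfl⟩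
      set D := A.D _ p.1.2
      have hs : Completion.coneEnd 𝓜 p ∈ D.completionChart.source := A.mem _ p.1.2
      refine ContMDiffWithinAt.prodMk ?_ ?_
      · have h1 := ((contMDiffOn_π_base h D).contMDiffAt
          (D.completionChart.open_source.mem_nhds hs)).contMDiffWithinAt
          (s := range (Completion.coneEnd 𝓜 (X := X)))
        refine h1.congr_of_eventuallyEq_of_mem ?_ (mem_range_self p)
        filter_upwards [self_mem_nhdsWithin] with q hq
        obtain ⟨q, rfl⟩ := hq
        exact (C.π_boundary _ q.1.2).symm
      · have h1 : ContDiffAt ℝ ∞ (fun t : ℝ => Real.log (1 + t)) (C.height (Completion.coneEnd 𝓜 p)) := by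
          refine (contDiffAt_const.add contDiffAt_id).log ?_
          rw [C.height_coneEnd]
          simp [(Real.exp_pos _).ne']
        exact (h1.contMDiffAt.comp _ (contMDiff_height h _)).contMDiffWithinAt

end Gluing

/-! ### The extension of the submanifold to the completions -/

section GluingMap

variable {E : Type*} [NormedAddCommGroup E] [NormedSpace ℝ E]
  {H : Type*} [TopologicalSpace H]
  {𝓜 : ModelWithCorners ℝ E H} {X : Type*} [TopologicalSpace X] [ChartedSpace H X]
  [IsManifold 𝓜 ∞ X] [CompactSpace X] [T2Space X] {K : CollarData 𝓜 X}
  {F : Type*} [NormedAddCommGroup F] [NormedSpace ℝ F]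
  {G : Type*} [TopologicalSpace G]
  {𝓝' : ModelWithCorners ℝ F G} {N : Type*} [TopologicalSpace N] [ChartedSpace G N]
  [IsManifold 𝓝' ∞ N] [CompactSpace N] [T2Space N] {K' : CollarData 𝓝' N}

/-- In the charts `D` and `D'`, the map `j` is the linear map `w ↦ e (w, 0)`. -/
structure IsAdaptedEnd {Z : Type*} [NormedAddCommGroup Z] [NormedSpace ℝ Z] (j : N → X)
    (D : EndChart K) (D' : EndChart K') (e : (F × Z) ≃L[ℝ] E) : Prop where
  source : ∀ y, j y ∈ D.chart.source → y ∈ D'.chart.source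
  ext : ∀ y ∈ D'.chart.source, D.ext (j y) = e (D'.ext y, 0)
  ν : e (D'.ν, 0) = D.ν
  ℓ : ∀ w, D.ℓ (e (w, 0)) = D'.ℓ w

variable (Z : Type*) [NormedAddCommGroup Z] [NormedSpace ℝ Z]

/-- Collars of a manifold and of a submanifold which are compatible with each other. -/
structure IsAdaptedCollar (j : N → X) (A : CollarAtlas K) (A' : CollarAtlas K') : Prop where
  hB : ∀ y, y ∈ 𝓝'.boundary N ↔ j y ∈ 𝓜.boundary X
  ρ_comp : ∀ y, K'.ρ y = K.ρ (j y)
  π_comp : ∀ y, j (K'.π y) = K.π (j y)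
  adapted : ∀ x hx, (∀ y, j y ∉ (A.D x hx).chart.source) ∨
    ∃ (D' : EndChart K') (e : (F × Z) ≃L[ℝ] E), IsAdaptedEnd j (A.D x hx) D' e

variable {Z} {j : N → X} {A : CollarAtlas K} {A' : CollarAtlas K'}

namespace IsAdaptedCollar

variable (ha : IsAdaptedCollar Z j A A')

/-- The extension of `j` to the completions. -/
def map (ha : IsAdaptedCollar Z j A A') : Completion 𝓝' N → Completion 𝓜 X :=
  Completion.map 𝓜 𝓝' j (fun y hy => (ha.hB y).1 hy)

@[simp] lemma base_map (q : Completion 𝓝' N) :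
    Completion.base (ha.map q) = j (Completion.base q) := by
  induction q using Completion.ind with
  | h1 y => rfl
  | h2 p => rfl

@[simp] lemma height_map (q : Completion 𝓝' N) : K.height (ha.map q) = K'.height q := by
  induction q using Completion.ind with
  | h1 y => exact (ha.ρ_comp y).symm
  | h2 p => rfl

lemma continuous_map (hj : Continuous j) : Continuous ha.map :=
  continuous_quot_lift _ (continuous_sum_dom.2 ⟨Completion.continuous_core.comp hj,
    Completion.continuous_coneEnd.comp (((hj.comp (continuous_subtype_val.comp continuous_fst)).subtype_mk
      fun p => (ha.hB _).1 p.1.2).prodMk continuous_snd)⟩)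

/-- The extension of `j` in adapted charts. -/
lemma completionChart_map {D : EndChart K} {D' : EndChart K'} {e : (F × Z) ≃L[ℝ] E}
    (h : IsAdaptedEnd j D D' e) {q : Completion 𝓝' N} (hq : Completion.base q ∈ D'.chart.source) :
    D.completionChart (ha.map q) = e (D'.completionChart q, 0) := by
  rw [D.completionChart_apply, D'.completionChart_apply, ha.height_map, ha.base_map, ← ha.π_comp,
    h.ext _ (D'.π_source _ hq), ← h.ν, ← map_smul, ← map_add]
  congr 1
  ext <;> simp

/-- As subspaces of `N × ℝ` and `X × ℝ`, the completions are related by `j × id`. -/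
lemma isEmbedding_map (hj : IsEmbedding j) : IsEmbedding ha.map := by
  refine IsEmbedding.of_comp (ha.continuous_map hj.continuous) K.continuous_embed ?_
  have : K.embed ∘ ha.map = Prod.map j id ∘ K'.embed := by
    funext q
    simp [CollarData.embed]
  rw [this]
  exact (hj.prodMap .id).comp K'.isClosedEmbedding_embed.isEmbedding

variable [cs : ChartedSpace E (Completion 𝓜 X)] [IsManifold 𝓘(ℝ, E) ∞ (Completion 𝓜 X)]
  [cs' : ChartedSpace F (Completion 𝓝' N)] [IsManifold 𝓘(ℝ, F) ∞ (Completion 𝓝' N)]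

/-- On the end the map is the linear inclusion of adapted charts; in the interior of the core the
immersion charts of `j` serve again, with the same complement. -/
theorem isImmersionOfComplement_map (h : IsCollarStructure A) (h' : IsCollarStructure A')
    (hj : IsEmbedding j) (himm : IsImmersionOfComplement Z 𝓝' 𝓜 ∞ j) :
    IsImmersionOfComplement Z 𝓘(ℝ, F) 𝓘(ℝ, E) ∞ ha.map := by
  intro q
  have hc := (ha.continuous_map hj.continuous).continuousAt (x := q)
  by_cases hq : Completion.base q ∈ 𝓝'.boundary N
  · have hx := (ha.hB _).1 hq
    obtain h0 | ⟨D', e, hD⟩ := ha.adapted _ hx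
    · exact absurd (A.mem _ hx) (h0 _)
    · have hs' := hD.source _ (A.mem _ hx)
      refine IsImmersionAtOfComplement.mk_of_continuousAt hc e D'.completionChart
        (A.D _ hx).completionChart hs' ?_ (D'.mem_maximalAtlas h') ((A.D _ hx).mem_maximalAtlas h) ?_
      · rw [(A.D _ hx).mem_completionChart_source, ha.base_map]
        exact A.mem _ hx
      · intro u hu
        have hu' : u ∈ D'.completionChart.target := by simpa using hu
        change (A.D _ hx).completionChart (ha.map (D'.completionChart.symm u)) = e (u, 0)
        rw [ha.completionChart_map hD (D'.completionChart.map_target hu'),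
          D'.completionChart.right_inv hu']
  · have hi := himm (Completion.base q)
    have hq' := (base_notMem_iff (C := K')).1 hq
    refine IsImmersionAtOfComplement.mk_of_continuousAt hc hi.equiv
      (interiorChart hi.domChart K' hi.domChart_mem_maximalAtlas)
      (interiorChart hi.codChart K hi.codChart_mem_maximalAtlas)
      ⟨hq', hi.mem_domChart_source⟩ ⟨?_, ?_⟩ (interiorChart_mem_maximalAtlas h' _)
      (interiorChart_mem_maximalAtlas h _) ?_
    · change K.height (ha.map q) < 0
      rwa [ha.height_map]
    · rw [mem_preimage, ha.base_map]
      exact hi.mem_codChart_source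
    · intro u hu
      have hu' : u ∈ (hi.domChart.extend 𝓝').target := by
        have h1 : u ∈ 𝓝'.symm ⁻¹' hi.domChart.target ∩ interior (range 𝓝') := by
          simpa [interiorChart] using! hu
        rw [hi.domChart.extend_target]
        exact ⟨h1.1, interior_subset h1.2⟩
      exact hi.writtenInCharts hu'

end IsAdaptedCollar

end GluingMap

/-! ### Endomorphism fields in coordinates -/

section Frames

variable {E : Type*} [NormedAddCommGroup E] [NormedSpace ℝ E]
  {H : Type*} [TopologicalSpace H]
  {𝓜 : ModelWithCorners ℝ E H} {X : Type*} [TopologicalSpace X] [ChartedSpace H X]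

variable (𝓜) in
/-- The differential of a map to the model space. -/
def frame (f : X → E) (x : X) : E →L[ℝ] E := mfderiv 𝓜 𝓘(ℝ, E) f x

lemma isUnit_of_isInvertible {A : E →L[ℝ] E} (h : A.IsInvertible) : IsUnit A := by
  obtain ⟨e, rfl⟩ := h
  exact ⟨⟨e, e.symm, by ext v; simp, by ext v; simp⟩, rfl⟩

lemma bijective_of_isUnit {A : E →L[ℝ] E} (h : IsUnit A) : Function.Bijective A := by
  obtain ⟨u, rfl⟩ := h
  refine ⟨fun v w hvw => ?_, fun v => ⟨(↑u⁻¹ : E →L[ℝ] E) v, ?_⟩⟩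
  · have : ((↑u⁻¹ * ↑u : E →L[ℝ] E)) v = ((↑u⁻¹ * ↑u : E →L[ℝ] E)) w :=
      congrArg (↑u⁻¹ : E →L[ℝ] E) hvw
    rwa [u.inv_mul] at this
  · have : ((↑u * ↑u⁻¹ : E →L[ℝ] E)) v = v := by rw [u.mul_inv]; rfl
    exact this

variable [IsManifold 𝓜 ∞ X] [CompleteSpace E]

lemma isUnit_frame_extChartAt {x y : X} (hy : y ∈ (chartAt H x).source) :
    IsUnit (frame 𝓜 (extChartAt 𝓜 x) y) :=
  isUnit_of_isInvertible (isInvertible_mfderiv_extChartAt (I := 𝓜) (by rwa [extChartAt_source]))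

lemma contMDiffAt_mul_clm {f g : X → E →L[ℝ] E} {x : X}
    (hf : ContMDiffAt 𝓜 𝓘(ℝ, E →L[ℝ] E) ∞ f x) (hg : ContMDiffAt 𝓜 𝓘(ℝ, E →L[ℝ] E) ∞ g x) :
    ContMDiffAt 𝓜 𝓘(ℝ, E →L[ℝ] E) ∞ (fun y => f y * g y) x := hf.clm_comp hg

lemma contMDiffAt_ringInverse_clm {f : X → E →L[ℝ] E} {x : X}
    (hf : ContMDiffAt 𝓜 𝓘(ℝ, E →L[ℝ] E) ∞ f x) (hu : IsUnit (f x)) :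
    ContMDiffAt 𝓜 𝓘(ℝ, E →L[ℝ] E) ∞ (fun y => (f y)⁻¹ʳ) x := by
  obtain ⟨a, ha⟩ := hu
  have := contDiffAt_ringInverse ℝ a (n := ∞)
  rw [ha] at this
  exact this.contMDiffAt.comp x hf

lemma contMDiffAt_ringConj {f g : X → E →L[ℝ] E} {x : X}
    (hf : ContMDiffAt 𝓜 𝓘(ℝ, E →L[ℝ] E) ∞ f x) (hg : ContMDiffAt 𝓜 𝓘(ℝ, E →L[ℝ] E) ∞ g x)
    (hu : IsUnit (f x)) : ContMDiffAt 𝓜 𝓘(ℝ, E →L[ℝ] E) ∞ (fun y => ringConj (f y) (g y)) x :=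
  contMDiffAt_mul_clm (contMDiffAt_mul_clm hf hg) (contMDiffAt_ringInverse_clm hf hu)

lemma ringInverse_frame_extChartAt {x y : X} (hy : y ∈ (chartAt H x).source) :
    (frame 𝓜 (extChartAt 𝓜 x) y)⁻¹ʳ =
      mfderivWithin 𝓘(ℝ, E) 𝓜 (extChartAt 𝓜 x).symm (range 𝓜) (extChartAt 𝓜 x y) := by
  have hu := isUnit_frame_extChartAt (𝓜 := 𝓜) hy
  have h1 := mfderiv_extChartAt_comp_mfderivWithin_extChartAt_symm' (I := 𝓜) (x := x) (y := y)
    (by rwa [extChartAt_source])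
  have h2 : frame 𝓜 (extChartAt 𝓜 x) y *
    (show E →L[ℝ] E from mfderivWithin 𝓘(ℝ, E) 𝓜 (extChartAt 𝓜 x).symm (range 𝓜) (extChartAt 𝓜 x y)) = 1 := h1
  calc _ = (frame 𝓜 (extChartAt 𝓜 x) y)⁻¹ʳ * (frame 𝓜 (extChartAt 𝓜 x) y *
    (show E →L[ℝ] E from mfderivWithin 𝓘(ℝ, E) 𝓜 (extChartAt 𝓜 x).symm (range 𝓜) (extChartAt 𝓜 x y))) := by
        rw [h2, mul_one]
    _ = _ := by rw [← mul_assoc, Ring.inverse_mul_cancel _ hu, one_mul]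

variable (𝓜) in
/-- Smoothness at a point of a field of endomorphisms, whose values are regarded as endomorphisms
of the model space. -/
def SmoothEndAt (A : X → E →L[ℝ] E) (x : X) : Prop :=
  ContMDiffAt 𝓜 (𝓜.prod 𝓘(ℝ, E →L[ℝ] E)) ∞ (fun x => Bundle.TotalSpace.mk' (E →L[ℝ] E)
      (E := fun x : X => TangentSpace 𝓜 x →L[ℝ] TangentSpace 𝓜 x) x (A x)) x

/-- An endomorphism field is smooth if and only if it is smooth in the preferred chart. -/
lemma smoothEndAt_iff_extChartAt {A : X → E →L[ℝ] E} {x : X} :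
    SmoothEndAt 𝓜 A x ↔ ContMDiffAt 𝓜 𝓘(ℝ, E →L[ℝ] E) ∞
      (fun y => ringConj (frame 𝓜 (extChartAt 𝓜 x) y) (A y)) x := by
  rw [SmoothEndAt, contMDiffAt_hom_bundle]
  have e : (fun y => inTangentCoordinates 𝓜 𝓜 id id (fun y => A y) x y) =ᶠ[𝓝 x]
      fun y => ringConj (frame 𝓜 (extChartAt 𝓜 x) y) (A y) := by
    filter_upwards [(chartAt H x).open_source.mem_nhds (mem_chart_source H x)] with y hy
    rw [ringConj, ringInverse_frame_extChartAt hy]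
    exact inTangentCoordinates_eq_mfderiv_comp (I := 𝓜) (I' := 𝓜) (f := id) (g := id) hy hy
  constructor
  · intro h
    exact h.2.congr_of_eventuallyEq e.symm
  · intro h
    exact ⟨contMDiffAt_id, h.congr_of_eventuallyEq e⟩

/-- The differential of a map to the model space, in the preferred chart. -/
lemma contMDiffAt_frame {f : X → E} {x : X} (hf : ContMDiffAt 𝓜 𝓘(ℝ, E) ∞ f x) :
    ContMDiffAt 𝓜 𝓘(ℝ, E →L[ℝ] E) ∞
      (fun y => frame 𝓜 f y * (frame 𝓜 (extChartAt 𝓜 x) y)⁻¹ʳ) x := by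
  refine (hf.mfderiv_const (m := ∞) (by simp)).congr_of_eventuallyEq ?_
  filter_upwards [(chartAt H x).open_source.mem_nhds (mem_chart_source H x)] with y hy
  rw [ringInverse_frame_extChartAt hy]
  have h1 := inTangentCoordinates_eq_mfderiv_comp (I := 𝓜) (I' := 𝓘(ℝ, E)) (f := id) (g := f)
    (ϕ := fun y => mfderiv 𝓜 𝓘(ℝ, E) f y) (x₀ := x) (x := y) hy (mem_univ _)
  have h2 : mfderiv 𝓘(ℝ, E) 𝓘(ℝ, E) (extChartAt 𝓘(ℝ, E) (f x)) (f y) = ContinuousLinearMap.id ℝ E := by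
    rw [extChartAt_model_space_eq_id]
    exact mfderiv_id
  refine Eq.trans ?_ h1.symm
  rw [h2]
  rfl

lemma eventually_isUnit_frame {f : X → E} {x : X} (hf : ContMDiffAt 𝓜 𝓘(ℝ, E) ∞ f x)
    (hu : IsUnit (frame 𝓜 f x)) : ∀ᶠ y in 𝓝 x, IsUnit (frame 𝓜 f y) := by
  have h1 := contMDiffAt_frame hf
  have hx := isUnit_frame_extChartAt (𝓜 := 𝓜) (mem_chart_source H x)
  have open_units : IsOpen {A : E →L[ℝ] E | IsUnit A} := Units.isOpen
  filter_upwards [h1.continuousAt.eventually (open_units.mem_nhds (hu.mul hx.ringInverse)),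
    (chartAt H x).open_source.mem_nhds (mem_chart_source H x)] with y h2 h3
  have h4 := isUnit_frame_extChartAt (𝓜 := 𝓜) h3
  have h5 : IsUnit (frame 𝓜 f y * (frame 𝓜 (extChartAt 𝓜 x) y)⁻¹ʳ) := h2
  have := h5.mul h4
  rwa [mul_assoc, Ring.inverse_mul_cancel _ h4, mul_one] at this

/-- An endomorphism field is smooth if and only if it is smooth in any coordinates. -/
theorem smoothEndAt_iff {A : X → E →L[ℝ] E}
    {f : X → E} {x : X} (hf : ContMDiffAt 𝓜 𝓘(ℝ, E) ∞ f x) (hu : IsUnit (frame 𝓜 f x)) :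
    SmoothEndAt 𝓜 A x ↔ ContMDiffAt 𝓜 𝓘(ℝ, E →L[ℝ] E) ∞ (fun y => ringConj (frame 𝓜 f y) (A y)) x := by
  rw [smoothEndAt_iff_extChartAt]
  have hx := isUnit_frame_extChartAt (𝓜 := 𝓜) (mem_chart_source H x)
  have hc := contMDiffAt_frame hf
  have ev : ∀ᶠ y in 𝓝 x, IsUnit (frame 𝓜 f y) ∧ IsUnit (frame 𝓜 (extChartAt 𝓜 x) y) := by
    filter_upwards [eventually_isUnit_frame hf hu,
      (chartAt H x).open_source.mem_nhds (mem_chart_source H x)] with y h1 h2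
    exact ⟨h1, isUnit_frame_extChartAt (𝓜 := 𝓜) h2⟩
  constructor
  · intro h
    refine (contMDiffAt_ringConj hc h (hu.mul hx.ringInverse)).congr_of_eventuallyEq ?_
    filter_upwards [ev] with y hy
    rw [← ringConj_mul_left (hy.1.mul hy.2.ringInverse) hy.2, mul_assoc,
      Ring.inverse_mul_cancel _ hy.2, mul_one]
  · intro h
    refine (contMDiffAt_ringConj (contMDiffAt_ringInverse_clm hc (hu.mul hx.ringInverse)) h
      (hu.mul hx.ringInverse).ringInverse).congr_of_eventuallyEq ?_
    filter_upwards [ev] with y hy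
    have h1 := hy.1.mul hy.2.ringInverse
    rw [← ringConj_mul_left h1.ringInverse hy.1]
    congr 1
    have h2 := Ring.inverse_mul_cancel _ h1
    calc frame 𝓜 (extChartAt 𝓜 x) y = (frame 𝓜 f y * (frame 𝓜 (extChartAt 𝓜 x) y)⁻¹ʳ)⁻¹ʳ *
        (frame 𝓜 f y * (frame 𝓜 (extChartAt 𝓜 x) y)⁻¹ʳ) * frame 𝓜 (extChartAt 𝓜 x) y := by
          rw [h2, one_mul]
      _ = _ := by
          rw [mul_assoc, mul_assoc (frame 𝓜 f y), Ring.inverse_mul_cancel _ hy.2, mul_one]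

end Frames

/-! ### Differentials as maps between the model spaces -/

section TangentMaps

variable {E : Type*} [NormedAddCommGroup E] [NormedSpace ℝ E]
  {H : Type*} [TopologicalSpace H]
  {𝓜 : ModelWithCorners ℝ E H} {X : Type*} [TopologicalSpace X] [ChartedSpace H X]
  {F : Type*} [NormedAddCommGroup F] [NormedSpace ℝ F]
  {G : Type*} [TopologicalSpace G]
  {𝓝' : ModelWithCorners ℝ F G} {Y : Type*} [TopologicalSpace Y] [ChartedSpace G Y]
  {F' : Type*} [NormedAddCommGroup F'] [NormedSpace ℝ F']
  {G' : Type*} [TopologicalSpace G']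
  {𝓝'' : ModelWithCorners ℝ F' G'} {Z : Type*} [TopologicalSpace Z] [ChartedSpace G' Z]

variable (𝓜 𝓝') in
/-- The differential of a map, as a map of the model spaces. -/
def md (f : X → Y) (x : X) : E →L[ℝ] F := mfderiv 𝓜 𝓝' f x

lemma md_comp {f : X → Y} {g : Y → Z} {x : X} (hf : ContMDiffAt 𝓜 𝓝' ∞ f x)
    (hg : ContMDiffAt 𝓝' 𝓝'' ∞ g (f x)) :
    md 𝓜 𝓝'' (g ∘ f) x = (md 𝓝' 𝓝'' g (f x)).comp (md 𝓜 𝓝' f x) :=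
  mfderiv_comp x (hg.mdifferentiableAt (by simp)) (hf.mdifferentiableAt (by simp))

lemma md_congr {f g : X → Y} {x : X} (h : f =ᶠ[𝓝 x] g) : md 𝓜 𝓝' f x = md 𝓜 𝓝' g x :=
  h.mfderiv_eq

lemma md_clm (T : F →L[ℝ] F') (u : F) : md 𝓘(ℝ, F) 𝓘(ℝ, F') T u = T := by
  rw [md, mfderiv_eq_fderiv, T.fderiv]

lemma md_eq_fderiv (f : F → F') (u : F) : md 𝓘(ℝ, F) 𝓘(ℝ, F') f u = fderiv ℝ f u :=
  mfderiv_eq_fderiv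

/-- The left inverse need only be smooth within a set, because the inverse of a chart of the core is
defined on one side of the hyperplane. Since `f` maps a neighborhood into that set, the chain rule
still applies. -/
lemma md_leftInverse {f : X → Y} {g : Y → X} {s : Set Y} {x : X}
    (hf : ContMDiffAt 𝓜 𝓝' ∞ f x) (hg : ContMDiffWithinAt 𝓝' 𝓜 ∞ g s (f x))
    (hs : ∀ᶠ y in 𝓝 x, f y ∈ s) (hgf : ∀ᶠ y in 𝓝 x, g (f y) = y) :
    Function.Injective (md 𝓜 𝓝' f x) := by
  have h1 := (hf.mdifferentiableAt (by simp)).hasMFDerivAt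
  have h2 := (hg.mdifferentiableWithinAt (by simp)).hasMFDerivWithinAt
  obtain ⟨t, ht, hts⟩ := hs.exists_mem
  have h3 := h2.comp x (h1.hasMFDerivWithinAt (s := t)) fun y hy => hts y hy
  have h4 := (h3.hasMFDerivAt ht).congr_of_eventuallyEq (f₁ := id)
    (by filter_upwards [hgf] with y hy; exact hy.symm)
  have h5 := hasMFDerivAt_unique h4 (hasMFDerivAt_id x)
  intro v w hvw
  have h6 : ∀ v : E, (mfderivWithin 𝓝' 𝓜 g s (f x)) (md 𝓜 𝓝' f x v) = v := fun v =>
    congrArg (fun A : E →L[ℝ] E => A v) h5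
  rw [← h6 v, ← h6 w]
  exact congrArg (mfderivWithin 𝓝' 𝓜 g s (f x)) hvw

lemma isUnit_of_injective [FiniteDimensional ℝ E] {A : E →L[ℝ] E} (h : Function.Injective A) :
    IsUnit A := by
  let e := (LinearEquiv.ofInjectiveEndo A.toLinearMap h).toContinuousLinearEquiv
  have : (e : E →L[ℝ] E) = A := by ext v; rfl
  rw [← this]
  exact isUnit_of_isInvertible ⟨e, rfl⟩

end TangentMaps

/-! ### The charts of the conical end -/

section ChartFrames

universe u

variable {E : Type u} [NormedAddCommGroup E] [NormedSpace ℝ E] [FiniteDimensional ℝ E]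
  {H : Type*} [TopologicalSpace H]
  {𝓜 : ModelWithCorners ℝ E H} {X : Type*} [TopologicalSpace X] [ChartedSpace H X]
  [IsManifold 𝓜 ∞ X] [CompactSpace X] [T2Space X] {C : CollarData 𝓜 X}
  [cs : ChartedSpace E (Completion 𝓜 X)] [IsManifold 𝓘(ℝ, E) ∞ (Completion 𝓜 X)]
  {A : CollarAtlas C}

variable (𝓜) in
/-- The differential of the inclusion of the core. -/
def coreDeriv (x : X) : E →L[ℝ] E := md 𝓜 𝓘(ℝ, E) (Completion.core 𝓜) x

/-- The differential of a chart of the conical end. -/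
def EndChart.chartFrame (D : EndChart C) (p : Completion 𝓜 X) : E →L[ℝ] E :=
  frame 𝓘(ℝ, E) D.completionChart p

/-- The differential of a chart of the conical end, restricted to the core. -/
def EndChart.coreFrame (D : EndChart C) (x : X) : E →L[ℝ] E :=
  frame 𝓜 (fun y => D.completionChart (Completion.core 𝓜 y)) x

lemma contMDiffAt_core (h : IsCollarStructure A) (x : X) :
    ContMDiffAt 𝓜 𝓘(ℝ, E) ∞ (Completion.core 𝓜) x :=
  (isImmersionAtOfComplement_core h x).contMDiffAt

lemma EndChart.contMDiffAt (h : IsCollarStructure A) (D : EndChart C) {p : Completion 𝓜 X}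
    (hp : Completion.base p ∈ D.chart.source) :
    ContMDiffAt 𝓘(ℝ, E) 𝓘(ℝ, E) ∞ D.completionChart p :=
  (D.contMDiffOn h).contMDiffAt (D.completionChart.open_source.mem_nhds hp)

lemma EndChart.contMDiffAt_coreChart (D : EndChart C) {x : X} (hx : x ∈ D.chart.source) :
    ContMDiffAt 𝓜 𝓘(ℝ, E) ∞ (fun y => D.completionChart (Completion.core 𝓜 y)) x :=
  D.contMDiffOn_completionChart_core.contMDiffAt (D.chart.open_source.mem_nhds hx)

lemma EndChart.isUnit_chartFrame (h : IsCollarStructure A) (D : EndChart C) {p : Completion 𝓜 X}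
    (hp : Completion.base p ∈ D.chart.source) : IsUnit (D.chartFrame p) := by
  have hs := D.completionChart.open_source.mem_nhds (show p ∈ D.completionChart.source from hp)
  refine isUnit_of_injective (md_leftInverse (D.contMDiffAt h hp) (g := D.completionChart.symm)
    (s := D.completionChart.target) (D.contMDiffOn_symm h _ (D.completionChart.map_source hp)) ?_ ?_)
  · filter_upwards [hs] with q hq using D.completionChart.map_source hq
  · filter_upwards [hs] with q hq using D.completionChart.left_inv hq

lemma EndChart.coreChart_mem (D : EndChart C) {x : X} (hx : x ∈ D.chart.source) :
    D.completionChart (Completion.core 𝓜 x) ∈ D.completionChart.target ∩ {u | 0 ≤ D.ℓ u} := by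
  have hx' : Completion.core 𝓜 x ∈ D.completionChart.source := hx
  refine ⟨D.completionChart.map_source hx', ?_⟩
  have h1 := D.ℓ_completionChart hx'
  have h2 := C.nonpos x
  rw [mem_ofPred_eq, h1, C.height_core]
  linarith

lemma EndChart.basePoint_coreChart (D : EndChart C) {x : X} (hx : x ∈ D.chart.source) :
    D.basePoint (D.completionChart (Completion.core 𝓜 x)) = x := by
  rw [← D.base_symm, D.completionChart.left_inv (show Completion.core 𝓜 x ∈ D.completionChart.source from hx)]
  rfl

lemma EndChart.isUnit_coreFrame (D : EndChart C) {x : X}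
    (hx : x ∈ D.chart.source) : IsUnit (D.coreFrame x) := by
  have hs := D.chart.open_source.mem_nhds hx
  refine isUnit_of_injective (md_leftInverse (D.contMDiffAt_coreChart hx) (g := D.basePoint)
    (D.contMDiffOn_basePoint _ (D.coreChart_mem hx)) ?_ ?_)
  · filter_upwards [hs] with q hq using D.coreChart_mem hq
  · filter_upwards [hs] with q hq using D.basePoint_coreChart hq

lemma frame_comp_core (h : IsCollarStructure A) {f : Completion 𝓜 X → E} {x : X}
    (hf : ContMDiffAt 𝓘(ℝ, E) 𝓘(ℝ, E) ∞ f (Completion.core 𝓜 x)) :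
    frame 𝓜 (fun y => f (Completion.core 𝓜 y)) x =
      frame 𝓘(ℝ, E) f (Completion.core 𝓜 x) * coreDeriv 𝓜 x :=
  md_comp (contMDiffAt_core h x) hf

lemma EndChart.coreFrame_eq (h : IsCollarStructure A) (D : EndChart C) {x : X}
    (hx : x ∈ D.chart.source) :
    D.coreFrame x = D.chartFrame (Completion.core 𝓜 x) * coreDeriv 𝓜 x :=
  frame_comp_core h (D.contMDiffAt h hx)

lemma isUnit_coreDeriv (h : IsCollarStructure A) (x : X) :
    IsUnit (coreDeriv (E := E) 𝓜 x) := by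
  have key : ∀ f : Completion 𝓜 X → E, ContMDiffAt 𝓘(ℝ, E) 𝓘(ℝ, E) ∞ f (Completion.core 𝓜 x) →
      IsUnit (frame 𝓜 (fun y => f (Completion.core 𝓜 y)) x) → IsUnit (coreDeriv (E := E) 𝓜 x) := by
    intro f hf hu
    rw [frame_comp_core h hf] at hu
    refine isUnit_of_injective fun v w hvw => (bijective_of_isUnit hu).1 ?_
    exact congrArg (frame 𝓘(ℝ, E) f (Completion.core 𝓜 x)) hvw
  by_cases hx : x ∈ 𝓜.boundary X
  · exact key _ ((A.D x hx).contMDiffAt h (A.mem x hx)) ((A.D x hx).isUnit_coreFrame (A.mem x hx))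
  · have hκ : chartAt H x ∈ IsManifold.maximalAtlas 𝓜 ∞ X := IsManifold.chart_mem_maximalAtlas _
    refine key (interiorChart (chartAt H x) C hκ) ?_ (isUnit_frame_extChartAt (mem_chart_source H x))
    have hs : Completion.core 𝓜 x ∈ (interiorChart (chartAt H x) C hκ).source :=
      ⟨(base_notMem_iff (C := C) (p := Completion.core 𝓜 x)).1 hx, mem_chart_source _ _⟩
    exact (contMDiffOn_of_mem_maximalAtlas (interiorChart_mem_maximalAtlas h hκ)).contMDiffAt
      ((interiorChart (chartAt H x) C hκ).open_source.mem_nhds hs)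

/-- In the preferred charts of the conical end, the differential of the chart is the identity. -/
lemma chartFrame_eq_one (h : IsCollarStructure A) {p : Completion 𝓜 X}
    (hp : Completion.base p ∈ 𝓜.boundary X) : (A.D _ hp).chartFrame p = 1 := by
  have h1 := chartAt_of_base_mem A h hp
  have h2 : (extChartAt 𝓘(ℝ, E) p : Completion 𝓜 X → E) = (A.D _ hp).completionChart := by
    rw [← h1]; rfl
  have h3 := mfderiv_extChartAt_self (I := 𝓘(ℝ, E)) (x := p)
  rw [h2] at h3
  exact h3

lemma EndChart.ℓ_chartFrame (h : IsCollarStructure A) (D : EndChart C) {p : Completion 𝓜 X}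
    (hp : Completion.base p ∈ D.chart.source) (v : E) :
    D.ℓ (D.chartFrame p v) = -md 𝓘(ℝ, E) 𝓘(ℝ, ℝ) C.height p v := by
  have h1 : C.height =ᶠ[𝓝 p] (-D.ℓ : E →L[ℝ] ℝ) ∘ D.completionChart := by
    filter_upwards [D.completionChart.open_source.mem_nhds hp] with q hq
    simp [D.ℓ_completionChart hq]
  rw [md_congr h1, md_comp (D.contMDiffAt h hp) (-D.ℓ).contMDiff.contMDiffAt, md_clm]
  exact (neg_neg _).symm

/-- The transition map from a preferred chart. -/
lemma EndChart.chartFrame_eq_fderiv (h : IsCollarStructure A) (D' : EndChart C)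
    {p : Completion 𝓜 X} (hp : Completion.base p ∈ 𝓜.boundary X)
    (hp' : Completion.base p ∈ D'.chart.source) :
    D'.chartFrame p = fderiv ℝ (D'.completionChart ∘ (A.D _ hp).completionChart.symm)
      ((A.D _ hp).completionChart p) := by
  set D := A.D _ hp
  have hs : p ∈ D.completionChart.source := A.mem _ hp
  have h1 : D'.completionChart =ᶠ[𝓝 p]
      (D'.completionChart ∘ D.completionChart.symm) ∘ D.completionChart := by
    filter_upwards [D.completionChart.open_source.mem_nhds hs] with q hq
    simp [D.completionChart.left_inv hq]
  have h2 : ContMDiffAt 𝓘(ℝ, E) 𝓘(ℝ, E) ∞ (D'.completionChart ∘ D.completionChart.symm)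
      (D.completionChart p) := by
    refine ContMDiffAt.comp _ ?_ ((D.contMDiffOn_symm h).contMDiffAt
      (D.completionChart.open_target.mem_nhds (D.completionChart.map_source hs)))
    rw [D.completionChart.left_inv hs]
    exact D'.contMDiffAt h hp'
  have h3 : D'.chartFrame p = _ := md_congr h1
  rw [h3, md_comp (D.contMDiffAt h hs) h2, md_eq_fderiv]
  have h4 : md 𝓘(ℝ, E) 𝓘(ℝ, E) D.completionChart p = 1 := chartFrame_eq_one h hp
  rw [h4]
  rfl

/-- `flat` is invariant under translation by `ν`, so transition maps take rays to rays with their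
parametrization. This is the reason why constructions along rays do not depend on charts. -/
lemma EndChart.transition_add (D D' : EndChart C) {u : E} {s : ℝ}
    (hu : u ∈ D.completionChart.target) (hu' : u + s • D.ν ∈ D.completionChart.target) :
    (D'.completionChart ∘ D.completionChart.symm) (u + s • D.ν) =
      (D'.completionChart ∘ D.completionChart.symm) u + s • D'.ν := by
  have h1 : D.flat (u + s • D.ν) = D.flat u := by
    simp only [flat, map_add, map_smul, D.ℓ_ν, smul_eq_mul, mul_one]; module
  simp only [Function.comp_apply]
  rw [D.transition D' hu, D.transition D' hu', h1, map_add, map_smul, D.ℓ_ν]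
  simp only [smul_eq_mul, mul_one]
  module

/-- The differentials of a chart at the points of a ray of the conical end agree. -/
lemma EndChart.chartFrame_eq_of_base_eq (h : IsCollarStructure A) (D' : EndChart C)
    {p p' : Completion 𝓜 X} (hp : Completion.base p ∈ 𝓜.boundary X)
    (hp' : Completion.base p ∈ D'.chart.source) (e : Completion.base p' = Completion.base p) :
    D'.chartFrame p' = D'.chartFrame p := by
  obtain ⟨b, hb⟩ : ∃ b, b = Completion.base p := ⟨_, rfl⟩
  have hb' : b = Completion.base p' := hb.trans e.symm
  have hbm : b ∈ 𝓜.boundary X := hb ▸ hp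
  have key : ∀ q : Completion 𝓜 X, b = Completion.base q → D'.chartFrame q =
      fderiv ℝ (D'.completionChart ∘ (A.D b hbm).completionChart.symm) ((A.D b hbm).completionChart q) := by
    rintro q rfl
    exact D'.chartFrame_eq_fderiv h hbm (hb ▸ hp')
  rw [key p hb, key p' hb']
  set D := A.D b hbm
  have hs : p ∈ D.completionChart.source := by
    rw [D.mem_completionChart_source, ← hb]; exact A.mem _ _
  have hs' : p' ∈ D.completionChart.source := by
    rw [D.mem_completionChart_source, ← hb']; exact A.mem _ _
  have hu := D.completionChart.map_source hs
  have hu' := D.completionChart.map_source hs'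
  obtain ⟨s, hs⟩ : ∃ s : ℝ, D.completionChart p' = D.completionChart p + s • D.ν := by
    refine ⟨C.height p - C.height p', ?_⟩
    rw [D.completionChart_apply, D.completionChart_apply, e]
    module
  rw [hs] at hu' ⊢
  rw [← fderiv_comp_add_right]
  have hev : (fun v => (D'.completionChart ∘ D.completionChart.symm) (v + s • D.ν))
      =ᶠ[𝓝 (D.completionChart p)]
      fun v => (D'.completionChart ∘ D.completionChart.symm) v + s • D'.ν := by
    have hc : ContinuousAt (fun v : E => v + s • D.ν) (D.completionChart p) := by fun_prop
    filter_upwards [D.completionChart.open_target.mem_nhds hu,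
      hc.eventually (D.completionChart.open_target.mem_nhds hu')] with v h1 h2
    exact D.transition_add D' h1 h2
  rw [hev.fderiv_eq, fderiv_add_const]

/-- Differentiating `transition_add` in the parameter shows that `ν` represents one radial vector in
all end charts. -/
lemma EndChart.chartFrame_ν (h : IsCollarStructure A) (D' : EndChart C)
    {p : Completion 𝓜 X} (hp : Completion.base p ∈ 𝓜.boundary X)
    (hp' : Completion.base p ∈ D'.chart.source) :
    D'.chartFrame p (A.D _ hp).ν = D'.ν := by
  rw [D'.chartFrame_eq_fderiv h hp hp']
  set D := A.D _ hp
  have hs : p ∈ D.completionChart.source := A.mem _ hp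
  have hu := D.completionChart.map_source hs
  set τ := D'.completionChart ∘ D.completionChart.symm
  set u := D.completionChart p
  have hτ : DifferentiableAt ℝ τ u := by
    have h1 := D.contDiffOn_transition D'
    have hm : D.completionChart.target ∩ D.completionChart.symm ⁻¹' D'.completionChart.source ∈ 𝓝 u := by
      refine (D.completionChart.isOpen_inter_preimage_symm D'.completionChart.open_source).mem_nhds ⟨hu, ?_⟩
      rw [mem_preimage, D.completionChart.left_inv hs]
      exact hp'
    exact (h1.contDiffAt hm).differentiableAt (by simp)
  have hc : HasDerivAt (fun s : ℝ => u + s • D.ν) D.ν 0 := by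
    simpa using! ((hasDerivAt_id (0 : ℝ)).smul_const D.ν).const_add u
  have h1 : HasDerivAt (fun s : ℝ => τ (u + s • D.ν)) (fderiv ℝ τ u D.ν) 0 := by
    refine HasFDerivAt.comp_hasDerivAt (f := fun s : ℝ => u + s • D.ν) (l := τ) (0 : ℝ) ?_ hc
    simpa using hτ.hasFDerivAt
  have h2 : HasDerivAt (fun s : ℝ => τ (u + s • D.ν)) D'.ν 0 := by
    have h3 : HasDerivAt (fun s : ℝ => τ u + s • D'.ν) D'.ν 0 := by
      simpa using! ((hasDerivAt_id (0 : ℝ)).smul_const D'.ν).const_add (τ u)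
    refine h3.congr_of_eventuallyEq ?_
    have h4 : ∀ᶠ s : ℝ in 𝓝 0, u + s • D.ν ∈ D.completionChart.target :=
      hc.continuousAt.eventually (D.completionChart.open_target.mem_nhds (by simpa using hu))
    filter_upwards [h4] with s hs
    exact D.transition_add D' hu hs
  exact h1.unique h2

end ChartFrames

/-! ### Extension of endomorphism fields -/

section FieldExtension

universe u

variable {E : Type u} [NormedAddCommGroup E] [NormedSpace ℝ E] [FiniteDimensional ℝ E]
  {H : Type*} [TopologicalSpace H]
  {𝓜 : ModelWithCorners ℝ E H} {X : Type*} [TopologicalSpace X] [ChartedSpace H X]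
  [IsManifold 𝓜 ∞ X] [CompactSpace X] [T2Space X] {C : CollarData 𝓜 X}
  [cs : ChartedSpace E (Completion 𝓜 X)] [IsManifold 𝓘(ℝ, E) ∞ (Completion 𝓜 X)]
  {A : CollarAtlas C}

variable (𝓜) in
/-- The endomorphism field along the core induced by an endomorphism field. -/
def hatField (a : X → E →L[ℝ] E) (x : X) : E →L[ℝ] E := ringConj (coreDeriv 𝓜 x) (a x)

/-- The coordinate expression of an endomorphism field. -/
def EndChart.coordRep (D : EndChart C) (a : X → E →L[ℝ] E) (u : E) : E →L[ℝ] E :=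
  ringConj (D.coreFrame (D.basePoint u)) (a (D.basePoint u))

lemma EndChart.contDiffOn_coordRep (D : EndChart C) {a : X → E →L[ℝ] E}
    (ha : ∀ x, SmoothEndAt 𝓜 a x) :
    ContDiffOn ℝ ∞ (D.coordRep a) (D.completionChart.target ∩ {u | 0 ≤ D.ℓ u}) := by
  have h1 : ContMDiffOn 𝓜 𝓘(ℝ, E →L[ℝ] E) ∞ (fun x => ringConj (D.coreFrame x) (a x))
      D.chart.source := fun x hx =>
    ((smoothEndAt_iff (D.contMDiffAt_coreChart hx) (D.isUnit_coreFrame hx)).1 (ha x)).contMDiffWithinAt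
  rw [← contMDiffOn_iff_contDiffOn]
  exact h1.comp D.contMDiffOn_basePoint fun u hu => D.basePoint_mem hu.1

lemma EndChart.coordRep_core (h : IsCollarStructure A) (D : EndChart C) (a : X → E →L[ℝ] E) {x : X}
    (hx : x ∈ D.chart.source) : D.coordRep a (D.completionChart (Completion.core 𝓜 x)) =
      ringConj (D.chartFrame (Completion.core 𝓜 x)) (hatField 𝓜 a x) := by
  rw [coordRep, D.basePoint_coreChart hx, D.coreFrame_eq h hx,
    ringConj_mul_left (D.isUnit_chartFrame h (p := Completion.core 𝓜 x) hx) (isUnit_coreDeriv h x)]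
  rfl

lemma smoothEndAt_hatField_base (h : IsCollarStructure A) {a : X → E →L[ℝ] E}
    (ha : ∀ x, SmoothEndAt 𝓜 a x) {p : Completion 𝓜 X} (hp : C.height p < 0) :
    SmoothEndAt 𝓘(ℝ, E) (fun q => hatField 𝓜 a (Completion.base q)) p := by
  have hκ : chartAt H (Completion.base p) ∈ IsManifold.maximalAtlas 𝓜 ∞ X :=
    IsManifold.chart_mem_maximalAtlas _
  set κ := chartAt H (Completion.base p)
  set e := interiorChart κ C hκ
  have hs : p ∈ e.source := ⟨hp, mem_chart_source _ _⟩
  have hes := e.open_source.mem_nhds hs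
  have hmax := interiorChart_mem_maximalAtlas h hκ
  have he := contMDiffOn_of_mem_maximalAtlas hmax
  have hes' := contMDiffOn_symm_of_mem_maximalAtlas hmax
  have hcore : ∀ q ∈ e.source, q = Completion.core 𝓜 (Completion.base q) := by
    intro q hq
    have h1 := e.left_inv hq
    rw [← h1]
    rfl
  have hunit : ∀ q ∈ e.source, IsUnit (frame 𝓘(ℝ, E) e q) := by
    intro q hq
    have hn := e.open_source.mem_nhds hq
    refine isUnit_of_injective (md_leftInverse (he.contMDiffAt hn) (g := e.symm)
      (hes' _ (e.map_source hq)) ?_ ?_)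
    · filter_upwards [hn] with r hr using e.map_source hr
    · filter_upwards [hn] with r hr using e.left_inv hr
  rw [smoothEndAt_iff (he.contMDiffAt hes) (hunit p hs)]
  have hx : ContMDiffAt 𝓜 𝓘(ℝ, E) ∞ (κ.extend 𝓜) (Completion.base p) :=
    (κ.contMDiffOn_extend hκ).contMDiffAt (κ.open_source.mem_nhds (mem_chart_source _ _))
  have h1 := (smoothEndAt_iff (A := a) hx (isUnit_frame_extChartAt (mem_chart_source H _))).1 (ha _)
  have hb : ContMDiffAt 𝓘(ℝ, E) 𝓜 ∞ (Completion.base : Completion 𝓜 X → X) p := by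
    have h2 : ContMDiffOn 𝓘(ℝ, E) 𝓜 ∞ (fun q => (κ.extend 𝓜).symm (e q)) e.source :=
      (contMDiffOn_extend_symm_target hκ).comp he fun q hq => by
        have := e.map_source hq
        rw [κ.extend_target]
        exact ⟨this.1, interior_subset this.2⟩
    refine (h2.contMDiffAt hes).congr_of_eventuallyEq ?_
    filter_upwards [hes] with q hq
    exact (κ.extend_left_inv hq.2).symm
  refine (h1.comp p hb).congr_of_eventuallyEq ?_
  filter_upwards [hes] with q hq
  have h3 : frame 𝓜 (κ.extend 𝓜) (Completion.base q) =
      frame 𝓘(ℝ, E) e q * coreDeriv 𝓜 (Completion.base q) := by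
    have h4 : ContMDiffAt 𝓘(ℝ, E) 𝓘(ℝ, E) ∞ e (Completion.core 𝓜 (Completion.base q)) := by
      rw [← hcore q hq]
      exact he.contMDiffAt (e.open_source.mem_nhds hq)
    have h5 := frame_comp_core h h4
    rw [← hcore q hq] at h5
    exact h5
  rw [hatField, ← ringConj_mul_left (hunit q hq) (isUnit_coreDeriv h _), ← h3]
  rfl

end FieldExtension

/-! ### Extension of endomorphism fields subject to linear constraints -/

section ConstrainedExtension

universe u

variable {E : Type u} [NormedAddCommGroup E] [NormedSpace ℝ E] [FiniteDimensional ℝ E]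
  {H : Type*} [TopologicalSpace H]
  {𝓜 : ModelWithCorners ℝ E H} {X : Type*} [TopologicalSpace X] [ChartedSpace H X]
  [IsManifold 𝓜 ∞ X] [CompactSpace X] [T2Space X] {K : CollarData 𝓜 X}
  {F : Type*} [NormedAddCommGroup F] [NormedSpace ℝ F] [FiniteDimensional ℝ F]
  {G : Type*} [TopologicalSpace G]
  {𝓝' : ModelWithCorners ℝ F G} {N : Type*} [TopologicalSpace N] [ChartedSpace G N]
  [IsManifold 𝓝' ∞ N] [CompactSpace N] [T2Space N] {K' : CollarData 𝓝' N}
  {Z : Type*} [NormedAddCommGroup Z] [NormedSpace ℝ Z]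
  {j : N → X} {A : CollarAtlas K} {A' : CollarAtlas K'}
  [cs : ChartedSpace E (Completion 𝓜 X)] [IsManifold 𝓘(ℝ, E) ∞ (Completion 𝓜 X)]
  [cs' : ChartedSpace F (Completion 𝓝' N)] [IsManifold 𝓘(ℝ, F) ∞ (Completion 𝓝' N)]

namespace IsAdaptedCollar

variable (ha : IsAdaptedCollar Z j A A')

/-- The differential of the extension of `j`. -/
def mapDeriv (q : Completion 𝓝' N) : F →L[ℝ] E := md 𝓘(ℝ, F) 𝓘(ℝ, E) ha.map q

lemma chartFrame_mapDeriv (h : IsCollarStructure A) (h' : IsCollarStructure A')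
    (hm : ContMDiff 𝓘(ℝ, F) 𝓘(ℝ, E) ∞ ha.map) {D : EndChart K} {D' : EndChart K'}
    {e : (F × Z) ≃L[ℝ] E} (hD : IsAdaptedEnd j D D' e) {q : Completion 𝓝' N}
    (hq : j (Completion.base q) ∈ D.chart.source) (v : F) :
    D.chartFrame (ha.map q) (ha.mapDeriv q v) = e (D'.chartFrame q v, 0) := by
  have hq' := hD.source _ hq
  have h1 : D.completionChart ∘ ha.map =ᶠ[𝓝 q]
      ((e : (F × Z) →L[ℝ] E).comp (ContinuousLinearMap.inl ℝ F Z)) ∘ D'.completionChart := by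
    filter_upwards [D'.completionChart.open_source.mem_nhds hq'] with r hr
    exact ha.completionChart_map hD hr
  have h2 := md_congr (𝓜 := 𝓘(ℝ, F)) (𝓝' := 𝓘(ℝ, E)) h1
  rw [md_comp (hm q) (D.contMDiffAt h (by rwa [ha.base_map])),
    md_comp ((D'.contMDiffOn h').contMDiffAt (D'.completionChart.open_source.mem_nhds hq'))
      (ContinuousLinearMap.contMDiff _).contMDiffAt, md_clm] at h2
  exact congrArg (fun T : F →L[ℝ] E => T v) h2

/-- Extension of an endomorphism field from the core, subject to linear constraints along the
extension of the submanifold. -/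
theorem exists_field_extension (h : IsCollarStructure A) (h' : IsCollarStructure A')
    (hj : Continuous j) (hm : ContMDiff 𝓘(ℝ, F) 𝓘(ℝ, E) ∞ ha.map)
    {a : X → E →L[ℝ] E} (hsm : ∀ x, SmoothEndAt 𝓜 a x)
    (W : Completion 𝓝' N → Submodule ℝ E)
    (hW : ∀ x hx D' e, IsAdaptedEnd (Z := Z) (K' := K') j (A.D x hx) D' e → ∃ W' : Submodule ℝ E,
      ∀ q, j (Completion.base q) ∈ (A.D x hx).chart.source →
        ∀ v, v ∈ W q ↔ (A.D x hx).chartFrame (ha.map q) v ∈ W')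
    {U : Set X} (hU : IsOpen U) (hBU : 𝓜.boundary X ⊆ U)
    (hUW : ∀ y, j y ∈ U → ∀ v, hatField 𝓜 a (j y) (ha.mapDeriv (Completion.core 𝓝' y) v) ∈
      W (Completion.core 𝓝' y)) :
    ∃ a' : Completion 𝓜 X → E →L[ℝ] E, (∀ p, SmoothEndAt 𝓘(ℝ, E) a' p) ∧
      (∀ x, a' (Completion.core 𝓜 x) = hatField 𝓜 a x) ∧
      ∀ q, Completion.base q ∈ 𝓝'.boundary N → ∀ v, a' (ha.map q) (ha.mapDeriv q v) ∈ W q := by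
  have : T2Space (Completion 𝓜 X) := K.t2Space_completion
  have : SecondCountableTopology (Completion 𝓜 X) := K.secondCountable_completion
  have : LocallyCompactSpace (Completion 𝓜 X) :=
    Manifold.locallyCompact_of_finiteDimensional 𝓘(ℝ, E)
  -- Both conditions on `B` are affine, so local solutions can be patched by a partition of unity.
  let t : Completion 𝓜 X → Set (E →L[ℝ] E) := fun p => {B |
    (∀ x, p = Completion.core 𝓜 x → B = hatField 𝓜 a x) ∧
    ∀ q, ha.map q = p → Completion.base q ∈ 𝓝'.boundary N → ∀ v, B (ha.mapDeriv q v) ∈ W q}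
  have hconv : ∀ p, Convex ℝ (t p) := by
    rintro p B ⟨h1, h2⟩ B' ⟨h1', h2'⟩ c c' - - hcc
    refine ⟨fun x hx => ?_, fun q hq hq' v => ?_⟩
    · rw [h1 x hx, h1' x hx, ← add_smul, hcc, one_smul]
    · exact (W q).add_mem ((W q).smul_mem c (h2 q hq hq' v)) ((W q).smul_mem c' (h2' q hq hq' v))
  have Hloc : ∀ p₀ : Completion 𝓜 X, ∃ V ∈ 𝓝 p₀, ∃ s : Completion 𝓜 X → E →L[ℝ] E,
      (∀ p ∈ V, SmoothEndAt 𝓘(ℝ, E) s p) ∧ ∀ p ∈ V, s p ∈ t p := by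
    intro p₀
    obtain hp | hp := lt_trichotomy (K.height p₀) 0
    · -- the interior of the core
      refine ⟨{p | K.height p < 0}, (isOpen_lt K.continuous_height continuous_const).mem_nhds hp,
        fun p => hatField 𝓜 a (Completion.base p), fun p hp => smoothEndAt_hatField_base h hsm hp,
        fun p hp => ⟨?_, fun q hq hq' => ?_⟩⟩
      · rintro x rfl; rfl
      · subst hq
        rw [mem_ofPred_eq, ha.height_map] at hp
        exact absurd hq' (base_notMem_iff.2 hp)
    have hb₀ : Completion.base p₀ ∈ 𝓜.boundary X := by
      by_contra hcon
      have := base_notMem_iff (C := K).1 hcon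
      obtain hp | hp := hp <;> linarith
    obtain hp | hp := hp
    swap
    -- Beyond the core the zero field meets the constraints; invertibility plays no role before the
    -- correction, which takes place near the core only.
    · refine ⟨{p | 0 < K.height p}, (isOpen_lt continuous_const K.continuous_height).mem_nhds hp,
        0, fun p hp => ?_, fun p hp => ⟨?_, fun q hq hq' v => (W q).zero_mem⟩⟩
      · rw [smoothEndAt_iff_extChartAt]
        simpa [ringConj] using! contMDiffAt_const
      · rintro x rfl
        rw [mem_ofPred_eq, K.height_core] at hp
        exact absurd hp (not_lt.2 (K.nonpos x))
    -- the boundary of the core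
    set x := Completion.base p₀ with hx
    have hp₀ : p₀ = Completion.core 𝓜 x := by
      rw [← K.point_base_height p₀]
      exact K.point_core (by rw [K.ρ_base, hp, min_self])
    set D := A.D x hb₀ with hD
    have hs₀ : p₀ ∈ D.completionChart.source := A.mem x hb₀
    set Φ := D.completionChart with hΦ
    have ht₀ : Φ p₀ ∈ Φ.target := Φ.map_source hs₀
    -- a neighborhood in which the constraints are linear
    obtain ⟨O, hO, hOt, W', hOW⟩ : ∃ O ∈ 𝓝 (Φ p₀), O ⊆ Φ.target ∧ ∃ W' : Submodule ℝ E,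
        ∀ q, Φ (ha.map q) ∈ O → j (Completion.base q) ∈ D.chart.source →
          (∀ v, v ∈ W q ↔ D.chartFrame (ha.map q) v ∈ W') ∧
          ∀ v, ∀ s : ℝ, Φ (ha.map q) + s • D.ν ∈ O → 0 ≤ D.ℓ (Φ (ha.map q) + s • D.ν) →
            D.coordRep a (Φ (ha.map q) + s • D.ν) (D.chartFrame (ha.map q) (ha.mapDeriv q v)) ∈ W' := by
      by_cases hxr : x ∈ range j
      · obtain ⟨y, hy⟩ := hxr
        obtain h0 | ⟨D', e, hadp⟩ := ha.adapted x hb₀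
        · exact absurd (by rw [hy]; exact A.mem x hb₀) (h0 y)
        obtain ⟨W', hW'⟩ := hW x hb₀ D' e hadp
        have hD's : ∀ y, j y ∈ D.chart.source → y ∈ D'.chart.source := hadp.source
        have hyD : j y ∈ D.chart.source := by rw [hy]; exact A.mem x hb₀
        set Φ' := D'.completionChart with hΦ'
        have hc : Continuous fun q : Completion 𝓝' N => j (Completion.base q) :=
          hj.comp Completion.continuous_base
        let S : Set F := Φ'.target ∩ Φ'.symm ⁻¹' ((fun q => j (Completion.base q)) ⁻¹' (D.chart.source ∩ U))
        have hS : IsOpen S := Φ'.isOpen_inter_preimage_symm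
          ((D.chart.open_source.inter hU).preimage hc)
        have hp₀' : p₀ = ha.map (Completion.core 𝓝' y) := by rw [hp₀, ← hy]; rfl
        have hΦp : Φ p₀ = e (Φ' (Completion.core 𝓝' y), 0) := by
          rw [hp₀']
          exact ha.completionChart_map hadp (hD's y hyD)
        have hys : Completion.core 𝓝' y ∈ Φ'.source := hD's y hyD
        have hcont : Continuous fun u : E => (e.symm u).1 := by fun_prop
        refine ⟨Φ.target ∩ (fun u : E => (e.symm u).1) ⁻¹' S,
          (Φ.open_target.inter (hS.preimage hcont)).mem_nhds ⟨ht₀, ?_⟩, inter_subset_left, W', ?_⟩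
        · rw [mem_preimage, hΦp, e.symm_apply_apply]
          refine ⟨Φ'.map_source hys, ?_⟩
          rw [mem_preimage, Φ'.left_inv hys]
          exact ⟨hyD, hBU (by change j y ∈ _; rw [hy]; exact hb₀)⟩
        · intro q hq hq1
          refine ⟨hW' q hq1, fun v s hs hsℓ => ?_⟩
          have hq' := hD's _ hq1
          have e1 : Φ (ha.map q) + s • D.ν = e (Φ' q + s • D'.ν, 0) := by
            rw [ha.completionChart_map hadp hq', ← hadp.ν, ← map_smul, ← map_add]
            exact congrArg e (Prod.ext rfl (by simp))
          rw [e1] at hs hsℓ ⊢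
          set u' := Φ' q + s • D'.ν
          have hu' : u' ∈ S := by simpa using hs.2
          have hℓ' : 0 ≤ D'.ℓ u' := by rwa [hadp.ℓ] at hsℓ
          have e2 := D'.symm_eq_core hu'.1 hℓ'
          set y' := D'.basePoint u'
          have hy' : j y' ∈ D.chart.source ∩ U := by
            have := hu'.2
            rw [mem_preimage, e2] at this
            exact this
          have e3 : Φ' (Completion.core 𝓝' y') = u' := by
            rw [← e2]; exact Φ'.right_inv hu'.1
          have e4 : e (u', 0) = Φ (Completion.core 𝓜 (j y')) := by
            rw [← e3]
            exact (ha.completionChart_map hadp (q := Completion.core 𝓝' y') (hD's y' hy'.1)).symm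
          rw [e4, D.coordRep_core h a hy'.1, ha.chartFrame_mapDeriv h h' hm hadp hq1]
          -- The coordinate vector stays fixed while the point moves along the ray. At the core
          -- point `j y'` it represents a tangent vector of the submanifold, to which the hypothesis
          -- on the core applies.
          obtain ⟨w, hw⟩ := (bijective_of_isUnit (D'.isUnit_chartFrame h'
            (p := Completion.core 𝓝' y') (hD's y' hy'.1))).2 (D'.chartFrame q v)
          rw [← hw, ← ha.chartFrame_mapDeriv h h' hm hadp (q := Completion.core 𝓝' y') hy'.1]
          have e5 := ringConj_mul_self (D.isUnit_chartFrame h (p := Completion.core 𝓜 (j y')) hy'.1)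
            (hatField 𝓜 a (j y'))
          have e6 := congrArg (fun T : E →L[ℝ] E => T (ha.mapDeriv (Completion.core 𝓝' y') w)) e5
          refine mem_of_eq_of_mem e6 ?_
          exact (hW' (Completion.core 𝓝' y') hy'.1 _).1 (hUW y' hy'.2 w)
      · have hcl : IsClosed (range j) := (isCompact_range hj).isClosed
        refine ⟨Φ.target ∩ Φ.symm ⁻¹' (Completion.base ⁻¹' (range j)ᶜ),
          (Φ.isOpen_inter_preimage_symm (hcl.isOpen_compl.preimage
            Completion.continuous_base)).mem_nhds ⟨ht₀, ?_⟩, inter_subset_left, ⊥, ?_⟩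
        · rw [mem_preimage, Φ.left_inv hs₀]
          exact hxr
        · intro q hq hq1
          have h2 := hq.2
          rw [mem_preimage, Φ.left_inv (show ha.map q ∈ Φ.source by
            rw [hΦ, D.mem_completionChart_source, ha.base_map]; exact hq1), mem_preimage,
            ha.base_map] at h2
          exact absurd (mem_range_self _) h2
    obtain ⟨R, hR, hRO⟩ := Metric.mem_nhds_iff.1 hO
    have hf : ContDiffOn ℝ ∞ (D.coordRep a) (Metric.ball (Φ p₀) R ∩ {u | 0 ≤ D.ℓ u}) :=
      (D.contDiffOn_coordRep hsm).mono fun u hu => ⟨hOt (hRO hu.1), hu.2⟩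
    obtain ⟨g, hg, hg1, hg2⟩ := exists_contDiff_extension D.ℓ_ν hR hf
    refine ⟨Φ.source ∩ Φ ⁻¹' Metric.ball (Φ p₀) (R / 2),
      (Φ.isOpen_inter_preimage Metric.isOpen_ball).mem_nhds ⟨hs₀, Metric.mem_ball_self (by positivity)⟩,
      fun p => ringConj (D.chartFrame p)⁻¹ʳ (g (Φ p)), fun p hp => ?_, fun p hp => ⟨?_, ?_⟩⟩
    · rw [smoothEndAt_iff (D.contMDiffAt h hp.1) (D.isUnit_chartFrame h hp.1)]
      refine (hg.contMDiff.contMDiffAt.comp p (D.contMDiffAt h hp.1)).congr_of_eventuallyEq ?_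
      filter_upwards [Φ.open_source.mem_nhds hp.1] with r hr
      have hu := D.isUnit_chartFrame h hr
      change ringConj (D.chartFrame r) _ = _
      rw [← ringConj_mul_left hu hu.ringInverse, Ring.mul_inverse_cancel _ hu]
      simp [ringConj, hΦ]
    · rintro y rfl
      have hy : y ∈ D.chart.source := hp.1
      have hu := D.isUnit_chartFrame h hp.1
      change ringConj _ (g _) = _
      rw [hg1 _ hp.2 (D.coreChart_mem hy).2, D.coordRep_core h a hy,
        ← ringConj_mul_left hu.ringInverse hu, Ring.inverse_mul_cancel _ hu]
      simp [ringConj]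
    · rintro q rfl hq v
      have hu := D.isUnit_chartFrame h hp.1
      have hq1 : j (Completion.base q) ∈ D.chart.source := by
        rw [← ha.base_map]; exact hp.1
      have hball : Φ (ha.map q) ∈ Metric.ball (Φ p₀) R :=
        Metric.ball_subset_ball (by linarith) hp.2
      obtain ⟨hq2, hq3⟩ := hOW q (hRO hball) hq1
      rw [hq2]
      have e1 : D.chartFrame (ha.map q) (ringConj (D.chartFrame (ha.map q))⁻¹ʳ (g (Φ (ha.map q)))
          (ha.mapDeriv q v)) = g (Φ (ha.map q)) (D.chartFrame (ha.map q) (ha.mapDeriv q v)) := by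
        rw [TransportData.ringConj_inverse_apply hu]
        have := Ring.mul_inverse_cancel _ hu
        exact congrArg (fun T : E →L[ℝ] E => T (g (Φ (ha.map q)) (D.chartFrame (ha.map q) (ha.mapDeriv q v)))) this
      rw [e1]
      -- A vector outside `W'` is detected by a functional that vanishes on `W'`. Composed with
      -- evaluation at the fixed tangent vector it is a linear constraint on the field along the
      -- ray, and the extension preserves such constraints.
      by_contra hcon
      obtain ⟨φ, hφ1, hφ2⟩ := Submodule.exists_le_ker_of_notMem hcon
      let φ' : E →L[ℝ] ℝ := φ.toContinuousLinearMap
      refine hφ1 (hg2 (φ'.comp (ContinuousLinearMap.apply ℝ E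
        (D.chartFrame (ha.map q) (ha.mapDeriv q v)))) _ fun s hs hsb => ?_)
      exact hφ2 (hq3 v s (hRO hsb) hs)
  obtain ⟨s, hs⟩ := exists_contMDiffSection_forall_mem_convex_of_local (n := (⊤ : ℕ∞)) 𝓘(ℝ, E)
    (F_fiber := E →L[ℝ] E)
    (fun p : Completion 𝓜 X => TangentSpace 𝓘(ℝ, E) p →L[ℝ] TangentSpace 𝓘(ℝ, E) p) t hconv
    (by
      intro p₀
      obtain ⟨V, hV, s, h1, h2⟩ := Hloc p₀
      exact ⟨V, hV, s, fun p hp => (h1 p hp).contMDiffWithinAt, h2⟩)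
  exact ⟨fun p => s p, fun p => s.contMDiff p, fun x => (hs _).1 x rfl, fun q hq => (hs _).2 q rfl hq⟩

end IsAdaptedCollar

end ConstrainedExtension

/-! ### Stretching in the direction of a vector -/

section Stretch

variable {V : Type*} [NormedAddCommGroup V] [NormedSpace ℝ V]

/-- The linear map which multiplies `eta` by `c` and is the identity on the kernel of `lam`, if
`lam eta = 1`. -/
def stretch (lam : V →L[ℝ] ℝ) (eta : V) (c : ℝ) : V →L[ℝ] V := 1 + (c - 1) • lam.smulRight eta

variable {lam : V →L[ℝ] ℝ} {eta : V}

lemma stretch_apply (lam : V →L[ℝ] ℝ) (eta : V) (c : ℝ) (v : V) :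
    stretch lam eta c v = v + ((c - 1) * lam v) • eta := by
  simp [stretch, mul_smul]

lemma stretch_one (lam : V →L[ℝ] ℝ) (eta : V) : stretch lam eta 1 = 1 := by simp [stretch]

lemma stretch_mul (h : lam eta = 1) (c d : ℝ) :
    stretch lam eta c * stretch lam eta d = stretch lam eta (c * d) := by
  ext v
  change stretch lam eta c (stretch lam eta d v) = _
  simp only [stretch_apply, map_add, map_smul, h]
  module

lemma isUnit_stretch (h : lam eta = 1) {c : ℝ} (hc : c ≠ 0) : IsUnit (stretch lam eta c) :=
  ⟨⟨stretch lam eta c, stretch lam eta c⁻¹, by rw [stretch_mul h, mul_inv_cancel₀ hc, stretch_one],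
    by rw [stretch_mul h, inv_mul_cancel₀ hc, stretch_one]⟩, rfl⟩

lemma ringInverse_stretch (h : lam eta = 1) {c : ℝ} (hc : c ≠ 0) :
    (stretch lam eta c)⁻¹ʳ = stretch lam eta c⁻¹ := by
  have h1 := Ring.inverse_mul_cancel _ (isUnit_stretch h hc)
  calc (stretch lam eta c)⁻¹ʳ = (stretch lam eta c)⁻¹ʳ * (stretch lam eta c * stretch lam eta c⁻¹) := by
        rw [stretch_mul h, mul_inv_cancel₀ hc, stretch_one, mul_one]
    _ = _ := by rw [← mul_assoc, h1, one_mul]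

lemma lam_stretch (h : lam eta = 1) (c : ℝ) (v : V) : lam (stretch lam eta c v) = c * lam v := by
  rw [stretch_apply, map_add, map_smul, h, smul_eq_mul]; ring

lemma stretch_mem {W : Submodule ℝ V} (h : eta ∈ W) (c : ℝ) {v : V} (hv : v ∈ W) :
    stretch lam eta c v ∈ W := by
  rw [stretch_apply]
  exact W.add_mem hv (W.smul_mem _ h)

lemma exists_equiv_of_isUnit {B : V →L[ℝ] V} (h : IsUnit B) :
    ∃ e : V ≃L[ℝ] V, (e : V →L[ℝ] V) = B := by
  obtain ⟨u, rfl⟩ := h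
  exact ⟨ContinuousLinearEquiv.unitsEquiv ℝ V u, rfl⟩

lemma conjContinuousAlgEquiv_eq_ringConj (e : V ≃L[ℝ] V) (B : V →L[ℝ] V) :
    e.conjContinuousAlgEquiv B = ringConj (e : V →L[ℝ] V) B := by
  have h1 : (e : V →L[ℝ] V)⁻¹ʳ = (e.symm : V →L[ℝ] V) :=
    Ring.inverse_unit (ContinuousLinearEquiv.toUnit e)
  rw [ringConj, h1]
  ext v
  simp

lemma conj_stretch (e : V ≃L[ℝ] V) (lam : V →L[ℝ] ℝ) (eta : V) (c : ℝ) :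
    e.conjContinuousAlgEquiv (stretch lam eta c) =
      stretch (lam.comp (e.symm : V →L[ℝ] V)) (e eta) c := by
  ext v
  simp [stretch_apply]

namespace TransportData

variable (T : TransportData V) (b : Prop)

/-- The corrected first complex structure. -/
def outI : V →L[ℝ] V := ringConj (T.total b) T.I0

/-- The corrected second complex structure. -/
def outJ : V →L[ℝ] V := ringConj (T.total b) T.J0

/-- The corrected third complex structure. -/
def outK : V →L[ℝ] V := ringConj (T.total b) T.K0

lemma out_map (e : V ≃L[ℝ] V) : (T.map e).outI b = e.conjContinuousAlgEquiv (T.outI b) ∧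
    (T.map e).outJ b = e.conjContinuousAlgEquiv (T.outJ b) ∧
    (T.map e).outK b = e.conjContinuousAlgEquiv (T.outK b) := by
  refine ⟨?_, ?_, ?_⟩ <;>
    simp only [outI, outJ, outK, map_ringConj, total_map, map_I0, map_J0, map_K0]

variable {T b}

lemma IsGood.isQuatTriple_out (h : T.IsGood b) (hq : IsQuatTriple T.I0 T.J0 T.K0) :
    IsQuatTriple (T.outI b) (T.outJ b) (T.outK b) := isQuatTriple_total hq h

lemma SmoothAt.contDiffAt_out {E : Type*} [NormedAddCommGroup E] [NormedSpace ℝ E]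
    [CompleteSpace V] {T : E → TransportData V} {u : E} (h : SmoothAt T u) (hg : (T u).IsGood b)
    (hlam : (T u).lam (T u).eta ≠ 0) :
    ContDiffAt ℝ ∞ (fun v => (T v).outI b) u ∧ ContDiffAt ℝ ∞ (fun v => (T v).outJ b) u ∧
      ContDiffAt ℝ ∞ (fun v => (T v).outK b) u := by
  have h1 := (h.total_and_eventually hg hlam).1
  exact ⟨contDiffAt_ringConj h1 h.I0 hg.isUnit_total, contDiffAt_ringConj h1 h.J0 hg.isUnit_total,
    contDiffAt_ringConj h1 h.K0 hg.isUnit_total⟩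

end TransportData

end Stretch

/-! ### Sliding along the conical end -/

section Slide

variable {V : Type*} [NormedAddCommGroup V] [NormedSpace ℝ V]

/-- The change of variables `t ↦ θ t` along the ray spanned by `-ν`, with `t = -ℓ u`. -/
def slide (ℓ : V →L[ℝ] ℝ) (ν : V) (θ : ℝ → ℝ) (u : V) : V := u + (-ℓ u - θ (-ℓ u)) • ν

variable {ℓ : V →L[ℝ] ℝ} {ν : V} {θ : ℝ → ℝ}

lemma ℓ_slide (h : ℓ ν = 1) (u : V) : -ℓ (slide ℓ ν θ u) = θ (-ℓ u) := by
  rw [slide, map_add, map_smul, h]; simp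

lemma contDiff_slide (hθ : ContDiff ℝ ∞ θ) : ContDiff ℝ ∞ (slide ℓ ν θ) :=
  contDiff_id.add ((ℓ.contDiff.neg.sub (hθ.comp ℓ.contDiff.neg)).smul contDiff_const)

lemma fderiv_slide (hθ : ContDiff ℝ ∞ θ) (u : V) :
    fderiv ℝ (slide ℓ ν θ) u = stretch (-ℓ) (-ν) (deriv θ (-ℓ u)) := by
  have h1 : HasFDerivAt (fun u : V => -ℓ u) (-ℓ) u := (-ℓ).hasFDerivAt
  have h2 : HasFDerivAt (fun u : V => θ (-ℓ u)) (deriv θ (-ℓ u) • -ℓ) u :=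
    ((hθ.differentiable (by simp) (-ℓ u)).hasDerivAt).comp_hasFDerivAt u h1
  have h3 : HasFDerivAt (slide ℓ ν θ) _ u := (hasFDerivAt_id u).add ((h1.sub h2).smul_const ν)
  rw [h3.fderiv]
  ext v
  simp [stretch_apply]
  module

lemma deriv_eq_one_of_nonpos (hθ : ContDiff ℝ ∞ θ) (h : ∀ t ≤ 0, θ t = t) {t : ℝ} (ht : t ≤ 0) :
    deriv θ t = 1 := by
  have h1 : HasDerivWithinAt θ (deriv θ t) (Iic 0) t :=
    (hθ.differentiable (by simp) t).hasDerivAt.hasDerivWithinAt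
  have h2 : HasDerivWithinAt θ 1 (Iic 0) t :=
    (hasDerivWithinAt_id t _).congr h (h t ht)
  exact ((uniqueDiffOn_Iic (0 : ℝ)) t ht).eq_deriv _ h1 h2

lemma slide_of_nonneg (h : ∀ t ≤ 0, θ t = t) {u : V} (hu : 0 ≤ ℓ u) : slide ℓ ν θ u = u := by
  rw [slide, h _ (by linarith), sub_self, zero_smul, add_zero]

end Slide

/-! ### Approximate almost quaternionic structures on the completion -/

section Endomorphisms

variable {E : Type*} [NormedAddCommGroup E] [NormedSpace ℝ E]
  {H : Type*} [TopologicalSpace H]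
  {𝓜 : ModelWithCorners ℝ E H} {X : Type*} [TopologicalSpace X] [ChartedSpace H X]
  [IsManifold 𝓜 ∞ X]

/-- A field of endomorphisms of the tangent spaces, as a map to the endomorphisms of the model
space. -/
def endField (a : ∀ x : X, TangentSpace 𝓜 x →L[ℝ] TangentSpace 𝓜 x) : X → E →L[ℝ] E := a

lemma AlmostQuaternionic.isQuatTriple (Q : AlmostQuaternionic 𝓜 X) (x : X) :
    IsQuatTriple (endField Q.I x) (endField Q.J x) (endField Q.K x) where
  I_sq := by ext v; exact Q.I_sq x v
  J_sq := by ext v; exact Q.J_sq x v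
  K_sq := by ext v; exact Q.K_sq x v
  I_J := by ext v; exact Q.I_J x v

end Endomorphisms

section Approximate

universe u

variable {E : Type u} [NormedAddCommGroup E] [NormedSpace ℝ E] [FiniteDimensional ℝ E]
  {H : Type*} [TopologicalSpace H]
  {𝓜 : ModelWithCorners ℝ E H} {X : Type*} [TopologicalSpace X] [ChartedSpace H X]
  [IsManifold 𝓜 ∞ X] [CompactSpace X] [T2Space X] {C : CollarData 𝓜 X}
  [cs : ChartedSpace E (Completion 𝓜 X)] [IsManifold 𝓘(ℝ, E) ∞ (Completion 𝓜 X)]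

variable (𝓜) in
/-- Smooth endomorphism fields on the completion which restrict to an almost quaternionic structure
on the core. -/
structure ApproxStructure (Q : AlmostQuaternionic 𝓜 X) where
  It : Completion 𝓜 X → E →L[ℝ] E
  Jt : Completion 𝓜 X → E →L[ℝ] E
  Kt : Completion 𝓜 X → E →L[ℝ] E
  smooth_It : ∀ p, SmoothEndAt 𝓘(ℝ, E) It p
  smooth_Jt : ∀ p, SmoothEndAt 𝓘(ℝ, E) Jt p
  smooth_Kt : ∀ p, SmoothEndAt 𝓘(ℝ, E) Kt p
  It_core : ∀ x, It (Completion.core 𝓜 x) = hatField 𝓜 (endField Q.I) x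
  Jt_core : ∀ x, Jt (Completion.core 𝓜 x) = hatField 𝓜 (endField Q.J) x
  Kt_core : ∀ x, Kt (Completion.core 𝓜 x) = hatField 𝓜 (endField Q.K) x

lemma isQuatTriple_hatField {A : CollarAtlas C} (h : IsCollarStructure A)
    (Q : AlmostQuaternionic 𝓜 X) (x : X) :
    IsQuatTriple (hatField 𝓜 (endField Q.I) x) (hatField 𝓜 (endField Q.J) x)
      (hatField 𝓜 (endField Q.K) x) := (Q.isQuatTriple x).ringConj (isUnit_coreDeriv h x)

namespace EndChart

variable (D : EndChart C)

lemma flat_mem_target {u : E} (hu : u ∈ D.completionChart.target) :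
    D.flat u ∈ D.completionChart.target ∩ {u | 0 ≤ D.ℓ u} := by
  have h1 := D.ext_π_basePoint hu
  have h2 := D.π_source _ (D.basePoint_mem hu)
  have h3 := D.π_boundary _ (D.basePoint_mem hu)
  have h4 : D.completionChart (Completion.core 𝓜 (C.π (D.basePoint u))) = D.flat u := by
    rw [D.completionChart_apply, C.height_core, (C.zero_iff _).1 h3, Completion.base_core,
      C.π_boundary _ h3, h1]
    simp
  rw [← h4]
  exact D.coreChart_mem h2

lemma flat_completionChart {p : Completion 𝓜 X} (hp : Completion.base p ∈ 𝓜.boundary X)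
    (hs : Completion.base p ∈ D.chart.source) :
    D.flat (D.completionChart p) = D.completionChart (Completion.core 𝓜 (Completion.base p)) := by
  rw [flat, D.ℓ_completionChart hs, D.completionChart_apply, D.completionChart_apply, C.height_core,
    Completion.base_core, (C.zero_iff _).1 hp]
  module

end EndChart

namespace ApproxStructure

variable {Q : AlmostQuaternionic 𝓜 X} (S : ApproxStructure 𝓜 Q)

/-- The transport data at a point of the conical end, in the coordinates given by `D`. -/
def data (D : EndChart C) (p : Completion 𝓜 X) : TransportData E where
  It  := S.It p
  Jt  := S.Jt p
  Kt  := S.Kt p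
  I0  := hatField 𝓜 (endField Q.I) (Completion.base p)
  J0  := hatField 𝓜 (endField Q.J) (Completion.base p)
  K0  := hatField 𝓜 (endField Q.K) (Completion.base p)
  lam := -D.ℓ
  eta := -D.ν

/-- The coordinate expression of the transport data. -/
def chartData (D : EndChart C) (u : E) : TransportData E where
  It  := ringConj (D.chartFrame (D.completionChart.symm u)) (S.It (D.completionChart.symm u))
  Jt  := ringConj (D.chartFrame (D.completionChart.symm u)) (S.Jt (D.completionChart.symm u))
  Kt  := ringConj (D.chartFrame (D.completionChart.symm u)) (S.Kt (D.completionChart.symm u))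
  I0  := D.coordRep (endField Q.I) (D.flat u)
  J0  := D.coordRep (endField Q.J) (D.flat u)
  K0  := D.coordRep (endField Q.K) (D.flat u)
  lam := -D.ℓ
  eta := -D.ν

lemma lam_eta_chartData (D : EndChart C) (u : E) :
    (S.chartData D u).lam (S.chartData D u).eta = 1 := by
  simp [chartData, D.ℓ_ν]

lemma isQuatTriple_chartData (D : EndChart C) {u : E} (hu : u ∈ D.completionChart.target) :
    IsQuatTriple (S.chartData D u).I0 (S.chartData D u).J0 (S.chartData D u).K0 :=
  (Q.isQuatTriple _).ringConj (D.isUnit_coreFrame (D.basePoint_mem (D.flat_mem_target hu).1))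

variable {A : CollarAtlas C} (h : IsCollarStructure A)

lemma smoothAt_chartData (h : IsCollarStructure A) (D : EndChart C) {u : E}
    (hu : u ∈ D.completionChart.target) : TransportData.SmoothAt (S.chartData D) u := by
  have hmem := D.completionChart.open_target.mem_nhds hu
  have key : ∀ a : Completion 𝓜 X → E →L[ℝ] E, (∀ p, SmoothEndAt 𝓘(ℝ, E) a p) →
      ContDiffAt ℝ ∞ (fun u => ringConj (D.chartFrame (D.completionChart.symm u))
        (a (D.completionChart.symm u))) u := by
    intro a ha
    have hp := D.completionChart.map_target hu
    have h1 := (smoothEndAt_iff (D.contMDiffAt h hp) (D.isUnit_chartFrame h hp)).1 (ha _)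
    exact (h1.comp u ((D.contMDiffOn_symm h).contMDiffAt hmem)).contDiffAt
  have key' : ∀ a : X → E →L[ℝ] E, (∀ p, SmoothEndAt 𝓜 a p) →
      ContDiffAt ℝ ∞ (fun u => D.coordRep a (D.flat u)) u := by
    intro a ha
    exact ((D.contDiffOn_coordRep ha).comp D.contDiff_flat.contDiffOn
      fun v hv => D.flat_mem_target hv).contDiffAt hmem
  exact ⟨key _ S.smooth_It, key _ S.smooth_Jt, key _ S.smooth_Kt, key' _ Q.smooth_I,
    key' _ Q.smooth_J, key' _ Q.smooth_K, contDiffAt_const, contDiffAt_const⟩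

/-- Naturality of the transport data. -/
lemma exists_chartData_eq_map (h : IsCollarStructure A) (D : EndChart C) {p : Completion 𝓜 X}
    (hp : Completion.base p ∈ 𝓜.boundary X) (hs : Completion.base p ∈ D.chart.source) :
    ∃ e : E ≃L[ℝ] E, (e : E →L[ℝ] E) = D.chartFrame p ∧
      S.chartData D (D.completionChart p) = (S.data (A.D _ hp) p).map e := by
  obtain ⟨e, he⟩ := exists_equiv_of_isUnit (D.isUnit_chartFrame h hs)
  refine ⟨e, he, ?_⟩
  have h0 : ∀ a : X → E →L[ℝ] E, D.coordRep a (D.flat (D.completionChart p)) =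
      e.conjContinuousAlgEquiv (hatField 𝓜 a (Completion.base p)) := by
    intro a
    rw [D.flat_completionChart hp hs, D.coordRep_core h a hs, conjContinuousAlgEquiv_eq_ringConj, he,
      D.chartFrame_eq_of_base_eq h hp hs (p' := Completion.core 𝓜 (Completion.base p)) rfl]
  have h1 : D.completionChart.symm (D.completionChart p) = p := D.completionChart.left_inv hs
  -- In each end chart, `-ℓ` represents the differential of the height, so it transforms as a
  -- covector.
  have h2 : -D.ℓ = (-(A.D _ hp).ℓ).comp (e.symm : E →L[ℝ] E) := by
    ext v
    obtain ⟨w, rfl⟩ := e.surjective v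
    have h3 : e w = D.chartFrame p w := by rw [← he]; rfl
    have h4 := (A.D _ hp).ℓ_chartFrame h (A.mem _ hp) w
    rw [chartFrame_eq_one h hp] at h4
    have h5 : (A.D _ hp).ℓ w = _ := h4
    change -(D.ℓ (e w)) = -((A.D _ hp).ℓ (e.symm (e w)))
    rw [e.symm_apply_apply, h3, D.ℓ_chartFrame h hs, h5]
  have h3 : -D.ν = e (-(A.D _ hp).ν) := by
    have h4 := D.chartFrame_ν h hp hs
    rw [← he] at h4
    rw [map_neg, ← h4]; rfl
  simp only [chartData, TransportData.map, data, h1, h0, h2, h3, conjContinuousAlgEquiv_eq_ringConj,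
    he]

lemma isGood_data_iff (h : IsCollarStructure A) (D : EndChart C) {p : Completion 𝓜 X}
    (hp : Completion.base p ∈ 𝓜.boundary X) (hs : Completion.base p ∈ D.chart.source) {b : Prop} :
    (S.chartData D (D.completionChart p)).IsGood b ↔ (S.data (A.D _ hp) p).IsGood b := by
  obtain ⟨e, -, he⟩ := S.exists_chartData_eq_map h D hp hs
  rw [he, TransportData.isGood_map]

/-- On the core, the corrected structure is the given one. -/
lemma out_chartData_core (h : IsCollarStructure A) (D : EndChart C) {b : Prop} {x : X}
    (hx : x ∈ D.chart.source)
    (hg : (S.chartData D (D.completionChart (Completion.core 𝓜 x))).IsGood b) :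
    (S.chartData D (D.completionChart (Completion.core 𝓜 x))).outI b =
      ringConj (D.chartFrame (Completion.core 𝓜 x)) (hatField 𝓜 (endField Q.I) x) ∧
    (S.chartData D (D.completionChart (Completion.core 𝓜 x))).outJ b =
      ringConj (D.chartFrame (Completion.core 𝓜 x)) (hatField 𝓜 (endField Q.J) x) ∧
    (S.chartData D (D.completionChart (Completion.core 𝓜 x))).outK b =
      ringConj (D.chartFrame (Completion.core 𝓜 x)) (hatField 𝓜 (endField Q.K) x) := by
  have hq := S.isQuatTriple_chartData D (D.coreChart_mem hx).1
  have h1 : D.completionChart.symm (D.completionChart (Completion.core 𝓜 x)) =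
    Completion.core 𝓜 x := D.completionChart.left_inv hx
  have e1 : (S.chartData D (D.completionChart (Completion.core 𝓜 x))).It =
      ringConj (D.chartFrame (Completion.core 𝓜 x)) (hatField 𝓜 (endField Q.I) x) := by
    rw [← S.It_core]; simp only [chartData, h1]
  have e2 : (S.chartData D (D.completionChart (Completion.core 𝓜 x))).Jt =
      ringConj (D.chartFrame (Completion.core 𝓜 x)) (hatField 𝓜 (endField Q.J) x) := by
    rw [← S.Jt_core]; simp only [chartData, h1]
  have e3 : (S.chartData D (D.completionChart (Completion.core 𝓜 x))).Kt =
      ringConj (D.chartFrame (Completion.core 𝓜 x)) (hatField 𝓜 (endField Q.K) x) := by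
    rw [← S.Kt_core]; simp only [chartData, h1]
  rw [← e1, ← e2, ← e3]
  refine TransportData.ringConj_total_of_isQuatTriple hq hg ?_
  rw [e1, e2, e3]
  exact (isQuatTriple_hatField h Q x).ringConj (D.isUnit_chartFrame h hx)

lemma isGood_chartData_core (h : IsCollarStructure A) (D : EndChart C) {b : Prop} {x : X}
    (hx : x ∈ D.chart.source) (hxb : x ∈ 𝓜.boundary X) :
    (S.chartData D (D.completionChart (Completion.core 𝓜 x))).IsGood b := by
  rw [S.isGood_data_iff h D (p := Completion.core 𝓜 x) hxb hx]
  exact TransportData.isGood_of_eq (isQuatTriple_hatField h Q x) (S.It_core x) (S.Jt_core x)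
    (S.Kt_core x)

/-- The coordinate expression of the corrected structure is good and convex at a point. -/
def IsConvexPoint (b : Prop) (D : EndChart C) (u : E) : Prop :=
  (S.chartData D u).IsGood b ∧ VectorConvexAt (fun v => (S.chartData D v).outI b)
    (fun v => (S.chartData D v).outJ b) (fun v => (S.chartData D v).outK b) (-D.ℓ : E →L[ℝ] ℝ) u

lemma IsConvexPoint.eventually (h : IsCollarStructure A) {b : Prop} {D : EndChart C} {u : E}
    (hu : u ∈ D.completionChart.target) (hc : S.IsConvexPoint b D u) :
    ∀ᶠ v in 𝓝 u, S.IsConvexPoint b D v := by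
  have hs := S.smoothAt_chartData h D hu
  have hlam : (S.chartData D u).lam (S.chartData D u).eta ≠ 0 := by
    rw [S.lam_eta_chartData]; exact one_ne_zero
  obtain ⟨s1, s2, s3⟩ := hs.contDiffAt_out hc.1 hlam
  have hg := (hs.total_and_eventually hc.1 hlam).2
  refine hg.and (VectorConvexAt.eventually s1 s2 s3 (-D.ℓ).contDiff.contDiffAt ?_ hc.2)
  filter_upwards [hg, D.completionChart.open_target.mem_nhds hu] with v h1 h2
  exact h1.isQuatTriple_out (S.isQuatTriple_chartData D h2)

/-- On the core the corrected structure is `Q` in coordinates and `-ℓ` is `ρ`. Naturality of the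
Levi form for the map `X → E` then turns the one-sided convexity at a boundary point into convexity
on an open set of the model space. -/
lemma isConvexPoint_core (h : IsCollarStructure A) (b : Prop) (D : EndChart C) {x : X}
    (hx : x ∈ D.chart.source) (hxb : x ∈ 𝓜.boundary X) (hc : Q.IsConvexAt C.ρ x) :
    S.IsConvexPoint b D (D.completionChart (Completion.core 𝓜 x)) := by
  have hg := S.isGood_chartData_core h D (b := b) hx hxb
  have hu := (D.coreChart_mem hx).1
  have hs := S.smoothAt_chartData h D hu
  have hlam : (S.chartData D (D.completionChart (Completion.core 𝓜 x))).lam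
      (S.chartData D (D.completionChart (Completion.core 𝓜 x))).eta ≠ 0 := by
    rw [S.lam_eta_chartData]; exact one_ne_zero
  obtain ⟨s1, s2, s3⟩ := hs.contDiffAt_out hg hlam
  have hf := D.contMDiffAt_coreChart hx
  have hev : ∀ᶠ y in 𝓝 x, (S.chartData D (D.completionChart (Completion.core 𝓜 y))).IsGood b ∧
      y ∈ D.chart.source :=
    (hf.continuousAt.eventually (hs.total_and_eventually hg hlam).2).and
      (D.chart.open_source.mem_nhds hx)
  have hrep : ∀ y ∈ D.chart.source, ∀ (a : X → E →L[ℝ] E) (v : E), D.coreFrame y (a y v) =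
      ringConj (D.chartFrame (Completion.core 𝓜 y)) (hatField 𝓜 a y) (D.coreFrame y v) := by
    intro y hy a v
    have h1 : ringConj (D.chartFrame (Completion.core 𝓜 y)) (hatField 𝓜 a y) =
        ringConj (D.coreFrame y) (a y) := by
      rw [D.coreFrame_eq h hy, ringConj_mul_left (D.isUnit_chartFrame h
        (p := Completion.core 𝓜 y) hy) (isUnit_coreDeriv h y)]
      rfl
    rw [h1]
    exact (congrArg (fun T : E →L[ℝ] E => T v) (ringConj_mul_self (D.isUnit_coreFrame hy) (a y))).symm
  refine ⟨hg, ?_⟩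
  have hbij : Function.Bijective (D.coreFrame x) := bijective_of_isUnit (D.isUnit_coreFrame hx)
  refine (isConvexAt_iff_vectorConvexAt Q hf hbij s1 s2 s3
    (-D.ℓ).contDiff.contDiffAt ?_ ?_ ?_ ?_).1 hc
  · filter_upwards [hev] with y hy
    simp only [Function.comp_apply, neg_apply]
    rw [D.ℓ_completionChart (p := Completion.core 𝓜 y) hy.2, neg_neg]
    rfl
  · filter_upwards [hev] with y hy v
    rw [(S.out_chartData_core h D hy.2 hy.1).1]
    exact hrep y hy.2 (endField Q.I) v
  · filter_upwards [hev] with y hy v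
    rw [(S.out_chartData_core h D hy.2 hy.1).2.1]
    exact hrep y hy.2 (endField Q.J) v
  · filter_upwards [hev] with y hy v
    rw [(S.out_chartData_core h D hy.2 hy.1).2.2]
    exact hrep y hy.2 (endField Q.K) v

/-- The corrected structure is convex on a neighborhood of the boundary of the core. -/
theorem exists_isConvexPoint (h : IsCollarStructure A) (b : Prop)
    (hc : ∀ x ∈ 𝓜.boundary X, Q.IsConvexAt C.ρ x) : ∃ ε > 0, ∀ p : Completion 𝓜 X,
    0 ≤ C.height p → C.height p < ε → ∃ D : EndChart C, Completion.base p ∈ D.chart.source ∧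
      S.IsConvexPoint b D (D.completionChart p) := by
  have hB : IsCompact (𝓜.boundary X) := (𝓜.isClosed_boundary (n := ∞) (by simp)).isCompact
  let O : Set (Completion 𝓜 X) := {p | ∃ D : EndChart C, Completion.base p ∈ D.chart.source ∧
      S.IsConvexPoint b D (D.completionChart p)}
  have hO : IsOpen O := by
    rw [isOpen_iff_mem_nhds]
    rintro p ⟨D, hp, hD⟩
    have hp' : p ∈ D.completionChart.source := hp
    have h1 := (D.completionChart.continuousAt hp').eventually
      (IsConvexPoint.eventually S h (D.completionChart.map_source hp') hD)
    filter_upwards [h1, D.completionChart.open_source.mem_nhds hp'] with q h2 h3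
    exact ⟨D, h3, h2⟩
  obtain ⟨V, hV, hVO⟩ := C.isClosedEmbedding_embed.isEmbedding.isInducing.isOpen_iff.1 hO
  have h1 : ∀ x ∈ 𝓜.boundary X, ∀ᶠ z : ℝ × X in 𝓝 ((0 : ℝ), x), (z.2, z.1) ∈ V := by
    intro x hx
    have h2 : (x, (0 : ℝ)) ∈ V := by
      have h3 : Completion.core 𝓜 x ∈ O := ⟨A.D x hx, A.mem x hx,
        S.isConvexPoint_core h b _ (A.mem x hx) hx (hc x hx)⟩
      rw [← hVO] at h3
      have h4 : C.embed (Completion.core 𝓜 x) ∈ V := h3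
      rwa [CollarData.embed, C.height_core, (C.zero_iff x).1 hx] at h4
    have h5 : ContinuousAt (fun z : ℝ × X => (z.2, z.1)) (0, x) := by fun_prop
    exact h5.eventually (hV.mem_nhds h2)
  -- Tube lemma: an open set containing `∂X × {0}` contains `∂X × {t}` for all small `t`, by
  -- compactness.
  have h2 := hB.eventually_forall_of_forall_eventually (P := fun (t : ℝ) x => (x, t) ∈ V) h1
  obtain ⟨ε, hε, h3⟩ := Metric.eventually_nhds_iff.1 h2
  refine ⟨ε, hε, fun p hp0 hpε => ?_⟩
  have hb : Completion.base p ∈ 𝓜.boundary X := by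
    by_contra hcon
    have := base_notMem_iff (C := C).1 hcon
    linarith
  have h4 : p ∈ O := by
    rw [← hVO]
    exact h3 (y := C.height p) (by rw [Real.dist_eq, sub_zero, abs_of_nonneg hp0]; exact hpε) _ hb
  exact h4

end ApproxStructure

end Approximate

/-! ### The almost quaternionic structure on the completion -/

section Structure

universe u

variable {E : Type u} [NormedAddCommGroup E] [NormedSpace ℝ E] [FiniteDimensional ℝ E]
  {H : Type*} [TopologicalSpace H]
  {𝓜 : ModelWithCorners ℝ E H} {X : Type*} [TopologicalSpace X] [ChartedSpace H X]
  [IsManifold 𝓜 ∞ X] [CompactSpace X] [T2Space X] {C : CollarData 𝓜 X}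

/-- The reparametrizations of the conical end. -/
structure IsReparametrization (θ : ℝ → ℝ) (ε : ℝ) : Prop where
  smooth : ContDiff ℝ ∞ θ
  eq_self : ∀ t ≤ 0, θ t = t
  deriv_pos : ∀ t, 0 < deriv θ t
  concave : ∀ t, deriv (deriv θ) t ≤ 0
  lt : ∀ t, θ t < ε
  nonneg : ∀ t, 0 ≤ t → 0 ≤ θ t

lemma base_mem_boundary {p : Completion 𝓜 X} (hp : 0 ≤ C.height p) :
    Completion.base p ∈ 𝓜.boundary X :=
  (C.zero_iff _).2 (by rw [C.ρ_base, min_eq_right hp])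

lemma eq_core_of_height_nonpos {p : Completion 𝓜 X} (hp : C.height p ≤ 0) :
    p = Completion.core 𝓜 (Completion.base p) := by
  nth_rewrite 1 [← C.point_base_height p]
  exact C.point_core (by rw [C.ρ_base, min_eq_left hp])

/-- The point of the ray through `p` with the reparametrized height. -/
def CollarData.slidePoint (C : CollarData 𝓜 X) (θ : ℝ → ℝ) (p : Completion 𝓜 X) :
    Completion 𝓜 X := C.point (Completion.base p, θ (C.height p))

@[simp] lemma CollarData.base_slidePoint (θ : ℝ → ℝ) (p : Completion 𝓜 X) :
    Completion.base (C.slidePoint θ p) = Completion.base p := C.base_point _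

lemma IsReparametrization.height_slidePoint {θ : ℝ → ℝ} {ε : ℝ} (hθ : IsReparametrization θ ε)
    {p : Completion 𝓜 X} (hp : 0 ≤ C.height p) :
    C.height (C.slidePoint θ p) = θ (C.height p) := by
  refine C.height_point (q := (Completion.base p, θ (C.height p))) ?_
  rw [C.ρ_base, min_eq_right hp, min_eq_right (hθ.nonneg _ hp)]

lemma IsReparametrization.slide_completionChart {θ : ℝ → ℝ} {ε : ℝ} (hθ : IsReparametrization θ ε)
    (D : EndChart C) {p : Completion 𝓜 X} (hp : 0 ≤ C.height p)
    (hs : Completion.base p ∈ D.chart.source) :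
    slide D.ℓ D.ν θ (D.completionChart p) = D.completionChart (C.slidePoint θ p) := by
  rw [slide, D.ℓ_completionChart hs, D.completionChart_apply, D.completionChart_apply,
    hθ.height_slidePoint hp, C.base_slidePoint, neg_neg]
  module

lemma IsReparametrization.slide_mem_target {θ : ℝ → ℝ} {ε : ℝ} (hθ : IsReparametrization θ ε)
    (D : EndChart C) {p : Completion 𝓜 X} (hs : Completion.base p ∈ D.chart.source) :
    slide D.ℓ D.ν θ (D.completionChart p) ∈ D.completionChart.target := by
  obtain hp | hp := le_total 0 (C.height p)
  · rw [hθ.slide_completionChart D hp hs]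
    exact D.completionChart.map_source (by rw [D.mem_completionChart_source, C.base_slidePoint]; exact hs)
  · rw [slide_of_nonneg hθ.eq_self (by rw [D.ℓ_completionChart hs]; linarith)]
    exact D.completionChart.map_source hs

variable [cs : ChartedSpace E (Completion 𝓜 X)] [IsManifold 𝓘(ℝ, E) ∞ (Completion 𝓜 X)]

namespace ApproxStructure

variable {Q : AlmostQuaternionic 𝓜 X} (S : ApproxStructure 𝓜 Q) (A : CollarAtlas C)

open Classical in
/-- The endomorphism field which is given on the core, and which is obtained on the conical end
from a natural function `out` of the transport data by reparametrization. -/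
def bent (θ : ℝ → ℝ) (a : X → E →L[ℝ] E) (out : TransportData E → E →L[ℝ] E)
    (p : Completion 𝓜 X) : E →L[ℝ] E :=
  if hp : 0 < C.height p then
    ringConj (stretch (-(A.D _ (base_mem_boundary hp.le)).ℓ) (-(A.D _ (base_mem_boundary hp.le)).ν)
      (deriv θ (C.height p)))⁻¹ʳ
      (out (S.data (A.D _ (base_mem_boundary hp.le)) (C.slidePoint θ p)))
  else hatField 𝓜 a (Completion.base p)

/-- The natural functions of the transport data that extend an endomorphism field. -/
structure IsOutput (b : Prop) (a : X → E →L[ℝ] E) (out : TransportData E → E →L[ℝ] E) : Prop where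
  smooth : ∀ x, SmoothEndAt 𝓜 a x
  map : ∀ (T : TransportData E) (e : E ≃L[ℝ] E), out (T.map e) = e.conjContinuousAlgEquiv (out T)
  core : ∀ (D : EndChart C) (x : X), x ∈ D.chart.source →
    (S.chartData D (D.completionChart (Completion.core 𝓜 x))).IsGood b →
    out (S.chartData D (D.completionChart (Completion.core 𝓜 x))) =
      ringConj (D.chartFrame (Completion.core 𝓜 x)) (hatField 𝓜 a x)
  contDiffAt : ∀ (D : EndChart C) (u : E), u ∈ D.completionChart.target →
    (S.chartData D u).IsGood b → ContDiffAt ℝ ∞ (fun v => out (S.chartData D v)) u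

variable {A}

lemma isOutput (h : IsCollarStructure A) (b : Prop) :
    S.IsOutput (C := C) b (endField Q.I) (fun T => T.outI b) ∧
    S.IsOutput (C := C) b (endField Q.J) (fun T => T.outJ b) ∧
    S.IsOutput (C := C) b (endField Q.K) (fun T => T.outK b) := by
  have key : ∀ (D : EndChart C) (u : E), u ∈ D.completionChart.target →
      (S.chartData D u).IsGood b → _ := fun D u hu hg =>
    (S.smoothAt_chartData h D hu).contDiffAt_out hg
      (by rw [S.lam_eta_chartData]; exact one_ne_zero)
  refine ⟨⟨Q.smooth_I, fun T e => (T.out_map b e).1, fun D x hx hg => ?_, fun D u hu hg => ?_⟩,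
    ⟨Q.smooth_J, fun T e => (T.out_map b e).2.1, fun D x hx hg => ?_, fun D u hu hg => ?_⟩,
    ⟨Q.smooth_K, fun T e => (T.out_map b e).2.2, fun D x hx hg => ?_, fun D u hu hg => ?_⟩⟩
  · exact (S.out_chartData_core h D hx hg).1
  · exact (key D u hu hg).1
  · exact (S.out_chartData_core h D hx hg).2.1
  · exact (key D u hu hg).2.1
  · exact (S.out_chartData_core h D hx hg).2.2
  · exact (key D u hu hg).2.2

lemma bent_of_nonpos (θ : ℝ → ℝ) (a : X → E →L[ℝ] E) (out : TransportData E → E →L[ℝ] E)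
    {p : Completion 𝓜 X} (hp : C.height p ≤ 0) :
    S.bent A θ a out p = hatField 𝓜 a (Completion.base p) := dif_neg (not_lt.2 hp)

lemma bent_of_pos (θ : ℝ → ℝ) (a : X → E →L[ℝ] E) (out : TransportData E → E →L[ℝ] E)
    {p : Completion 𝓜 X} (hp : 0 < C.height p) (hb : Completion.base p ∈ 𝓜.boundary X) :
    S.bent A θ a out p = ringConj (stretch (-(A.D _ hb).ℓ) (-(A.D _ hb).ν)
      (deriv θ (C.height p)))⁻¹ʳ (out (S.data (A.D _ hb) (C.slidePoint θ p))) := dif_pos hp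

/-- The coordinate expression of the extended endomorphism field. -/
def bentRep (D : EndChart C) (θ : ℝ → ℝ) (out : TransportData E → E →L[ℝ] E) (u : E) : E →L[ℝ] E :=
  ringConj (stretch (-D.ℓ) (-D.ν) (deriv θ (-D.ℓ u)))⁻¹ʳ
    (out (S.chartData D (slide D.ℓ D.ν θ u)))

variable {S} {b : Prop} {a : X → E →L[ℝ] E} {out : TransportData E → E →L[ℝ] E} {θ : ℝ → ℝ} {ε : ℝ}

lemma neg_ℓ_neg_ν (D : EndChart C) : (-D.ℓ : E →L[ℝ] ℝ) (-D.ν) = 1 := by simp [D.ℓ_ν]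

/-- `stretch` is the differential of the slide, so `bentRep` is the pull-back under the slide of the
corrected field. Naturality of `out` and constancy of the chart differentials along rays make the
definition through the preferred chart agree with it; on the core the slide is the identity. -/
lemma IsOutput.ringConj_bent (h : IsCollarStructure A) (ho : S.IsOutput (C := C) b a out)
    (hθ : IsReparametrization θ ε) (D : EndChart C) {p : Completion 𝓜 X}
    (hs : Completion.base p ∈ D.chart.source)
    (hg : (S.chartData D (slide D.ℓ D.ν θ (D.completionChart p))).IsGood b) :
    ringConj (D.chartFrame p) (S.bent A θ a out p) = S.bentRep D θ out (D.completionChart p) := by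
  obtain hp | hp := le_or_gt (C.height p) 0
  · have h1 := eq_core_of_height_nonpos hp
    have h2 : slide D.ℓ D.ν θ (D.completionChart p) = D.completionChart p :=
      slide_of_nonneg hθ.eq_self (by rw [D.ℓ_completionChart hs]; linarith)
    have h3 : deriv θ (-D.ℓ (D.completionChart p)) = 1 :=
      deriv_eq_one_of_nonpos hθ.smooth hθ.eq_self (by rw [D.ℓ_completionChart hs]; linarith)
    rw [h2] at hg
    rw [bentRep, h2, h3, stretch_one, S.bent_of_nonpos θ a out hp]
    obtain ⟨x, hx⟩ : ∃ x, x = Completion.base p := ⟨_, rfl⟩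
    rw [← hx] at h1 hs ⊢
    rw [h1] at hg ⊢
    rw [ho.core D x hs hg]
    simp [ringConj]
  · have hb := base_mem_boundary hp.le
    obtain ⟨e, he, hmap⟩ := S.exists_chartData_eq_map h D (p := C.slidePoint θ p)
      (by rwa [C.base_slidePoint]) (by rwa [C.base_slidePoint])
    have hfr : D.chartFrame (C.slidePoint θ p) = D.chartFrame p :=
      D.chartFrame_eq_of_base_eq h hb hs (C.base_slidePoint θ p)
    have hD : ∀ (x y : X) (hx : x ∈ 𝓜.boundary X) (hy : y ∈ 𝓜.boundary X), x = y →
        A.D x hx = A.D y hy := by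
      rintro x _ hx hy rfl; rfl
    rw [hD _ _ _ hb (C.base_slidePoint θ p)] at hmap
    have hst : stretch (-D.ℓ) (-D.ν) (deriv θ (C.height p)) =
        e.conjContinuousAlgEquiv (stretch (-(A.D _ hb).ℓ) (-(A.D _ hb).ν) (deriv θ (C.height p))) := by
      have h1 := congrArg TransportData.lam hmap
      have h2 := congrArg TransportData.eta hmap
      rw [conj_stretch]
      exact congrArg₂ (fun l v => stretch l v (deriv θ (C.height p))) h1 h2
    rw [S.bent_of_pos θ a out hp hb, bentRep, hθ.slide_completionChart D hp.le hs, hmap, ho.map,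
      D.ℓ_completionChart hs, neg_neg, hst, ← hfr, ← he, ← conjContinuousAlgEquiv_eq_ringConj,
      map_ringConj, map_ringInverse]

lemma IsOutput.contDiffAt_bentRep (ho : S.IsOutput (C := C) b a out)
    (hθ : IsReparametrization θ ε) (D : EndChart C) {u : E}
    (hu : slide D.ℓ D.ν θ u ∈ D.completionChart.target)
    (hg : (S.chartData D (slide D.ℓ D.ν θ u)).IsGood b) :
    ContDiffAt ℝ ∞ (S.bentRep D θ out) u := by
  have h1 : ContDiffAt ℝ ∞ (fun u => stretch (-D.ℓ) (-D.ν) (deriv θ (-D.ℓ u))) u := by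
    have h2 : ContDiff ℝ ∞ (deriv θ) := (contDiff_infty_iff_deriv.1 hθ.smooth).2
    exact contDiffAt_const.add (((h2.comp D.ℓ.contDiff.neg).contDiffAt.sub contDiffAt_const).smul
      contDiffAt_const)
  have hu1 : IsUnit (stretch (-D.ℓ) (-D.ν) (deriv θ (-D.ℓ u))) :=
    isUnit_stretch (neg_ℓ_neg_ν D) (hθ.deriv_pos _).ne'
  exact TransportData.contDiffAt_ringConj (TransportData.contDiffAt_ringInverse_comp h1 hu1)
    ((ho.contDiffAt D _ hu hg).comp u (contDiff_slide hθ.smooth).contDiffAt) hu1.ringInverse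

lemma eventually_isGood_slide (h : IsCollarStructure A) (S : ApproxStructure 𝓜 Q)
    (hθ : IsReparametrization θ ε) (D : EndChart C) {p : Completion 𝓜 X}
    (hs : Completion.base p ∈ D.chart.source)
    (hg : (S.chartData D (slide D.ℓ D.ν θ (D.completionChart p))).IsGood b) :
    ∀ᶠ q in 𝓝 p, Completion.base q ∈ D.chart.source ∧
      (S.chartData D (slide D.ℓ D.ν θ (D.completionChart q))).IsGood b := by
  have h1 := ((S.smoothAt_chartData h D (hθ.slide_mem_target D hs)).total_and_eventually hg
    (by rw [S.lam_eta_chartData]; exact one_ne_zero)).2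
  have h2 : ContinuousAt (fun q => slide D.ℓ D.ν θ (D.completionChart q)) p :=
    (contDiff_slide hθ.smooth).continuous.continuousAt.comp (D.completionChart.continuousAt hs)
  filter_upwards [h2.eventually h1, D.completionChart.open_source.mem_nhds hs] with q h3 h4
  exact ⟨h4, h3⟩

/-- Around a point of nonnegative height, `bentRep` is one smooth formula valid on both sides of the
boundary of the core. The slide brings every height below `ε`, where the correction is defined. -/
lemma IsOutput.smoothEndAt_bent (h : IsCollarStructure A) (ho : S.IsOutput (C := C) b a out)
    (hθ : IsReparametrization θ ε)
    (hε : ∀ p : Completion 𝓜 X, 0 ≤ C.height p → C.height p < ε → ∃ D : EndChart C,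
      Completion.base p ∈ D.chart.source ∧ S.IsConvexPoint b D (D.completionChart p))
    (p : Completion 𝓜 X) : SmoothEndAt 𝓘(ℝ, E) (S.bent A θ a out) p := by
  obtain hp | hp := lt_or_ge (C.height p) 0
  · refine (smoothEndAt_hatField_base h ho.smooth hp).congr_of_eventuallyEq ?_
    filter_upwards [(isOpen_lt C.continuous_height continuous_const).mem_nhds hp] with q hq
    rw [S.bent_of_nonpos θ a out (le_of_lt hq)]
  · obtain ⟨D, hs, hD⟩ := hε (C.slidePoint θ p) (by
      rw [hθ.height_slidePoint hp]; exact hθ.nonneg _ hp) (by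
      rw [hθ.height_slidePoint hp]; exact hθ.lt _)
    rw [C.base_slidePoint] at hs
    have hg := hD.1
    rw [← hθ.slide_completionChart D hp hs] at hg
    rw [smoothEndAt_iff (D.contMDiffAt h hs) (D.isUnit_chartFrame h hs)]
    have h1 := (ho.contDiffAt_bentRep hθ D (hθ.slide_mem_target D hs) hg).contMDiffAt.comp p
      (D.contMDiffAt h hs)
    refine h1.congr_of_eventuallyEq ?_
    filter_upwards [eventually_isGood_slide h S hθ D hs hg] with q hq
    exact ho.ringConj_bent h hθ D hq.1 hq.2

lemma isGood_data_slidePoint (h : IsCollarStructure A) (S : ApproxStructure 𝓜 Q)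
    (hθ : IsReparametrization θ ε)
    (hε : ∀ p : Completion 𝓜 X, 0 ≤ C.height p → C.height p < ε → ∃ D : EndChart C,
      Completion.base p ∈ D.chart.source ∧ S.IsConvexPoint b D (D.completionChart p))
    {p : Completion 𝓜 X} (hp : 0 ≤ C.height p) (hb : Completion.base p ∈ 𝓜.boundary X) :
    (S.data (A.D _ hb) (C.slidePoint θ p)).IsGood b := by
  obtain ⟨D, hs, hD⟩ := hε (C.slidePoint θ p) (by
    rw [hθ.height_slidePoint hp]; exact hθ.nonneg _ hp) (by
    rw [hθ.height_slidePoint hp]; exact hθ.lt _)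
  have h1 := (S.isGood_data_iff h D (by rwa [C.base_slidePoint]) hs).1 hD.1
  have hDD : ∀ (x y : X) (hx : x ∈ 𝓜.boundary X) (hy : y ∈ 𝓜.boundary X), x = y →
      A.D x hx = A.D y hy := by
    rintro x _ hx hy rfl; rfl
  rwa [hDD _ _ _ hb (C.base_slidePoint θ p)] at h1

lemma isQuatTriple_bent (h : IsCollarStructure A) (S : ApproxStructure 𝓜 Q)
    (hθ : IsReparametrization θ ε)
    (hε : ∀ p : Completion 𝓜 X, 0 ≤ C.height p → C.height p < ε → ∃ D : EndChart C,
      Completion.base p ∈ D.chart.source ∧ S.IsConvexPoint b D (D.completionChart p))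
    (p : Completion 𝓜 X) : IsQuatTriple (S.bent A θ (endField Q.I) (fun T => T.outI b) p)
      (S.bent A θ (endField Q.J) (fun T => T.outJ b) p)
      (S.bent A θ (endField Q.K) (fun T => T.outK b) p) := by
  obtain hp | hp := le_or_gt (C.height p) 0
  · simp only [S.bent_of_nonpos θ _ _ hp]
    exact isQuatTriple_hatField h Q _
  · have hb := base_mem_boundary hp.le
    simp only [S.bent_of_pos θ _ _ hp hb]
    refine ((isGood_data_slidePoint h S hθ hε hp.le hb).isQuatTriple_out ?_).ringConj
      (isUnit_stretch (neg_ℓ_neg_ν _) (hθ.deriv_pos _).ne').ringInverse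
    exact isQuatTriple_hatField h Q _

/-- The almost quaternionic structure on the completion. -/
def completed (h : IsCollarStructure A) (S : ApproxStructure 𝓜 Q) (hθ : IsReparametrization θ ε)
    (hε : ∀ p : Completion 𝓜 X, 0 ≤ C.height p → C.height p < ε → ∃ D : EndChart C,
      Completion.base p ∈ D.chart.source ∧ S.IsConvexPoint b D (D.completionChart p)) :
    AlmostQuaternionic 𝓘(ℝ, E) (Completion 𝓜 X) where
  I        := S.bent A θ (endField Q.I) (fun T => T.outI b)
  J        := S.bent A θ (endField Q.J) (fun T => T.outJ b)
  K        := S.bent A θ (endField Q.K) (fun T => T.outK b)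
  smooth_I := (S.isOutput h b).1.smoothEndAt_bent h hθ hε
  smooth_J := (S.isOutput h b).2.1.smoothEndAt_bent h hθ hε
  smooth_K := (S.isOutput h b).2.2.smoothEndAt_bent h hθ hε
  I_sq p v := congrArg (fun T : E →L[ℝ] E => T v) (isQuatTriple_bent h S hθ hε p).I_sq
  J_sq p v := congrArg (fun T : E →L[ℝ] E => T v) (isQuatTriple_bent h S hθ hε p).J_sq
  K_sq p v := congrArg (fun T : E →L[ℝ] E => T v) (isQuatTriple_bent h S hθ hε p).K_sq
  I_J p v  := congrArg (fun T : E →L[ℝ] E => T v) (isQuatTriple_bent h S hθ hε p).I_J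

lemma extends_completed (h : IsCollarStructure A) (S : ApproxStructure 𝓜 Q)
    (hθ : IsReparametrization θ ε)
    (hε : ∀ p : Completion 𝓜 X, 0 ≤ C.height p → C.height p < ε → ∃ D : EndChart C,
      Completion.base p ∈ D.chart.source ∧ S.IsConvexPoint b D (D.completionChart p)) :
    AlmostQuaternionic.Extends 𝓜 (completed h S hθ hε) Q := by
  have key : ∀ (a : X → E →L[ℝ] E) (out : TransportData E → E →L[ℝ] E) (x : X) (v : E),
      S.bent A θ a out (Completion.core 𝓜 x) (coreDeriv 𝓜 x v) = coreDeriv 𝓜 x (a x v) := by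
    intro a out x v
    rw [S.bent_of_nonpos θ a out (p := Completion.core 𝓜 x) (C.nonpos x)]
    exact congrArg (fun T : E →L[ℝ] E => T v) (ringConj_mul_self (isUnit_coreDeriv h x) (a x))
  exact fun x v => ⟨key _ _ x v, key _ _ x v, key _ _ x v⟩

/-- In an end chart the height is `-ℓ`, and `θ ∘ (-ℓ) = (-ℓ) ∘ slide`. The structure is a pull-back
under the slide, so `θ ∘ height` is convex because the height is convex at the image point, which
lies below `ε`. Concavity of `θ` passes this on to the height. -/
lemma isConvexAt_completed (h : IsCollarStructure A) (S : ApproxStructure 𝓜 Q)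
    (hθ : IsReparametrization θ ε)
    (hε : ∀ p : Completion 𝓜 X, 0 ≤ C.height p → C.height p < ε → ∃ D : EndChart C,
      Completion.base p ∈ D.chart.source ∧ S.IsConvexPoint b D (D.completionChart p))
    {p : Completion 𝓜 X} (hp : 0 ≤ C.height p) : (completed h S hθ hε).IsConvexAt C.height p := by
  obtain ⟨D, hs, hD⟩ := hε (C.slidePoint θ p) (by
    rw [hθ.height_slidePoint hp]; exact hθ.nonneg _ hp) (by
    rw [hθ.height_slidePoint hp]; exact hθ.lt _)
  rw [C.base_slidePoint] at hs
  rw [← hθ.slide_completionChart D hp hs] at hD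
  obtain ⟨hg, hc⟩ := hD
  have hu := hθ.slide_mem_target D hs
  obtain ⟨oI, oJ, oK⟩ := S.isOutput (C := C) h b
  have sI := oI.contDiffAt_bentRep hθ D hu hg
  have sJ := oJ.contDiffAt_bentRep hθ D hu hg
  have sK := oK.contDiffAt_bentRep hθ D hu hg
  have hℓ : ∀ u, ContDiffAt ℝ ∞ (-D.ℓ : E →L[ℝ] ℝ) u := fun u => (-D.ℓ).contDiff.contDiffAt
  have hst : ∀ u, IsUnit (stretch (-D.ℓ) (-D.ν) (deriv θ (-D.ℓ u))) := fun u =>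
    isUnit_stretch (neg_ℓ_neg_ν D) (hθ.deriv_pos _).ne'
  have hbij : Function.Bijective (D.chartFrame p) := bijective_of_isUnit (D.isUnit_chartFrame h hs)
  have hev : ∀ (a : X → E →L[ℝ] E) (out : TransportData E → E →L[ℝ] E),
      S.IsOutput (C := C) b a out → ∀ᶠ q in 𝓝 p, ∀ v : E, D.chartFrame q (S.bent A θ a out q v) =
        S.bentRep D θ out (D.completionChart q) (D.chartFrame q v) := by
    intro a out ho
    filter_upwards [eventually_isGood_slide h S hθ D hs hg] with q hq v
    rw [← ho.ringConj_bent h hθ D hq.1 hq.2]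
    exact (congrArg (fun T : E →L[ℝ] E => T v) (ringConj_mul_self (D.isUnit_chartFrame h hq.1) _)).symm
  refine (isConvexAt_iff_vectorConvexAt (completed h S hθ hε) (D.contMDiffAt h hs) hbij sI sJ sK
    (hℓ _) ?_ (hev _ _ oI) (hev _ _ oJ) (hev _ _ oK)).2 ?_
  · filter_upwards [D.completionChart.open_source.mem_nhds (show p ∈ D.completionChart.source from hs)]
      with q hq
    simp only [Function.comp_apply, neg_apply]
    rw [D.ℓ_completionChart hq, neg_neg]
  have hqt : IsQuatTriple (S.bentRep D θ (fun T => T.outI b) (D.completionChart p))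
      (S.bentRep D θ (fun T => T.outJ b) (D.completionChart p))
      (S.bentRep D θ (fun T => T.outK b) (D.completionChart p)) :=
    (hg.isQuatTriple_out (S.isQuatTriple_chartData D hu)).ringConj (hst _).ringInverse
  refine VectorConvexAt.of_comp_left hθ.smooth sI sJ sK (hℓ _) hqt (hθ.deriv_pos _) (hθ.concave _) ?_
  have hcomp : θ ∘ (-D.ℓ : E →L[ℝ] ℝ) = (-D.ℓ : E →L[ℝ] ℝ) ∘ slide D.ℓ D.ν θ := by
    funext u
    exact (ℓ_slide D.ℓ_ν u).symm
  have hfd : ∀ (out : TransportData E → E →L[ℝ] E) (u v : E),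
      fderiv ℝ (slide D.ℓ D.ν θ) u (S.bentRep D θ out u v) =
        out (S.chartData D (slide D.ℓ D.ν θ u)) (fderiv ℝ (slide D.ℓ D.ν θ) u v) := by
    intro out u v
    rw [fderiv_slide hθ.smooth, bentRep, TransportData.ringConj_inverse_apply (hst u)]
    exact congrArg (fun T : E →L[ℝ] E => T (out (S.chartData D (slide D.ℓ D.ν θ u))
      (stretch (-D.ℓ) (-D.ν) (deriv θ (-D.ℓ u)) v))) (Ring.mul_inverse_cancel _ (hst u))
  rw [hcomp]
  refine VectorConvexAt.comp (contDiff_slide hθ.smooth).contDiffAt ?_ sI sJ sK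
    (oI.contDiffAt D _ hu hg) (oJ.contDiffAt D _ hu hg) (oK.contDiffAt D _ hu hg) (hℓ _)
    (Eventually.of_forall fun u v => hfd _ u v) (Eventually.of_forall fun u v => hfd _ u v)
    (Eventually.of_forall fun u v => hfd _ u v) hc
  rw [fderiv_slide hθ.smooth]
  exact (bijective_of_isUnit (hst _)).1

end ApproxStructure

end Structure

/-! ### The completion of a submanifold with conical boundary -/

section Submanifold

universe u

variable {E : Type u} [NormedAddCommGroup E] [NormedSpace ℝ E] [FiniteDimensional ℝ E]
  {H : Type*} [TopologicalSpace H]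
  {𝓜 : ModelWithCorners ℝ E H} {X : Type*} [TopologicalSpace X] [ChartedSpace H X]
  [IsManifold 𝓜 ∞ X] [CompactSpace X] [T2Space X] {K : CollarData 𝓜 X}
  {F : Type*} [NormedAddCommGroup F] [NormedSpace ℝ F] [FiniteDimensional ℝ F]
  {G : Type*} [TopologicalSpace G]
  {𝓝' : ModelWithCorners ℝ F G} {N : Type*} [TopologicalSpace N] [ChartedSpace G N]
  [IsManifold 𝓝' ∞ N] [CompactSpace N] [T2Space N] {K' : CollarData 𝓝' N}
  {Z : Type*} [NormedAddCommGroup Z] [NormedSpace ℝ Z]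
  {j : N → X} {A : CollarAtlas K} {A' : CollarAtlas K'}
  [cs : ChartedSpace E (Completion 𝓜 X)] [IsManifold 𝓘(ℝ, E) ∞ (Completion 𝓜 X)]
  [cs' : ChartedSpace F (Completion 𝓝' N)] [IsManifold 𝓘(ℝ, F) ∞ (Completion 𝓝' N)]
  {Q : AlmostQuaternionic 𝓜 X} {b : Prop} {θ : ℝ → ℝ} {ε : ℝ}

lemma md_height_core (h : IsCollarStructure A) (x : X) (v : E) :
    md 𝓘(ℝ, E) 𝓘(ℝ, ℝ) K.height (Completion.core 𝓜 x) (coreDeriv 𝓜 x v) =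
      md 𝓜 𝓘(ℝ, ℝ) K.ρ x v :=
  (congrArg (fun T : E →L[ℝ] ℝ => T v)
    (md_comp (contMDiffAt_core h x) (contMDiff_height h (Completion.core 𝓜 x)))).symm

lemma md_height_eq (h : IsCollarStructure A) {p : Completion 𝓜 X}
    (hp : Completion.base p ∈ 𝓜.boundary X) (v : E) :
    md 𝓘(ℝ, E) 𝓘(ℝ, ℝ) K.height p v = -(A.D _ hp).ℓ v := by
  have h1 := (A.D _ hp).ℓ_chartFrame h (A.mem _ hp) v
  rw [chartFrame_eq_one h hp] at h1
  have h2 : (A.D _ hp).ℓ v = _ := h1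
  rw [h2, neg_neg]

lemma hatField_coreDeriv (h : IsCollarStructure A) (a : X → E →L[ℝ] E) (x : X) (v : E) :
    hatField 𝓜 a x (coreDeriv 𝓜 x v) = coreDeriv 𝓜 x (a x v) :=
  congrArg (fun T : E →L[ℝ] E => T v) (ringConj_mul_self (isUnit_coreDeriv h x) (a x))

namespace IsAdaptedCollar

variable (ha : IsAdaptedCollar Z j A A')

lemma mapDeriv_core (h : IsCollarStructure A) (h' : IsCollarStructure A')
    (hj : ContMDiff 𝓝' 𝓜 ∞ j) (hm : ContMDiff 𝓘(ℝ, F) 𝓘(ℝ, E) ∞ ha.map) (y : N) (v : F) :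
    ha.mapDeriv (Completion.core 𝓝' y) (coreDeriv 𝓝' y v) = coreDeriv 𝓜 (j y) (md 𝓝' 𝓜 j y v) := by
  have h1 := md_comp (contMDiffAt_core h' y) (hm (Completion.core 𝓝' y))
  have h2 := md_comp (hj y) (contMDiffAt_core h (j y))
  exact congrArg (fun T : F →L[ℝ] E => T v) (h1.symm.trans h2)

/-- The tangent spaces of the extended submanifold along a ray agree. -/
lemma exists_tangent (h : IsCollarStructure A) (h' : IsCollarStructure A')
    (hm : ContMDiff 𝓘(ℝ, F) 𝓘(ℝ, E) ∞ ha.map) {y : N} (hy : j y ∈ 𝓜.boundary X) :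
    ∃ W : Submodule ℝ E, (A.D _ hy).ν ∈ W ∧
      ∀ q, Completion.base q = y → ∀ v, v ∈ W ↔ ∃ w, ha.mapDeriv q w = v := by
  obtain h0 | ⟨D', e, hD⟩ := ha.adapted _ hy
  · exact absurd (A.mem _ hy) (h0 y)
  refine ⟨LinearMap.range ((e : (F × Z) →L[ℝ] E).comp (ContinuousLinearMap.inl ℝ F Z)).toLinearMap,
    ⟨D'.ν, hD.ν⟩, ?_⟩
  rintro q rfl v
  have hs := hD.source _ (A.mem _ hy)
  have h1 : ∀ w, ha.mapDeriv q w = e (D'.chartFrame q w, 0) := by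
    intro w
    rw [← ha.chartFrame_mapDeriv h h' hm hD (A.mem _ hy)]
    have hb : Completion.base (ha.map q) ∈ 𝓜.boundary X := by rwa [ha.base_map]
    have hDD : ∀ (x x' : X) (hx : x ∈ 𝓜.boundary X) (hx' : x' ∈ 𝓜.boundary X), x = x' →
        A.D x hx = A.D x' hx' := by
      rintro x _ hx hx' rfl; rfl
    rw [hDD _ _ hy hb (ha.base_map q).symm, chartFrame_eq_one h hb]
    rfl
  constructor
  · rintro ⟨w, rfl⟩
    obtain ⟨w', rfl⟩ := (bijective_of_isUnit (D'.isUnit_chartFrame h' hs)).2 w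
    exact ⟨w', h1 w'⟩
  · rintro ⟨w, rfl⟩
    exact ⟨D'.chartFrame q w, (h1 w).symm⟩

variable {S : ApproxStructure 𝓜 Q}

/-- The linear constraints along the submanifold. -/
structure IsConstrained (ha : IsAdaptedCollar Z j A A') (S : ApproxStructure 𝓜 Q) (b : Prop) :
    Prop where
  J : ∀ q, Completion.base q ∈ 𝓝'.boundary N → ∀ v,
    md 𝓘(ℝ, E) 𝓘(ℝ, ℝ) K.height (ha.map q) (S.Jt (ha.map q) (ha.mapDeriv q v)) = 0
  K : ∀ q, Completion.base q ∈ 𝓝'.boundary N → ∀ v,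
    md 𝓘(ℝ, E) 𝓘(ℝ, ℝ) K.height (ha.map q) (S.Kt (ha.map q) (ha.mapDeriv q v)) = 0
  I : b → ∀ q, Completion.base q ∈ 𝓝'.boundary N → ∀ v, ∃ w,
    S.It (ha.map q) (ha.mapDeriv q v) = ha.mapDeriv q w

/-- The conclusions on the conical end, in terms of the transport data. -/
lemma completed_cone (h : IsCollarStructure A) (h' : IsCollarStructure A')
    (hm : ContMDiff 𝓘(ℝ, F) 𝓘(ℝ, E) ∞ ha.map) (hS : ha.IsConstrained S b)
    (hθ : IsReparametrization θ ε)
    (hε : ∀ p : Completion 𝓜 X, 0 ≤ K.height p → K.height p < ε → ∃ D : EndChart K,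
      Completion.base p ∈ D.chart.source ∧ S.IsConvexPoint b D (D.completionChart p))
    {q : Completion 𝓝' N} (hq : 0 < K'.height q) (v : F) :
    md 𝓘(ℝ, E) 𝓘(ℝ, ℝ) K.height (ha.map q)
      (S.bent A θ (endField Q.J) (fun T => T.outJ b) (ha.map q) (ha.mapDeriv q v)) = 0 ∧
    md 𝓘(ℝ, E) 𝓘(ℝ, ℝ) K.height (ha.map q)
      (S.bent A θ (endField Q.K) (fun T => T.outK b) (ha.map q) (ha.mapDeriv q v)) = 0 ∧
    (b → ∃ w, S.bent A θ (endField Q.I) (fun T => T.outI b) (ha.map q) (ha.mapDeriv q v) =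
      ha.mapDeriv q w) := by
  have hqN := base_mem_boundary hq.le
  set p := ha.map q with hp
  have hpq : 0 < K.height p := by rwa [hp, ha.height_map]
  have hb : Completion.base p ∈ 𝓜.boundary X := base_mem_boundary hpq.le
  set q' := K'.slidePoint θ q with hq'
  have hq'N : Completion.base q' = Completion.base q := K'.base_slidePoint θ q
  -- Sliding commutes with the extension of `j`, so constraints at `q'` are constraints at the point
  -- whose data are used.
  have hpq' : ha.map q' = K.slidePoint θ p := by
    refine K.injective_embed (Prod.ext ?_ ?_)
    · change Completion.base _ = Completion.base _
      rw [ha.base_map, hq'N, K.base_slidePoint, hp, ha.base_map]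
    · change K.height _ = K.height _
      rw [ha.height_map, hθ.height_slidePoint hq.le, hθ.height_slidePoint hpq.le, hp, ha.height_map]
  have hy : j (Completion.base q) ∈ 𝓜.boundary X := (ha.hB _).1 hqN
  have hDD : ∀ (x x' : X) (hx : x ∈ 𝓜.boundary X) (hx' : x' ∈ 𝓜.boundary X), x = x' →
      A.D x hx = A.D x' hx' := by
    rintro x _ hx hx' rfl; rfl
  obtain ⟨W, hν, hW⟩ := ha.exists_tangent h h' hm hy
  set D := A.D _ hb with hD
  rw [hDD _ _ hy hb (ha.base_map q).symm, ← hD] at hν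
  -- The radial vector is tangent to the extended submanifold; hence stretching preserves its
  -- tangent space.
  have hν' : -D.ν ∈ W := W.neg_mem hν
  -- the transport data
  set T := S.data D (K.slidePoint θ p) with hT
  have hg : T.IsGood b := ApproxStructure.isGood_data_slidePoint h S hθ hε hpq.le hb
  have hqt : IsQuatTriple T.I0 T.J0 T.K0 := isQuatTriple_hatField h Q _
  have hlam1 : T.lam T.eta = 1 := ApproxStructure.neg_ℓ_neg_ν D
  have hlam : T.lam T.eta ≠ 0 := by rw [hlam1]; exact one_ne_zero
  have hdh : ∀ w, T.lam w = md 𝓘(ℝ, E) 𝓘(ℝ, ℝ) K.height (ha.map q') w := by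
    intro w
    have h1 : Completion.base (ha.map q') ∈ 𝓜.boundary X := by rwa [ha.base_map, hq'N]
    rw [md_height_eq h h1, hDD _ _ h1 hb (by rw [ha.base_map, hq'N, hp, ha.base_map])]
    rfl
  have hdh' : ∀ w, md 𝓘(ℝ, E) 𝓘(ℝ, ℝ) K.height p w = T.lam w := fun w => md_height_eq h hb w
  have cJ : ∀ w ∈ W, T.lam (T.Jt w) = 0 := by
    intro w hw
    obtain ⟨w', rfl⟩ := (hW q' hq'N w).1 hw
    rw [hdh, hT, ← hpq']
    exact hS.J q' (by rwa [hq'N]) w'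
  have cK : ∀ w ∈ W, T.lam (T.Kt w) = 0 := by
    intro w hw
    obtain ⟨w', rfl⟩ := (hW q' hq'N w).1 hw
    rw [hdh, hT, ← hpq']
    exact hS.K q' (by rwa [hq'N]) w'
  have cIt : b → ∀ w ∈ W, T.It w ∈ W := by
    intro hb w hw
    obtain ⟨w', rfl⟩ := (hW q' hq'N w).1 hw
    obtain ⟨w'', hw''⟩ := hS.I hb q' (by rwa [hq'N]) w'
    rw [hpq'] at hw''
    exact (hW q' hq'N _).2 ⟨w'', hw''.symm⟩
  -- The reference structure `I0` is the value of `It` at the core point of the same ray, where the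
  -- tangent space is the same `W`.
  have cI0 : b → ∀ w ∈ W, T.I0 w ∈ W := by
    intro hb w hw
    have hc : Completion.base (Completion.core 𝓝' (Completion.base q)) = Completion.base q := rfl
    obtain ⟨w', rfl⟩ := (hW _ hc w).1 hw
    obtain ⟨w'', hw''⟩ := hS.I hb _ (by rwa [hc]) w'
    have h1 : T.I0 = S.It (ha.map (Completion.core 𝓝' (Completion.base q))) := by
      have h2 : ha.map (Completion.core 𝓝' (Completion.base q)) =
        Completion.core 𝓜 (j (Completion.base q)) := rfl
      rw [h2, S.It_core, hT]
      change hatField 𝓜 _ (Completion.base _) = _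
      rw [K.base_slidePoint, hp, ha.base_map]
    rw [h1]
    exact (hW _ hc _).2 ⟨w'', hw''.symm⟩
  have cI1 : b → ∀ w ∈ W, T.I1 w ∈ W := fun hb => TransportData.I1_mem hg (cIt hb) (cI0 hb)
  have oJ : ∀ w ∈ W, T.lam (T.outJ b w) = 0 := fun w hw =>
    (TransportData.lam_total_J hqt hlam hg w).trans (cJ w hw)
  have oK : ∀ w ∈ W, T.lam (T.outK b w) = 0 := by
    intro w hw
    -- In the `I`-complex case `λ K` is `-λ Jt I1`, which vanishes on `W` because `I1` preserves
    -- `W`; otherwise the constraint on `Kt` is used.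
    by_cases hb : b
    · refine (TransportData.lam_total_K hqt hlam hg hb w).trans ?_
      rw [cJ _ (cI1 hb w hw), neg_zero]
    · exact (TransportData.lam_total_K_of_not hqt hlam hg hb w).trans (cK w hw)
  -- the effect of stretching
  have hc : deriv θ (K.height p) ≠ 0 := (hθ.deriv_pos _).ne'
  have hmem : ha.mapDeriv q v ∈ W := (hW q rfl _).2 ⟨v, rfl⟩
  have hst : ∀ B : E →L[ℝ] E, ringConj (stretch T.lam T.eta (deriv θ (K.height p)))⁻¹ʳ B
      (ha.mapDeriv q v) = stretch T.lam T.eta (deriv θ (K.height p))⁻¹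
        (B (stretch T.lam T.eta (deriv θ (K.height p)) (ha.mapDeriv q v))) := by
    intro B
    rw [TransportData.ringConj_inverse_apply (isUnit_stretch hlam1 hc), ringInverse_stretch hlam1 hc]
  have hmem' : stretch T.lam T.eta (deriv θ (K.height p)) (ha.mapDeriv q v) ∈ W :=
    stretch_mem hν' _ hmem
  refine ⟨?_, ?_, fun hbb => ?_⟩
  · rw [S.bent_of_pos θ _ _ hpq hb, hdh']
    refine (congrArg T.lam (hst (T.outJ b))).trans ?_
    rw [lam_stretch hlam1, oJ _ hmem', mul_zero]
  · rw [S.bent_of_pos θ _ _ hpq hb, hdh']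
    refine (congrArg T.lam (hst (T.outK b))).trans ?_
    rw [lam_stretch hlam1, oK _ hmem', mul_zero]
  · rw [S.bent_of_pos θ _ _ hpq hb]
    have hI : T.outI b = T.I1 := TransportData.ringConj_total_I hqt hg hbb
    obtain ⟨w, hw⟩ := (hW q rfl _).1 (stretch_mem (lam := T.lam) hν' (deriv θ (K.height p))⁻¹
      (cI1 hbb _ hmem'))
    refine ⟨w, (hst (T.outI b)).trans ?_⟩
    rw [hI, hw]
    rfl

/-- The radial vector `ν` is tangent to the extended submanifold, and the differential of the height
takes the value `-1` on it. At height zero the completed fields coincide with the approximate ones,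
so their constraints apply directly. -/
theorem isJKConicalAt_completed (h : IsCollarStructure A) (h' : IsCollarStructure A')
    (hm : ContMDiff 𝓘(ℝ, F) 𝓘(ℝ, E) ∞ ha.map) (hS : ha.IsConstrained S b)
    (hθ : IsReparametrization θ ε)
    (hε : ∀ p : Completion 𝓜 X, 0 ≤ K.height p → K.height p < ε → ∃ D : EndChart K,
      Completion.base p ∈ D.chart.source ∧ S.IsConvexPoint b D (D.completionChart p))
    {q : Completion 𝓝' N} (hq : 0 ≤ K'.height q) :
    (ApproxStructure.completed h S hθ hε).IsJKConicalAt 𝓘(ℝ, F) K.height ha.map q := by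
  have hqN := base_mem_boundary hq
  refine ⟨?_, ?_⟩
  · have hy : j (Completion.base q) ∈ 𝓜.boundary X := (ha.hB _).1 hqN
    obtain ⟨W, hν, hW⟩ := ha.exists_tangent h h' hm hy
    obtain ⟨w, hw⟩ := (hW q rfl _).1 hν
    refine ⟨w, ?_⟩
    have hb : Completion.base (ha.map q) ∈ 𝓜.boundary X := by rwa [ha.base_map]
    have hDD : ∀ (x x' : X) (hx : x ∈ 𝓜.boundary X) (hx' : x' ∈ 𝓜.boundary X), x = x' →
        A.D x hx = A.D x' hx' := by
      rintro x _ hx hx' rfl; rfl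
    have h1 : md 𝓘(ℝ, E) 𝓘(ℝ, ℝ) K.height (ha.map q) (ha.mapDeriv q w) = -1 := by
      rw [hw, md_height_eq h hb, hDD _ _ hb hy (ha.base_map q), (A.D _ hy).ℓ_ν]
    intro h2
    have h3 : (-1 : ℝ) = 0 := h1.symm.trans h2
    norm_num at h3
  · obtain hq0 | hq0 := hq.lt_or_eq
    · exact ⟨fun v => (ha.completed_cone h h' hm hS hθ hε hq0 v).1,
        fun v => (ha.completed_cone h h' hm hS hθ hε hq0 v).2.1⟩
    · have hp0 : K.height (ha.map q) ≤ 0 := by rw [ha.height_map, ← hq0]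
      have hcore := eq_core_of_height_nonpos hp0
      have eJ : S.bent A θ (endField Q.J) (fun T => T.outJ b) (ha.map q) = S.Jt (ha.map q) := by
        rw [S.bent_of_nonpos θ _ _ hp0, ← S.Jt_core, ← hcore]
      have eK : S.bent A θ (endField Q.K) (fun T => T.outK b) (ha.map q) = S.Kt (ha.map q) := by
        rw [S.bent_of_nonpos θ _ _ hp0, ← S.Kt_core, ← hcore]
      refine ⟨fun v => ?_, fun v => ?_⟩
      · have h1 := hS.J q hqN v
        rw [← eJ] at h1
        exact h1
      · have h1 := hS.K q hqN v
        rw [← eK] at h1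
        exact h1

theorem isIComplex_completed (h : IsCollarStructure A) (h' : IsCollarStructure A')
    (hj : ContMDiff 𝓝' 𝓜 ∞ j)
    (hm : ContMDiff 𝓘(ℝ, F) 𝓘(ℝ, E) ∞ ha.map) (hS : ha.IsConstrained S b)
    (hθ : IsReparametrization θ ε)
    (hε : ∀ p : Completion 𝓜 X, 0 ≤ K.height p → K.height p < ε → ∃ D : EndChart K,
      Completion.base p ∈ D.chart.source ∧ S.IsConvexPoint b D (D.completionChart p))
    (hb : b) (hI : Q.IsIComplex 𝓝' j) :
    (ApproxStructure.completed h S hθ hε).IsIComplex 𝓘(ℝ, F) ha.map := by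
  intro q v
  obtain hq | hq := le_or_gt (K'.height q) 0
  · obtain ⟨y, rfl⟩ : ∃ y, q = Completion.core 𝓝' y := ⟨_, eq_core_of_height_nonpos hq⟩
    obtain ⟨v, rfl⟩ := (bijective_of_isUnit (isUnit_coreDeriv (E := F) h' y)).2 v
    obtain ⟨w, hw⟩ := hI y v
    refine ⟨coreDeriv 𝓝' y w, ?_⟩
    have h1 := ha.mapDeriv_core h h' hj hm y
    have h2 : S.bent A θ (endField Q.I) (fun T => T.outI b) (ha.map (Completion.core 𝓝' y)) =
        hatField 𝓜 (endField Q.I) (j y) := by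
      rw [S.bent_of_nonpos θ _ _ (by rwa [ha.height_map]), ha.base_map]
      rfl
    have h3 := hatField_coreDeriv h (endField Q.I) (j y) (md 𝓝' 𝓜 j y v)
    rw [← h1, ← h2] at h3
    refine h3.trans ?_
    have h4 : endField Q.I (j y) (md 𝓝' 𝓜 j y v) = md 𝓝' 𝓜 j y w := hw
    rw [h4]
    exact (h1 w).symm
  · exact (ha.completed_cone h h' hm hS hθ hε hq v).2.2 hb

/-- Existence of approximate structures satisfying the constraints along the submanifold. -/
theorem exists_isConstrained (h : IsCollarStructure A) (h' : IsCollarStructure A')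
    (hj : ContMDiff 𝓝' 𝓜 ∞ j) (hm : ContMDiff 𝓘(ℝ, F) 𝓘(ℝ, E) ∞ ha.map)
    {U : Set X} (hU : IsOpen U) (hBU : 𝓜.boundary X ⊆ U)
    (hcon : ∀ y, j y ∈ U → Q.IsJKConicalAt 𝓝' K.ρ j y) :
    ∃ S : ApproxStructure 𝓜 Q, ha.IsConstrained S (Q.IsIComplex 𝓝' j) := by
  have hcore : ∀ (a : X → E →L[ℝ] E) (y : N) (v : F),
      ∃ w : F, hatField 𝓜 a (j y) (ha.mapDeriv (Completion.core 𝓝' y) v) =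
        coreDeriv 𝓜 (j y) (a (j y) (md 𝓝' 𝓜 j y w)) ∧ v = coreDeriv 𝓝' y w := by
    intro a y v
    obtain ⟨w, rfl⟩ := (bijective_of_isUnit (isUnit_coreDeriv (E := F) h' y)).2 v
    exact ⟨w, by rw [ha.mapDeriv_core h h' hj hm, hatField_coreDeriv h], rfl⟩
  -- In every end chart this kernel is the fixed hyperplane `ker ℓ`, as the extension with
  -- constraints demands.
  let WJ : Completion 𝓝' N → Submodule ℝ E := fun q =>
    LinearMap.ker (md 𝓘(ℝ, E) 𝓘(ℝ, ℝ) K.height (ha.map q)).toLinearMap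
  have hWJ : ∀ x hx D' e, IsAdaptedEnd (Z := Z) (K' := K') j (A.D x hx) D' e → ∃ W' : Submodule ℝ E,
      ∀ q, j (Completion.base q) ∈ (A.D x hx).chart.source →
        ∀ v, v ∈ WJ q ↔ (A.D x hx).chartFrame (ha.map q) v ∈ W' := by
    intro x hx D' e hD
    refine ⟨LinearMap.ker (A.D x hx).ℓ.toLinearMap, fun q hq v => ?_⟩
    have h1 := (A.D x hx).ℓ_chartFrame h (p := ha.map q) (by rwa [ha.base_map]) v
    change md 𝓘(ℝ, E) 𝓘(ℝ, ℝ) K.height (ha.map q) v = 0 ↔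
      (A.D x hx).ℓ ((A.D x hx).chartFrame (ha.map q) v) = 0
    rw [h1, neg_eq_zero]
  obtain ⟨Jt, J1, J2, J3⟩ := ha.exists_field_extension h h' hj.continuous hm
    (a := endField Q.J) Q.smooth_J WJ hWJ hU hBU (by
      intro y hy v
      obtain ⟨w, hw, -⟩ := hcore (endField Q.J) y v
      rw [hw]
      exact (md_height_core h (j y) _).trans ((hcon y hy).2.1 w))
  obtain ⟨Kt, K1, K2, K3⟩ := ha.exists_field_extension h h' hj.continuous hm
    (a := endField Q.K) Q.smooth_K WJ hWJ hU hBU (by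
      intro y hy v
      obtain ⟨w, hw, -⟩ := hcore (endField Q.K) y v
      rw [hw]
      exact (md_height_core h (j y) _).trans ((hcon y hy).2.2 w))
  by_cases hb : Q.IsIComplex 𝓝' j
  -- In adapted charts the tangent spaces are the fixed subspace `e (F × 0)`.
  · let WI : Completion 𝓝' N → Submodule ℝ E := fun q => LinearMap.range (ha.mapDeriv q).toLinearMap
    obtain ⟨It, I1, I2, I3⟩ := ha.exists_field_extension h h' hj.continuous hm
      (a := endField Q.I) Q.smooth_I WI (by
        intro x hx D' e hD
        refine ⟨LinearMap.range
          ((e : (F × Z) →L[ℝ] E).comp (ContinuousLinearMap.inl ℝ F Z)).toLinearMap, fun q hq v => ?_⟩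
        have h1 := ha.chartFrame_mapDeriv h h' hm hD hq
        constructor
        · rintro ⟨w, rfl⟩
          exact ⟨D'.chartFrame q w, (h1 w).symm⟩
        · rintro ⟨w, hw⟩
          obtain ⟨w', rfl⟩ := (bijective_of_isUnit (D'.isUnit_chartFrame h' (hD.source _ hq))).2 w
          refine ⟨w', (bijective_of_isUnit ((A.D x hx).isUnit_chartFrame h (p := ha.map q)
            (by rwa [ha.base_map]))).1 ?_⟩
          exact (h1 w').trans hw) hU hBU (by
        intro y hy v
        obtain ⟨w, hw, -⟩ := hcore (endField Q.I) y v
        obtain ⟨w', hw'⟩ := hb y w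
        refine ⟨coreDeriv 𝓝' y w', ?_⟩
        rw [hw]
        refine (ha.mapDeriv_core h h' hj hm y w').trans ?_
        exact congrArg (coreDeriv 𝓜 (j y)) hw'.symm)
    refine ⟨⟨It, Jt, Kt, I1, J1, K1, I2, J2, K2⟩, J3, K3, fun _ q hq v => ?_⟩
    obtain ⟨w, hw⟩ := I3 q hq v
    exact ⟨w, hw.symm⟩
  · obtain ⟨It, I1, I2, -⟩ := ha.exists_field_extension h h' hj.continuous hm
      (a := endField Q.I) Q.smooth_I (fun _ => ⊤) (fun _ _ _ _ _ => ⟨⊤, fun _ _ _ => by simp⟩)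
      hU hBU (fun _ _ _ => Submodule.mem_top)
    exact ⟨⟨It, Jt, Kt, I1, J1, K1, I2, J2, K2⟩, J3, K3, fun h => absurd h hb⟩

end IsAdaptedCollar

end Submanifold

/-! ### Existence of conical completions -/

/-- A conical completion adapted to a submanifold with `JK`-conical boundary. -/
theorem exists_conicalCompletion {d : ℕ} [NeZero d] {M : Type*} [TopologicalSpace M] [T2Space M]
    [CompactSpace M] [ChartedSpace (EuclideanHalfSpace d) M] [IsManifold (𝓡∂ d) ∞ M]
    (Q : AlmostQuaternionic (𝓡∂ d) M) (ρ : M → ℝ) (hρ : IsBoundaryDefining (d := d) ρ)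
    (hconv : ∀ x ∈ (𝓡∂ d).boundary M, Q.IsConvexAt ρ x)
    {F : Type*} [NormedAddCommGroup F] [NormedSpace ℝ F] [FiniteDimensional ℝ F]
    {G : Type*} [TopologicalSpace G] (𝓝' : ModelWithCorners ℝ F G)
    {N : Type*} [TopologicalSpace N] [CompactSpace N] [ChartedSpace G N]
    [IsManifold 𝓝' ∞ N] (j : N → M) (hj : HasJKConicalBoundary Q ρ 𝓝' j) :
    ∃ (_ : ChartedSpace (EuclideanSpace ℝ (Fin d)) (Completion (𝓡∂ d) M))
      (_ : IsManifold (𝓡 d) ∞ (Completion (𝓡∂ d) M))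
      (Q' : AlmostQuaternionic (𝓡 d) (Completion (𝓡∂ d) M))
      (_ : ChartedSpace F (Completion 𝓝' N)),
      IsConicalCompletion (𝓡∂ d) Q ρ (fun x hx => (hρ.zero_iff x).1 hx) Q' ∧
      IsSmoothGluing 𝓝' (X := N) ∧
      IsSmoothEmbedding 𝓘(ℝ, F) (𝓡 d) ∞
        (Completion.map (𝓡∂ d) 𝓝' j (fun y hy => (hj.boundary_iff y).1 hy)) ∧
      (∀ p : 𝓝'.boundary N × Ici (0 : ℝ),
        Q'.IsJKConicalAt 𝓘(ℝ, F)
          (Completion.extendFun (𝓡∂ d) ρ (fun x hx => (hρ.zero_iff x).1 hx))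
          (Completion.map (𝓡∂ d) 𝓝' j (fun y hy => (hj.boundary_iff y).1 hy))
          (Completion.coneEnd 𝓝' p)) ∧
      (Q.IsIComplex 𝓝' j →
        Q'.IsIComplex 𝓘(ℝ, F)
          (Completion.map (𝓡∂ d) 𝓝' j (fun y hy => (hj.boundary_iff y).1 hy))) := by
  obtain ⟨⟨Z, _, _, himm⟩, hemb⟩ := hj.isSmoothEmbedding
  have := hemb.t2Space
  have hjs : ContMDiff 𝓝' (𝓡∂ d) ∞ j := himm.contMDiff
  obtain ⟨U, hU, hBU, hcon⟩ := hj.conical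
  obtain ⟨K, K', rfl, hK', hπ, hD⟩ := exists_collarData hρ hj.boundary_iff hemb himm
    fun y hy => (hcon y (hBU ((hj.boundary_iff y).1 hy))).1
  choose D hxD hD using hD
  let A : CollarAtlas K := ⟨D, hxD⟩
  have hD' : ∀ y ∈ 𝓝'.boundary N, ∃ D' : EndChart K', y ∈ D'.chart.source := by
    intro y hy
    have hx := (hj.boundary_iff y).1 hy
    obtain h0 | ⟨D', -, y', hy', hs, -⟩ := hD _ hx
    · exact absurd (hxD _ hx) (h0 y)
    · exact ⟨D', hemb.injective hy' ▸ hs⟩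
  choose D' hD' using hD'
  let A' : CollarAtlas K' := ⟨D', hD'⟩
  have ha : IsAdaptedCollar Z j A A' := by
    refine ⟨hj.boundary_iff, hK', hπ, fun x hx => (hD x hx).imp_right ?_⟩
    rintro ⟨D', e, y, -, -, h1, h2, h3, h4⟩
    exact ⟨D', e, h1, h2, h3, h4⟩
  let _ := A.chartedSpace
  let _ := A'.chartedSpace
  have := A.isManifold
  have := A'.isManifold
  have h : IsCollarStructure A := ⟨rfl⟩
  have h' : IsCollarStructure A' := ⟨rfl⟩
  have hm := ha.isImmersionOfComplement_map h h' hemb himm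
  obtain ⟨S, hS⟩ := ha.exists_isConstrained h h' hjs hm.contMDiff hU hBU hcon
  -- The proposition selecting the correction is `I`-complexity of the submanifold itself, so one
  -- construction yields the conical condition in both cases and `I`-invariance when it is asked
  -- for.
  obtain ⟨ε, hε0, hε⟩ := S.exists_isConvexPoint h (Q.IsIComplex 𝓝' j) hconv
  obtain ⟨θ, t1, t2, t3, t4, t5, t6⟩ := exists_bounded_reparametrization hε0
  have hθ : IsReparametrization θ ε := ⟨t1, t2, t3, t4, t5, t6⟩
  refine ⟨inferInstance, inferInstance, ApproxStructure.completed h S hθ hε, inferInstance,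
    ⟨isSmoothGluing h, ApproxStructure.extends_completed h S hθ hε, contMDiff_height h, fun p => ?_⟩,
    isSmoothGluing h', ⟨⟨Z, _, _, hm⟩, ha.isEmbedding_map hemb⟩, fun p => ?_, fun hI => ?_⟩
  · exact ApproxStructure.isConvexAt_completed h S hθ hε (CollarData.height_coneEnd_nonneg p)
  · exact ha.isJKConicalAt_completed h h' hm.contMDiff hS hθ hε (CollarData.height_coneEnd_nonneg p)
  · exact ha.isIComplex_completed h h' hjs hm.contMDiff hS hθ hε hI hI

end ConicalCompletion

end

open ConicalCompletion in
theorem mainTheorem8 {n : ℕ} [NeZero n] {M : Type*} [TopologicalSpace M] [T2Space M]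
    [CompactSpace M] [ChartedSpace (EuclideanHalfSpace (4 * n)) M]
    [IsManifold (𝓡∂ (4 * n)) ∞ M]
    (Q : AlmostQuaternionic (𝓡∂ (4 * n)) M) (ρ : M → ℝ)
    (hρ : IsBoundaryDefining (d := 4 * n) ρ)
    (hconv : ∃ U : Set M, IsOpen U ∧ (𝓡∂ (4 * n)).boundary M ⊆ U ∧
      ∀ x ∈ U, Q.IsConvexAt ρ x) :
    (∃ (_ : ChartedSpace (EuclideanSpace ℝ (Fin (4 * n))) (Completion (𝓡∂ (4 * n)) M))
        (_ : IsManifold (𝓡 (4 * n)) ∞ (Completion (𝓡∂ (4 * n)) M))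
        (Q' : AlmostQuaternionic (𝓡 (4 * n)) (Completion (𝓡∂ (4 * n)) M)),
        IsConicalCompletion (𝓡∂ (4 * n)) Q ρ (fun x hx => (hρ.zero_iff x).1 hx) Q') ∧
    (∀ {F : Type*} [NormedAddCommGroup F] [NormedSpace ℝ F] [FiniteDimensional ℝ F]
        {G : Type*} [TopologicalSpace G] (𝓝' : ModelWithCorners ℝ F G)
        {N : Type*} [TopologicalSpace N] [CompactSpace N] [ChartedSpace G N]
        [IsManifold 𝓝' ∞ N] (j : N → M) (hj : HasJKConicalBoundary Q ρ 𝓝' j),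
      ∃ (_ : ChartedSpace (EuclideanSpace ℝ (Fin (4 * n))) (Completion (𝓡∂ (4 * n)) M))
        (_ : IsManifold (𝓡 (4 * n)) ∞ (Completion (𝓡∂ (4 * n)) M))
        (Q' : AlmostQuaternionic (𝓡 (4 * n)) (Completion (𝓡∂ (4 * n)) M))
        (_ : ChartedSpace F (Completion 𝓝' N)),
        IsConicalCompletion (𝓡∂ (4 * n)) Q ρ (fun x hx => (hρ.zero_iff x).1 hx) Q' ∧
        IsSmoothGluing 𝓝' (X := N) ∧
        IsSmoothEmbedding 𝓘(ℝ, F) (𝓡 (4 * n)) ∞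
          (Completion.map (𝓡∂ (4 * n)) 𝓝' j (fun y hy => (hj.boundary_iff y).1 hy)) ∧
        (∀ p : 𝓝'.boundary N × Ici (0 : ℝ),
          Q'.IsJKConicalAt 𝓘(ℝ, F)
            (Completion.extendFun (𝓡∂ (4 * n)) ρ (fun x hx => (hρ.zero_iff x).1 hx))
            (Completion.map (𝓡∂ (4 * n)) 𝓝' j (fun y hy => (hj.boundary_iff y).1 hy))
            (Completion.coneEnd 𝓝' p)) ∧
        (Q.IsIComplex 𝓝' j →
          Q'.IsIComplex 𝓘(ℝ, F)
            (Completion.map (𝓡∂ (4 * n)) 𝓝' j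
              (fun y hy => (hj.boundary_iff y).1 hy)))) := by
  obtain ⟨U, -, hBU, hU⟩ := hconv
  have hc : ∀ x ∈ (𝓡∂ (4 * n)).boundary M, Q.IsConvexAt ρ x := fun x hx => hU x (hBU hx)
  have : NeZero (4 * n) := ⟨mul_ne_zero four_ne_zero (NeZero.ne n)⟩
  refine ⟨?_, by
    intro F _ _ _ G _ 𝓝' N _ _ _ _ j hj
    exact exists_conicalCompletion Q ρ hρ hc 𝓝' j hj⟩
  -- The first assertion is the second one for the empty submanifold.
  let _ := ChartedSpace.empty ℝ PEmpty.{1}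
  have : IsManifold 𝓘(ℝ, ℝ) ∞ PEmpty.{1} :=
    isManifold_of_contDiffOn _ _ _ fun _ _ he => he.elim
  have hj : HasJKConicalBoundary Q ρ 𝓘(ℝ, ℝ) (PEmpty.elim : PEmpty.{1} → M) :=
    ⟨⟨⟨ℝ, inferInstance, inferInstance, fun y => y.elim⟩, IsEmbedding.of_subsingleton _⟩,
      fun y => y.elim, fun y => y.elim, univ, isOpen_univ, subset_univ _, fun y => y.elim⟩
  obtain ⟨c, hc, Q', -, h, -⟩ := exists_conicalCompletion Q ρ hρ hc 𝓘(ℝ, ℝ) _ hj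
  exact ⟨c, hc, Q', h⟩
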